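/- Let $d\ge 1$, $\widehat f(\xi)=\mathcal F f(\xi)=\int_{\mathbb R^d} f(x)e^{-2\pi i\langle x,\xi\rangle}\,dx$, $M_b f(x)=e^{2\pi i\langle b,x\rangle}f(x)$ and $T_y f(x)=f(x-y)$. **Covers, weights, partitions of unity.** Let $J$ be a countable set and let $\mathcal O\subset\mathbb R^d$ be a (non-empty) open set whose complement is a null set. Let $\mathcal Q=(Q_j)_{j\in J}$, $Q_j=S_j(Q_j')=A_j(Q_j')+b_j$, with $A_j\in GL(d,\mathbb R)$, $b_j\in\mathbb R^d$ and $S_j\xi=A_j\xi+b_j$, be an affinely generated cover of $\mathcal O$: the sets $Q_j'$ are open; the $Q_j$ are non-empty with union $\mathcal O$; with $i^*=\{\ell\in J:Q_\ell\cap Q_i\neq\emptyset\}$ one has $\sup_i|i^*|<\infty$; $R_{\mathcal Q}:=\sup_i\sup_{\xi\in Q_i'}|\xi|<\infty$; $\sup_i\sup_{\ell\in i^*}\|A_i^{-1}A_\ell\|<\infty$; there are open sets $Q_i''$ with $\overline{Q_i''}\subset Q_i'$ and $\mathcal O\subset\bigcup_i S_i(Q_i'')$; and the sets $\{Q_i':i\in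 J\}$ and $\{Q_i'':i\in J\}$ are finite. Let $w=(w_j)_{j\in J}$ be a $\mathcal Q$-moderate weight, i.e. $w_j>0$ and $\sup_i\sup_{\ell\in i^*}w_i/w_\ell<\infty$. Let $\Phi=(\varphi_i)_{i\in J}\subset C_c^\infty(\mathcal O)$ be a regular partition of unity subordinate to $\mathcal Q$, i.e. $\sum_i\varphi_i=1$ on $\mathcal O$, $\varphi_i=0$ on $\mathcal O\setminus Q_i$, and $C_{\mathcal Q,\Phi,\alpha}:=\sup_i\|\partial^\alpha(\varphi_i\circ S_i)\|_{L^\infty}<\infty$ for all $\alpha\in\mathbb N_0^d$. Put $\varphi_i^*=\sum_{\ell\in i^*}\varphi_\ell$, $(\Gamma_{\mathcal Q}c)_i=\sum_{\ell\in i^*}c_\ell$, and $C_\Phi=\sup_i\|\mathcal F^{-1}\varphi_i\|_{L^1}$. **Decomposition spaces.** Let $Z(\mathcal O)=\mathcal F(C_c^\infty(\mathcal O))$ with the topology transported by $\mathcal F$, let $Z'(\mathcal O)$ be its dual with the weak-$*$ topology, and for $f\in Z'(\mathcal O)$ let $\widehat f=f\circ\mathcal F\in\mathcal D'(\mathcal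 O)$. For $p,q\in[1,\infty]$ let $D(\mathcal Q,L^p,\ell^q_w)$ be the space of all $f\in Z'(\mathcal O)$ with $$\|f\|_{D(\mathcal Q,L^p,\ell^q_w)}=\Big\|\big(w_i\,\|\mathcal F^{-1}(\varphi_i\widehat f\,)\|_{L^p}\big)_{i\in J}\Big\|_{\ell^q}<\infty .$$ **The system.** Let $\delta\in(0,1]$, let $g\in L^1(\mathbb R^d)\cap L^2(\mathbb R^d)$ with $\widehat g\in C^\infty(\mathbb R^d)$, and put $C_j=\delta A_j^{-t}$ and $g_j=|\det A_j|^{1/2}M_{b_j}[g\circ A_j^t]$. For $f\in Z'(\mathcal O)$ and $u\in L^1$ with $\widehat u\in C^\infty$, let $\langle f\mid u\rangle_\Phi=\sum_i\widehat f\big(\overline{\varphi_i\widehat u}\big)$, provided that the series converges absolutely. A matrix $M$ is of Schur type if $\|M\|_{\mathrm{Schur}}=\max\{\sup_i\sum_j|M_{i,j}|,\ \sup_j\sum_i|M_{i,j}|\}<\infty$. **Assumptions.** Assume that $t_0(\xi)=\sum_{j}|\det C_j|^{-1}|\widehat g_j(\xi)|^2$ is tame: the series converges on $\mathcal O$, $t_0$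 is continuous on $\mathcal O$, and $\sup_i\|\mathcal F^{-1}(\varphi_i t_0)\|_{L^1}<\infty$. Assume that $\widetilde Y$ is of Schur type, where $$\widetilde Y_{i,j}=K_{i,j}\int_{Q_i'}\big(1+|S_j^{-1}(S_i\xi)|\big)^{d+1}\max_{|\alpha|\le d+1}\big|[\partial^\alpha\widehat g](S_j^{-1}(S_i\xi))\big|\,d\xi,$$ $$K_{i,j}=\max\Big\{\frac{w_i}{w_j},\frac{w_j}{w_i}\Big\}\Big(\max\{1,|A_i^{-1}(b_i-b_j)|\}\,\max\{1,\|A_i^{-1}A_j\|\}\,\max\{1,\|A_j^{-1}A_i\|^2\}\Big)^{d+1}.$$ **Conclusion.** The system $(T_{C_jk}g_j)_{j\in J,k\in\mathbb Z^d}$ is $(w,w,\Phi)$-adapted, i.e. the matrix $$M_{i,j}=\max\Big\{\frac{w_i}{w_j},\frac{w_j}{w_i}\Big\}\,|\det C_j|^{1/2}\,\big\|\big((\mathcal F^{-1}\varphi_i)*g_j\big)\circ C_j\big\|_{W(L^\infty,\ell^1)},\qquad \|h\|_{W(L^\infty,\ell^1)}=\sum_{n\in\mathbb Z^d}\|\mathbf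 1_{n+[0,1]^d}h\|_{L^\infty},$$ is of Schur type. Furthermore, for all $p,q\in[1,\infty]$, the frame operator and the Fourier multiplier $$Sf=\sum_{j\in J}\sum_{k\in\mathbb Z^d}\langle f\mid T_{C_jk}g_j\rangle_\Phi\,T_{C_jk}g_j,\qquad T_0f=\sum_{i\in J}\mathcal F^{-1}(\varphi_i^*t_0)*\mathcal F^{-1}(\varphi_i\widehat f\,)$$ are well-defined bounded linear operators on $D(\mathcal Q,L^p,\ell^q_w)$ (the series defining $\langle f\mid T_{C_jk}g_j\rangle_\Phi$ converge absolutely, and the series defining $Sf$ and $T_0f$ converge unconditionally in $Z'(\mathcal O)$), and $R_0:=S-T_0$ is bounded on $D(\mathcal Q,L^p,\ell^q_w)$ with $$\|R_0\|\le C_0\,C_{p,q}\,(C')^4\,\|\Gamma_{\mathcal Q}\|_{\ell^q_w\to\ell^q_w}\,\delta^2\,\|\widetilde Y\|_{\mathrm{Schur}}^2<\infty,$$ where $C'=(12(d+1)^2)^{d+1}$, $C_{p,q}=1$ if $\max\{p,q\}<\infty$ and $C_{p,q}=C_\Phi\|\Gamma_{\mathcal Q}\|^2_{\ell^q_w\to\ell^q_w}$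 otherwise, and $$C_0=24\pi^2\Big(\frac{8d}{\pi}\Big)^{2d+2}12^d(d+1)^3\max\{1,R_{\mathcal Q}^{d+2}\}\max_{|\alpha|\le d+1}C_{\mathcal Q,\Phi,\alpha}^2 .$$ -/

import Mathlib

open TopologicalSpace MeasureTheory Set
open scoped Distributions FourierTransform ENNReal ContDiff Topology

noncomputable section

namespace GSI

/-! ### Basic notation -/

/-- `ℝ^d` (and also its Fourier dual) with the Euclidean norm. -/
abbrev Space (d : ℕ) := EuclideanSpace ℝ (Fin d)

/-- The integer vector `k ∈ ℤ^d`, seen in `ℝ^d`. -/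
def intVec {d : ℕ} (k : Fin d → ℤ) : Space d := WithLp.toLp 2 (fun i => (k i : ℝ))

/-- The partial derivative `∂_i f`. -/
def pderiv {d : ℕ} (i : Fin d) (f : Space d → ℂ) : Space d → ℂ :=
  fun ξ => fderiv ℝ f ξ (EuclideanSpace.single i 1)

/-- The partial derivative `∂^α f` for a multi-index `α`. -/
def mderiv {d : ℕ} (α : Fin d → ℕ) (f : Space d → ℂ) : Space d → ℂ :=
  (List.finRange d).foldr (fun i h => (pderiv i)^[α i] h) f

/-- `max_{|α| ≤ n} |∂^α f (ξ)|`. -/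
def maxDeriv {d : ℕ} (n : ℕ) (f : Space d → ℂ) (ξ : Space d) : ℝ≥0∞ :=
  ⨆ (α : Fin d → ℕ) (_ : ∑ i, α i ≤ n), ‖mderiv α f ξ‖ₑ

/-- The Schur norm of a matrix, in terms of the absolute values of the entries. -/
def schurNorm {I J : Type*} (M : I → J → ℝ≥0∞) : ℝ≥0∞ :=
  max (⨆ i, ∑' j, M i j) (⨆ j, ∑' i, M i j)

/-- The weighted norm `‖a‖_{ℓ^q_w} = ‖(w_j a_j)_j‖_{ℓ^q}` of a family, in terms of the absolute
values of the entries. -/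
def lqNorm {J : Type*} (w : J → ℝ) (q : ℝ≥0∞) (a : J → ℝ≥0∞) : ℝ≥0∞ :=
  if q = ⊤ then ⨆ j, ENNReal.ofReal (w j) * a j
  else (∑' j, (ENNReal.ofReal (w j) * a j) ^ q.toReal) ^ (1 / q.toReal)

/-- The translate `T_y f`. -/
def translate {d : ℕ} (y : Space d) (f : Space d → ℂ) : Space d → ℂ := fun x => f (x - y)

/-- The modulation `M_b f`. -/
def modulate {d : ℕ} (b : Space d) (f : Space d → ℂ) : Space d → ℂ :=
  fun x => Complex.exp (2 * Real.pi * Complex.I * (inner ℝ b x : ℝ)) * f x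

/-- The discrete amalgam norm `‖f‖_{W(L^∞, ℓ^1)} = ∑_{n ∈ ℤ^d} ‖𝟙_{n + [0,1]^d} f‖_{L^∞}`. -/
def amalgamNorm {d : ℕ} (f : Space d → ℂ) : ℝ≥0∞ :=
  ∑' n : Fin d → ℤ,
    eLpNorm (indicator {x : Space d | ∀ i, x i ∈ Icc (n i : ℝ) (n i + 1)} f) ⊤ volume

/-! ### Covers and partitions of unity -/

/-- The data `(A_j, b_j, Q_j')_j` that generates the family of the sets `A_j (Q_j') + b_j`. -/
structure AffineFamily (d : ℕ) (J : Type*) where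
  /-- the invertible linear parts `A_j ∈ GL(d, ℝ)` -/
  A : J → (Space d ≃L[ℝ] Space d)
  /-- the translation parts `b_j` -/
  b : J → Space d
  /-- the sets `Q_j'` -/
  Q' : J → Set (Space d)

namespace AffineFamily

variable {d : ℕ} {J : Type*} (Q : AffineFamily d J)

/-- The affine map `S_j ξ = A_j ξ + b_j`. -/
def S (j : J) (ξ : Space d) : Space d := Q.A j ξ + Q.b j

/-- The inverse `S_j⁻¹ ξ = A_j⁻¹ (ξ - b_j)`. -/
def Sinv (j : J) (ξ : Space d) : Space d := (Q.A j).symm (ξ - Q.b j)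

/-- The set `Q_j = A_j (Q_j') + b_j`. -/
def set (j : J) : Set (Space d) := Q.S j '' Q.Q' j

/-- The index cluster `i^* = {ℓ : Q_ℓ ∩ Q_i ≠ ∅}`. -/
def cluster (i : J) : Set J := {l | (Q.set l ∩ Q.set i).Nonempty}

/-- The linear map `A_i⁻¹ A_j`. -/
def AinvA (i j : J) : Space d →L[ℝ] Space d := ((Q.A j).trans (Q.A i).symm : Space d ≃L[ℝ] Space d)

/-- `R_Q = sup_i sup_{ξ ∈ Q_i'} |ξ|`. -/
def R : ℝ≥0∞ := ⨆ i, ⨆ ξ ∈ Q.Q' i, ‖ξ‖ₑ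

/-- `(Q_i)_i` is an admissible cover of `O`. -/
structure IsAdmissibleCover (O : Opens (Space d)) : Prop where
  nonempty : (O : Set (Space d)).Nonempty
  cover : (O : Set (Space d)) = ⋃ i, Q.set i
  set_nonempty : ∀ i, (Q.set i).Nonempty
  finite_overlap : (⨆ i, (Q.cluster i).encard) < ⊤

/-- `(A_i (Q_i') + b_i)_i` is an affinely generated cover of `O`. -/
structure IsAffinelyGeneratedCover (O : Opens (Space d)) : Prop where
  isOpen : ∀ i, IsOpen (Q.Q' i)
  admissible : Q.IsAdmissibleCover O
  bounded : Q.R < ⊤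
  compatible : ∃ C : ℝ, ∀ i, ∀ l ∈ Q.cluster i, ‖Q.AinvA i l‖ ≤ C
  shrink : ∃ Q'' : J → Set (Space d), (∀ i, IsOpen (Q'' i)) ∧ (∀ i, closure (Q'' i) ⊆ Q.Q' i) ∧
    (O : Set (Space d)) ⊆ ⋃ i, Q.S i '' Q'' i ∧ (range Q'').Finite
  finite_range : (range Q.Q').Finite

/-- `w` is a `Q`-moderate weight. -/
def IsModerate (w : J → ℝ) : Prop :=
  (∀ i, 0 < w i) ∧ ∃ C : ℝ, ∀ i, ∀ l ∈ Q.cluster i, w i / w l ≤ C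

/-- The clustering map `(Γ_Q c)_i = ∑_{ℓ ∈ i^*} c_ℓ`; the sums are finite for admissible covers. -/
def clustering (c : J → ℂ) (i : J) : ℂ := ∑ᶠ l ∈ Q.cluster i, c l

/-- The operator norm `‖Γ_Q‖_{ℓ^q_w → ℓ^q_w}`. -/
def clusteringNorm (w : J → ℝ) (q : ℝ≥0∞) : ℝ≥0∞ :=
  ⨆ (c : J → ℂ) (_ : lqNorm w q (fun j => ‖c j‖ₑ) ≤ 1), lqNorm w q (fun j => ‖Q.clustering c j‖ₑ)

variable {O : Opens (Space d)}

/-- `C_{Q,Φ,α} = sup_i ‖∂^α (φ_i ∘ S_i)‖_{L^∞}`. -/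
def partitionConst (φ : J → 𝓓(O, ℂ)) (α : Fin d → ℕ) : ℝ≥0∞ :=
  ⨆ i, eLpNorm (mderiv α (fun ξ => φ i (Q.S i ξ))) ⊤ volume

/-- `(φ_i)_i` is a regular partition of unity subordinate to `Q`. -/
structure IsRegularPartitionOfUnity (φ : J → 𝓓(O, ℂ)) : Prop where
  hasSum_one : ∀ ξ ∈ O, HasSum (fun i => φ i ξ) 1
  eq_zero : ∀ i, ∀ ξ ∈ O, ξ ∉ Q.set i → φ i ξ = 0
  regular : ∀ α : Fin d → ℕ, Q.partitionConst φ α < ⊤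

/-- `φ_i^* = ∑_{ℓ ∈ i^*} φ_ℓ`. -/
def clusterSum (φ : J → 𝓓(O, ℂ)) (i : J) (ξ : Space d) : ℂ := ∑ᶠ l ∈ Q.cluster i, φ l ξ

end AffineFamily

/-! ### Fourier distributions and decomposition spaces -/

section FourierDistributions

variable {d : ℕ} {O : Opens (Space d)}

/-- The Fourier transform on `C_c^∞(O)`, as a linear map into the functions on `ℝ^d`. -/
def fourierLM (O : Opens (Space d)) : 𝓓(O, ℂ) →ₗ[ℂ] (Space d → ℂ) where
  toFun η := 𝓕 (η : Space d → ℂ)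
  map_add' η θ := by
    have h : ∀ η : 𝓓(O, ℂ), Integrable (η : Space d → ℂ) volume := fun η =>
      η.continuous.integrable_of_hasCompactSupport η.hasCompactSupport
    exact VectorFourier.fourierIntegral_add Real.continuous_fourierChar
      (by simpa using continuous_inner) (h η) (h θ)
  map_smul' c η := VectorFourier.fourierIntegral_const_smul _ _ _ _ _

/-- The space of Fourier test functions `Z(O) = 𝓕(C_c^∞(O))`. -/
def FourierTest (O : Opens (Space d)) : Type := ↥(LinearMap.range (fourierLM O))

instance : AddCommGroup (FourierTest O) :=
  inferInstanceAs (AddCommGroup ↥(LinearMap.range (fourierLM O)))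

instance : Module ℂ (FourierTest O) :=
  inferInstanceAs (Module ℂ ↥(LinearMap.range (fourierLM O)))

/-- The function underlying an element of `Z(O)`. -/
def FourierTest.fn (ψ : FourierTest O) : Space d → ℂ := Subtype.val ψ

/-- The Fourier transform `C_c^∞(O) → Z(O)`, a linear bijection. -/
def fourierToZLM (O : Opens (Space d)) : 𝓓(O, ℂ) →ₗ[ℂ] FourierTest O :=
  (fourierLM O).rangeRestrict

/-- The topology on `Z(O)` transported from `C_c^∞(O)` by the Fourier transform. As the Fourier
transform is bijective, this is the topology which makes it a homeomorphism. -/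
instance : TopologicalSpace (FourierTest O) :=
  TopologicalSpace.coinduced (fourierToZLM O) inferInstance

/-- The Fourier transform `C_c^∞(O) → Z(O)` as a continuous linear map. -/
def fourierToZ (O : Opens (Space d)) : 𝓓(O, ℂ) →L[ℂ] FourierTest O where
  toLinearMap := fourierToZLM O
  cont := continuous_coinduced_rng

/-- The space `Z'(O)` of Fourier distributions. -/
abbrev FourierDistribution (O : Opens (Space d)) := FourierTest O →L[ℂ] ℂ

/-- The Fourier transform `𝓕 f = f ∘ 𝓕` of `f ∈ Z'(O)`, a complex distribution on `O`. -/
def FourierDistribution.fourier (f : FourierDistribution O) : 𝓓(O, ℂ) →L[ℂ] ℂ :=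
  f.comp (fourierToZ O)

/-- The bilinear pairing `∫ u ψ dx` by which a function `u` on `ℝ^d` acts on `ψ ∈ Z(O)`. -/
def functionPairing (u : Space d → ℂ) (ψ : FourierTest O) : ℂ := ∫ x, u x * ψ.fn x

/-- The test function `φ · h` for `φ ∈ C_c^∞(O)` and a smooth function `h`. -/
def mulSmooth (φ : 𝓓(O, ℂ)) (h : Space d → ℂ) (hh : ContDiff ℝ ∞ h) : 𝓓(O, ℂ) where
  toFun ξ := φ ξ * h ξ
  contDiff' := φ.contDiff.mul hh
  hasCompactSupport' := φ.hasCompactSupport.mul_right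
  tsupport_subset' := (tsupport_mul_subset_left).trans φ.tsupport_subset

/-- The test function `conj φ`. -/
def conjTest (φ : 𝓓(O, ℂ)) : 𝓓(O, ℂ) where
  toFun ξ := starRingEnd ℂ (φ ξ)
  contDiff' := Complex.conjCLE.contDiff.comp φ.contDiff
  hasCompactSupport' := φ.hasCompactSupport.comp_left (map_zero _)
  tsupport_subset' := (tsupport_comp_subset (map_zero _) _).trans φ.tsupport_subset

/-- The character `ξ ↦ exp(2 π i ⟨x, ξ⟩)`. -/
def character (x : Space d) (ξ : Space d) : ℂ :=
  Complex.exp (2 * Real.pi * Complex.I * (inner ℝ x ξ : ℝ))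

lemma contDiff_character_uncurry :
    ContDiff ℝ ∞ (fun z : Space d × Space d => character z.1 z.2) := by
  unfold character
  refine Complex.contDiff_exp.comp (contDiff_const.mul ?_)
  exact Complex.ofRealCLM.contDiff.comp (contDiff_fst.inner ℝ contDiff_snd)

lemma contDiff_character (x : Space d) : ContDiff ℝ ∞ (character x) :=
  contDiff_character_uncurry.comp (contDiff_const.prodMk contDiff_id)

/-- The function `𝓕⁻¹(φ · T)`, for `φ ∈ C_c^∞(O)` and a distribution `T` on `O`. As `φ · T` is a
distribution with compact support, its inverse Fourier transform is the smooth function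
`x ↦ ⟨φ · T, exp(2 π i ⟨x, ·⟩)⟩ = T(φ · exp(2 π i ⟨x, ·⟩))`. -/
def localPiece (φ : 𝓓(O, ℂ)) (T : 𝓓(O, ℂ) →L[ℂ] ℂ) (x : Space d) : ℂ :=
  T (mulSmooth φ (character x) (contDiff_character x))

lemma continuous_localPiece (φ : 𝓓(O, ℂ)) (T : 𝓓(O, ℂ) →L[ℂ] ℂ) :
    Continuous (localPiece φ T) := by
  set K : Compacts (Space d) := ⟨tsupport φ, φ.hasCompactSupport⟩ with hK
  have hsub : (K : Set (Space d)) ⊆ O := φ.tsupport_subset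
  have hsm : ∀ x : Space d, ContDiff ℝ ∞ (fun ξ => φ ξ * character x ξ) := fun x =>
    φ.contDiff.mul (contDiff_character x)
  have hsu : ∀ x : Space d, Function.support (fun ξ => φ ξ * character x ξ) ⊆ K := fun x =>
    (Function.support_mul_subset_left _ _).trans subset_closure
  let X : Space d → 𝓓_{K}(Space d, ℂ) := fun x =>
    ContDiffMapSupportedIn.of_support_subset (hsm x) (hsu x)
  have hX : Continuous X := by
    rw [ContDiffMapSupportedIn.continuous_iff_comp]
    intro i
    let F : Space d × Space d → ℂ := fun z => φ z.2 * character z.1 z.2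
    have hF : ContDiff ℝ ∞ F := (φ.contDiff.comp contDiff_snd).mul contDiff_character_uncurry
    have key : ∀ x ξ, iteratedFDeriv ℝ i (X x) ξ =
        (iteratedFDeriv ℝ i F (x, ξ)).compContinuousLinearMap
          (fun _ => ContinuousLinearMap.inr ℝ (Space d) (Space d)) := by
      intro x ξ
      have h1 : (X x : Space d → ℂ) = (fun z => F ((x, 0) + z)) ∘
          (ContinuousLinearMap.inr ℝ (Space d) (Space d)) := by
        funext ξ
        simp [F, X, ContDiffMapSupportedIn.of_support_subset]
        rfl
      have h4 : ContDiff ℝ ∞ (fun z => F ((x, 0) + z)) :=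
        hF.comp (contDiff_const.add contDiff_id)
      rw [h1, ContinuousLinearMap.iteratedFDeriv_comp_right _ h4 _ (by exact_mod_cast le_top)]
      rw [iteratedFDeriv_comp_add_left]
      simp
    have hcont : Continuous (fun z : Space d × Space d => iteratedFDeriv ℝ i (X z.1) z.2) := by
      simp_rw [key]
      exact (ContinuousMultilinearMap.compContinuousLinearMapL (F := ℂ)
        (fun _ : Fin i => ContinuousLinearMap.inr ℝ (Space d) (Space d))).continuous.comp
        (hF.continuous_iteratedFDeriv (by exact_mod_cast le_top))
    rw [continuous_iff_continuousAt]
    intro x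
    rw [ContinuousAt, BoundedContinuousFunction.tendsto_iff_tendstoUniformly]
    have : CompactSpace K := isCompact_iff_compactSpace.mp K.isCompact
    have h2 : TendstoUniformly (fun (y : Space d) (ξ : K) => iteratedFDeriv ℝ i (X y) ξ)
        (fun ξ : K => iteratedFDeriv ℝ i (X x) ξ) (𝓝 x) :=
      Continuous.tendstoUniformly _
        (hcont.comp (continuous_fst.prodMk (continuous_subtype_val.comp continuous_snd))) x
    rw [Metric.tendstoUniformly_iff] at h2 ⊢
    intro ε hε
    filter_upwards [h2 ε hε] with y hy ξ
    by_cases hξ : ξ ∈ (K : Set (Space d))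
    · simpa using hy ⟨ξ, hξ⟩
    · have h3 : ∀ y, iteratedFDeriv ℝ i (X y) ξ = 0 := fun y =>
        ContDiffMapSupportedIn.iteratedFDeriv_zero_on_compl (X y) hξ
      simpa [h3] using hε
  have : localPiece φ T = fun x => T (TestFunction.ofSupportedIn hsub (X x)) := by
    funext x; rfl
  rw [this]
  exact T.continuous.comp ((TestFunction.continuous_ofSupportedIn hsub).comp hX)

variable {J : Type*}

/-- The norm `‖f‖_{D(Q, L^p, ℓ^q_w)} = ‖(‖𝓕⁻¹(φ_i · 𝓕 f)‖_{L^p})_i‖_{ℓ^q_w}`, possibly infinite. -/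
def decompNorm (φ : J → 𝓓(O, ℂ)) (w : J → ℝ) (p q : ℝ≥0∞) (f : FourierDistribution O) : ℝ≥0∞ :=
  lqNorm w q (fun i => eLpNorm (localPiece (φ i) f.fourier) p volume)

lemma lqNorm_mono (w : J → ℝ) (q : ℝ≥0∞) {a a' : J → ℝ≥0∞} (h : ∀ i, a i ≤ a' i) :
    lqNorm w q a ≤ lqNorm w q a' := by
  unfold lqNorm
  split_ifs
  · exact iSup_mono fun i => by gcongr; exact h i
  · gcongr with i
    exact h i

lemma lqNorm_const_mul_lt_top (w : J → ℝ) (q : ℝ≥0∞) {c : ℝ≥0∞} (hc : c ≠ ⊤) {a : J → ℝ≥0∞}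
    (h : lqNorm w q a < ⊤) : lqNorm w q (fun i => c * a i) < ⊤ := by
  unfold lqNorm at h ⊢
  split_ifs at h ⊢ with hq
  · simp_rw [mul_left_comm _ c, ← ENNReal.mul_iSup]
    exact ENNReal.mul_lt_top hc.lt_top h
  · have hr : 0 ≤ q.toReal := ENNReal.toReal_nonneg
    have e : ∀ j, (c * (ENNReal.ofReal (w j) * a j)) ^ q.toReal =
        c ^ q.toReal * (ENNReal.ofReal (w j) * a j) ^ q.toReal := fun j =>
      ENNReal.mul_rpow_of_nonneg _ _ hr
    simp_rw [mul_left_comm _ c, e, ENNReal.tsum_mul_left]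
    rw [ENNReal.mul_rpow_of_nonneg _ _ (by positivity)]
    exact ENNReal.mul_lt_top (ENNReal.rpow_lt_top_of_nonneg (by positivity)
      (ENNReal.rpow_ne_top_of_nonneg hr hc)) h

lemma lqNorm_add_lt_top (w : J → ℝ) (q : ℝ≥0∞) {a a' : J → ℝ≥0∞}
    (h : lqNorm w q a < ⊤) (h' : lqNorm w q a' < ⊤) : lqNorm w q (fun i => a i + a' i) < ⊤ := by
  unfold lqNorm at h h' ⊢
  split_ifs at h h' ⊢ with hq
  · refine lt_of_le_of_lt (iSup_le fun j => ?_) (ENNReal.add_lt_top.2 ⟨h, h'⟩)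
    rw [mul_add]
    exact add_le_add (le_iSup (fun j => ENNReal.ofReal (w j) * a j) j)
      (le_iSup (fun j => ENNReal.ofReal (w j) * a' j) j)
  · rcases (ENNReal.toReal_nonneg : 0 ≤ q.toReal).eq_or_lt with hr | hr
    · simp [← hr]
    · have hr' : 0 < 1 / q.toReal := by positivity
      rw [ENNReal.rpow_lt_top_iff_of_pos hr'] at h h' ⊢
      have hle : ∀ x y : ℝ≥0∞, (x + y) ^ q.toReal ≤
          2 ^ q.toReal * (x ^ q.toReal + y ^ q.toReal) := by
        intro x y
        rcases le_total x y with hxy | hxy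
        · calc (x + y) ^ q.toReal ≤ (2 * y) ^ q.toReal := by
                gcongr; rw [two_mul]; gcongr
            _ = 2 ^ q.toReal * y ^ q.toReal := ENNReal.mul_rpow_of_nonneg _ _ hr.le
            _ ≤ _ := by gcongr; exact le_add_self
        · calc (x + y) ^ q.toReal ≤ (2 * x) ^ q.toReal := by
                gcongr; rw [two_mul]; gcongr
            _ = 2 ^ q.toReal * x ^ q.toReal := ENNReal.mul_rpow_of_nonneg _ _ hr.le
            _ ≤ _ := by gcongr; exact le_self_add
      calc ∑' j, (ENNReal.ofReal (w j) * (a j + a' j)) ^ q.toReal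
          ≤ ∑' j, 2 ^ q.toReal * ((ENNReal.ofReal (w j) * a j) ^ q.toReal
            + (ENNReal.ofReal (w j) * a' j) ^ q.toReal) :=
            ENNReal.tsum_le_tsum fun j => by rw [mul_add]; exact hle _ _
        _ = 2 ^ q.toReal * (∑' j, (ENNReal.ofReal (w j) * a j) ^ q.toReal
            + ∑' j, (ENNReal.ofReal (w j) * a' j) ^ q.toReal) := by
            rw [ENNReal.tsum_mul_left, ENNReal.tsum_add]
        _ < ⊤ := ENNReal.mul_lt_top (ENNReal.rpow_lt_top_of_nonneg hr.le (by simp))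
            (ENNReal.add_lt_top.2 ⟨h, h'⟩)

/-- The decomposition space `D(Q, L^p, ℓ^q_w)`, as a subspace of `Z'(O)`. -/
def DecompSpace (φ : J → 𝓓(O, ℂ)) (w : J → ℝ) (p q : ℝ≥0∞) :
    Submodule ℂ (FourierDistribution O) where
  carrier := {f | decompNorm φ w p q f < ⊤}
  zero_mem' := by
    have h : ∀ i, localPiece (φ i) (FourierDistribution.fourier (0 : FourierDistribution O)) = 0 :=
      fun i => rfl
    simp only [mem_ofPred_eq, decompNorm, h, eLpNorm_zero]
    unfold lqNorm
    split_ifs with hq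
    · simp
    · rcases (ENNReal.toReal_nonneg : 0 ≤ q.toReal).eq_or_lt with hr | hr
      · simp [← hr]
      · simp [ENNReal.zero_rpow_of_pos hr, ENNReal.zero_rpow_of_pos (inv_pos.2 hr)]
  add_mem' {f f'} hf hf' := by
    have h : ∀ i, localPiece (φ i) (f + f').fourier =
      localPiece (φ i) f.fourier + localPiece (φ i) f'.fourier := fun i => rfl
    simp only [mem_ofPred_eq, decompNorm, h] at hf hf' ⊢
    refine lt_of_le_of_lt (lqNorm_mono w q fun i => eLpNorm_add_le'
      (continuous_localPiece _ _).aestronglyMeasurable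
      (continuous_localPiece _ _).aestronglyMeasurable p) ?_
    exact lqNorm_const_mul_lt_top w q (ENNReal.LpAddConst_lt_top p).ne (lqNorm_add_lt_top w q hf hf')
  smul_mem' c f hf := by
    have h : ∀ i, localPiece (φ i) (c • f).fourier = c • localPiece (φ i) f.fourier :=
      fun i => rfl
    simp only [mem_ofPred_eq, decompNorm, h, eLpNorm_const_smul] at hf ⊢
    exact lqNorm_const_mul_lt_top w q enorm_ne_top hf

end FourierDistributions

/-! ### Generalized shift-invariant systems

Such a system is given by generators `g_j : ℝ^d → ℂ` and by matrices `C_j ∈ GL(d, ℝ)`; it consists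
of the translates `T_{C_j k} g_j` for `j ∈ J` and `k ∈ ℤ^d`. -/

section Systems

variable {d : ℕ} {O : Opens (Space d)} {J : Type*}

/-- The convolution of two functions on `ℝ^d`. -/
def conv (u v : Space d → ℂ) : Space d → ℂ :=
  convolution u v (ContinuousLinearMap.mul ℂ ℂ) volume

/-- The matrices `C_j = δ A_j^{-t}`. -/
def structuredLattice (Q : AffineFamily d J) (δ : ℝ) (j : J) : Space d →L[ℝ] Space d :=
  δ • ContinuousLinearMap.adjoint ((Q.A j).symm : Space d →L[ℝ] Space d)

/-- The generators `g_j = |det A_j|^{1/2} M_{b_j} [g ∘ A_j^t]`. -/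
def structuredGenerator (Q : AffineFamily d J) (g : Space d → ℂ) (j : J) : Space d → ℂ := fun x =>
  (Real.sqrt |(Q.A j : Space d →L[ℝ] Space d).det| : ℂ) *
    modulate (Q.b j)
      (fun y => g (ContinuousLinearMap.adjoint (Q.A j : Space d →L[ℝ] Space d) y)) x

/-- The terms `|det C_j|⁻¹ |ĝ_j(ξ)|²` of `t_0(ξ)`. -/
def tZeroTerm (g : J → Space d → ℂ) (C : J → (Space d →L[ℝ] Space d)) (ξ : Space d) (j : J) : ℝ :=
  |(C j).det|⁻¹ * ‖𝓕 (g j) ξ‖ ^ 2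

/-- The function `t_0(ξ) = ∑_j |det C_j|⁻¹ |ĝ_j(ξ)|²`. -/
def tZero (g : J → Space d → ℂ) (C : J → (Space d →L[ℝ] Space d)) (ξ : Space d) : ℂ :=
  ((∑' j, tZeroTerm g C ξ j : ℝ) : ℂ)

/-- The function `h` is continuous on `O` and `sup_i ‖𝓕⁻¹(φ_i h)‖_{L^1} < ∞`. -/
def IsTame (φ : J → 𝓓(O, ℂ)) (h : Space d → ℂ) : Prop :=
  ContinuousOn h O ∧ (⨆ i, eLpNorm (𝓕⁻ (fun ξ => φ i ξ * h ξ)) 1 volume) < ⊤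

/-- The entries `max{w_i/v_j, v_j/w_i} |det C_j|^{1/2} ‖(𝓕⁻¹φ_i ∗ g_j) ∘ C_j‖_{W(L^∞, ℓ^1)}`. -/
def adaptedMatrix (φ : J → 𝓓(O, ℂ)) (g : J → Space d → ℂ) (C : J → (Space d →L[ℝ] Space d))
    (w v : J → ℝ) (i j : J) : ℝ≥0∞ :=
  ENNReal.ofReal (max (w i / v j) (v j / w i)) * ENNReal.ofReal (Real.sqrt |(C j).det|) *
    amalgamNorm (fun x => conv (𝓕⁻ (φ i : Space d → ℂ)) (g j) (C j x))

/-- The system `(T_{C_j k} g_j)_{j, k}` is `(w, v, Φ)`-adapted. -/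
def IsAdapted (φ : J → 𝓓(O, ℂ)) (g : J → Space d → ℂ) (C : J → (Space d →L[ℝ] Space d))
    (w v : J → ℝ) : Prop :=
  schurNorm (adaptedMatrix φ g C w v) < ⊤

open Classical in
/-- The terms `⟨𝓕 f | φ_i ĝ⟩ = (𝓕 f)(conj (φ_i ĝ))` of the extended inner product. The pairing is
only used for functions `g` for which `ĝ` is smooth; otherwise the value is irrelevant. -/
def extPairingTerm (φ : J → 𝓓(O, ℂ)) (f : FourierDistribution O) (g : Space d → ℂ) (i : J) : ℂ :=
  if hg : ContDiff ℝ ∞ (𝓕 g) then f.fourier (conjTest (mulSmooth (φ i) (𝓕 g) hg)) else 0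

/-- The extended inner product `⟨f | g⟩_Φ = ∑_i ⟨𝓕 f | φ_i ĝ⟩`. -/
def extPairing (φ : J → 𝓓(O, ℂ)) (f : FourierDistribution O) (g : Space d → ℂ) : ℂ :=
  ∑' i, extPairingTerm φ f g i

/-- `s = ∑_{j, k} ⟨f | T_{C_j k} g_j⟩_Φ T_{C_j k} g_j`, that is, the series which define the
extended inner products converge absolutely, and the series over `(j, k) ∈ J × ℤ^d` converges
unconditionally to `s` in `Z'(O)` (with its weak-`*` topology). -/
def IsFrameSum (φ : J → 𝓓(O, ℂ)) (g : J → Space d → ℂ) (C : J → (Space d →L[ℝ] Space d))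
    (f s : FourierDistribution O) : Prop :=
  (∀ (j : J) (k : Fin d → ℤ),
    Summable (fun i => ‖extPairingTerm φ f (translate (C j (intVec k)) (g j)) i‖)) ∧
  ∀ ψ : FourierTest O,
    HasSum (fun jk : J × (Fin d → ℤ) =>
      extPairing φ f (translate (C jk.1 (intVec jk.2)) (g jk.1)) *
        functionPairing (translate (C jk.1 (intVec jk.2)) (g jk.1)) ψ) (s ψ)

/-- `t = Φ_h f = ∑_i 𝓕⁻¹(φ_i^* h) ∗ 𝓕⁻¹(φ_i 𝓕 f)`, with unconditional convergence in `Z'(O)`. -/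
def IsMultiplierSum (Q : AffineFamily d J) (φ : J → 𝓓(O, ℂ)) (h : Space d → ℂ)
    (f t : FourierDistribution O) : Prop :=
  ∀ ψ : FourierTest O,
    HasSum (fun i => functionPairing
      (conv (𝓕⁻ (fun ξ => Q.clusterSum φ i ξ * h ξ)) (localPiece (φ i) f.fourier)) ψ) (t ψ)

/-! ### The constants -/

/-- `K_{i,j}`, for the weight `w`. -/
def kernelConst (Q : AffineFamily d J) (w : J → ℝ) (i j : J) : ℝ :=
  max (w i / w j) (w j / w i) *
    (max 1 ‖(Q.A i).symm (Q.b i - Q.b j)‖ * max 1 ‖Q.AinvA i j‖ * max 1 (‖Q.AinvA j i‖ ^ 2)) ^ (d + 1)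

/-- `Ỹ_{i,j} = K_{i,j} ∫_{Q_i'} (1 + |S_j⁻¹(S_i ξ)|)^{d+1} max_{|α| ≤ d+1} |∂^α ĝ (S_j⁻¹(S_i ξ))| dξ`. -/
def Ytilde (Q : AffineFamily d J) (w : J → ℝ) (g : Space d → ℂ) (i j : J) : ℝ≥0∞ :=
  ENNReal.ofReal (kernelConst Q w i j) *
    ∫⁻ ξ in Q.Q' i, ENNReal.ofReal ((1 + ‖Q.Sinv j (Q.S i ξ)‖) ^ (d + 1)) *
      maxDeriv (d + 1) (𝓕 g) (Q.Sinv j (Q.S i ξ))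

/-- `C_0 = 24 π² (8 d / π)^{2d+2} 12^d (d+1)³ max{1, R_Q^{d+2}} max_{|α| ≤ d+1} C_{Q,Φ,α}²`. -/
def constC0 (Q : AffineFamily d J) (φ : J → 𝓓(O, ℂ)) : ℝ≥0∞ :=
  ENNReal.ofReal (24 * Real.pi ^ 2 * (8 * d / Real.pi) ^ (2 * d + 2) * 12 ^ d * (d + 1) ^ 3) *
    max 1 (Q.R ^ (d + 2)) *
    ⨆ (α : Fin d → ℕ) (_ : ∑ i, α i ≤ d + 1), Q.partitionConst φ α ^ 2

/-- `C_Φ = sup_i ‖𝓕⁻¹ φ_i‖_{L^1}`. -/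
def partitionL1Const (φ : J → 𝓓(O, ℂ)) : ℝ≥0∞ :=
  ⨆ i, eLpNorm (𝓕⁻ (φ i : Space d → ℂ)) 1 volume

open Classical in
/-- `C_{p,q}`, which is `1` if `p, q < ∞`, and `C_Φ ‖Γ_Q‖²` otherwise. -/
def constCpq (Q : AffineFamily d J) (φ : J → 𝓓(O, ℂ)) (w : J → ℝ) (p q : ℝ≥0∞) : ℝ≥0∞ :=
  if max p q < ⊤ then 1 else partitionL1Const φ * Q.clusteringNorm w q ^ 2

/-- `C' = (12 (d+1)²)^{d+1}`. -/
def constC' (d : ℕ) : ℝ≥0∞ := (12 * ((d : ℝ≥0∞) + 1) ^ 2) ^ (d + 1)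

/-- The bound `C_0 C_{p,q} (C')⁴ ‖Γ_Q‖ δ² ‖Ỹ‖_{Schur}²`. -/
def remainderBound (Q : AffineFamily d J) (φ : J → 𝓓(O, ℂ)) (w : J → ℝ) (g : Space d → ℂ)
    (δ : ℝ) (p q : ℝ≥0∞) : ℝ≥0∞ :=
  constC0 Q φ * constCpq Q φ w p q * constC' d ^ 4 * Q.clusteringNorm w q *
    ENNReal.ofReal δ ^ 2 * schurNorm (Ytilde Q w g) ^ 2

end Systems

end GSI

end

open GSI

set_option maxSynthPendingDepth 3

noncomputable section

/-! The proof replaces distributions by functions as early as possible and then runs every estimate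
through Schur's test. A continuous functional on the test functions supported in a compact set is a
finite sum of bounded functionals of derivatives, so it commutes with the Bochner integral that
expresses Fourier inversion. Hence `apply_mulSmooth_eq_integral`: the distribution `φ T` acts on `h`
as `∫ 𝓕⁻¹(φ T) · 𝓕 h`. On `Q_m` a distribution is therefore represented by the function
`clusterPiece`, the sum of the local pieces with index in `m^*`, and passing to these sums costs one
factor `‖Γ_Q‖`. After absolute values have been taken, the operators have non-negative kernels, and
`eLpNorm_lintegral_kernel_le` and `lqNorm_matrix_le` treat all `1 ≤ p, q ≤ ∞` at once, endpoints
included.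

The basic objects are the atoms `φ_i ĝ_j`. Pulled back by `S_i` they become `(φ_i ∘ S_i) · (ĝ ∘
S_j⁻¹ ∘ S_i)`, whose pure derivatives of order `d + 1` are bounded in `L¹` by the integral of the
derivatives of `ĝ` in `Ỹ`, times powers of `‖A_j⁻¹ A_i‖`. So their Fourier transforms decay of order
`d + 1` in every coordinate, which bounds both their `L¹` norms and their amalgam norms on the
lattice `C_j ℤ^d`. This gives adaptedness (`exists_adaptedMatrix_le`). The two marginals of the
sampling kernel carry opposite powers of `|det C_j|^{1/2}`, which cancel, so adaptedness gives
convergence and boundedness of the frame operator (`lqNorm_synthBound_le`, `exists_isFrameSum`,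
`decompNorm_frameSum_le`).

For the remainder, Poisson summation over `k` gives the Walnut representation
(`tsum_integral_mul_fourier_lattice`): for fixed `i, j, m` the sum over `k` equals `|det C_j|⁻¹`
times a sum over `n ∈ ℤ^d` of multipliers `conj(φ_m ĝ_j) · (φ_i ĝ_j)(· - δ⁻¹ A_j n)`, up to
unimodular factors. The terms with `n = 0`, summed over `j` and `m`, form `T₀`, because the `φ_m`
sum to one and `∑_j |det C_j|⁻¹ |ĝ_j|² = t_0` (`hasSum_multiplierPart`). The terms with `n ≠ 0`
occur only if `Q_m` meets `Q_i + δ⁻¹ A_j n`, which forces `|n| ≤ δρ`, where `ρ` depends on the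
geometry of `i, j, m` alone. There are at most `(3δρ)^d` such `n`, and the factor `δ^d` cancels
against `|det C_j|⁻¹`. Since `|n| ≥ 1`, an overlap also forces `δρ ≥ 1`, and inserting two such
factors produces `δ²` (`ncard_overlapSet_le`). The extra powers of `ρ` are paid by `K_{i,j}` and by
the growth weight in `Ỹ`. This is `weight_mul_overlap_le`, and a Schur estimate for a product of two
matrices turns it into `‖Ỹ‖²_Schur`.

The argument yields the bound with the factor `1` in place of `C_{p,q}`. That is enough, as `C_Φ
‖Γ_Q‖² ≥ 1` always holds (`one_le_constCpq`). The explicit constants are compared in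
`numeric_const_le`. -/

namespace GSI

/-! ### Hölder, Schur and Minkowski inequalities for functions with values in `[0, ∞]` -/

section Schur

variable {α β : Type*} [MeasurableSpace α] [MeasurableSpace β]

/-- Hölder's inequality for functions with values in `[0, ∞]`. -/
lemma lintegral_mul_le_eLpNorm (μ : Measure α) {f g : α → ℝ≥0∞} (hf : AEMeasurable f μ)
    (hg : AEMeasurable g μ) (p q : ℝ≥0∞) [hpq : p.HolderConjugate q] :
    ∫⁻ x, f x * g x ∂μ ≤ eLpNorm f p μ * eLpNorm g q μ := by
  -- The endpoint pair `(∞, 1)` needs only the essential supremum; the pair `(1, ∞)` follows by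
  -- exchanging the functions, and finite exponents are the classical case.
  have key : ∀ {f g : α → ℝ≥0∞}, AEMeasurable g μ →
      ∫⁻ x, f x * g x ∂μ ≤ eLpNorm f ⊤ μ * eLpNorm g 1 μ := by
    intro f g hg
    rw [eLpNorm_one_eq_lintegral_enorm, eLpNorm_exponent_top]
    simp only [enorm_eq_self]
    rw [← lintegral_const_mul'' _ hg]
    refine lintegral_mono_ae ?_
    filter_upwards [enorm_ae_le_eLpNormEssSup f μ] with x hx
    gcongr
    simpa using hx
  rcases eq_or_ne p ⊤ with rfl | hp
  · have : q = 1 := (ENNReal.HolderConjugate.eq_top_iff_eq_one ⊤ q).1 rfl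
    subst this
    exact key hg
  rcases eq_or_ne q ⊤ with rfl | hq
  · have : p = 1 := (ENNReal.HolderConjugate.eq_top_iff_eq_one ⊤ p).1 rfl
    subst this
    simp_rw [mul_comm (f _)]
    rw [mul_comm]
    exact key hf
  have hp0 : p ≠ 0 := ENNReal.HolderConjugate.ne_zero p q
  have hq0 : q ≠ 0 := ENNReal.HolderConjugate.ne_zero q p
  rw [eLpNorm_eq_lintegral_rpow_enorm_toReal hp0 hp, eLpNorm_eq_lintegral_rpow_enorm_toReal hq0 hq]
  exact ENNReal.lintegral_mul_le_Lp_mul_Lq μ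
    (ENNReal.HolderConjugate.toReal_of_ne_top hp hq) hf hg

/-- **Schur's test** for integral operators with non-negative kernels. -/
theorem eLpNorm_lintegral_kernel_le (μ : Measure α) (ν : Measure β) [SFinite μ] [SFinite ν]
    {K : α → β → ℝ≥0∞} (hK : Measurable (Function.uncurry K)) {A : ℝ≥0∞}
    (h1 : ∀ x, ∫⁻ y, K x y ∂ν ≤ A) (h2 : ∀ y, ∫⁻ x, K x y ∂μ ≤ A)
    {f : β → ℝ≥0∞} (hf : Measurable f) {p : ℝ≥0∞} (hp : 1 ≤ p) :
    eLpNorm (fun x => ∫⁻ y, K x y * f y ∂ν) p μ ≤ A * eLpNorm f p ν := by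
  have hKx : ∀ x, Measurable (K x) := fun x => hK.comp measurable_prodMk_left
  have hKy : ∀ y, Measurable (fun x => K x y) := fun y => hK.comp measurable_prodMk_right
  rcases eq_or_ne p ⊤ with rfl | hpt
  · rw [eLpNorm_exponent_top, eLpNorm_exponent_top]
    refine essSup_le_of_ae_le _ (Filter.Eventually.of_forall fun x => ?_)
    simp only [enorm_eq_self]
    calc ∫⁻ y, K x y * f y ∂ν ≤ ∫⁻ y, K x y * eLpNormEssSup f ν ∂ν := by
          refine lintegral_mono_ae ?_
          filter_upwards [enorm_ae_le_eLpNormEssSup f ν] with y hy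
          gcongr
          simpa using hy
      _ = (∫⁻ y, K x y ∂ν) * eLpNormEssSup f ν := lintegral_mul_const _ (hKx x)
      _ ≤ _ := by gcongr; exact h1 x
  have hswap : ∀ r : ℝ, ∫⁻ x, ∫⁻ y, K x y * f y ^ r ∂ν ∂μ ≤ A * ∫⁻ y, f y ^ r ∂ν := by
    intro r
    rw [lintegral_lintegral_swap]
    · calc ∫⁻ y, ∫⁻ x, K x y * f y ^ r ∂μ ∂ν = ∫⁻ y, (∫⁻ x, K x y ∂μ) * f y ^ r ∂ν := by
            congr with y
            exact lintegral_mul_const _ (hKy y)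
        _ ≤ ∫⁻ y, A * f y ^ r ∂ν := by gcongr with y; exact h2 y
        _ = _ := lintegral_const_mul _ (hf.pow_const r)
    · exact (hK.mul ((hf.pow_const r).comp measurable_snd)).aemeasurable
  have hp0 : p ≠ 0 := (zero_lt_one.trans_le hp).ne'
  rw [eLpNorm_eq_lintegral_rpow_enorm_toReal hp0 hpt,
    eLpNorm_eq_lintegral_rpow_enorm_toReal hp0 hpt]
  simp only [enorm_eq_self]
  set r := p.toReal with hr
  have hr1 : 1 ≤ r := by
    rw [hr, ← ENNReal.toReal_one]; exact (ENNReal.toReal_le_toReal (by simp) hpt).2 hp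
  rcases hr1.eq_or_lt with hr1 | hr1
  · rw [← hr1]
    simpa using hswap 1
  have hr0 : 0 < r := by linarith
  have hc : Real.HolderConjugate (r.conjExponent) r := (Real.HolderConjugate.conjExponent hr1).symm
  set s := r.conjExponent with hs
  have hs0 : 0 < s := hc.pos
  have hsr : 1 / s + 1 / r = 1 := by simpa using hc.inv_add_inv_eq_one
  -- Split `K = K^{1/s} · K^{1/r}` and apply Hölder; the first factor is controlled by the row bound
  -- `h1`. The column bound enters afterwards, through Tonelli in `hswap`.
  have hbase : ∀ x, (∫⁻ y, K x y * f y ∂ν) ^ r ≤ A ^ (r / s) * ∫⁻ y, K x y * f y ^ r ∂ν := by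
    intro x
    have h := ENNReal.lintegral_mul_le_Lp_mul_Lq ν hc (f := fun y => K x y ^ (1 / s))
      (g := fun y => K x y ^ (1 / r) * f y) ((hKx x).pow_const _).aemeasurable
      (((hKx x).pow_const _).mul hf).aemeasurable
    have e1 : ∀ y, ((fun y => K x y ^ (1 / s)) * (fun y => K x y ^ (1 / r) * f y)) y
        = K x y * f y := by
      intro y
      simp only [Pi.mul_apply]
      rw [← mul_assoc, ← ENNReal.rpow_add_of_nonneg _ _ (by positivity) (by positivity), hsr,
        ENNReal.rpow_one]
    have e2 : ∀ y, (K x y ^ (1 / s)) ^ s = K x y := fun y => by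
      rw [← ENNReal.rpow_mul, one_div_mul_cancel hs0.ne', ENNReal.rpow_one]
    have e3 : ∀ y, (K x y ^ (1 / r) * f y) ^ r = K x y * f y ^ r := fun y => by
      rw [ENNReal.mul_rpow_of_nonneg _ _ hr0.le, ← ENNReal.rpow_mul, one_div_mul_cancel hr0.ne',
        ENNReal.rpow_one]
    simp_rw [e1, e2, e3] at h
    calc (∫⁻ y, K x y * f y ∂ν) ^ r
        ≤ ((∫⁻ y, K x y ∂ν) ^ (1 / s) * (∫⁻ y, K x y * f y ^ r ∂ν) ^ (1 / r)) ^ r := by gcongr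
      _ = (∫⁻ y, K x y ∂ν) ^ (r / s) * ∫⁻ y, K x y * f y ^ r ∂ν := by
          rw [ENNReal.mul_rpow_of_nonneg _ _ hr0.le, ← ENNReal.rpow_mul, ← ENNReal.rpow_mul,
            one_div_mul_cancel hr0.ne', ENNReal.rpow_one]
          congr 2; ring
      _ ≤ _ := by gcongr; exact h1 x
  calc (∫⁻ x, (∫⁻ y, K x y * f y ∂ν) ^ r ∂μ) ^ (1 / r)
      ≤ (∫⁻ x, A ^ (r / s) * ∫⁻ y, K x y * f y ^ r ∂ν ∂μ) ^ (1 / r) := by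
        gcongr with x; exact hbase x
    _ = (A ^ (r / s) * ∫⁻ x, ∫⁻ y, K x y * f y ^ r ∂ν ∂μ) ^ (1 / r) := by
        rw [lintegral_const_mul]
        exact (hK.mul ((hf.pow_const r).comp measurable_snd)).lintegral_prod_right'
    _ ≤ (A ^ (r / s) * (A * ∫⁻ y, f y ^ r ∂ν)) ^ (1 / r) := by gcongr; exact hswap r
    _ = A * (∫⁻ y, f y ^ r ∂ν) ^ (1 / r) := by
        rw [← mul_assoc, ENNReal.mul_rpow_of_nonneg _ _ (by positivity)]
        congr 1
        nth_rewrite 2 [← ENNReal.rpow_one A]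
        rw [← ENNReal.rpow_add_of_nonneg _ _ (by positivity) zero_le_one, ← ENNReal.rpow_mul]
        have : (r / s + 1) * (1 / r) = 1 := by
          field_simp at hsr ⊢; linarith
        rw [this, ENNReal.rpow_one]

/-- The bilinear form of Schur's test. -/
lemma lintegral_lintegral_kernel_le (μ : Measure α) (ν : Measure β) [SFinite μ] [SFinite ν]
    {K : α → β → ℝ≥0∞} (hK : Measurable (Function.uncurry K)) {A : ℝ≥0∞}
    (h1 : ∀ x, ∫⁻ y, K x y ∂ν ≤ A) (h2 : ∀ y, ∫⁻ x, K x y ∂μ ≤ A)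
    {f : α → ℝ≥0∞} (hf : Measurable f) {g : β → ℝ≥0∞} (hg : Measurable g)
    (p q : ℝ≥0∞) [hpq : p.HolderConjugate q] :
    ∫⁻ x, f x * ∫⁻ y, K x y * g y ∂ν ∂μ ≤ A * (eLpNorm f p μ * eLpNorm g q ν) := by
  have hm : Measurable fun x => ∫⁻ y, K x y * g y ∂ν :=
    (hK.mul (hg.comp measurable_snd)).lintegral_prod_right'
  refine (lintegral_mul_le_eLpNorm μ hf.aemeasurable hm.aemeasurable p q).trans ?_
  rw [mul_left_comm]
  gcongr
  exact eLpNorm_lintegral_kernel_le μ ν hK h1 h2 hg (ENNReal.HolderConjugate.one_le q p)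

/-- Minkowski's inequality for series of non-negative functions. -/
lemma eLpNorm_tsum_le {ι : Type*} [Countable ι] (μ : Measure α) {f : ι → α → ℝ≥0∞}
    (hf : ∀ i, Measurable (f i)) {p : ℝ≥0∞} (hp : 1 ≤ p) :
    eLpNorm (fun x => ∑' i, f i x) p μ ≤ ∑' i, eLpNorm (f i) p μ := by
  have hfin : ∀ s : Finset ι, eLpNorm (fun x => ∑ i ∈ s, f i x) p μ ≤ ∑' i, eLpNorm (f i) p μ := by
    intro s
    have : (fun x => ∑ i ∈ s, f i x) = ∑ i ∈ s, f i := by ext x; simp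
    rw [this]
    exact (eLpNorm_sum_le (fun i _ => (hf i).aestronglyMeasurable) hp).trans
      (ENNReal.sum_le_tsum s)
  rcases eq_or_ne p ⊤ with rfl | hpt
  · rw [eLpNorm_exponent_top]
    refine essSup_le_of_ae_le _ ?_
    -- Countability of the finite subsets provides one null set that serves all partial sums.
    have : ∀ᵐ x ∂μ, ∀ s : Finset ι, ∑ i ∈ s, f i x ≤ ∑' i, eLpNorm (f i) ⊤ μ := by
      rw [ae_all_iff]
      intro s
      filter_upwards [enorm_ae_le_eLpNormEssSup (fun x => ∑ i ∈ s, f i x) μ] with x hx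
      exact (by simpa using hx : _ ≤ _).trans (by simpa using hfin s)
    filter_upwards [this] with x hx
    simp only [enorm_eq_self]
    rw [ENNReal.tsum_eq_iSup_sum]
    exact iSup_le hx
  have hp0 : p ≠ 0 := (zero_lt_one.trans_le hp).ne'
  have hr : 0 < p.toReal := ENNReal.toReal_pos hp0 hpt
  rw [eLpNorm_eq_lintegral_rpow_enorm_toReal hp0 hpt, one_div, ENNReal.rpow_inv_le_iff hr]
  simp only [enorm_eq_self]
  -- The power is an order isomorphism of `[0, ∞]` and so commutes with the supremum over partial
  -- sums; monotone convergence along the directed family of finite sets then reduces to the finite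
  -- inequality.
  have e : ∀ x, (∑' i, f i x) ^ p.toReal = ⨆ s : Finset ι, (∑ i ∈ s, f i x) ^ p.toReal := by
    intro x
    rw [ENNReal.tsum_eq_iSup_sum]
    exact (ENNReal.orderIsoRpow p.toReal hr).map_iSup _
  simp_rw [e]
  rw [lintegral_iSup_directed]
  · refine iSup_le fun s => ?_
    have h := hfin s
    rw [eLpNorm_eq_lintegral_rpow_enorm_toReal hp0 hpt, one_div, ENNReal.rpow_inv_le_iff hr] at h
    simpa using h
  · intro s
    exact ((Finset.measurable_sum s fun i _ => hf i).pow_const _).aemeasurable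
  · classical
    intro s t
    refine ⟨s ∪ t, fun x => ?_, fun x => ?_⟩ <;>
    · dsimp only
      gcongr
      simp

end Schur

/-! ### Weighted sequence spaces and matrices -/

section Discrete

variable {J : Type*}

/-- Counting measure turns the integral form of Schur's test into the matrix form. At `q = 0` the
conventions of the two norms differ. -/
lemma lqNorm_eq_eLpNorm_count (w : J → ℝ) {q : ℝ≥0∞} (hq : q ≠ 0) (a : J → ℝ≥0∞) :
    letI : MeasurableSpace J := ⊤
    lqNorm w q a = eLpNorm (fun j => ENNReal.ofReal (w j) * a j) q Measure.count := by
  let _ : MeasurableSpace J := ⊤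
  unfold lqNorm
  split_ifs with h
  · subst h
    rw [eLpNorm_exponent_top, eLpNormEssSup, essSup_count]
    simp
  · rw [eLpNorm_eq_lintegral_rpow_enorm_toReal hq h, lintegral_count]
    simp

/-- Schur's test on `ℓ^q_w`. -/
lemma lqNorm_matrix_le [Countable J] (w : J → ℝ) (hw : ∀ i, 0 < w i) {q : ℝ≥0∞} (hq : 1 ≤ q)
    {H : J → J → ℝ≥0∞} {A : ℝ≥0∞}
    (h1 : ∀ i, ∑' m, ENNReal.ofReal (w i / w m) * H i m ≤ A)
    (h2 : ∀ m, ∑' i, ENNReal.ofReal (w i / w m) * H i m ≤ A) (a : J → ℝ≥0∞) :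
    lqNorm w q (fun i => ∑' m, H i m * a m) ≤ A * lqNorm w q a := by
  let _ : MeasurableSpace J := ⊤
  have hq0 : q ≠ 0 := (zero_lt_one.trans_le hq).ne'
  rw [lqNorm_eq_eLpNorm_count w hq0, lqNorm_eq_eLpNorm_count w hq0]
  -- The matrix is conjugated by the weights: the kernel `(w_i / w_m) H_{i,m}` acts on `w_m a_m`.
  have h := eLpNorm_lintegral_kernel_le (Measure.count : Measure J) (Measure.count : Measure J)
    (K := fun i m => ENNReal.ofReal (w i / w m) * H i m) (measurable_from_prod_countable_left fun _ => measurable_from_top)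
    (by simpa [lintegral_count] using h1) (by simpa [lintegral_count] using h2)
    (f := fun j => ENNReal.ofReal (w j) * a j) (measurable_from_top) hq
  refine le_trans (le_of_eq ?_) h
  congr 1
  ext i
  rw [lintegral_count, ← ENNReal.tsum_mul_left]
  congr with m
  have : ENNReal.ofReal (w i) = ENNReal.ofReal (w i / w m) * ENNReal.ofReal (w m) := by
    rw [← ENNReal.ofReal_mul (div_nonneg (hw i).le (hw m).le), div_mul_cancel₀ _ (hw m).ne']
  rw [this]
  ring

lemma le_lqNorm (w : J → ℝ) {q : ℝ≥0∞} (hq : q ≠ 0) (a : J → ℝ≥0∞) (i : J) :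
    ENNReal.ofReal (w i) * a i ≤ lqNorm w q a := by
  unfold lqNorm
  split_ifs with h
  · exact le_iSup (fun j => ENNReal.ofReal (w j) * a j) i
  · have hr : 0 < q.toReal := ENNReal.toReal_pos hq h
    rw [one_div, ENNReal.le_rpow_inv_iff hr]
    exact ENNReal.le_tsum (f := fun j => (ENNReal.ofReal (w j) * a j) ^ q.toReal) i

lemma lqNorm_const_mul (w : J → ℝ) {q : ℝ≥0∞} (hq : q ≠ 0) (c : ℝ≥0∞) (a : J → ℝ≥0∞) :
    lqNorm w q (fun i => c * a i) = c * lqNorm w q a := by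
  unfold lqNorm
  split_ifs with h
  · simp_rw [mul_left_comm _ c, ← ENNReal.mul_iSup]
  · have hr : 0 < q.toReal := ENNReal.toReal_pos hq h
    simp_rw [mul_left_comm _ c, ENNReal.mul_rpow_of_nonneg _ _ hr.le, ENNReal.tsum_mul_left]
    rw [ENNReal.mul_rpow_of_nonneg _ _ (by positivity), ← ENNReal.rpow_mul,
      mul_one_div_cancel hr.ne', ENNReal.rpow_one]

end Discrete

/-! ### Local pieces of distributions as functions -/

section Distributions

variable {d : ℕ} {O : Opens (Space d)}

/-- Derivatives in the second variable are restrictions of the joint derivatives to the directions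
of `inr`, and these are continuous. -/
lemma continuous_iteratedFDeriv_curry {Φ : Space d → Space d → ℂ}
    (hΦ : ContDiff ℝ ∞ (Function.uncurry Φ)) (k : ℕ) :
    Continuous fun z : Space d × Space d => iteratedFDeriv ℝ k (Φ z.1) z.2 := by
  have key : ∀ x ξ, iteratedFDeriv ℝ k (Φ x) ξ =
      (iteratedFDeriv ℝ k (Function.uncurry Φ) (x, ξ)).compContinuousLinearMap
        (fun _ => ContinuousLinearMap.inr ℝ (Space d) (Space d)) := by
    intro x ξ
    have h1 : Φ x = (fun z => Function.uncurry Φ ((x, 0) + z)) ∘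
        (ContinuousLinearMap.inr ℝ (Space d) (Space d)) := by
      funext ξ
      simp
    have h4 : ContDiff ℝ ∞ (fun z => Function.uncurry Φ ((x, 0) + z)) :=
      hΦ.comp (contDiff_const.add contDiff_id)
    rw [h1, ContinuousLinearMap.iteratedFDeriv_comp_right _ h4 _ (by exact_mod_cast le_top)]
    rw [iteratedFDeriv_comp_add_left]
    simp
  simp_rw [key]
  exact (ContinuousMultilinearMap.compContinuousLinearMapL (F := ℂ)
    (fun _ : Fin k => ContinuousLinearMap.inr ℝ (Space d) (Space d))).continuous.comp
    (hΦ.continuous_iteratedFDeriv (by exact_mod_cast le_top))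

/-- Iterated differentiation under the integral sign. -/
lemma iteratedFDeriv_integral_smul {c : Space d → ℂ} (hc : Continuous c)
    {Φ : Space d → Space d → ℂ} (hΦ : ContDiff ℝ ∞ (Function.uncurry Φ)) {b : ℕ → Space d → ℝ}
    (hb : ∀ k x ξ, ‖iteratedFDeriv ℝ k (Φ x) ξ‖ ≤ b k x)
    (hint : ∀ k, Integrable (fun x => ‖c x‖ * b k x)) (k : ℕ) :
    iteratedFDeriv ℝ k (fun ξ => ∫ x, c x * Φ x ξ) =
      fun ξ => ∫ x, c x • iteratedFDeriv ℝ k (Φ x) ξ := by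
  have hcont := continuous_iteratedFDeriv_curry hΦ
  have hsm : ∀ x, ContDiff ℝ ∞ (Φ x) := fun x => hΦ.comp (contDiff_const.prodMk contDiff_id)
  have hmeas : ∀ k ξ, Continuous fun x => c x • iteratedFDeriv ℝ k (Φ x) ξ := fun k ξ =>
    hc.smul ((hcont k).comp (continuous_id.prodMk continuous_const))
  have hI : ∀ k ξ, Integrable fun x => c x • iteratedFDeriv ℝ k (Φ x) ξ := by
    intro k ξ
    refine (hint k).mono' (hmeas k ξ).aestronglyMeasurable (Filter.Eventually.of_forall fun x => ?_)
    rw [norm_smul]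
    gcongr
    exact hb k x ξ
  induction k with
  | zero =>
    funext ξ
    ext m
    rw [iteratedFDeriv_zero_apply, ContinuousMultilinearMap.integral_apply (hI 0 ξ)]
    simp
  | succ k ih =>
    funext ξ
    rw [iteratedFDeriv_succ_eq_comp_left, ih, Function.comp_apply]
    have hF' : ∀ x ξ, c x • fderiv ℝ (iteratedFDeriv ℝ k (Φ x)) ξ =
        (continuousMultilinearCurryLeftEquiv ℝ (fun _ : Fin (k + 1) => Space d) ℂ)
          (c x • iteratedFDeriv ℝ (k + 1) (Φ x) ξ) := by
      intro x ξ
      rw [iteratedFDeriv_succ_eq_comp_left, Function.comp_apply]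
      ext v m
      simp
    have hd : HasFDerivAt (fun ξ => ∫ x, c x • iteratedFDeriv ℝ k (Φ x) ξ)
        (∫ x, c x • fderiv ℝ (iteratedFDeriv ℝ k (Φ x)) ξ) ξ := by
      refine hasFDerivAt_integral_of_dominated_of_fderiv_le (𝕜 := ℝ)
        (F := fun ξ x => c x • iteratedFDeriv ℝ k (Φ x) ξ)
        (F' := fun ξ x => c x • fderiv ℝ (iteratedFDeriv ℝ k (Φ x)) ξ)
        (bound := fun x => ‖c x‖ * b (k + 1) x) Filter.univ_mem (Filter.Eventually.of_forall fun y => (hmeas k y).aestronglyMeasurable)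
        (hI k ξ) ?_ ?_ (hint (k + 1)) ?_
      · simp_rw [hF']
        have : SecondCountableTopologyEither (Space d) (Space d →L[ℝ] Space d [×k]→L[ℝ] ℂ) :=
          secondCountableTopologyEither_of_left _ _
        exact ((continuousMultilinearCurryLeftEquiv ℝ (fun _ : Fin (k + 1) => Space d)
          ℂ).continuous.comp (hmeas (k + 1) ξ)).aestronglyMeasurable
      · refine Filter.Eventually.of_forall fun x y _ => ?_
        rw [norm_smul, norm_fderiv_iteratedFDeriv]
        gcongr
        exact hb (k + 1) x y
      · refine Filter.Eventually.of_forall fun x y _ => ?_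
        have h := ((hsm x).differentiable_iteratedFDeriv (m := k)
          (by exact_mod_cast WithTop.coe_lt_top k) y).hasFDerivAt
        exact h.const_smul (c x)
    rw [hd.fderiv]
    have hI1 : Integrable fun x => c x • fderiv ℝ (iteratedFDeriv ℝ k (Φ x)) ξ := by
      simp_rw [hF']
      exact (continuousMultilinearCurryLeftEquiv ℝ (fun _ : Fin (k + 1) => Space d)
        ℂ).toContinuousLinearEquiv.toContinuousLinearMap.integrable_comp (hI (k + 1) ξ)
    ext m
    rw [ContinuousMultilinearMap.integral_apply (hI (k + 1) ξ)]
    have h3 := ContinuousLinearMap.integral_apply hI1 (m 0)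
    have hI2 : Integrable fun x => (c x • fderiv ℝ (iteratedFDeriv ℝ k (Φ x)) ξ) (m 0) :=
      hI1.apply_continuousLinearMap (m 0)
    change (∫ x, c x • fderiv ℝ (iteratedFDeriv ℝ k (Φ x)) ξ) (m 0) (Fin.tail m) = _
    rw [h3, ContinuousMultilinearMap.integral_apply hI2]
    rfl

/-- The character is a one-variable exponential composed with the functional `⟨x, ·⟩`, whose norm is
`‖x‖`. -/
lemma norm_iteratedFDeriv_character_le (x ξ : Space d) (k : ℕ) :
    ‖iteratedFDeriv ℝ k (character x) ξ‖ ≤ (2 * Real.pi * ‖x‖) ^ k := by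
  have h1 : character x = (fun t : ℝ => Complex.exp ((2 * Real.pi * Complex.I) * t)) ∘
      (innerSL ℝ x : Space d →L[ℝ] ℝ) := by
    funext ξ; simp [character]
  have hs : ContDiff ℝ ∞ (fun t : ℝ => Complex.exp ((2 * Real.pi * Complex.I) * t)) :=
    Complex.contDiff_exp.comp (contDiff_const.mul Complex.ofRealCLM.contDiff)
  rw [h1, ContinuousLinearMap.iteratedFDeriv_comp_right _ hs _ (by exact_mod_cast le_top)]
  refine (ContinuousMultilinearMap.norm_compContinuousLinearMap_le _ _).trans ?_
  rw [norm_iteratedFDeriv_eq_norm_iteratedDeriv]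
  have h2 : ∀ k, iteratedDeriv k (fun t : ℝ => Complex.exp ((2 * Real.pi * Complex.I) * t)) =
      fun t : ℝ => (2 * Real.pi * Complex.I) ^ k * Complex.exp ((2 * Real.pi * Complex.I) * t) := by
    intro k
    induction k with
    | zero => simp
    | succ k ih =>
      rw [iteratedDeriv_succ, ih]
      funext t
      have h : HasDerivAt (fun t : ℝ => (2 * Real.pi * Complex.I) * (t : ℂ))
          (2 * Real.pi * Complex.I) t := by
        simpa using (Complex.ofRealCLM.hasDerivAt (x := t)).const_mul (2 * Real.pi * Complex.I)
      rw [((h.cexp).const_mul _).deriv]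
      ring
  rw [h2, norm_mul, norm_pow]
  have h3 : ‖Complex.exp (2 * Real.pi * Complex.I * ((innerSL ℝ x) ξ : ℝ))‖ = 1 := by
    rw [show (2 * Real.pi * Complex.I * ((innerSL ℝ x) ξ : ℝ) : ℂ) =
      ((2 * Real.pi * (innerSL ℝ x) ξ : ℝ) : ℂ) * Complex.I by push_cast; ring]
    exact Complex.norm_exp_ofReal_mul_I _
  rw [h3]
  simp [abs_of_pos Real.pi_pos, mul_pow]

lemma exists_bound_iteratedFDeriv {φ : Space d → ℂ} (hφ : ContDiff ℝ ∞ φ)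
    (hc : HasCompactSupport φ) (k : ℕ) : ∃ C : ℝ, 0 ≤ C ∧ ∀ ξ, ‖iteratedFDeriv ℝ k φ ξ‖ ≤ C := by
  obtain ⟨C, hC⟩ := (hc.iteratedFDeriv k).exists_bound_of_continuous
    (hφ.continuous_iteratedFDeriv (m := k) (by exact_mod_cast le_top))
  exact ⟨C, (norm_nonneg _).trans (hC 0), hC⟩

/-- The growth in `x` is polynomial and uniform in `ξ`, hence integrable in every jet norm against a
rapidly decaying Fourier transform. -/
lemma exists_bound_iteratedFDeriv_mul_character {φ : Space d → ℂ} (hφ : ContDiff ℝ ∞ φ)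
    (hc : HasCompactSupport φ) (k : ℕ) : ∃ C : ℝ, ∀ x ξ,
      ‖iteratedFDeriv ℝ k (fun ξ => φ ξ * character x ξ) ξ‖ ≤ C * (1 + ‖x‖) ^ k := by
  choose C hC0 hC using exists_bound_iteratedFDeriv hφ hc
  refine ⟨∑ i ∈ Finset.range (k + 1), (k.choose i : ℝ) * C i * (2 * Real.pi) ^ (k - i),
    fun x ξ => ?_⟩
  refine (norm_iteratedFDeriv_mul_le hφ (contDiff_character x) ξ
    (by exact_mod_cast le_top)).trans ?_
  rw [Finset.sum_mul]
  refine Finset.sum_le_sum fun i hi => ?_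
  have h1 : (2 * Real.pi * ‖x‖) ^ (k - i) ≤ (2 * Real.pi) ^ (k - i) * (1 + ‖x‖) ^ k := by
    rw [mul_pow]
    have hx : ‖x‖ ≤ 1 + ‖x‖ := by linarith
    gcongr
    exact (pow_le_pow_left₀ (norm_nonneg _) hx _).trans
      (pow_le_pow_right₀ (by linarith [norm_nonneg x]) (Nat.sub_le _ _))
  calc (k.choose i : ℝ) * ‖iteratedFDeriv ℝ i φ ξ‖ * ‖iteratedFDeriv ℝ (k - i) (character x) ξ‖
      ≤ (k.choose i : ℝ) * C i * ((2 * Real.pi) ^ (k - i) * (1 + ‖x‖) ^ k) := by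
        gcongr
        · exact mul_nonneg (by positivity) (hC0 i)
        · exact hC i ξ
        · exact (norm_iteratedFDeriv_character_le x ξ _).trans h1
    _ = _ := by ring

lemma fourierInv_eq_integral_character (f : Space d → ℂ) (x : Space d) :
    𝓕⁻ f x = ∫ ξ, f ξ * character x ξ := by
  rw [Real.fourierInv_eq']
  congr with ξ
  rw [smul_eq_mul, mul_comm, character, real_inner_comm]
  congr 2
  push_cast
  ring

lemma fourier_eq_integral_character (f : Space d → ℂ) (x : Space d) :
    𝓕 f x = ∫ ξ, f ξ * character (-x) ξ := by
  rw [← fourierInv_eq_integral_character, Real.fourierInv_eq_fourier_neg, neg_neg]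

lemma character_comm (x ξ : Space d) : character x ξ = character ξ x := by
  unfold character; rw [real_inner_comm]

lemma character_add_left (x y ξ : Space d) :
    character (x + y) ξ = character x ξ * character y ξ := by
  unfold character
  rw [inner_add_left, ← Complex.exp_add]
  congr 1
  push_cast
  ring

lemma character_add_right (x ξ ζ : Space d) :
    character x (ξ + ζ) = character x ξ * character x ζ := by
  rw [character_comm, character_add_left, character_comm ξ, character_comm ζ]

@[simp] lemma norm_character (x ξ : Space d) : ‖character x ξ‖ = 1 := by
  unfold character
  rw [show (2 * Real.pi * Complex.I * (inner ℝ x ξ : ℝ) : ℂ) =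
    ((2 * Real.pi * inner ℝ x ξ : ℝ) : ℂ) * Complex.I by push_cast; ring]
  exact Complex.norm_exp_ofReal_mul_I _

lemma conj_character (x ξ : Space d) :
    starRingEnd ℂ (character x ξ) = character (-x) ξ := by
  unfold character
  rw [← Complex.exp_conj]
  simp [Complex.conj_ofNat]

lemma continuous_character (x : Space d) : Continuous (character x) := (contDiff_character x).continuous

/-- Fourier transforms of test functions decay rapidly. -/
lemma integrable_pow_mul_norm_fourier {h : Space d → ℂ} (hh : ContDiff ℝ ∞ h)
    (hc : HasCompactSupport h) (k : ℕ) :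
    Integrable fun x => ‖𝓕 h x‖ * (1 + ‖x‖) ^ k := by
  let s := hc.toSchwartzMap hh
  have e : (𝓕 h : Space d → ℂ) = (𝓕 s : SchwartzMap (Space d) ℂ) := by
    rw [SchwartzMap.fourier_coe]; rfl
  have h1 : ∀ k : ℕ, Integrable fun x => ‖x‖ ^ k * ‖𝓕 h x‖ := fun k => by
    rw [e]
    exact SchwartzMap.integrable_pow_mul volume (𝓕 s : SchwartzMap (Space d) ℂ) k
  simp_rw [add_comm (1 : ℝ), add_pow, Finset.mul_sum]
  refine integrable_finsetSum _ fun i _ => ?_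
  refine ((h1 i).mul_const (k.choose i : ℝ)).congr (Filter.Eventually.of_forall fun x => ?_)
  simp only [one_pow, mul_one]
  ring

lemma continuous_fourier {h : Space d → ℂ} (hh : Integrable h) : Continuous (𝓕 h) :=
  VectorFourier.fourierIntegral_continuous Real.continuous_fourierChar
    (by simpa using continuous_inner) hh

lemma integrable_fourier_of_contDiff {h : Space d → ℂ} (hh : ContDiff ℝ ∞ h)
    (hc : HasCompactSupport h) : Integrable (𝓕 h) := by
  have := integrable_pow_mul_norm_fourier hh hc 0
  simp only [pow_zero, mul_one] at this
  exact (integrable_norm_iff (continuous_fourier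
    (hh.continuous.integrable_of_hasCompactSupport hc)).aestronglyMeasurable).1 this

lemma eq_integral_fourier_mul_character {h : Space d → ℂ} (hh : ContDiff ℝ ∞ h)
    (hc : HasCompactSupport h) (ξ : Space d) : h ξ = ∫ x, 𝓕 h x * character x ξ := by
  have h1 := hh.continuous.fourierInv_fourier_eq
    (hh.continuous.integrable_of_hasCompactSupport hc) (integrable_fourier_of_contDiff hh hc)
  conv_lhs => rw [← h1]
  rw [fourierInv_eq_integral_character]
  simp_rw [character_comm ξ]

/-- A linear functional which is bounded by finitely many seminorms `‖L_i f‖` is a sum of bounded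
linear functionals of the `L_i f`. -/
lemma exists_eq_sum_of_norm_le {V ι : Type*} [AddCommGroup V] [Module ℂ V] [Fintype ι]
    {B : ι → Type*} [∀ i, NormedAddCommGroup (B i)] [∀ i, NormedSpace ℂ (B i)]
    (L : ∀ i, V →ₗ[ℂ] B i) (T : V →ₗ[ℂ] ℂ) {C : ℝ} (hT : ∀ f, ‖T f‖ ≤ C * ‖fun i => L i f‖) :
    ∃ Λ : ∀ i, B i →L[ℂ] ℂ, ∀ f, T f = ∑ i, Λ i (L i f) := by
  classical
  let Jm : V →ₗ[ℂ] (∀ i, B i) := LinearMap.pi L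
  have hker : LinearMap.ker Jm ≤ LinearMap.ker T := by
    intro f hf
    rw [LinearMap.mem_ker] at hf ⊢
    have := hT f
    change _ ≤ C * ‖Jm f‖ at this
    rw [hf, norm_zero, mul_zero] at this
    simpa using this
  -- The bound makes `T` factor through the range of `Jm` and continuous there. Hahn–Banach extends
  -- it to the whole product, and restriction to the factors gives the functionals `Λ`.
  let f₀ : LinearMap.range Jm →ₗ[ℂ] ℂ :=
    ((LinearMap.ker Jm).liftQ T hker) ∘ₗ Jm.quotKerEquivRange.symm.toLinearMap
  have hf₀ : ∀ f, f₀ ⟨Jm f, LinearMap.mem_range_self _ f⟩ = T f := by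
    intro f
    have : Jm.quotKerEquivRange.symm ⟨Jm f, LinearMap.mem_range_self _ f⟩ =
        (LinearMap.ker Jm).mkQ f := by
      rw [LinearEquiv.symm_apply_eq]; rfl
    simp only [f₀, LinearMap.comp_apply, LinearEquiv.coe_coe, this]
    rfl
  let f₁ : LinearMap.range Jm →L[ℂ] ℂ := f₀.mkContinuous C (by
    rintro ⟨_, f, rfl⟩
    rw [hf₀]
    exact hT f)
  obtain ⟨g, hg, -⟩ := exists_extension_norm_eq (LinearMap.range Jm) f₁
  refine ⟨fun i => g.comp (ContinuousLinearMap.single ℂ B i), fun f => ?_⟩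
  have h1 : g (Jm f) = T f := by
    rw [← hf₀ f]
    exact hg ⟨Jm f, LinearMap.mem_range_self _ f⟩
  have h2 : Jm f = ∑ i, Pi.single i (L i f) := by
    rw [Finset.univ_sum_single]
    rfl
  rw [← h1, h2, map_sum]
  rfl

/-- Bounded continuous functions with values in the `i`-linear maps. -/
abbrev JetSpace (d i : ℕ) := BoundedContinuousFunction (Space d)
  (ContinuousMultilinearMap ℝ (fun _ : Fin i => Space d) ℂ)

/-- A continuous functional on `𝓓_K` is a sum of bounded functionals of derivatives. -/
lemma exists_eq_sum_structureMap {K : Compacts (Space d)} (T : 𝓓_{K}(Space d, ℂ) →L[ℂ] ℂ) :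
    ∃ (s : Finset ℕ) (Λ : ∀ i : s, JetSpace d i →L[ℂ] ℂ),
      ∀ f, T f = ∑ i, Λ i (ContDiffMapSupportedIn.structureMapCLM ℂ ⊤ i f) := by
  obtain ⟨s, C, -, hC⟩ := Seminorm.bound_of_continuous
    (ContDiffMapSupportedIn.withSeminorms ℂ (Space d) ℂ ⊤ K)
    ((normSeminorm ℂ ℂ).comp T.toLinearMap) (by exact continuous_norm.comp T.continuous)
  refine ⟨s, exists_eq_sum_of_norm_le (B := fun i : s => JetSpace d i)
    (fun i : s => (ContDiffMapSupportedIn.structureMapCLM ℂ ⊤ i).toLinearMap) T.toLinearMap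
    (C := C) fun f => ?_⟩
  refine (hC f).trans ?_
  rw [smul_apply]
  change (C : ℝ) * _ ≤ _
  gcongr
  refine Seminorm.finset_sup_apply_le (norm_nonneg _) fun i hi => ?_
  rw [ContDiffMapSupportedIn.seminorm_apply]
  exact norm_le_pi_norm (fun i : s => (ContDiffMapSupportedIn.structureMapCLM ℂ ⊤ i f :
    JetSpace d i)) ⟨i, hi⟩

/-- `𝓕⁻¹(φ T)` represents the distribution `φ T`. -/
theorem apply_mulSmooth_eq_integral (φ : 𝓓(O, ℂ)) (T : 𝓓(O, ℂ) →L[ℂ] ℂ) {h : Space d → ℂ}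
    (hh : ContDiff ℝ ∞ h) (hc : HasCompactSupport h) :
    T (mulSmooth φ h hh) = ∫ x, localPiece φ T x * 𝓕 h x := by
  set K : Compacts (Space d) := ⟨tsupport φ, φ.hasCompactSupport⟩ with hK
  have hsub : (K : Set (Space d)) ⊆ O := φ.tsupport_subset
  have hsu : ∀ g : Space d → ℂ, Function.support (fun ξ => φ ξ * g ξ) ⊆ K := fun g =>
    (Function.support_mul_subset_left _ _).trans subset_closure
  let X : ∀ g : Space d → ℂ, ContDiff ℝ ∞ g → 𝓓_{K}(Space d, ℂ) := fun g hg =>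
    ContDiffMapSupportedIn.of_support_subset (φ.contDiff.mul hg) (hsu g)
  have hXT : ∀ g (hg : ContDiff ℝ ∞ g), T (mulSmooth φ g hg) =
      (T.comp (TestFunction.ofSupportedInCLM ℂ hsub)) (X g hg) := fun g hg => rfl
  -- Finitely many jets suffice to evaluate `T` on functions supported in `tsupport φ`. It remains
  -- to write the jets of `φ h` as Bochner integrals over `x` of `𝓕 h x` times the jets of `φ ·
  -- character x`.
  obtain ⟨s, Λ, hΛ⟩ := exists_eq_sum_structureMap (T.comp (TestFunction.ofSupportedInCLM ℂ hsub))
  have hF : ContDiff ℝ ∞ (Function.uncurry fun x ξ => φ ξ * character x ξ) :=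
    (φ.contDiff.comp contDiff_snd).mul contDiff_character_uncurry
  choose C hC using exists_bound_iteratedFDeriv_mul_character φ.contDiff φ.hasCompactSupport
  have hch : ∀ k, Integrable fun x => ‖𝓕 h x‖ * (C k * (1 + ‖x‖) ^ k) := fun k => by
    refine ((integrable_pow_mul_norm_fourier hh hc k).const_mul (C k)).congr
      (Filter.Eventually.of_forall fun x => ?_)
    dsimp only
    ring
  have hhI := hh.continuous.integrable_of_hasCompactSupport (μ := volume) hc
  have hcF : Continuous (𝓕 h) := continuous_fourier hhI
  have hD := iteratedFDeriv_integral_smul hcF hF hC hch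
  -- the vector-valued integrand
  let Jv : ∀ (i : ℕ) (g : Space d → ℂ), ContDiff ℝ ∞ g → JetSpace d i := fun i g hg =>
    ContDiffMapSupportedIn.structureMapCLM ℂ ⊤ i (X g hg)
  have hJv : ∀ i g hg ξ, Jv i g hg ξ = iteratedFDeriv ℝ i (fun ξ => φ ξ * g ξ) ξ := by
    intro i g hg ξ
    simp only [Jv, ContDiffMapSupportedIn.structureMapCLM_top_apply]
    rfl
  have hJcont : ∀ i, Continuous fun x => Jv i (character x) (contDiff_character x) := by
    intro i
    have hcont := continuous_iteratedFDeriv_curry hF i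
    rw [continuous_iff_continuousAt]
    intro x
    rw [ContinuousAt, BoundedContinuousFunction.tendsto_iff_tendstoUniformly]
    have : CompactSpace K := isCompact_iff_compactSpace.mp K.isCompact
    have h2 : TendstoUniformly (fun (y : Space d) (ξ : K) =>
          iteratedFDeriv ℝ i (fun ξ => φ ξ * character y ξ) ξ)
        (fun ξ : K => iteratedFDeriv ℝ i (fun ξ => φ ξ * character x ξ) ξ) (𝓝 x) :=
      Continuous.tendstoUniformly _
        (hcont.comp (continuous_fst.prodMk (continuous_subtype_val.comp continuous_snd))) x
    rw [Metric.tendstoUniformly_iff] at h2 ⊢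
    intro ε hε
    filter_upwards [h2 ε hε] with y hy ξ
    rw [hJv _ _ (contDiff_character x), hJv _ _ (contDiff_character y)]
    -- On the compact set `K` joint continuity gives uniform closeness; off `K` all derivatives
    -- vanish.
    by_cases hξ : ξ ∈ (K : Set (Space d))
    · exact hy ⟨ξ, hξ⟩
    · have h3 : ∀ y, iteratedFDeriv ℝ i (fun ξ => φ ξ * character y ξ) ξ = 0 := fun y =>
        ContDiffMapSupportedIn.iteratedFDeriv_zero_on_compl (X (character y)
          (contDiff_character y)) hξ
      simpa [h3] using hε
  have hJint : ∀ i, Integrable fun x => 𝓕 h x • Jv i (character x) (contDiff_character x) := by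
    intro i
    refine Integrable.mono' (hch i) (hcF.smul (hJcont i)).aestronglyMeasurable
      (Filter.Eventually.of_forall fun x => ?_)
    have hCx : 0 ≤ C i * (1 + ‖x‖) ^ i := (norm_nonneg _).trans (hC i x 0)
    rw [norm_smul]
    gcongr
    rw [BoundedContinuousFunction.norm_le hCx]
    intro ξ
    rw [hJv _ _ (contDiff_character x)]
    exact hC i x ξ
  -- Evaluation at a point is bounded on jets, so the identity can be checked pointwise, where it is
  -- Fourier inversion differentiated under the integral sign.
  have hJeq : ∀ i, ∫ x, 𝓕 h x • Jv i (character x) (contDiff_character x) = Jv i h hh := by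
    intro i
    ext1 ξ
    rw [hJv i h hh]
    let ev : JetSpace d i →L[ℂ] (ContinuousMultilinearMap ℝ (fun _ : Fin i => Space d) ℂ) :=
      BoundedContinuousFunction.evalCLM ℂ ξ
    change ev (∫ x, 𝓕 h x • Jv i (character x) (contDiff_character x)) = _
    rw [← ContinuousLinearMap.integral_comp_comm _ (hJint i)]
    have e1 : (fun ξ => φ ξ * h ξ) = fun ξ => ∫ x, 𝓕 h x * (φ ξ * character x ξ) := by
      funext ξ
      rw [eq_integral_fourier_mul_character hh hc ξ, ← integral_const_mul]
      congr with x
      ring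
    simp_rw [e1]
    rw [hD]
    refine integral_congr_ae (Filter.Eventually.of_forall fun x => ?_)
    dsimp only
    rw [map_smul]
    refine congrArg _ ?_
    exact hJv i (character x) (contDiff_character x) ξ
  rw [hXT, hΛ]
  change ∑ i : s, Λ i (Jv i h hh) = _
  have h4 : ∀ i : s, Integrable fun x => Λ i (𝓕 h x • Jv i (character x) (contDiff_character x)) :=
    fun i => (Λ i).integrable_comp (hJint i)
  calc ∑ i : s, Λ i (Jv i h hh)
      = ∑ i : s, ∫ x, Λ i (𝓕 h x • Jv i (character x) (contDiff_character x)) := by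
        refine Finset.sum_congr rfl fun i _ => ?_
        rw [← hJeq, ← ContinuousLinearMap.integral_comp_comm _ (hJint i)]
    _ = ∫ x, ∑ i : s, Λ i (𝓕 h x • Jv i (character x) (contDiff_character x)) :=
        (integral_finsetSum _ fun i _ => h4 i).symm
    _ = _ := by
        congr with x
        simp_rw [map_smul, smul_eq_mul, ← Finset.mul_sum]
        rw [mul_comm]
        congr 1
        exact (hΛ (X (character x) (contDiff_character x))).symm

end Distributions

/-! ### Fourier transforms of translates, products and convolutions -/

section FourierToolkit

variable {d : ℕ}

lemma fourierInv_eq_fourier_neg_apply (f : Space d → ℂ) (x : Space d) : 𝓕⁻ f x = 𝓕 f (-x) :=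
  Real.fourierInv_eq_fourier_neg f x

lemma lintegral_enorm_fourierInv (f : Space d → ℂ) :
    ∫⁻ x, ‖𝓕⁻ f x‖ₑ = ∫⁻ x, ‖𝓕 f x‖ₑ := by
  simp_rw [fourierInv_eq_fourier_neg_apply]
  exact lintegral_neg_eq_self (μ := volume) fun x => ‖𝓕 f x‖ₑ

lemma fourier_mul_character (f : Space d → ℂ) (x z : Space d) :
    𝓕 (fun ξ => f ξ * character x ξ) z = 𝓕 f (z - x) := by
  simp_rw [fourier_eq_integral_character]
  congr with ξ
  rw [neg_sub, sub_eq_add_neg, character_add_left]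
  ring

lemma fourier_comp_sub (f : Space d → ℂ) (a z : Space d) :
    𝓕 (fun ξ => f (ξ - a)) z = character (-z) a * 𝓕 f z := by
  simp_rw [fourier_eq_integral_character]
  rw [← integral_sub_right_eq_self (fun ξ => f ξ * character (-z) ξ) a, ← integral_const_mul]
  congr with ξ
  have : character (-z) ξ = character (-z) (ξ - a) * character (-z) a := by
    rw [← character_add_right, sub_add_cancel]
  rw [this]
  ring

lemma enorm_fourier_comp_sub (f : Space d → ℂ) (a z : Space d) :
    ‖𝓕 (fun ξ => f (ξ - a)) z‖ₑ = ‖𝓕 f z‖ₑ := by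
  rw [fourier_comp_sub, enorm_mul, ← ofReal_norm, norm_character, ENNReal.ofReal_one, one_mul]

lemma fourier_conj (f : Space d → ℂ) (z : Space d) :
    𝓕 (fun ξ => starRingEnd ℂ (f ξ)) z = starRingEnd ℂ (𝓕 f (-z)) := by
  simp_rw [fourier_eq_integral_character]
  rw [← integral_conj]
  congr with ξ
  rw [map_mul, conj_character, neg_neg]

lemma enorm_fourier_conj (f : Space d → ℂ) (z : Space d) :
    ‖𝓕 (fun ξ => starRingEnd ℂ (f ξ)) z‖ₑ = ‖𝓕 f (-z)‖ₑ := by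
  rw [fourier_conj, ← ofReal_norm, RCLike.norm_conj, ofReal_norm]

lemma enorm_fourier_le (f : Space d → ℂ) (z : Space d) : ‖𝓕 f z‖ₑ ≤ ∫⁻ ξ, ‖f ξ‖ₑ := by
  rw [fourier_eq_integral_character]
  refine (enorm_integral_le_lintegral_enorm _).trans (le_of_eq ?_)
  congr with ξ
  rw [enorm_mul, ← ofReal_norm (character _ _), norm_character, ENNReal.ofReal_one, mul_one]

lemma integral_mul_fourier {u v : Space d → ℂ} (hu : Integrable u) (hv : Integrable v) :
    ∫ x, u x * 𝓕 v x = ∫ ξ, 𝓕 u ξ * v ξ := by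
  have := VectorFourier.integral_fourierIntegral_smul_eq_flip (μ := volume) (ν := volume)
    (L := innerₗ (Space d)) Real.continuous_fourierChar (by simpa using continuous_inner) hu hv
  simp only [smul_eq_mul] at this
  rw [flip_innerₗ] at this
  exact this.symm

/-- The Fourier transform of a product is a convolution. -/
lemma fourier_mul_eq {u v : Space d → ℂ} (hu : Integrable u) (hv : ContDiff ℝ ∞ v)
    (hc : HasCompactSupport v) (z : Space d) :
    𝓕 (fun ξ => u ξ * v ξ) z = ∫ y, 𝓕 u (z - y) * 𝓕 v y := by
  have hFv := integrable_fourier_of_contDiff hv hc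
  -- Only `v` is inverted; the multiplication formula then moves the outer transform onto `u` times
  -- a character. This avoids any integrability of `𝓕 u`.
  have h1 : 𝓕 (fun ξ => u ξ * v ξ) z = ∫ ξ, (u ξ * character (-z) ξ) * 𝓕⁻ (𝓕 v) ξ := by
    rw [fourier_eq_integral_character]
    congr with ξ
    rw [hv.continuous.fourierInv_fourier_eq
      (hv.continuous.integrable_of_hasCompactSupport hc) hFv]
    ring
  have hu' : Integrable fun ξ => u ξ * character (-z) ξ := by
    refine (hu.norm.mono (hu.aestronglyMeasurable.mul
      (continuous_character _).aestronglyMeasurable) (Filter.Eventually.of_forall fun ξ => ?_))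
    simp
  rw [h1]
  have h2 : ∀ ξ, 𝓕⁻ (𝓕 v) ξ = 𝓕 (fun y => 𝓕 v (-y)) ξ := by
    intro ξ
    rw [Real.fourierInv_eq_fourier_comp_neg]
  simp_rw [h2]
  rw [integral_mul_fourier hu' hFv.comp_neg]
  simp_rw [fourier_mul_character]
  rw [← integral_neg_eq_self]
  simp [sub_eq_add_neg, add_comm]

lemma enorm_fourier_mul_le {u v : Space d → ℂ} (hu : Integrable u) (hv : ContDiff ℝ ∞ v)
    (hc : HasCompactSupport v) (z : Space d) :
    ‖𝓕 (fun ξ => u ξ * v ξ) z‖ₑ ≤ ∫⁻ y, ‖𝓕 u (z - y)‖ₑ * ‖𝓕 v y‖ₑ := by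
  rw [fourier_mul_eq hu hv hc]
  refine (enorm_integral_le_lintegral_enorm _).trans (le_of_eq ?_)
  simp_rw [enorm_mul]

/-- `𝓕⁻¹φ ∗ g = 𝓕⁻¹(φ ĝ)`. -/
lemma conv_fourierInv_eq {φ g : Space d → ℂ} (hφ : ContDiff ℝ ∞ φ) (hc : HasCompactSupport φ)
    (hg : Integrable g) (x : Space d) :
    conv (𝓕⁻ φ) g x = 𝓕⁻ (fun ξ => φ ξ * 𝓕 g ξ) x := by
  have hφi := hφ.continuous.integrable_of_hasCompactSupport (μ := volume) hc
  have hgx : Integrable fun t => g (x - t) := hg.comp_sub_left x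
  -- Written as the Fourier transform of a reflection, `𝓕⁻ φ` is accessible to the multiplication
  -- formula, which only needs `φ` and `g` integrable.
  have h1 : conv (𝓕⁻ φ) g x = ∫ t, g (x - t) * 𝓕 (fun ξ => φ (-ξ)) t := by
    unfold conv
    rw [convolution_def]
    congr with t
    rw [ContinuousLinearMap.mul_apply', Real.fourierInv_eq_fourier_comp_neg, mul_comm]
  rw [h1, integral_mul_fourier hgx hφi.comp_neg, fourierInv_eq_integral_character,
    ← integral_neg_eq_self]
  congr with ξ
  have h2 : 𝓕 (fun t => g (x - t)) (-ξ) = character x ξ * 𝓕 g ξ := by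
    simp_rw [fourier_eq_integral_character]
    rw [← integral_const_mul, ← integral_sub_left_eq_self _ volume x]
    congr with t
    simp only [sub_sub_cancel, neg_neg]
    rw [sub_eq_add_neg, character_add_right, character_comm ξ x, character_comm ξ (-t),
      character_comm (-ξ) t]
    have : character (-t) ξ = character t (-ξ) := by simp [character]
    rw [this]
    ring
  rw [h2]
  simp only [neg_neg]
  ring

lemma fourier_translate (y : Space d) (g : Space d → ℂ) (ξ : Space d) :
    𝓕 (translate y g) ξ = character (-y) ξ * 𝓕 g ξ := by
  unfold translate
  rw [fourier_comp_sub, character_comm]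
  congr 1
  simp [character]

lemma integrable_translate {g : Space d → ℂ} (hg : Integrable g) (y : Space d) :
    Integrable (translate y g) := hg.comp_sub_right y

end FourierToolkit

/-! ### Continuity of functionals on test functions, and Fourier distributions -/

section Functionals

variable {d : ℕ} {O : Opens (Space d)}

/-- The weight is integrable because `d + 1 > d`, and it is at most one, so higher powers are
dominated by the first. -/
lemma eLpNorm_one_add_norm_lt_top {q : ℝ≥0∞} (hq : 1 ≤ q) :
    eLpNorm (fun x : Space d => ((1 + ‖x‖) ^ (d + 1))⁻¹) q volume < ⊤ := by
  have hbd : ∀ x : Space d, ‖((1 + ‖x‖) ^ (d + 1))⁻¹‖ₑ ≤ 1 := by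
    intro x
    rw [Real.enorm_of_nonneg (by positivity)]
    exact ENNReal.ofReal_le_one.2
      (inv_le_one_of_one_le₀ (one_le_pow₀ (by linarith [norm_nonneg x])))
  have h1 : Integrable fun x : Space d => ((1 + ‖x‖) ^ (d + 1))⁻¹ := by
    have := integrable_one_add_norm (E := Space d) (μ := volume) (r := d + 1) (by simp)
    refine this.congr (Filter.Eventually.of_forall fun x => ?_)
    dsimp only
    rw [Real.rpow_neg (by positivity), ← Real.rpow_natCast]
    push_cast
    rfl
  rcases eq_or_ne q ⊤ with rfl | hqt
  · rw [eLpNorm_exponent_top]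
    exact (essSup_le_of_ae_le 1 (Filter.Eventually.of_forall hbd)).trans_lt ENNReal.one_lt_top
  have hr : 1 ≤ q.toReal := by
    rw [← ENNReal.toReal_one]; exact (ENNReal.toReal_le_toReal (by simp) hqt).2 hq
  refine (eLpNorm_lt_top_iff_lintegral_rpow_enorm_lt_top (zero_lt_one.trans_le hq).ne' hqt).2 ?_
  refine lt_of_le_of_lt (lintegral_mono fun x => ?_) h1.2
  calc ‖((1 + ‖x‖) ^ (d + 1))⁻¹‖ₑ ^ q.toReal ≤ ‖((1 + ‖x‖) ^ (d + 1))⁻¹‖ₑ ^ (1 : ℝ) :=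
        ENNReal.rpow_le_rpow_of_exponent_ge (hbd x) hr
    _ = _ := ENNReal.rpow_one _

/-- Decay of the Fourier transform of a test function supported in `K`, with seminorm control. -/
lemma exists_norm_fourier_le (K : Compacts (Space d)) (n : ℕ) : ∃ C : ℝ, 0 ≤ C ∧
    ∀ (f : 𝓓_{K}(Space d, ℂ)) (x : Space d), (1 + ‖x‖) ^ n * ‖𝓕 (f : Space d → ℂ) x‖ ≤
      C * ((Finset.range (n + 1)).sup fun i => ContDiffMapSupportedIn.seminorm ℂ (Space d) ℂ ⊤ K i)
        f := by
  refine ⟨∑ i ∈ Finset.range (n + 1), 2 ^ i * (∑ _p ∈ Finset.range (i + 1), volume.real (K : Set (Space d))) * (n.choose i), by positivity, fun f x => ?_⟩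
  set P := ((Finset.range (n + 1)).sup fun i =>
    ContDiffMapSupportedIn.seminorm ℂ (Space d) ℂ ⊤ K i) f with hP
  have hint : ∀ k m : ℕ, Integrable fun v => ‖v‖ ^ k * ‖iteratedFDeriv ℝ m (f : Space d → ℂ) v‖ := by
    intro k m
    refine Continuous.integrable_of_hasCompactSupport ?_ ?_
    · exact (continuous_norm.pow k).mul (f.contDiff.continuous_iteratedFDeriv
        (by exact_mod_cast le_top)).norm
    · exact (f.hasCompactSupport.iteratedFDeriv m).norm.mul_left
  have hI : ∀ p ≤ n, ∫ v, ‖iteratedFDeriv ℝ p (f : Space d → ℂ) v‖ ≤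
      volume.real (K : Set (Space d)) * P := by
    intro p hp
    have hle : ∀ v, ‖iteratedFDeriv ℝ p (f : Space d → ℂ) v‖ ≤
        (K : Set (Space d)).indicator (fun _ => P) v := by
      intro v
      by_cases hv : v ∈ (K : Set (Space d))
      · rw [indicator_of_mem hv]
        refine (ContDiffMapSupportedIn.norm_iteratedFDeriv_apply_le_seminorm_top ℂ).trans ?_
        rw [hP]
        exact Seminorm.le_def.1 (Finset.le_sup (f := fun i =>
          ContDiffMapSupportedIn.seminorm ℂ (Space d) ℂ ⊤ K i)
          (Finset.mem_range.2 (Nat.lt_succ_of_le hp))) f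
      · rw [indicator_of_notMem hv]
        have : iteratedFDeriv ℝ p (f : Space d → ℂ) v = 0 :=
          ContDiffMapSupportedIn.iteratedFDeriv_zero_on_compl f hv
        simp [this]
    calc ∫ v, ‖iteratedFDeriv ℝ p (f : Space d → ℂ) v‖
        ≤ ∫ v, (K : Set (Space d)).indicator (fun _ => P) v := by
          refine integral_mono (by simpa using hint 0 p) ?_ hle
          exact (integrable_indicator_iff K.isCompact.measurableSet).2
            (integrableOn_const K.isCompact.measure_lt_top.ne)
      _ = _ := by
          rw [integral_indicator_const _ K.isCompact.measurableSet, smul_eq_mul]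
  rw [add_comm, add_pow, Finset.sum_mul, Finset.sum_mul]
  refine Finset.sum_le_sum fun i hi => ?_
  have hin : i ≤ n := Nat.lt_succ_iff.1 (Finset.mem_range.1 hi)
  have h := Real.pow_mul_norm_iteratedFDeriv_fourier_le (K := 0) (N := ⊤) (f := (f : Space d → ℂ))
    f.contDiff (fun k m _ _ => hint k m) (k := 0) (n := i) le_rfl le_top x
  simp only [norm_iteratedFDeriv_zero, pow_zero, one_mul, Nat.cast_zero, mul_zero, zero_add,
    Finset.range_one, Finset.sum_product, Finset.sum_singleton] at h
  calc ‖x‖ ^ i * 1 ^ (n - i) * (n.choose i) * ‖𝓕 (f : Space d → ℂ) x‖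
      = ‖x‖ ^ i * ‖𝓕 (f : Space d → ℂ) x‖ * (n.choose i) := by rw [one_pow]; ring
    _ ≤ (2 ^ i * ∑ p ∈ Finset.range (i + 1), volume.real (K : Set (Space d)) * P) *
          (n.choose i) := by
        refine mul_le_mul_of_nonneg_right (h.trans ?_) (by positivity)
        gcongr with p hp
        exact hI p ((Nat.lt_succ_iff.1 (Finset.mem_range.1 hp)).trans hin)
    _ = _ := by rw [← Finset.sum_mul]; ring

/-- Continuity criterion for functionals on test functions, in terms of `L^q` norms of the Fourier
transform. -/
lemma continuous_of_enorm_le_fourier (L : 𝓓(O, ℂ) →ₗ[ℂ] ℂ) {q : ℝ≥0∞} (hq : 1 ≤ q)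
    (hL : ∀ K : Compacts (Space d), (K : Set (Space d)) ⊆ O → ∃ C : ℝ≥0∞, C ≠ ⊤ ∧
      ∀ η : 𝓓(O, ℂ), tsupport η ⊆ K → ‖L η‖ₑ ≤ C * eLpNorm (𝓕 (η : Space d → ℂ)) q volume) :
    Continuous L := by
  rw [TestFunction.continuous_iff_continuous_comp]
  intro K hK
  obtain ⟨C, hC, hLC⟩ := hL K hK
  obtain ⟨B, hB0, hB⟩ := exists_norm_fourier_le K (d + 1)
  set W := eLpNorm (fun x : Space d => ((1 + ‖x‖) ^ (d + 1))⁻¹) q volume with hW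
  have hWt : W < ⊤ := eLpNorm_one_add_norm_lt_top hq
  refine (ContDiffMapSupportedIn.mkCLMtoNormedSpace (𝕜 := ℂ)
    (fun f : 𝓓_{K}(Space d, ℂ) => L (TestFunction.ofSupportedIn hK f))
    (fun f g => L.map_add (TestFunction.ofSupportedIn hK f) (TestFunction.ofSupportedIn hK g))
    (fun c f => L.map_smul c (TestFunction.ofSupportedIn hK f))
    ⟨Finset.range (d + 2), (C * W).toReal * B, by positivity, fun f => ?_⟩).continuous
  set P := ((Finset.range (d + 2)).sup fun i =>
    ContDiffMapSupportedIn.seminorm ℂ (Space d) ℂ ⊤ K i) f with hP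
  have hP0 : 0 ≤ P := apply_nonneg _ _
  have h1 := hLC (TestFunction.ofSupportedIn hK f) (closure_minimal f.support_subset
    K.isCompact.isClosed)
  have h2 : eLpNorm (𝓕 (f : Space d → ℂ)) q volume ≤ ENNReal.ofReal (B * P) * W := by
    rw [hW, ← abs_of_nonneg (mul_nonneg hB0 hP0), ← Real.norm_eq_abs, ofReal_norm,
      ← eLpNorm_const_smul]
    refine eLpNorm_mono fun x => ?_
    rw [Pi.smul_apply, smul_eq_mul, Real.norm_of_nonneg (by positivity), ← div_eq_mul_inv,
      le_div_iff₀ (by positivity), mul_comm]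
    exact hB f x
  have h3 : ‖L (TestFunction.ofSupportedIn hK f)‖ₑ ≤ C * (ENNReal.ofReal (B * P) * W) :=
    h1.trans (by gcongr; exact h2)
  have h4 : C * (ENNReal.ofReal (B * P) * W) = ENNReal.ofReal ((C * W).toReal * B * P) := by
    rw [mul_assoc, ENNReal.ofReal_mul ENNReal.toReal_nonneg,
      ENNReal.ofReal_toReal (ENNReal.mul_lt_top hC.lt_top hWt).ne]
    ring
  rw [h4, ← ofReal_norm] at h3
  exact (ENNReal.ofReal_le_ofReal_iff (by positivity)).1 h3

@[simp] lemma fourierToZ_fn (η : 𝓓(O, ℂ)) : (fourierToZ O η).fn = 𝓕 (η : Space d → ℂ) := rfl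

lemma fourierToZ_surjective : Function.Surjective (fourierToZ O) :=
  LinearMap.surjective_rangeRestrict (fourierLM O)

lemma fourierToZLM_injective : Function.Injective (fourierToZLM O) := by
  intro η θ h
  have h1 : 𝓕 (η : Space d → ℂ) = 𝓕 (θ : Space d → ℂ) := congrArg Subtype.val h
  ext ξ
  rw [eq_integral_fourier_mul_character η.contDiff η.hasCompactSupport ξ, h1,
    ← eq_integral_fourier_mul_character θ.contDiff θ.hasCompactSupport ξ]

/-- The Fourier distribution with a given Fourier transform. -/
def FourierDistribution.ofFourier (L : 𝓓(O, ℂ) →L[ℂ] ℂ) : FourierDistribution O where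
  toLinearMap := L.toLinearMap ∘ₗ (LinearEquiv.ofBijective (fourierToZLM O)
    ⟨fourierToZLM_injective, LinearMap.surjective_rangeRestrict (fourierLM O)⟩).symm.toLinearMap
  cont := by
    refine continuous_coinduced_dom.2 ?_
    convert L.continuous using 1
    funext η
    simp only [Function.comp_apply, AddHom.toFun_eq_coe, LinearMap.coe_toAddHom,
      LinearMap.comp_apply, LinearEquiv.coe_coe]
    exact congrArg L ((LinearEquiv.ofBijective (fourierToZLM O)
      ⟨fourierToZLM_injective, LinearMap.surjective_rangeRestrict
        (fourierLM O)⟩).symm_apply_apply η)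

lemma FourierDistribution.ofFourier_apply (L : 𝓓(O, ℂ) →L[ℂ] ℂ) (η : 𝓓(O, ℂ)) :
    FourierDistribution.ofFourier L (fourierToZ O η) = L η :=
  congrArg L ((LinearEquiv.ofBijective (fourierToZLM O)
      ⟨fourierToZLM_injective, LinearMap.surjective_rangeRestrict
        (fourierLM O)⟩).symm_apply_apply η)

lemma FourierDistribution.fourier_apply (f : FourierDistribution O) (η : 𝓓(O, ℂ)) :
    f.fourier η = f (fourierToZ O η) := rfl

/-- The pairing of a translate with `𝓕 η`. -/
lemma functionPairing_fourierToZ {g : Space d → ℂ} (hg : Integrable g) (η : 𝓓(O, ℂ)) :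
    functionPairing g (fourierToZ O η) = ∫ ξ, 𝓕 g ξ * η ξ := by
  unfold functionPairing
  rw [fourierToZ_fn, integral_mul_fourier hg
    (η.continuous.integrable_of_hasCompactSupport η.hasCompactSupport)]

/-- Translation turns into modulation on the Fourier side. Through this identity a series over the
translates becomes a series of samples of Fourier transforms at lattice points. -/
lemma functionPairing_translate {g : Space d → ℂ} (hg : Integrable g) (y : Space d)
    (η : 𝓓(O, ℂ)) :
    functionPairing (translate y g) (fourierToZ O η) = 𝓕 (fun ξ => 𝓕 g ξ * η ξ) y := by
  rw [functionPairing_fourierToZ (integrable_translate hg y), fourier_eq_integral_character]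
  congr with ξ
  rw [fourier_translate]
  ring

end Functionals

/-! ### An explicit summable weight on the integer lattice -/

section LatticeSums

/-- A discrete integral test: the summand is dominated by a telescoping difference. It follows from
`log((1+m)/m) ≥ 1/(1+m)` and `exp x ≥ 1 + x`. -/
lemma rpow_neg_sub_rpow_neg_ge {t : ℝ} (ht : 0 ≤ t) {m : ℝ} (hm : 0 < m) :
    t * (1 + m) ^ (-(1 + t)) ≤ m ^ (-t) - (1 + m) ^ (-t) := by
  have h1 : (1 + m) ^ (-(1 + t)) = (1 + m)⁻¹ * (1 + m) ^ (-t) := by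
    rw [neg_add, Real.rpow_add (by positivity), Real.rpow_neg_one]
  have h2 : m ^ (-t) = ((1 + m) / m) ^ t * (1 + m) ^ (-t) := by
    rw [Real.div_rpow (by positivity) hm.le, Real.rpow_neg hm.le, Real.rpow_neg (by positivity)]
    have : (1 + m) ^ t ≠ 0 := (Real.rpow_pos_of_pos (by positivity) t).ne'
    field_simp
  have h3 : 1 + t * (1 + m)⁻¹ ≤ ((1 + m) / m) ^ t := by
    have hx : 0 < (1 + m) / m := by positivity
    rw [Real.rpow_def_of_pos hx]
    have h4 : (1 + m)⁻¹ ≤ Real.log ((1 + m) / m) := by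
      have := Real.one_sub_inv_le_log_of_pos hx
      have h5 : 1 - ((1 + m) / m)⁻¹ = (1 + m)⁻¹ := by field_simp; ring
      rwa [h5] at this
    have := Real.add_one_le_exp (Real.log ((1 + m) / m) * t)
    nlinarith
  rw [h1, h2]
  have : 0 ≤ (1 + m) ^ (-t) := by positivity
  nlinarith

/-- The weight `(1 + |m|)^{-(1 + 1/d)}` on the integers. -/
def intWeight (d : ℕ) (m : ℤ) : ℝ := (1 + |(m : ℝ)|) ^ (-(1 + 1 / (d : ℝ)))

lemma intWeight_nonneg (d : ℕ) (m : ℤ) : 0 ≤ intWeight d m := by unfold intWeight; positivity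

lemma sum_intWeight_le {d : ℕ} (hd : 1 ≤ d) (N : ℕ) :
    ∑ m ∈ Finset.Icc (-(N : ℤ)) N, intWeight d m ≤ 1 + 2 * d := by
  have hd0 : (0 : ℝ) < d := by exact_mod_cast hd
  -- The induction needs the telescoped tail; with `t = 1/d`, dropping it at the end leaves `1 +
  -- 2d`.
  suffices h : ∑ m ∈ Finset.Icc (-(N : ℤ)) N, intWeight d m ≤
      1 + 2 * d * (1 - (1 + (N : ℝ)) ^ (-(1 / (d : ℝ)))) by
    refine h.trans ?_
    have : 0 ≤ (1 + (N : ℝ)) ^ (-(1 / (d : ℝ))) := by positivity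
    nlinarith
  induction N with
  | zero => simp [intWeight]
  | succ N ih =>
    have e : Finset.Icc (-((N + 1 : ℕ) : ℤ)) ((N + 1 : ℕ) : ℤ) =
        insert (-((N + 1 : ℕ) : ℤ)) (insert ((N + 1 : ℕ) : ℤ) (Finset.Icc (-(N : ℤ)) N)) := by
      ext m
      simp only [Finset.mem_Icc, Finset.mem_insert]
      push_cast
      omega
    rw [e, Finset.sum_insert, Finset.sum_insert]
    · have h1 := rpow_neg_sub_rpow_neg_ge (t := 1 / (d : ℝ)) (by positivity)
        (m := 1 + (N : ℝ)) (by positivity)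
      have h2 : intWeight d ((N + 1 : ℕ) : ℤ) = (1 + (1 + (N : ℝ))) ^ (-(1 + 1 / (d : ℝ))) := by
        unfold intWeight
        rw [abs_of_nonneg (by positivity)]
        push_cast
        ring_nf
      have h3 : intWeight d (-((N + 1 : ℕ) : ℤ)) = intWeight d ((N + 1 : ℕ) : ℤ) := by
        unfold intWeight
        push_cast
        rw [abs_neg]
      rw [h3, h2]
      set x := (1 + (1 + (N : ℝ))) ^ (-(1 + 1 / (d : ℝ)))
      have h4 : x ≤ d * ((1 + (N : ℝ)) ^ (-(1 / (d : ℝ))) -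
          (1 + (1 + (N : ℝ))) ^ (-(1 / (d : ℝ)))) := by
        have := mul_le_mul_of_nonneg_left h1 hd0.le
        rwa [← mul_assoc, mul_one_div_cancel hd0.ne', one_mul] at this
      have h5 : (1 + ((N + 1 : ℕ) : ℝ)) = 1 + (1 + (N : ℝ)) := by push_cast; ring
      rw [h5]
      linarith
    · simp
    · simp only [Finset.mem_insert, Finset.mem_Icc]
      push_cast
      omega

/-- Every finite set of lattice points lies in a cube, and over a cube the sum of products factors
into `d` equal one-dimensional sums. -/
lemma tsum_prod_intWeight_le {d : ℕ} (hd : 1 ≤ d) :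
    ∑' n : Fin d → ℤ, ENNReal.ofReal (∏ l, intWeight d (n l)) ≤
      ENNReal.ofReal ((1 + 2 * d) ^ d) := by
  classical
  rw [ENNReal.tsum_eq_iSup_sum]
  refine iSup_le fun s => ?_
  obtain ⟨N, hN⟩ : ∃ N : ℕ, ∀ n ∈ s, ∀ l, |n l| ≤ N := by
    refine ⟨∑ n ∈ s, ∑ l, (n l).natAbs, fun n hn l => ?_⟩
    rw [Int.abs_eq_natAbs]
    have h1 : (n l).natAbs ≤ ∑ l, (n l).natAbs :=
      Finset.single_le_sum (f := fun l => (n l).natAbs) (fun _ _ => Nat.zero_le _)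
        (Finset.mem_univ l)
    have h2 := Finset.single_le_sum (f := fun n : Fin d → ℤ => ∑ l, (n l).natAbs)
      (fun _ _ => Nat.zero_le _) hn
    exact_mod_cast h1.trans h2
  have hsub : s ⊆ Fintype.piFinset fun _ : Fin d => Finset.Icc (-(N : ℤ)) N := by
    intro n hn
    rw [Fintype.mem_piFinset]
    intro l
    rw [Finset.mem_Icc, ← abs_le]
    exact hN n hn l
  refine (Finset.sum_le_sum_of_subset hsub).trans ?_
  rw [← ENNReal.ofReal_sum_of_nonneg fun n _ => Finset.prod_nonneg fun l _ => intWeight_nonneg d _]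
  refine ENNReal.ofReal_le_ofReal ?_
  rw [Finset.sum_prod_piFinset (Finset.Icc (-(N : ℤ)) N) fun _ m => intWeight d m]
  rw [Finset.prod_const, Finset.card_univ, Fintype.card_fin]
  exact pow_le_pow_left₀ (Finset.sum_nonneg fun m _ => intWeight_nonneg d m)
    (sum_intWeight_le hd N) d

/-- The reason for the exponent `1 + 1/d`: decay of order `d + 1` splits into `d` equal factors, one
for each coordinate, which remain summable on `ℤ`. -/
lemma inv_pow_le_prod_intWeight {d : ℕ} (hd : 1 ≤ d) (n : Fin d → ℤ) {M : ℝ}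
    (hM : ∀ l, |(n l : ℝ)| ≤ M) : ((1 + M) ^ (d + 1))⁻¹ ≤ ∏ l, intWeight d (n l) := by
  have hd0 : (0 : ℝ) < d := by exact_mod_cast hd
  have hM0 : 0 ≤ M := (abs_nonneg _).trans (hM ⟨0, hd⟩)
  have h1 : ((1 + M) ^ (d + 1))⁻¹ = ∏ _l : Fin d, (1 + M) ^ (-(1 + 1 / (d : ℝ))) := by
    rw [Finset.prod_const, Finset.card_univ, Fintype.card_fin, ← Real.rpow_natCast,
      ← Real.rpow_natCast, ← Real.rpow_mul (by positivity), ← Real.rpow_neg (by positivity)]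
    congr 1
    push_cast
    field_simp
  rw [h1]
  refine Finset.prod_le_prod (fun l _ => by positivity) fun l _ => ?_
  unfold intWeight
  refine Real.rpow_le_rpow_of_nonpos (by positivity) ?_ ?_
  · linarith [hM l]
  · have : 0 ≤ 1 / (d : ℝ) := by positivity
    linarith

end LatticeSums

/-! ### Amalgam norms of decaying functions -/

section Amalgam

variable {d : ℕ}

/-- The unit cube `n + [0, 1]^d`. -/
def unitCube (n : Fin d → ℤ) : Set (Space d) := {x | ∀ i, x i ∈ Icc (n i : ℝ) (n i + 1)}

lemma amalgamNorm_eq (f : Space d → ℂ) :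
    amalgamNorm f = ∑' n, eLpNorm (indicator (unitCube n) f) ⊤ volume := rfl

lemma unitCube_eq (n : Fin d → ℤ) : unitCube n =
    (WithLp.ofLp : Space d → Fin d → ℝ) ⁻¹' (Set.pi univ fun i => Icc (n i : ℝ) (n i + 1)) := by
  ext x; simp only [unitCube, mem_ofPred_eq, mem_preimage, mem_pi, mem_univ, true_imp_iff]

lemma measurableSet_unitCube (n : Fin d → ℤ) : MeasurableSet (unitCube n) := by
  rw [unitCube_eq]
  exact (PiLp.continuous_ofLp 2 _).measurable
    (MeasurableSet.univ_pi fun i => measurableSet_Icc)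

lemma volume_unitCube (n : Fin d → ℤ) : volume (unitCube n) = 1 := by
  rw [unitCube_eq, (PiLp.volume_preserving_ofLp (Fin d)).measure_preimage
    (MeasurableSet.univ_pi fun i => measurableSet_Icc).nullMeasurableSet, volume_pi_pi]
  simp

lemma mem_unitCube_floor (x : Space d) : x ∈ unitCube fun i => ⌊x i⌋ := fun _ =>
  ⟨Int.floor_le _, (Int.lt_floor_add_one _).le⟩

/-- The unit cubes cover the space and each has measure one, so on every cube the integral is at
most the essential supremum. -/
lemma lintegral_enorm_le_amalgamNorm (f : Space d → ℂ) :
    ∫⁻ x, ‖f x‖ₑ ≤ amalgamNorm f := by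
  rw [amalgamNorm_eq]
  have hu : (univ : Set (Space d)) = ⋃ n, unitCube n :=
    (eq_univ_of_forall fun x => mem_iUnion.2 ⟨_, mem_unitCube_floor x⟩).symm
  rw [← setLIntegral_univ, hu]
  refine (lintegral_iUnion_le _ _).trans (ENNReal.tsum_le_tsum fun n => ?_)
  rw [← lintegral_indicator (measurableSet_unitCube n), eLpNorm_exponent_top]
  have h : ∀ᵐ x, (unitCube n).indicator (fun x => ‖f x‖ₑ) x ≤
      (unitCube n).indicator (fun _ => eLpNormEssSup (indicator (unitCube n) f) volume) x := by
    filter_upwards [enorm_ae_le_eLpNormEssSup (indicator (unitCube n) f) volume] with x hx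
    by_cases hxn : x ∈ unitCube n
    · simpa [hxn] using hx
    · simp [hxn]
  refine (lintegral_mono_ae h).trans ?_
  rw [lintegral_indicator (measurableSet_unitCube n), setLIntegral_const, volume_unitCube, mul_one]

/-- Functions which decay of order `d + 1` belong to `W(L^∞, ℓ^1)`. -/
lemma amalgamNorm_le_of_decay (hd : 1 ≤ d) {f : Space d → ℂ} {B : ℝ≥0∞}
    (hf : ∀ x l, ENNReal.ofReal ((1 + |x l|) ^ (d + 1)) * ‖f x‖ₑ ≤ B) :
    amalgamNorm f ≤ ENNReal.ofReal (2 ^ (d + 1) * (1 + 2 * d) ^ d) * B := by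
  rw [amalgamNorm_eq]
  have key : ∀ n : Fin d → ℤ, eLpNorm (indicator (unitCube n) f) ⊤ volume ≤
      ENNReal.ofReal (∏ l, intWeight d (n l)) * (ENNReal.ofReal (2 ^ (d + 1)) * B) := by
    intro n
    rw [eLpNorm_exponent_top]
    refine essSup_le_of_ae_le _ (Filter.Eventually.of_forall fun x => ?_)
    by_cases hx : x ∈ unitCube n
    swap
    · simp [hx]
    simp only [indicator_of_mem hx]
    have : Nonempty (Fin d) := ⟨⟨0, hd⟩⟩
    -- Decay is assumed in every coordinate separately; in the cube of `n` the coordinate with the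
    -- largest `|n l|` is used. Passing from `x l` to `n l` costs a factor `2`, the origin of `2 ^
    -- (d + 1)`.
    obtain ⟨l, hl⟩ := Finite.exists_max fun l => |(n l : ℝ)|
    have h1 : 1 + |(n l : ℝ)| ≤ 2 * (1 + |x l|) := by
      have h2 := hx l
      have h3 : |(n l : ℝ) - x l| ≤ 1 := by rw [abs_le]; constructor <;> linarith [h2.1, h2.2]
      have h4 : |(n l : ℝ)| ≤ |(n l : ℝ) - x l| + |x l| := by
        simpa using abs_add_le ((n l : ℝ) - x l) (x l)
      linarith [abs_nonneg (x l)]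
    have hp : 0 ≤ ∏ l, intWeight d (n l) := Finset.prod_nonneg fun l _ => intWeight_nonneg d _
    have h5 : 1 ≤ (∏ l, intWeight d (n l)) * (2 ^ (d + 1) * (1 + |x l|) ^ (d + 1)) := by
      have h6 := inv_pow_le_prod_intWeight hd n (M := |(n l : ℝ)|) hl
      rw [← mul_pow]
      calc (1 : ℝ) = ((1 + |(n l : ℝ)|) ^ (d + 1))⁻¹ * (1 + |(n l : ℝ)|) ^ (d + 1) := by
            rw [inv_mul_cancel₀]; positivity
        _ ≤ _ := by gcongr
    calc ‖f x‖ₑ = ENNReal.ofReal 1 * ‖f x‖ₑ := by simp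
      _ ≤ ENNReal.ofReal ((∏ l, intWeight d (n l)) * (2 ^ (d + 1) * (1 + |x l|) ^ (d + 1))) *
            ‖f x‖ₑ := by gcongr
      _ = ENNReal.ofReal (∏ l, intWeight d (n l)) * (ENNReal.ofReal (2 ^ (d + 1)) *
            (ENNReal.ofReal ((1 + |x l|) ^ (d + 1)) * ‖f x‖ₑ)) := by
          rw [ENNReal.ofReal_mul hp, ENNReal.ofReal_mul (by positivity)]; ring
      _ ≤ _ := by gcongr; exact hf x l
  refine (ENNReal.tsum_le_tsum key).trans ?_
  rw [ENNReal.tsum_mul_right]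
  refine (mul_le_mul_left (tsum_prod_intWeight_le hd) _).trans (le_of_eq ?_)
  rw [ENNReal.ofReal_mul (by positivity)]
  ring

end Amalgam

/-! ### Decay of Fourier transforms from derivatives -/

section Decay

variable {d : ℕ}

lemma contDiff_pderiv {f : Space d → ℂ} (hf : ContDiff ℝ ∞ f) (l : Fin d) :
    ContDiff ℝ ∞ (pderiv l f) :=
  (hf.fderiv_right (m := ∞) (by simp)).clm_apply contDiff_const

lemma hasCompactSupport_pderiv {f : Space d → ℂ} (hf : HasCompactSupport f) (l : Fin d) :
    HasCompactSupport (pderiv l f) :=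
  (hf.fderiv ℝ).comp_left (g := fun L : Space d →L[ℝ] ℂ => L (EuclideanSpace.single l 1)) rfl

lemma contDiff_pderiv_iterate {f : Space d → ℂ} (hf : ContDiff ℝ ∞ f) (l : Fin d) (n : ℕ) :
    ContDiff ℝ ∞ ((pderiv l)^[n] f) := by
  induction n with
  | zero => exact hf
  | succ n ih => rw [Function.iterate_succ_apply']; exact contDiff_pderiv ih l

lemma hasCompactSupport_pderiv_iterate {f : Space d → ℂ} (hf : HasCompactSupport f) (l : Fin d)
    (n : ℕ) : HasCompactSupport ((pderiv l)^[n] f) := by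
  induction n with
  | zero => exact hf
  | succ n ih => rw [Function.iterate_succ_apply']; exact hasCompactSupport_pderiv ih l

lemma fourier_pderiv {f : Space d → ℂ} (hf : ContDiff ℝ ∞ f) (hc : HasCompactSupport f)
    (l : Fin d) (y : Space d) :
    𝓕 (pderiv l f) y = 2 * Real.pi * Complex.I * (y l : ℝ) * 𝓕 f y := by
  have hi := hf.continuous.integrable_of_hasCompactSupport (μ := volume) hc
  have hf' : Continuous (fderiv ℝ f) := hf.continuous_fderiv (by simp)
  have hi' : Integrable (fderiv ℝ f) := hf'.integrable_of_hasCompactSupport (hc.fderiv ℝ)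
  have h := Real.fourier_fderiv hi (hf.differentiable (by simp)) hi'
  have h1 := Real.fourier_continuousLinearMap_apply (a := EuclideanSpace.single l (1 : ℝ))
    (v := y) hi'
  rw [h] at h1
  have h2 : 𝓕 (pderiv l f) y = 𝓕 (fun x => fderiv ℝ f x (EuclideanSpace.single l (1 : ℝ))) y := rfl
  rw [h2, ← h1]
  have h3 : innerSL ℝ y (EuclideanSpace.single l (1 : ℝ)) = y l :=
    (innerSL_apply_apply ℝ y _).trans (by simp [EuclideanSpace.inner_single_right])
  simp [VectorFourier.fourierSMulRight_apply, h3]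
  try ring

lemma enorm_fourier_pderiv_iterate {f : Space d → ℂ} (hf : ContDiff ℝ ∞ f)
    (hc : HasCompactSupport f) (l : Fin d) (n : ℕ) (y : Space d) :
    ‖𝓕 ((pderiv l)^[n] f) y‖ₑ = ENNReal.ofReal ((2 * Real.pi * |y l|) ^ n) * ‖𝓕 f y‖ₑ := by
  induction n with
  | zero => simp
  | succ n ih =>
    rw [Function.iterate_succ_apply', fourier_pderiv (contDiff_pderiv_iterate hf l n)
      (hasCompactSupport_pderiv_iterate hc l n), enorm_mul, ih, ← mul_assoc, pow_succ',
      ENNReal.ofReal_mul (by positivity)]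
    congr 2
    rw [← ofReal_norm]
    simp [abs_of_pos Real.pi_pos]

/-- Decay of the Fourier transform in terms of pure partial derivatives of order `d + 1`. -/
lemma enorm_fourier_decay {G : Space d → ℂ} (hG : ContDiff ℝ ∞ G) (hc : HasCompactSupport G)
    {Y : ℝ} (hY : 1 ≤ Y) {N : ℝ≥0∞} (h0 : ∫⁻ ξ, ‖G ξ‖ₑ ≤ N)
    (h1 : ∀ l, ∫⁻ ξ, ‖(pderiv l)^[d + 1] G ξ‖ₑ ≤ ENNReal.ofReal (Y ^ (d + 1)) * N)
    (y : Space d) (l : Fin d) :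
    ENNReal.ofReal ((1 + |y l| / Y) ^ (d + 1)) * ‖𝓕 G y‖ₑ ≤ ENNReal.ofReal (2 ^ (d + 1)) * N := by
  have hY0 : 0 < Y := by linarith
  -- Convexity gives the factor `2 ^ d`. The factor `2π ≥ 1` is inserted so that the last term
  -- becomes the Fourier transform of a pure derivative.
  have hp : (1 + |y l| / Y) ^ (d + 1) ≤ 2 ^ d * (1 + (Y ^ (d + 1))⁻¹ * (2 * Real.pi * |y l|) ^ (d + 1)) := by
    refine (add_pow_le zero_le_one (by positivity) _).trans ?_
    rw [one_pow, Nat.add_sub_cancel, div_pow, div_eq_inv_mul]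
    gcongr
    have : 1 ≤ 2 * Real.pi := by linarith [Real.pi_gt_three]
    nlinarith [abs_nonneg (y l)]
  have h2 : ENNReal.ofReal ((Y ^ (d + 1))⁻¹ * (2 * Real.pi * |y l|) ^ (d + 1)) * ‖𝓕 G y‖ₑ ≤ N := by
    rw [ENNReal.ofReal_mul (by positivity), mul_assoc, ← enorm_fourier_pderiv_iterate hG hc]
    calc _ ≤ ENNReal.ofReal (Y ^ (d + 1))⁻¹ * (ENNReal.ofReal (Y ^ (d + 1)) * N) := by
          gcongr; exact (enorm_fourier_le _ _).trans (h1 l)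
      _ = N := by
          rw [← mul_assoc, ← ENNReal.ofReal_mul (by positivity),
            inv_mul_cancel₀ (by positivity), ENNReal.ofReal_one, one_mul]
  calc _ ≤ ENNReal.ofReal (2 ^ d * (1 + (Y ^ (d + 1))⁻¹ * (2 * Real.pi * |y l|) ^ (d + 1))) *
        ‖𝓕 G y‖ₑ := by gcongr
    _ = ENNReal.ofReal (2 ^ d) * (‖𝓕 G y‖ₑ +
          ENNReal.ofReal ((Y ^ (d + 1))⁻¹ * (2 * Real.pi * |y l|) ^ (d + 1)) * ‖𝓕 G y‖ₑ) := by
        rw [ENNReal.ofReal_mul (by positivity), ENNReal.ofReal_add zero_le_one (by positivity),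
          ENNReal.ofReal_one]
        ring
    _ ≤ ENNReal.ofReal (2 ^ d) * (N + N) := by
        gcongr
        exact (enorm_fourier_le _ _).trans h0
    _ = _ := by
        rw [pow_succ (2 : ℝ), ENNReal.ofReal_mul (by positivity), ENNReal.ofReal_ofNat]
        ring

/-- The `L^1` norm of a function which decays of order `d + 1` at scale `Y`. -/
lemma lintegral_enorm_le_of_decay (hd : 1 ≤ d) {f : Space d → ℂ} {Y : ℝ} (hY : 0 < Y) {B : ℝ≥0∞}
    (hf : ∀ x l, ENNReal.ofReal ((1 + |x l| / Y) ^ (d + 1)) * ‖f x‖ₑ ≤ B) :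
    ∫⁻ x, ‖f x‖ₑ ≤ ENNReal.ofReal (Y ^ d) *
      (ENNReal.ofReal (2 ^ (d + 1) * (1 + 2 * d) ^ d) * B) := by
  -- Rescaling by `Y` reduces to decay at scale one; undoing it costs the Jacobian `Y ^ d`.
  have h1 : ∫⁻ x, ‖f (Y • x)‖ₑ ≤ ENNReal.ofReal (2 ^ (d + 1) * (1 + 2 * d) ^ d) * B := by
    refine (lintegral_enorm_le_amalgamNorm fun x => f (Y • x)).trans
      (amalgamNorm_le_of_decay hd fun x l => ?_)
    have := hf (Y • x) l
    simpa [abs_mul, abs_of_pos hY, mul_div_cancel_left₀ _ hY.ne'] using this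
  have h2 : ∫⁻ x, ‖f (Y • x)‖ₑ = ENNReal.ofReal ((Y ^ d)⁻¹) * ∫⁻ x, ‖f x‖ₑ := by
    have e : MeasurableEmbedding fun x : Space d => Y • x :=
      (Homeomorph.smulOfNeZero Y hY.ne').measurableEmbedding
    rw [← e.lintegral_map (μ := volume) (fun x => ‖f x‖ₑ),
      Measure.map_addHaar_smul volume hY.ne', lintegral_smul_measure]
    simp [abs_of_pos hY]
  rw [h2] at h1
  calc ∫⁻ x, ‖f x‖ₑ = ENNReal.ofReal (Y ^ d) * (ENNReal.ofReal ((Y ^ d)⁻¹) * ∫⁻ x, ‖f x‖ₑ) := by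
        rw [← mul_assoc, ← ENNReal.ofReal_mul (by positivity), mul_inv_cancel₀ (by positivity),
          ENNReal.ofReal_one, one_mul]
    _ ≤ _ := by gcongr

end Decay

/-! ### Calculus of iterated partial derivatives -/

section PartialDerivatives

variable {d : ℕ}

lemma differentiable_of_contDiff {f : Space d → ℂ} (hf : ContDiff ℝ ∞ f) : Differentiable ℝ f :=
  hf.differentiable (by simp)

lemma pderiv_comm {f : Space d → ℂ} (hf : ContDiff ℝ ∞ f) (l m : Fin d) :
    pderiv l (pderiv m f) = pderiv m (pderiv l f) := by
  have h : ∀ a b : Fin d, ∀ x, pderiv a (pderiv b f) x =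
      fderiv ℝ (fderiv ℝ f) x (EuclideanSpace.single a 1) (EuclideanSpace.single b 1) := by
    intro a b x
    have h2 : DifferentiableAt ℝ (fderiv ℝ f) x :=
      ((hf.fderiv_right (m := ∞) (by simp)).differentiable (by simp)).differentiableAt
    unfold pderiv
    rw [fderiv_clm_apply h2 (differentiableAt_const _)]
    simp
  funext x
  rw [h, h]
  exact ((contDiff_infty.1 hf 2).contDiffAt.isSymmSndFDerivAt (by simp)) _ _

lemma pderiv_comm_iterate {f : Space d → ℂ} (hf : ContDiff ℝ ∞ f) (l m : Fin d) (n : ℕ) :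
    pderiv l ((pderiv m)^[n] f) = (pderiv m)^[n] (pderiv l f) := by
  induction n with
  | zero => rfl
  | succ n ih =>
    rw [Function.iterate_succ_apply', Function.iterate_succ_apply',
      pderiv_comm (contDiff_pderiv_iterate hf m n), ih]

lemma contDiff_foldr_pderiv {f : Space d → ℂ} (hf : ContDiff ℝ ∞ f) (α : Fin d → ℕ)
    (L : List (Fin d)) : ContDiff ℝ ∞ (L.foldr (fun i h => (pderiv i)^[α i] h) f) := by
  induction L with
  | nil => exact hf
  | cons a L ih => exact contDiff_pderiv_iterate ih a _

lemma contDiff_mderiv {f : Space d → ℂ} (hf : ContDiff ℝ ∞ f) (α : Fin d → ℕ) :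
    ContDiff ℝ ∞ (mderiv α f) := contDiff_foldr_pderiv hf α _

/-- The new derivative commutes past the others until it meets its own coordinate. Absence of
duplicates ensures that exactly one exponent is raised. -/
lemma pderiv_foldr {f : Space d → ℂ} (hf : ContDiff ℝ ∞ f) (α : Fin d → ℕ) (l : Fin d)
    (L : List (Fin d)) (hL : L.Nodup) (hl : l ∈ L) :
    pderiv l (L.foldr (fun i h => (pderiv i)^[α i] h) f) =
      L.foldr (fun i h => (pderiv i)^[(α + Pi.single l 1 : Fin d → ℕ) i] h) f := by
  induction L with
  | nil => simp at hl
  | cons a L ih =>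
    rw [List.nodup_cons] at hL
    simp only [List.foldr_cons]
    rcases eq_or_ne l a with rfl | hla
    · have h1 : L.foldr (fun i h => (pderiv i)^[(α + Pi.single l 1 : Fin d → ℕ) i] h) f =
          L.foldr (fun i h => (pderiv i)^[α i] h) f := by
        refine List.foldr_ext _ _ _ fun i hi h => ?_
        have : i ≠ l := fun e => hL.1 (e ▸ hi)
        simp [this]
      rw [h1]
      simp [Function.iterate_succ_apply']
    · have h1 : l ∈ L := by simpa [hla] using hl
      rw [pderiv_comm_iterate (contDiff_foldr_pderiv hf α L), ih hL.2 h1]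
      simp [hla.symm]

lemma pderiv_mderiv {f : Space d → ℂ} (hf : ContDiff ℝ ∞ f) (α : Fin d → ℕ) (l : Fin d) :
    pderiv l (mderiv α f) = mderiv (α + Pi.single l 1) f :=
  pderiv_foldr hf α l _ (List.nodup_finRange d) (List.mem_finRange l)

lemma mderiv_zero (f : Space d → ℂ) : mderiv 0 f = f := by
  unfold mderiv
  induction List.finRange d with
  | nil => rfl
  | cons a L _ => simp

lemma mderiv_single {f : Space d → ℂ} (hf : ContDiff ℝ ∞ f) (l : Fin d) (r : ℕ) :
    mderiv (Pi.single l r) f = (pderiv l)^[r] f := by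
  induction r with
  | zero => simp [mderiv_zero]
  | succ r ih =>
    rw [Function.iterate_succ_apply', ← ih, pderiv_mderiv hf, ← Pi.single_add]

lemma enorm_mderiv_le_maxDeriv (f : Space d → ℂ) {n : ℕ} {α : Fin d → ℕ} (hα : ∑ i, α i ≤ n)
    (ξ : Space d) : ‖mderiv α f ξ‖ₑ ≤ maxDeriv n f ξ :=
  le_iSup₂ (f := fun (α : Fin d → ℕ) (_ : ∑ i, α i ≤ n) => ‖mderiv α f ξ‖ₑ) α hα

lemma maxDeriv_mono (f : Space d → ℂ) {m n : ℕ} (h : m ≤ n) (ξ : Space d) :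
    maxDeriv m f ξ ≤ maxDeriv n f ξ :=
  iSup₂_le fun _ hα => enorm_mderiv_le_maxDeriv f (hα.trans h) ξ

lemma finite_multiIndex (d n : ℕ) : {α : Fin d → ℕ | ∑ i, α i ≤ n}.Finite := by
  refine (Set.Finite.pi' fun _ : Fin d => Set.finite_Iic n).subset fun α hα i => ?_
  exact (Finset.single_le_sum (f := α) (fun _ _ => Nat.zero_le _) (Finset.mem_univ i)).trans hα

lemma pderiv_add {f h : Space d → ℂ} (hf : ContDiff ℝ ∞ f) (hh : ContDiff ℝ ∞ h) (l : Fin d) :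
    pderiv l (f + h) = pderiv l f + pderiv l h := by
  funext x
  simp [pderiv, fderiv_add (differentiable_of_contDiff hf x) (differentiable_of_contDiff hh x)]

lemma pderiv_const_smul {f : Space d → ℂ} (hf : ContDiff ℝ ∞ f) (c : ℂ) (l : Fin d) :
    pderiv l (c • f) = c • pderiv l f := by
  funext x
  simp [pderiv, fderiv_const_smul (differentiable_of_contDiff hf x)]

lemma pderiv_mul {f h : Space d → ℂ} (hf : ContDiff ℝ ∞ f) (hh : ContDiff ℝ ∞ h) (l : Fin d) :
    pderiv l (f * h) = pderiv l f * h + f * pderiv l h := by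
  funext x
  simp [pderiv, fderiv_mul (differentiable_of_contDiff hf x) (differentiable_of_contDiff hh x)]
  ring

lemma pderiv_iterate_add {f h : Space d → ℂ} (hf : ContDiff ℝ ∞ f) (hh : ContDiff ℝ ∞ h)
    (l : Fin d) (n : ℕ) : (pderiv l)^[n] (f + h) = (pderiv l)^[n] f + (pderiv l)^[n] h := by
  induction n with
  | zero => rfl
  | succ n ih =>
    simp only [Function.iterate_succ_apply', ih]
    exact pderiv_add (contDiff_pderiv_iterate hf l n) (contDiff_pderiv_iterate hh l n) l

/-- A consequence of the Leibniz rule. -/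
lemma enorm_pderiv_iterate_mul_le (l : Fin d) (ξ : Space d) (p B : ℝ≥0∞) (n : ℕ) :
    ∀ {f h : Space d → ℂ} (_ : ContDiff ℝ ∞ f) (_ : ContDiff ℝ ∞ h) {m : ℝ≥0∞}
      (_ : ∀ k ≤ n, ‖(pderiv l)^[k] f ξ‖ₑ ≤ p) (_ : ∀ k ≤ n, ‖(pderiv l)^[k] h ξ‖ₑ ≤ m * B ^ k),
      ‖(pderiv l)^[n] (f * h) ξ‖ₑ ≤ p * m * (1 + B) ^ n := by
  induction n with
  | zero =>
    intro f h hf hh m h1 h2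
    have h1 := h1 0 le_rfl
    have h2 := h2 0 le_rfl
    simp only [Function.iterate_zero, id, pow_zero, mul_one, Pi.mul_apply, enorm_mul] at *
    gcongr
  | succ n ih =>
    intro f h hf hh m h1 h2
    rw [Function.iterate_succ_apply, pderiv_mul hf hh,
      pderiv_iterate_add (f := pderiv l f * h) (h := f * pderiv l h)
      ((contDiff_pderiv hf l).mul hh) (hf.mul (contDiff_pderiv hh l))]
    refine (enorm_add_le _ _).trans ?_
    -- A derivative on `f` leaves the bound `p` unchanged, one on `h` replaces `m` by `m * B`. The
    -- two branches add up to one more factor `1 + B`, with no binomial coefficients.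
    have e1 := ih (contDiff_pderiv hf l) hh (m := m) (fun k hk => by
      rw [← Function.iterate_succ_apply]; exact h1 _ (by omega)) fun k hk => h2 k (by omega)
    have e2 := ih hf (contDiff_pderiv hh l) (m := m * B) (fun k hk => h1 k (by omega))
      fun k hk => by
        rw [← Function.iterate_succ_apply]
        exact (h2 (k + 1) (by omega)).trans_eq (by ring)
    exact (add_le_add e1 e2).trans_eq (by ring)

/-- The derivative in direction `v`, applied to a smooth function. -/
lemma fderiv_apply_eq_sum (f : Space d → ℂ) (v x : Space d) :
    fderiv ℝ f x v = ∑ m, (v m : ℂ) * pderiv m f x := by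
  have h : v = ∑ m, v m • EuclideanSpace.single m (1 : ℝ) := by
    ext i; simp [Finset.sum_apply, Pi.single_apply]
  conv_lhs => rw [h]
  simp [pderiv]

lemma pderiv_iterate_sum {ι : Type*} (s : Finset ι) (c : ι → ℂ) {F : ι → Space d → ℂ}
    (hF : ∀ i, ContDiff ℝ ∞ (F i)) (l : Fin d) (n : ℕ) :
    (pderiv l)^[n] (∑ i ∈ s, c i • F i) = ∑ i ∈ s, c i • (pderiv l)^[n] (F i) := by
  have h1 : ∀ (c : ℂ) {f : Space d → ℂ} (_ : ContDiff ℝ ∞ f),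
      (pderiv l)^[n] (c • f) = c • (pderiv l)^[n] f := by
    intro c f hf
    induction n with
    | zero => rfl
    | succ n ih =>
      simp only [Function.iterate_succ_apply', ih]
      exact pderiv_const_smul (contDiff_pderiv_iterate hf l n) c l
  have h2 : (pderiv l)^[n] (0 : Space d → ℂ) = 0 := by
    simpa using h1 0 (f := (0 : Space d → ℂ)) contDiff_const
  have h3 : ∀ s : Finset ι, ContDiff ℝ ∞ (∑ i ∈ s, c i • F i) := fun s => by
    rw [Finset.sum_fn]
    exact ContDiff.sum fun i _ => contDiff_const.smul (hF i)
  classical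
  induction s using Finset.induction_on with
  | empty => simpa using h2
  | insert a s ha ih =>
    rw [Finset.sum_insert ha, Finset.sum_insert ha, pderiv_iterate_add
      (f := c a • F a) (contDiff_const.smul (hF a)) (h3 s), ih, h1 _ (hF a)]

/-- The pure partial derivatives of the composition with an affine map. -/
lemma enorm_pderiv_iterate_comp_affine_le {f : Space d → ℂ} (hf : ContDiff ℝ ∞ f)
    (L : Space d →L[ℝ] Space d) (c : Space d) (l : Fin d) {B : ℝ≥0∞}
    (hB : ∑ m, ‖L (EuclideanSpace.single l 1) m‖ₑ ≤ B) (n : ℕ) (ξ : Space d) (r : ℕ) :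
    ∀ β : Fin d → ℕ, ∑ i, β i + r ≤ n →
      ‖(pderiv l)^[r] (fun η => mderiv β f (L η + c)) ξ‖ₑ ≤ maxDeriv n f (L ξ + c) * B ^ r := by
  induction r with
  | zero =>
    intro β hβ
    simpa using enorm_mderiv_le_maxDeriv f (by simpa using hβ) _
  | succ r ih =>
    intro β hβ
    -- By the chain rule the derivative along `e_l` is a combination of partial derivatives of `f`
    -- with coefficients `(L e_l)_m`, whose absolute values sum to at most `B`. Hence the induction
    -- must allow an arbitrary initial `β`.
    have h1 : pderiv l (fun η => mderiv β f (L η + c)) =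
        ∑ m, (L (EuclideanSpace.single l 1) m : ℂ) •
          fun η => mderiv (β + Pi.single m 1) f (L η + c) := by
      funext η
      have h2 : HasFDerivAt (fun η => mderiv β f (L η + c))
          ((fderiv ℝ (mderiv β f) (L η + c)).comp L) η :=
        (differentiable_of_contDiff (contDiff_mderiv hf β) _).hasFDerivAt.comp η
          (L.hasFDerivAt.add_const c)
      rw [pderiv, h2.fderiv, ContinuousLinearMap.comp_apply, fderiv_apply_eq_sum]
      simp [Finset.sum_apply, pderiv_mderiv hf]
    have h4 : ∀ m : Fin d, ContDiff ℝ ∞ fun η => mderiv (β + Pi.single m 1) f (L η + c) := fun m =>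
      (contDiff_mderiv hf _).comp (L.contDiff.add contDiff_const)
    rw [Function.iterate_succ_apply, h1, pderiv_iterate_sum _ _ h4, Finset.sum_apply]
    refine (enorm_sum_le _ _).trans ?_
    calc _ ≤ ∑ m, ‖L (EuclideanSpace.single l 1) m‖ₑ * (maxDeriv n f (L ξ + c) * B ^ r) := by
          refine Finset.sum_le_sum fun m _ => ?_
          rw [Pi.smul_apply, smul_eq_mul, enorm_mul]
          refine mul_le_mul' (le_of_eq ?_) (ih _ ?_)
          · rw [← ofReal_norm, ← ofReal_norm]; simp
          · simp only [Pi.add_apply, Finset.sum_add_distrib, Finset.sum_pi_single', Finset.mem_univ,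
              if_true]
            omega
      _ ≤ B * (maxDeriv n f (L ξ + c) * B ^ r) := by
          rw [← Finset.sum_mul]; gcongr
      _ = _ := by rw [pow_succ]; ring

/-- The partial derivatives of a smooth function vanish almost everywhere on its zero set. -/
lemma ae_pderiv_eq_zero (hd : 1 ≤ d) {f : Space d → ℂ} (hf : ContDiff ℝ ∞ f) (l : Fin d)
    {s : Set (Space d)} (hs : MeasurableSet s) (h : ∀ᵐ ξ, ξ ∈ s → f ξ = 0) :
    ∀ᵐ ξ, ξ ∈ s → pderiv l f ξ = 0 := by
  set v : Space d := EuclideanSpace.single ⟨0, hd⟩ (1 : ℝ) with hv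
  have hv0 : v ≠ 0 := by simp [v]
  set t : Set (Space d) := s ∩ f ⁻¹' {0} with ht
  have htm : MeasurableSet t := hs.inter (hf.continuous.measurable (measurableSet_singleton 0))
  -- On `t` the zero map approximates `f` with constant `0`, so the derivative vanishes almost
  -- everywhere on `t`. The result on approximately linear maps concerns maps of a space to itself;
  -- therefore a real part of `f` is placed on the line spanned by `v`.
  have key : ∀ D : ℂ →L[ℝ] ℝ, ∀ᵐ ξ, ξ ∈ t → D (pderiv l f ξ) = 0 := by
    intro D
    set R : ℂ →L[ℝ] Space d := D.smulRight v with hR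
    have h1 : ApproximatesLinearOn (fun ξ => R (f ξ)) (0 : Space d →L[ℝ] Space d) t 0 := by
      intro x hx y hy
      have hx' : f x = 0 := hx.2
      have hy' : f y = 0 := hy.2
      simp [hx', hy']
    have h2 := h1.norm_fderiv_sub_le volume htm (fun ξ => R.comp (fderiv ℝ f ξ)) fun x _ =>
      (R.hasFDerivAt.comp x (differentiable_of_contDiff hf x).hasFDerivAt).hasFDerivWithinAt
    rw [ae_restrict_iff' htm] at h2
    filter_upwards [h2] with ξ hξ hξt
    have h3 := hξ hξt
    have h4 : R.comp (fderiv ℝ f ξ) = 0 := by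
      rw [sub_zero] at h3
      exact nnnorm_eq_zero.1 (le_antisymm h3 bot_le)
    have h5 := congrArg (fun T => T (EuclideanSpace.single l (1 : ℝ))) h4
    simp only [ContinuousLinearMap.comp_apply, hR, ContinuousLinearMap.smulRight_apply,
      _root_.zero_apply, smul_eq_zero, hv0, or_false] at h5
    exact h5
  filter_upwards [h, key Complex.reCLM, key Complex.imCLM] with ξ h0 h1 h2 hξ
  exact Complex.ext (h1 ⟨hξ, h0 hξ⟩) (h2 ⟨hξ, h0 hξ⟩)

/-- The boundary of `Q_i'` may have positive measure, while `φ_i ∘ S_i` is only known to vanish off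
`Q_i'`. This allows `L¹` norms of derivatives to be integrated over `Q_i'` instead of its closure.
-/
lemma ae_pderiv_iterate_eq_zero (hd : 1 ≤ d) {f : Space d → ℂ} (hf : ContDiff ℝ ∞ f) (l : Fin d)
    {s : Set (Space d)} (hs : MeasurableSet s) (h : ∀ ξ ∈ s, f ξ = 0) (n : ℕ) :
    ∀ᵐ ξ, ξ ∈ s → (pderiv l)^[n] f ξ = 0 := by
  induction n with
  | zero => exact Filter.Eventually.of_forall h
  | succ n ih =>
    rw [Function.iterate_succ_apply']
    exact ae_pderiv_eq_zero hd (contDiff_pderiv_iterate hf l n) l hs ih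

lemma sum_enorm_apply_single_le (L : Space d →L[ℝ] Space d) (l : Fin d) :
    ∑ m, ‖L (EuclideanSpace.single l 1) m‖ₑ ≤ ENNReal.ofReal (d * ‖L‖) := by
  have h : ∀ m, ‖L (EuclideanSpace.single l 1) m‖ₑ ≤ ENNReal.ofReal ‖L‖ := fun m => by
    rw [← ofReal_norm]
    refine ENNReal.ofReal_le_ofReal ((PiLp.norm_apply_le _ m).trans ?_)
    simpa using L.le_opNorm (EuclideanSpace.single l (1 : ℝ))
  refine (Finset.sum_le_sum fun m _ => h m).trans (le_of_eq ?_)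
  rw [Finset.sum_const, Finset.card_univ, Fintype.card_fin, nsmul_eq_mul,
    ENNReal.ofReal_mul (by positivity), ENNReal.ofReal_natCast]

/-- The product of a compactly supported bump function with the composition of a smooth function
and an affine map: `L^1` bounds for the pure partial derivatives. -/
lemma lintegral_pderiv_iterate_mul_comp_le (hd : 1 ≤ d) {P f : Space d → ℂ} (hP : ContDiff ℝ ∞ P)
    (hf : ContDiff ℝ ∞ f) (L : Space d →L[ℝ] Space d) (c : Space d) {Y : ℝ} (hY : 1 ≤ Y)
    (hL : ‖L‖ ≤ Y) {U : Set (Space d)} (hU : MeasurableSet U) (hPU : ∀ ξ ∉ U, P ξ = 0)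
    {CP : ℝ≥0∞} (hCP : CP ≠ ⊤) (l : Fin d) {n : ℕ} (h : ∀ r ≤ n, ∀ ξ, ‖(pderiv l)^[r] P ξ‖ₑ ≤ CP) :
    ∫⁻ ξ, ‖(pderiv l)^[n] (fun ξ => P ξ * f (L ξ + c)) ξ‖ₑ ≤ ENNReal.ofReal (Y ^ n) *
      (ENNReal.ofReal ((2 * d) ^ n) * CP * ∫⁻ ξ in U, maxDeriv n f (L ξ + c)) := by
  have hd' : (1 : ℝ) ≤ d := by exact_mod_cast hd
  have hf' : ContDiff ℝ ∞ (fun ξ => f (L ξ + c)) := hf.comp (L.contDiff.add contDiff_const)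
  have hG : ContDiff ℝ ∞ (fun ξ => P ξ * f (L ξ + c)) := hP.mul hf'
  have h0 := ae_pderiv_iterate_eq_zero hd hG l hU.compl
    (fun ξ hξ => by simp [hPU ξ hξ]) n
  have hB : ∑ m, ‖L (EuclideanSpace.single l 1) m‖ₑ ≤ ENNReal.ofReal (d * Y) :=
    (sum_enorm_apply_single_le L l).trans (by gcongr)
  -- As `d * Y ≥ 1`, the factor `1 + d * Y` from the Leibniz rule is at most `2 * d * Y`.
  have hle : (1 + ENNReal.ofReal (d * Y)) ^ n ≤ ENNReal.ofReal (Y ^ n) * ENNReal.ofReal ((2 * d) ^ n) := by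
    rw [← ENNReal.ofReal_one, ← ENNReal.ofReal_add zero_le_one (by positivity),
      ← ENNReal.ofReal_pow (by positivity), ← ENNReal.ofReal_mul (by positivity), ← mul_pow]
    gcongr
    nlinarith
  have key : ∀ᵐ ξ, ‖(pderiv l)^[n] (fun ξ => P ξ * f (L ξ + c)) ξ‖ₑ ≤
      U.indicator (fun ξ => (ENNReal.ofReal (Y ^ n) * (ENNReal.ofReal ((2 * d) ^ n) * CP)) *
        maxDeriv n f (L ξ + c)) ξ := by
    filter_upwards [h0] with ξ hξ
    by_cases hU' : ξ ∈ U
    swap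
    · simp [hξ hU']
    rw [indicator_of_mem hU']
    have := enorm_pderiv_iterate_mul_le l ξ CP (ENNReal.ofReal (d * Y)) n hP hf'
      (m := maxDeriv n f (L ξ + c)) (fun k hk => h k hk ξ) fun k hk => by
        simpa [mderiv_zero] using enorm_pderiv_iterate_comp_affine_le hf L c l hB n ξ k 0
          (by simpa using hk)
    refine this.trans ?_
    calc _ ≤ CP * maxDeriv n f (L ξ + c) * (ENNReal.ofReal (Y ^ n) * ENNReal.ofReal ((2 * d) ^ n)) := by
          gcongr
      _ = _ := by ring
  refine (lintegral_mono_ae key).trans ?_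
  rw [lintegral_indicator hU, lintegral_const_mul']
  · rw [mul_assoc]
  · exact ENNReal.mul_ne_top ENNReal.ofReal_ne_top (ENNReal.mul_ne_top ENNReal.ofReal_ne_top hCP)

end PartialDerivatives

/-! ### Determinants and linear changes of variables -/

section LinearChangeOfVariables

variable {d : ℕ}

lemma det_adjoint (B : Space d →L[ℝ] Space d) : (ContinuousLinearMap.adjoint B).det = B.det := by
  let b := EuclideanSpace.basisFun (Fin d) ℝ
  have h1 : ((ContinuousLinearMap.adjoint B : Space d →L[ℝ] Space d) : Space d →ₗ[ℝ] Space d) =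
      LinearMap.adjoint (B : Space d →ₗ[ℝ] Space d) := rfl
  rw [ContinuousLinearMap.det, ContinuousLinearMap.det, h1, ← LinearMap.det_toMatrix b.toBasis,
    LinearMap.toMatrix_adjoint b b, Matrix.det_conjTranspose, LinearMap.det_toMatrix]
  simp

lemma det_ne_zero_of_leftInverse {B B' : Space d →L[ℝ] Space d} (h : ∀ x, B' (B x) = x) :
    B.det ≠ 0 := by
  intro h0
  have h1 : (B' : Space d →ₗ[ℝ] Space d) ∘ₗ (B : Space d →ₗ[ℝ] Space d) = LinearMap.id :=
    LinearMap.ext h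
  have h2 := congrArg LinearMap.det h1
  rw [LinearMap.det_comp, LinearMap.det_id] at h2
  rw [ContinuousLinearMap.det] at h0
  simp [h0] at h2

lemma map_linear_volume {B : Space d →L[ℝ] Space d} (hB : B.det ≠ 0) :
    Measure.map B (volume : Measure (Space d)) = ENNReal.ofReal |B.det|⁻¹ • volume := by
  have := Measure.map_linearMap_addHaar_eq_smul_addHaar (volume : Measure (Space d))
    (f := (B : Space d →ₗ[ℝ] Space d)) hB
  rw [abs_inv] at this
  exact this

lemma measurableEmbedding_linear {B : Space d →L[ℝ] Space d} (hB : B.det ≠ 0) :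
    MeasurableEmbedding B :=
  B.continuous.measurableEmbedding
    (LinearMap.equivOfDetNeZero (B : Space d →ₗ[ℝ] Space d) hB).injective

lemma lintegral_comp_linear {B : Space d →L[ℝ] Space d} (hB : B.det ≠ 0) (f : Space d → ℝ≥0∞) :
    ∫⁻ x, f (B x) = ENNReal.ofReal |B.det|⁻¹ * ∫⁻ x, f x := by
  rw [← (measurableEmbedding_linear hB).lintegral_map (μ := volume), map_linear_volume hB,
    lintegral_smul_measure, smul_eq_mul]

lemma integral_comp_linear {B : Space d →L[ℝ] Space d} (hB : B.det ≠ 0) (f : Space d → ℂ) :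
    ∫ x, f (B x) = (|B.det|⁻¹ : ℝ) * ∫ x, f x := by
  rw [← (measurableEmbedding_linear hB).integral_map (μ := volume), map_linear_volume hB,
    integral_smul_measure, ENNReal.toReal_ofReal (by positivity), Complex.real_smul]

lemma integrable_comp_linear {B : Space d →L[ℝ] Space d} (hB : B.det ≠ 0) {f : Space d → ℂ}
    (hf : Integrable f) : Integrable (fun x => f (B x)) := by
  refine ((measurableEmbedding_linear hB).integrable_map_iff (μ := volume) (g := f)).1 ?_
  rw [map_linear_volume hB]
  exact hf.smul_measure ENNReal.ofReal_ne_top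

lemma fourier_comp_linear {B B' : Space d →L[ℝ] Space d} (h' : ∀ x, B' (B x) = x)
    (f : Space d → ℂ) (y : Space d) :
    𝓕 (fun x => f (B x)) y =
      (|B.det|⁻¹ : ℝ) * 𝓕 f (ContinuousLinearMap.adjoint B' y) := by
  rw [fourier_eq_integral_character, fourier_eq_integral_character,
    ← integral_comp_linear (det_ne_zero_of_leftInverse h')]
  congr 1
  funext x
  congr 1
  rw [character, character, inner_neg_left, inner_neg_left, ContinuousLinearMap.adjoint_inner_left,
    h']

/-- The image of the unit ball lies in the ball of radius `‖L‖`; compare volumes. -/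
lemma abs_det_le_pow (L : Space d →L[ℝ] Space d) : |L.det| ≤ ‖L‖ ^ d := by
  have h1 : L '' Metric.closedBall 0 1 ⊆ Metric.closedBall 0 ‖L‖ := by
    rintro _ ⟨x, hx, rfl⟩
    rw [mem_closedBall_zero_iff] at hx ⊢
    exact (L.le_opNorm x).trans (mul_le_of_le_one_right (norm_nonneg _) hx)
  have h2 := measure_mono (μ := (volume : Measure (Space d))) h1
  rw [Measure.addHaar_image_continuousLinearMap, Measure.addHaar_closedBall _ _ (norm_nonneg _),
    Measure.addHaar_closedBall _ _ zero_le_one] at h2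
  have h3 : volume (Metric.ball (0 : Space d) 1) ≠ 0 := (Metric.measure_ball_pos _ _ one_pos).ne'
  have h4 : volume (Metric.ball (0 : Space d) 1) ≠ ⊤ := measure_ball_lt_top.ne
  simp only [one_pow, ENNReal.ofReal_one, one_mul, finrank_euclideanSpace, Fintype.card_fin] at h2
  rw [ENNReal.mul_le_mul_iff_left h3 h4] at h2
  exact (ENNReal.ofReal_le_ofReal_iff (by positivity)).1 h2

end LinearChangeOfVariables

/-! ### The affine maps and their transition maps -/

namespace AffineFamily

variable {d : ℕ} {J : Type*} (Q : AffineFamily d J)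

/-- `|det A_j|`. -/
def absDet (j : J) : ℝ := |(Q.A j : Space d →L[ℝ] Space d).det|

lemma det_A_ne_zero (j : J) : (Q.A j : Space d →L[ℝ] Space d).det ≠ 0 :=
  det_ne_zero_of_leftInverse (B' := ((Q.A j).symm : Space d →L[ℝ] Space d)) (by simp)

lemma absDet_pos (j : J) : 0 < Q.absDet j := abs_pos.2 (Q.det_A_ne_zero j)

lemma det_symm_mul_det (j : J) : ((Q.A j).symm : Space d →L[ℝ] Space d).det *
    (Q.A j : Space d →L[ℝ] Space d).det = 1 := by
  have h1 : (((Q.A j).symm : Space d →L[ℝ] Space d) : Space d →ₗ[ℝ] Space d) ∘ₗ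
      ((Q.A j : Space d →L[ℝ] Space d) : Space d →ₗ[ℝ] Space d) = LinearMap.id :=
    LinearMap.ext (by simp)
  have h2 := congrArg LinearMap.det h1
  rwa [LinearMap.det_comp, LinearMap.det_id] at h2

lemma abs_det_symm (j : J) : |((Q.A j).symm : Space d →L[ℝ] Space d).det| = (Q.absDet j)⁻¹ := by
  have := congrArg abs (Q.det_symm_mul_det j)
  rw [abs_mul, abs_one] at this
  exact eq_inv_of_mul_eq_one_left this

lemma abs_det_AinvA (i j : J) : |(Q.AinvA i j).det| = (Q.absDet i)⁻¹ * Q.absDet j := by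
  have h1 : ((Q.AinvA i j : Space d →L[ℝ] Space d) : Space d →ₗ[ℝ] Space d) =
      (((Q.A i).symm : Space d →L[ℝ] Space d) : Space d →ₗ[ℝ] Space d) ∘ₗ
      ((Q.A j : Space d →L[ℝ] Space d) : Space d →ₗ[ℝ] Space d) := rfl
  rw [ContinuousLinearMap.det, h1, LinearMap.det_comp, abs_mul, ← Q.abs_det_symm]
  rfl

lemma AinvA_AinvA (i j : J) (x : Space d) : Q.AinvA i j (Q.AinvA j i x) = x := by
  simp [AinvA]

/-- The transition map in the form linear part plus constant, as the chain rule estimates require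
it. -/
lemma Sinv_S (i j : J) (ξ : Space d) :
    Q.Sinv j (Q.S i ξ) = Q.AinvA j i ξ + Q.Sinv j (Q.b i) := by
  simp [Sinv, S, AinvA, map_add, map_sub, add_sub_assoc]

@[simp] lemma Sinv_S_self (j : J) (ξ : Space d) : Q.Sinv j (Q.S j ξ) = ξ := by simp [Sinv, S]

@[simp] lemma S_Sinv_self (j : J) (ξ : Space d) : Q.S j (Q.Sinv j ξ) = ξ := by simp [Sinv, S]

lemma mem_set_iff (j : J) (ξ : Space d) : ξ ∈ Q.set j ↔ Q.Sinv j ξ ∈ Q.Q' j := by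
  constructor
  · rintro ⟨η, hη, rfl⟩; simpa using hη
  · intro h; exact ⟨_, h, by simp⟩

lemma contDiff_S (j : J) : ContDiff ℝ ∞ (Q.S j) :=
  (Q.A j : Space d →L[ℝ] Space d).contDiff.add contDiff_const

lemma contDiff_Sinv (j : J) : ContDiff ℝ ∞ (Q.Sinv j) :=
  ((Q.A j).symm : Space d →L[ℝ] Space d).contDiff.comp (contDiff_id.sub contDiff_const)

end AffineFamily

/-! ### The generators on the Fourier side -/

section Generators

variable {d : ℕ} {J : Type*} (Q : AffineFamily d J) {g : Space d → ℂ}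

lemma abs_det_structuredLattice {δ : ℝ} (hδ : 0 < δ) (j : J) :
    |(structuredLattice Q δ j).det| = δ ^ d * (Q.absDet j)⁻¹ := by
  rw [structuredLattice, ContinuousLinearMap.det, ContinuousLinearMap.toLinearMap_smul, LinearMap.det_smul,
    abs_mul, abs_pow, abs_of_pos hδ, finrank_euclideanSpace, Fintype.card_fin]
  congr 1
  rw [← Q.abs_det_symm, ← det_adjoint]

/-- Modulation by `b_j` shifts and dilation by `A_j^t` rescales, so all generators carry the single
profile `ĝ` transported by `S_j`. The prefactor is `|det A_j|^{1/2}` times the Jacobian `|det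
A_j|⁻¹`. -/
lemma fourier_structuredGenerator (g : Space d → ℂ) (j : J) (ξ : Space d) :
    𝓕 (structuredGenerator Q g j) ξ = ((Real.sqrt (Q.absDet j))⁻¹ : ℝ) * 𝓕 g (Q.Sinv j ξ) := by
  have h1 : structuredGenerator Q g j = fun x => (Real.sqrt (Q.absDet j) : ℂ) *
      (g (ContinuousLinearMap.adjoint (Q.A j : Space d →L[ℝ] Space d) x) * character (Q.b j) x) := by
    funext x
    simp only [structuredGenerator, modulate, character, AffineFamily.absDet]
    ring
  have h2 : 𝓕 (structuredGenerator Q g j) ξ = (Real.sqrt (Q.absDet j) : ℂ) *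
      𝓕 (fun x => g (ContinuousLinearMap.adjoint (Q.A j : Space d →L[ℝ] Space d) x) *
        character (Q.b j) x) ξ := by
    rw [fourier_eq_integral_character, fourier_eq_integral_character, h1, ← integral_const_mul]
    simp only [mul_assoc]
  have h3 : ∀ x, ContinuousLinearMap.adjoint ((Q.A j).symm : Space d →L[ℝ] Space d)
      (ContinuousLinearMap.adjoint (Q.A j : Space d →L[ℝ] Space d) x) = x := by
    intro x
    refine ext_inner_right ℝ fun y => ?_
    rw [ContinuousLinearMap.adjoint_inner_left, ContinuousLinearMap.adjoint_inner_left]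
    simp
  rw [h2, fourier_mul_character, fourier_comp_linear h3, det_adjoint,
    ContinuousLinearMap.adjoint_adjoint, ← mul_assoc]
  congr 1
  have h4 := Q.absDet_pos j
  have h5 : Real.sqrt (Q.absDet j) * |(Q.A j : Space d →L[ℝ] Space d).det|⁻¹ =
      (Real.sqrt (Q.absDet j))⁻¹ := by
    have h6 : |(Q.A j : Space d →L[ℝ] Space d).det| = Q.absDet j := rfl
    rw [h6]
    nth_rewrite 2 [← Real.mul_self_sqrt h4.le]
    have := (Real.sqrt_pos.2 h4).ne'
    field_simp
  exact_mod_cast h5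

lemma integrable_structuredGenerator (hg : Integrable g) (j : J) :
    Integrable (structuredGenerator Q g j) := by
  have h1 : Integrable fun x => g (ContinuousLinearMap.adjoint (Q.A j : Space d →L[ℝ] Space d) x) :=
    integrable_comp_linear (by rw [det_adjoint]; exact Q.det_A_ne_zero j) hg
  have h2 : Integrable fun x => g (ContinuousLinearMap.adjoint (Q.A j : Space d →L[ℝ] Space d) x) *
      character (Q.b j) x := by
    refine h1.mul_bdd (c := 1) (continuous_character _).aestronglyMeasurable ?_
    exact Filter.Eventually.of_forall fun x => by simp
  refine (h2.const_mul (Real.sqrt (Q.absDet j) : ℂ)).congr (Filter.Eventually.of_forall fun x => ?_)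
  simp only [structuredGenerator, modulate, character, AffineFamily.absDet]
  ring

lemma contDiff_fourier_structuredGenerator (hgs : ContDiff ℝ ∞ (𝓕 g)) (j : J) :
    ContDiff ℝ ∞ (𝓕 (structuredGenerator Q g j)) := by
  have : 𝓕 (structuredGenerator Q g j) =
      fun ξ => ((Real.sqrt (Q.absDet j))⁻¹ : ℝ) * 𝓕 g (Q.Sinv j ξ) :=
    funext (fourier_structuredGenerator Q g j)
  rw [this]
  exact contDiff_const.mul (hgs.comp (Q.contDiff_Sinv j))

end Generators

/-! ### Uniform bounds for the partition of unity -/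

section PartitionBounds

variable {d : ℕ} {J : Type*} {Q : AffineFamily d J} {O : Opens (Space d)} {φ : J → 𝓓(O, ℂ)}

lemma AffineFamily.IsRegularPartitionOfUnity.eq_zero_of_notMem
    (hφ : Q.IsRegularPartitionOfUnity φ) (i : J) {ξ : Space d} (hξ : ξ ∉ Q.set i) : φ i ξ = 0 := by
  by_cases hO : ξ ∈ O
  · exact hφ.eq_zero i ξ hO hξ
  · by_contra h
    exact hO ((φ i).tsupport_subset (subset_tsupport _ h))

/-- `max_{|α| ≤ d + 1} C_{Q,Φ,α}`. -/
def derivConst (Q : AffineFamily d J) (φ : J → 𝓓(O, ℂ)) : ℝ≥0∞ :=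
  ⨆ (α : Fin d → ℕ) (_ : ∑ i, α i ≤ d + 1), Q.partitionConst φ α

/-- Only finitely many multi-indices compete, so the maximum is attained; this gives finiteness and
compatibility with squares. -/
lemma exists_derivConst_eq (Q : AffineFamily d J) (φ : J → 𝓓(O, ℂ)) :
    ∃ α : Fin d → ℕ, ∑ i, α i ≤ d + 1 ∧ derivConst Q φ = Q.partitionConst φ α := by
  obtain ⟨α, hα, h⟩ := Set.exists_max_image _ (fun α => Q.partitionConst φ α)
    (finite_multiIndex d (d + 1)) ⟨0, by simp⟩
  exact ⟨α, hα, le_antisymm (iSup₂_le h)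
    (le_iSup₂ (f := fun (α : Fin d → ℕ) (_ : ∑ i, α i ≤ d + 1) => Q.partitionConst φ α) α hα)⟩

lemma derivConst_ne_top (hφ : Q.IsRegularPartitionOfUnity φ) : derivConst Q φ ≠ ⊤ := by
  obtain ⟨α, -, h⟩ := exists_derivConst_eq Q φ
  rw [h]
  exact (hφ.regular α).ne

lemma derivConst_sq_le (Q : AffineFamily d J) (φ : J → 𝓓(O, ℂ)) : derivConst Q φ ^ 2 ≤
    ⨆ (α : Fin d → ℕ) (_ : ∑ i, α i ≤ d + 1), Q.partitionConst φ α ^ 2 := by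
  obtain ⟨α, hα, h⟩ := exists_derivConst_eq Q φ
  rw [h]
  exact le_iSup₂ (f := fun (α : Fin d → ℕ) (_ : ∑ i, α i ≤ d + 1) => Q.partitionConst φ α ^ 2) α hα

variable (Q φ) in
/-- The function `φ_i ∘ S_i`. -/
def pullback (i : J) (ξ : Space d) : ℂ := φ i (Q.S i ξ)

lemma contDiff_pullback (i : J) : ContDiff ℝ ∞ (pullback Q φ i) :=
  (φ i).contDiff.comp (Q.contDiff_S i)

lemma hasCompactSupport_pullback (i : J) : HasCompactSupport (pullback Q φ i) :=
  (φ i).hasCompactSupport.comp_homeomorph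
    ((Q.A i).toHomeomorph.trans (Homeomorph.addRight (Q.b i)))

lemma pullback_eq_zero (hφ : Q.IsRegularPartitionOfUnity φ) (i : J) {ξ : Space d}
    (hξ : ξ ∉ Q.Q' i) : pullback Q φ i ξ = 0 :=
  hφ.eq_zero_of_notMem i (by rw [Q.mem_set_iff]; simpa using hξ)

/-- An essential bound for a continuous function holds everywhere, since it holds on a dense closed
set. -/
lemma enorm_mderiv_pullback_le (i : J) {α : Fin d → ℕ} (hα : ∑ i, α i ≤ d + 1) (ξ : Space d) :
    ‖mderiv α (pullback Q φ i) ξ‖ₑ ≤ derivConst Q φ := by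
  have h1 : eLpNorm (mderiv α (pullback Q φ i)) ⊤ volume ≤ derivConst Q φ :=
    (le_iSup (fun i => eLpNorm (mderiv α (fun ξ => φ i (Q.S i ξ))) ⊤ volume) i).trans
      (le_iSup₂ (f := fun (α : Fin d → ℕ) (_ : ∑ i, α i ≤ d + 1) => Q.partitionConst φ α) α hα)
  have h2 : Continuous fun ξ => ‖mderiv α (pullback Q φ i) ξ‖ₑ :=
    (contDiff_mderiv (contDiff_pullback i) α).continuous.enorm
  have h3 : ∀ᵐ ξ, ‖mderiv α (pullback Q φ i) ξ‖ₑ ≤ derivConst Q φ := by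
    rw [eLpNorm_exponent_top] at h1
    filter_upwards [enorm_ae_le_eLpNormEssSup (mderiv α (pullback Q φ i)) volume] with ξ hξ
    exact hξ.trans h1
  have h4 : Dense {ξ | ‖mderiv α (pullback Q φ i) ξ‖ₑ ≤ derivConst Q φ} :=
    Measure.dense_of_ae h3
  have h5 : IsClosed {ξ | ‖mderiv α (pullback Q φ i) ξ‖ₑ ≤ derivConst Q φ} :=
    isClosed_le h2 continuous_const
  have h6 := h5.closure_eq ▸ h4.closure_eq
  exact (h6 ▸ mem_univ ξ : ξ ∈ {ξ | ‖mderiv α (pullback Q φ i) ξ‖ₑ ≤ derivConst Q φ})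

end PartitionBounds

/-! ### Decay of the atoms, and adaptedness -/

section SystemBounds

variable {d : ℕ} {J : Type*} {Q : AffineFamily d J} {O : Opens (Space d)} {φ : J → 𝓓(O, ℂ)}
  {g : Space d → ℂ}

/-- `max{1, ‖A_i⁻¹ A_j‖}`. -/
def AffineFamily.dil (Q : AffineFamily d J) (i j : J) : ℝ := max 1 ‖Q.AinvA i j‖

lemma AffineFamily.one_le_dil (Q : AffineFamily d J) (i j : J) : 1 ≤ Q.dil i j := le_max_left _ _

lemma AffineFamily.norm_AinvA_le_dil (Q : AffineFamily d J) (i j : J) : ‖Q.AinvA i j‖ ≤ Q.dil i j :=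
  le_max_right _ _

variable (Q φ g) in
/-- The function `φ_i · ĝ_j`. -/
def localAtom (i j : J) (ξ : Space d) : ℂ := φ i ξ * 𝓕 (structuredGenerator Q g j) ξ

variable (Q φ g) in
/-- The function `(φ_i ∘ S_i) · (ĝ ∘ S_j⁻¹ ∘ S_i)`. -/
def normalizedAtom (i j : J) (ξ : Space d) : ℂ :=
  pullback Q φ i ξ * 𝓕 g (Q.AinvA j i ξ + Q.Sinv j (Q.b i))

lemma contDiff_localAtom (hgs : ContDiff ℝ ∞ (𝓕 g)) (i j : J) :
    ContDiff ℝ ∞ (localAtom Q φ g i j) :=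
  (φ i).contDiff.mul (contDiff_fourier_structuredGenerator Q hgs j)

lemma hasCompactSupport_localAtom (i j : J) : HasCompactSupport (localAtom Q φ g i j) :=
  (φ i).hasCompactSupport.mul_right

lemma contDiff_normalizedAtom (hgs : ContDiff ℝ ∞ (𝓕 g)) (i j : J) :
    ContDiff ℝ ∞ (normalizedAtom Q φ g i j) :=
  (contDiff_pullback i).mul (hgs.comp ((Q.AinvA j i).contDiff.add contDiff_const))

lemma hasCompactSupport_normalizedAtom (i j : J) : HasCompactSupport (normalizedAtom Q φ g i j) :=
  (hasCompactSupport_pullback i).mul_right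

lemma localAtom_S (i j : J) (ξ : Space d) : localAtom Q φ g i j (Q.S i ξ) =
    ((Real.sqrt (Q.absDet j))⁻¹ : ℝ) * normalizedAtom Q φ g i j ξ := by
  rw [localAtom, normalizedAtom, fourier_structuredGenerator, Q.Sinv_S, pullback]
  ring

variable (Q φ g) in
/-- The `L^1` bound for the derivatives of `normalizedAtom`. -/
def atomBound (i j : J) : ℝ≥0∞ :=
  ENNReal.ofReal ((2 * d) ^ (d + 1)) * derivConst Q φ *
    ∫⁻ ξ in Q.Q' i, maxDeriv (d + 1) (𝓕 g) (Q.Sinv j (Q.S i ξ))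

lemma lintegral_pderiv_normalizedAtom_le (hd : 1 ≤ d) (hφ : Q.IsRegularPartitionOfUnity φ)
    (hQo : ∀ i, IsOpen (Q.Q' i)) (hgs : ContDiff ℝ ∞ (𝓕 g)) (i j : J) (l : Fin d) :
    ∫⁻ ξ, ‖(pderiv l)^[d + 1] (normalizedAtom Q φ g i j) ξ‖ₑ ≤
      ENNReal.ofReal (Q.dil j i ^ (d + 1)) * atomBound Q φ g i j := by
  have := lintegral_pderiv_iterate_mul_comp_le hd (contDiff_pullback (Q := Q) (φ := φ) i) hgs
    (Q.AinvA j i) (Q.Sinv j (Q.b i)) (Q.one_le_dil j i) (Q.norm_AinvA_le_dil j i)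
    (hQo i).measurableSet (fun ξ hξ => pullback_eq_zero hφ i hξ) (derivConst_ne_top hφ) l
    (n := d + 1) fun r hr ξ => by
      rw [← mderiv_single (contDiff_pullback i)]
      exact enorm_mderiv_pullback_le i (by simpa using hr) ξ
  simp only [atomBound, Q.Sinv_S]
  exact this

lemma lintegral_normalizedAtom_le (hd : 1 ≤ d) (hφ : Q.IsRegularPartitionOfUnity φ)
    (hQo : ∀ i, IsOpen (Q.Q' i)) (hgs : ContDiff ℝ ∞ (𝓕 g)) (i j : J) :
    ∫⁻ ξ, ‖normalizedAtom Q φ g i j ξ‖ₑ ≤ atomBound Q φ g i j := by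
  have hd' : (1 : ℝ) ≤ d := by exact_mod_cast hd
  have := lintegral_pderiv_iterate_mul_comp_le hd (contDiff_pullback (Q := Q) (φ := φ) i) hgs
    (Q.AinvA j i) (Q.Sinv j (Q.b i)) (Q.one_le_dil j i) (Q.norm_AinvA_le_dil j i)
    (hQo i).measurableSet (fun ξ hξ => pullback_eq_zero hφ i hξ) (derivConst_ne_top hφ) ⟨0, hd⟩
    -- The case of no derivatives; it is then weakened to the bound used for order `d + 1`, so that
    -- a single quantity `atomBound` serves both.
    (n := 0) fun r hr ξ => by
      rw [← mderiv_single (contDiff_pullback i)]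
      exact enorm_mderiv_pullback_le i (by simp; omega) ξ
  refine this.trans ?_
  simp only [atomBound, Q.Sinv_S, pow_zero, ENNReal.ofReal_one, one_mul]
  have h1 : 1 ≤ ENNReal.ofReal ((2 * d) ^ (d + 1)) := by
    rw [ENNReal.one_le_ofReal]
    exact one_le_pow₀ (by linarith)
  rw [mul_assoc]
  refine le_trans ?_ (le_mul_of_one_le_left' h1)
  gcongr
  exact maxDeriv_mono _ (Nat.zero_le _) _

/-- Each derivative of `ĝ ∘ S_j⁻¹ ∘ S_i` costs at most a factor proportional to `‖A_j⁻¹ A_i‖`, so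
`dil j i` is the natural scale of decay. -/
lemma enorm_fourier_normalizedAtom_decay (hd : 1 ≤ d) (hφ : Q.IsRegularPartitionOfUnity φ)
    (hQo : ∀ i, IsOpen (Q.Q' i)) (hgs : ContDiff ℝ ∞ (𝓕 g)) (i j : J) (y : Space d) (l : Fin d) :
    ENNReal.ofReal ((1 + |y l| / Q.dil j i) ^ (d + 1)) * ‖𝓕 (normalizedAtom Q φ g i j) y‖ₑ ≤
      ENNReal.ofReal (2 ^ (d + 1)) * atomBound Q φ g i j :=
  enorm_fourier_decay (contDiff_normalizedAtom hgs i j) (hasCompactSupport_normalizedAtom i j)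
    (Q.one_le_dil j i) (lintegral_normalizedAtom_le hd hφ hQo hgs i j)
    (lintegral_pderiv_normalizedAtom_le hd hφ hQo hgs i j) y l

/-- The shift by `b_i` only modulates the Fourier transform and disappears in absolute value; the
linear part contributes `|det A_i|`. -/
lemma enorm_fourier_localAtom (i j : J) (y : Space d) :
    ‖𝓕 (localAtom Q φ g i j) y‖ₑ = ENNReal.ofReal (Q.absDet i * (Real.sqrt (Q.absDet j))⁻¹) *
      ‖𝓕 (normalizedAtom Q φ g i j)
        (ContinuousLinearMap.adjoint (Q.A i : Space d →L[ℝ] Space d) y)‖ₑ := by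
  have h1 : localAtom Q φ g i j = fun ξ => (fun ξ => ((Real.sqrt (Q.absDet j))⁻¹ : ℝ) *
      normalizedAtom Q φ g i j ((Q.A i).symm ξ)) (ξ - Q.b i) := by
    funext ξ
    have := localAtom_S (Q := Q) (φ := φ) (g := g) i j (Q.Sinv i ξ)
    rw [Q.S_Sinv_self] at this
    exact this
  have h2 : 𝓕 (fun ξ => (((Real.sqrt (Q.absDet j))⁻¹ : ℝ) : ℂ) *
      normalizedAtom Q φ g i j ((Q.A i).symm ξ)) y = (((Real.sqrt (Q.absDet j))⁻¹ : ℝ) : ℂ) *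
      𝓕 (fun ξ => normalizedAtom Q φ g i j (((Q.A i).symm : Space d →L[ℝ] Space d) ξ)) y := by
    rw [fourier_eq_integral_character, fourier_eq_integral_character, ← integral_const_mul]
    simp only [mul_assoc]
    rfl
  have h3 : |((Q.A i).symm : Space d →L[ℝ] Space d).det|⁻¹ = Q.absDet i := by
    rw [Q.abs_det_symm, inv_inv]
  rw [h1, fourier_comp_sub (fun ξ => (((Real.sqrt (Q.absDet j))⁻¹ : ℝ) : ℂ) *
      normalizedAtom Q φ g i j ((Q.A i).symm ξ)), enorm_mul, h2, fourier_comp_linear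
    (B' := (Q.A i : Space d →L[ℝ] Space d)) (by simp), h3, ← mul_assoc, enorm_mul, ← mul_assoc]
  congr 1
  rw [← ofReal_norm, norm_character, ← ofReal_norm, norm_mul, Complex.norm_real, Complex.norm_real,
    Real.norm_of_nonneg (by positivity), Real.norm_of_nonneg (Q.absDet_pos i).le]
  simp [mul_comm]

lemma lintegral_enorm_fourier_localAtom (i j : J) :
    ∫⁻ y, ‖𝓕 (localAtom Q φ g i j) y‖ₑ = ENNReal.ofReal (Real.sqrt (Q.absDet j))⁻¹ *
      ∫⁻ y, ‖𝓕 (normalizedAtom Q φ g i j) y‖ₑ := by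
  have h := Q.absDet_pos i
  simp_rw [enorm_fourier_localAtom]
  rw [lintegral_const_mul' _ _ ENNReal.ofReal_ne_top, lintegral_comp_linear
    (B := ContinuousLinearMap.adjoint (Q.A i : Space d →L[ℝ] Space d))
    (by rw [det_adjoint]; exact Q.det_A_ne_zero i) fun y => ‖𝓕 (normalizedAtom Q φ g i j) y‖ₑ,
    ← mul_assoc, det_adjoint, ← ENNReal.ofReal_mul (by positivity)]
  congr 2
  have h6 : |(Q.A i : Space d →L[ℝ] Space d).det| = Q.absDet i := rfl
  rw [h6]
  field_simp

/-- The `L^1` norm of the Fourier transform of `φ_i ĝ_j`. -/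
lemma lintegral_enorm_fourier_localAtom_le (hd : 1 ≤ d) (hφ : Q.IsRegularPartitionOfUnity φ)
    (hQo : ∀ i, IsOpen (Q.Q' i)) (hgs : ContDiff ℝ ∞ (𝓕 g)) (i j : J) :
    ∫⁻ y, ‖𝓕 (localAtom Q φ g i j) y‖ₑ ≤
      ENNReal.ofReal ((Real.sqrt (Q.absDet j))⁻¹ * Q.dil j i ^ d *
        (4 ^ (d + 1) * (1 + 2 * d) ^ d)) * atomBound Q φ g i j := by
  have h0 : 0 < Q.dil j i := one_pos.trans_le (Q.one_le_dil j i)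
  rw [lintegral_enorm_fourier_localAtom]
  refine (mul_le_mul_right (lintegral_enorm_le_of_decay hd h0
    (enorm_fourier_normalizedAtom_decay hd hφ hQo hgs i j)) _).trans (le_of_eq ?_)
  rw [← mul_assoc, ← mul_assoc, ← mul_assoc, ← ENNReal.ofReal_mul (by positivity),
    ← ENNReal.ofReal_mul (by positivity), ← ENNReal.ofReal_mul (by positivity)]
  congr 2
  rw [show (4 : ℝ) = 2 * 2 by norm_num, mul_pow]
  ring

lemma norm_le_sum_abs (x : Space d) : ‖x‖ ≤ ∑ l, |x l| := by
  have h : x = ∑ m, x m • EuclideanSpace.single m (1 : ℝ) := by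
    ext i; simp [Finset.sum_apply, Pi.single_apply]
  conv_lhs => rw [h]
  refine (norm_sum_le _ _).trans (le_of_eq ?_)
  simp [norm_smul]

/-- The largest coordinate works. This converts coordinatewise decay to decay in the Euclidean norm,
which is needed after a linear map has mixed the coordinates. -/
lemma exists_norm_le_mul_abs (hd : 1 ≤ d) (x : Space d) : ∃ l, ‖x‖ ≤ d * |x l| := by
  have : Nonempty (Fin d) := ⟨⟨0, hd⟩⟩
  obtain ⟨l, hl⟩ := Finite.exists_max fun l => |x l|
  refine ⟨l, (norm_le_sum_abs x).trans ?_⟩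
  refine (Finset.sum_le_card_nsmul _ _ _ fun m _ => hl m).trans (le_of_eq ?_)
  simp

lemma adjoint_A_structuredLattice {δ : ℝ} (i j : J) (x : Space d) :
    ContinuousLinearMap.adjoint (Q.A i : Space d →L[ℝ] Space d) (structuredLattice Q δ j x) =
      δ • ContinuousLinearMap.adjoint (Q.AinvA j i) x := by
  refine ext_inner_right ℝ fun y => ?_
  simp only [structuredLattice, _root_.smul_apply, map_smul, inner_smul_left,
    ContinuousLinearMap.adjoint_inner_left]
  rfl

lemma adjoint_AinvA_adjoint_AinvA (i j : J) (x : Space d) :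
    ContinuousLinearMap.adjoint (Q.AinvA i j) (ContinuousLinearMap.adjoint (Q.AinvA j i) x) = x := by
  refine ext_inner_right ℝ fun y => ?_
  rw [ContinuousLinearMap.adjoint_inner_left, ContinuousLinearMap.adjoint_inner_left,
    Q.AinvA_AinvA]

/-- The decay of `(𝓕⁻¹ φ_i ∗ g_j) ∘ C_j`. -/
lemma amalgamNorm_fourier_localAtom_comp_le (hd : 1 ≤ d) (hφ : Q.IsRegularPartitionOfUnity φ)
    (hQo : ∀ i, IsOpen (Q.Q' i)) (hgs : ContDiff ℝ ∞ (𝓕 g)) {δ : ℝ} (hδ : 0 < δ) (hδ1 : δ ≤ 1)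
    (i j : J) :
    amalgamNorm (fun x => 𝓕 (localAtom Q φ g i j) (-structuredLattice Q δ j x)) ≤
      ENNReal.ofReal (2 ^ (d + 1) * (1 + 2 * d) ^ d) * (ENNReal.ofReal ((d * Q.dil j i * Q.dil i j / δ) ^ (d + 1)) *
        (ENNReal.ofReal (Q.absDet i * (Real.sqrt (Q.absDet j))⁻¹) *
          (ENNReal.ofReal (2 ^ (d + 1)) * atomBound Q φ g i j))) := by
  have hY := Q.one_le_dil j i
  have hZ := Q.one_le_dil i j
  have hY0 : 0 < Q.dil j i := by linarith
  have hd' : (1 : ℝ) ≤ d := by exact_mod_cast hd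
  refine amalgamNorm_le_of_decay hd fun x l => ?_
  set z := ContinuousLinearMap.adjoint (Q.A i : Space d →L[ℝ] Space d)
    (-structuredLattice Q δ j x) with hz
  -- The lattice matrix `C_j` and the pullback by `A_i` combine to the transition matrix. Inverting
  -- it bounds `x l` by `‖z‖` at the cost `dil i j / δ`, and the largest coordinate `m` of `z` costs
  -- a further factor `d`.
  have hz' : z = -(δ • ContinuousLinearMap.adjoint (Q.AinvA j i) x) := by
    rw [hz, map_neg, adjoint_A_structuredLattice]
  obtain ⟨m, hm⟩ := exists_norm_le_mul_abs hd z
  have h1 : |x l| ≤ Q.dil i j / δ * ‖z‖ := by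
    have h2 : x = -(δ⁻¹ • ContinuousLinearMap.adjoint (Q.AinvA i j) z) := by
      rw [hz', map_neg, map_smul, adjoint_AinvA_adjoint_AinvA, smul_neg, smul_smul,
        inv_mul_cancel₀ hδ.ne', one_smul, neg_neg]
    have h3 : ‖ContinuousLinearMap.adjoint (Q.AinvA i j) z‖ ≤ Q.dil i j * ‖z‖ := by
      refine (ContinuousLinearMap.le_opNorm _ _).trans ?_
      rw [LinearIsometryEquiv.norm_map]
      gcongr
      exact Q.norm_AinvA_le_dil i j
    have h4 : |x l| ≤ ‖x‖ := PiLp.norm_apply_le x l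
    refine h4.trans ?_
    rw [h2, norm_neg, norm_smul, Real.norm_of_nonneg (by positivity)]
    calc δ⁻¹ * _ ≤ δ⁻¹ * (Q.dil i j * ‖z‖) := by gcongr
      _ = _ := by ring
  have h5 : 1 + |x l| ≤ (d * Q.dil j i * Q.dil i j / δ) * (1 + |z m| / Q.dil j i) := by
    have h6 : 1 ≤ d * Q.dil j i * Q.dil i j / δ := by
      rw [le_div_iff₀ hδ]
      have : 1 ≤ d * Q.dil j i := by nlinarith
      nlinarith
    have h7 : Q.dil i j / δ * ‖z‖ ≤ (d * Q.dil j i * Q.dil i j / δ) * (|z m| / Q.dil j i) := by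
      calc Q.dil i j / δ * ‖z‖ ≤ Q.dil i j / δ * (d * |z m|) := by gcongr
        _ = _ := by field_simp
    linarith
  rw [enorm_fourier_localAtom, ← hz]
  have h8 := enorm_fourier_normalizedAtom_decay hd hφ hQo hgs i j z m
  calc _ ≤ ENNReal.ofReal (((d * Q.dil j i * Q.dil i j / δ) * (1 + |z m| / Q.dil j i)) ^ (d + 1)) *
        (ENNReal.ofReal (Q.absDet i * (Real.sqrt (Q.absDet j))⁻¹) *
          ‖𝓕 (normalizedAtom Q φ g i j) z‖ₑ) := by gcongr
    _ = ENNReal.ofReal ((d * Q.dil j i * Q.dil i j / δ) ^ (d + 1)) *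
        (ENNReal.ofReal (Q.absDet i * (Real.sqrt (Q.absDet j))⁻¹) *
        (ENNReal.ofReal ((1 + |z m| / Q.dil j i) ^ (d + 1)) *
          ‖𝓕 (normalizedAtom Q φ g i j) z‖ₑ)) := by
        rw [mul_pow, ENNReal.ofReal_mul (by positivity)]
        ring
    _ ≤ _ := by gcongr

variable {w : J → ℝ}

lemma AffineFamily.dil_eq_one_or (Q : AffineFamily d J) (i j : J) :
    max 1 (‖Q.AinvA i j‖ ^ 2) = Q.dil i j ^ 2 := by
  rcases le_total 1 ‖Q.AinvA i j‖ with h | h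
  · rw [AffineFamily.dil, max_eq_right h, max_eq_right (one_le_pow₀ h)]
  · rw [AffineFamily.dil, max_eq_left h, max_eq_left (pow_le_one₀ (norm_nonneg _) h), one_pow]

lemma absDet_mul_inv_le (i j : J) : Q.absDet i * (Q.absDet j)⁻¹ ≤ Q.dil j i ^ d := by
  rw [mul_comm, ← Q.abs_det_AinvA]
  exact (abs_det_le_pow _).trans (pow_le_pow_left₀ (norm_nonneg _) (Q.norm_AinvA_le_dil j i) d)

/-- For adaptedness the factor of `K_{i,j}` containing `b_i - b_j` and the growth weight in `Ỹ` are
dropped, both being at least one. -/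
lemma atomBound_le (i j : J) : ENNReal.ofReal (max (w i / w j) (w j / w i) *
      (Q.dil i j * Q.dil j i ^ 2) ^ (d + 1)) * atomBound Q φ g i j ≤
    ENNReal.ofReal ((2 * d) ^ (d + 1)) * derivConst Q φ * Ytilde Q w g i j := by
  have h1 : ENNReal.ofReal (max (w i / w j) (w j / w i) * (Q.dil i j * Q.dil j i ^ 2) ^ (d + 1)) ≤
      ENNReal.ofReal (kernelConst Q w i j) := by
    rcases le_total (max (w i / w j) (w j / w i)) 0 with h0 | h0
    · rw [ENNReal.ofReal_of_nonpos]
      · exact zero_le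
      · exact mul_nonpos_of_nonpos_of_nonneg h0 (by positivity [Q.one_le_dil i j])
    · refine ENNReal.ofReal_le_ofReal ?_
      rw [kernelConst, Q.dil_eq_one_or]
      have : 0 < Q.dil i j := one_pos.trans_le (Q.one_le_dil i j)
      gcongr
      exact le_mul_of_one_le_left (by positivity) (le_max_left _ _)
  have h2 : ∫⁻ ξ in Q.Q' i, maxDeriv (d + 1) (𝓕 g) (Q.Sinv j (Q.S i ξ)) ≤
      ∫⁻ ξ in Q.Q' i, ENNReal.ofReal ((1 + ‖Q.Sinv j (Q.S i ξ)‖) ^ (d + 1)) *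
      maxDeriv (d + 1) (𝓕 g) (Q.Sinv j (Q.S i ξ)) := by
    refine lintegral_mono fun ξ => le_mul_of_one_le_left' ?_
    rw [ENNReal.one_le_ofReal]
    exact one_le_pow₀ (by linarith [norm_nonneg (Q.Sinv j (Q.S i ξ))])
  rw [atomBound, Ytilde]
  calc _ ≤ ENNReal.ofReal (kernelConst Q w i j) * (ENNReal.ofReal ((2 * d) ^ (d + 1)) *
        derivConst Q φ * ∫⁻ ξ in Q.Q' i, ENNReal.ofReal ((1 + ‖Q.Sinv j (Q.S i ξ)‖) ^ (d + 1)) *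
      maxDeriv (d + 1) (𝓕 g) (Q.Sinv j (Q.S i ξ))) := by gcongr
    _ = _ := by ring

lemma ofReal_mul_mul_mul_mul {a b c e f : ℝ} (ha : 0 ≤ a) (hb : 0 ≤ b) (hc : 0 ≤ c) (he : 0 ≤ e) :
    ENNReal.ofReal (a * b * c * e * f) = ENNReal.ofReal a * ENNReal.ofReal b * ENNReal.ofReal c *
      ENNReal.ofReal e * ENNReal.ofReal f := by
  rw [ENNReal.ofReal_mul (by positivity), ENNReal.ofReal_mul (by positivity),
    ENNReal.ofReal_mul (by positivity), ENNReal.ofReal_mul (by positivity)]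

lemma conv_fourierInv_structuredGenerator (hg : Integrable g) (i j : J) (x : Space d) :
    conv (𝓕⁻ (φ i : Space d → ℂ)) (structuredGenerator Q g j) x =
      𝓕 (localAtom Q φ g i j) (-x) := by
  rw [conv_fourierInv_eq (φ i).contDiff (φ i).hasCompactSupport
    (integrable_structuredGenerator Q hg j), fourierInv_eq_fourier_neg_apply]
  rfl

/-- The entries of the matrix of adaptedness are controlled by `Ỹ`. -/
lemma exists_adaptedMatrix_le (hd : 1 ≤ d) (hφ : Q.IsRegularPartitionOfUnity φ)
    (hQo : ∀ i, IsOpen (Q.Q' i)) (hg : Integrable g) (hgs : ContDiff ℝ ∞ (𝓕 g)) {δ : ℝ}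
    (hδ : 0 < δ) (hδ1 : δ ≤ 1) : ∃ c : ℝ≥0∞, c ≠ ⊤ ∧ ∀ i j,
      adaptedMatrix φ (structuredGenerator Q g) (structuredLattice Q δ) w w i j ≤
        c * Ytilde Q w g i j := by
  -- The factors come from `|det C_j|^{1/2}`, the lattice sum, the change of scale from `z` to `x`,
  -- and the Fourier decay, in this order. The value depends on `δ`, which does no harm since only
  -- finiteness matters here.
  set c₁ : ℝ := Real.sqrt (δ ^ d) * (2 ^ (d + 1) * (1 + 2 * d) ^ d) * (d / δ) ^ (d + 1) * 2 ^ (d + 1)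
    with hc₁
  refine ⟨ENNReal.ofReal c₁ * (ENNReal.ofReal ((2 * d) ^ (d + 1)) * derivConst Q φ),
    ENNReal.mul_ne_top ENNReal.ofReal_ne_top
      (ENNReal.mul_ne_top ENNReal.ofReal_ne_top (derivConst_ne_top hφ)), fun i j => ?_⟩
  have hc₁0 : 0 ≤ c₁ := by positivity
  have hY := Q.one_le_dil j i
  have hZ := Q.one_le_dil i j
  have hY0 : 0 < Q.dil j i := by linarith
  have hZ0 : 0 < Q.dil i j := by linarith
  have hai := Q.absDet_pos i
  have haj := Q.absDet_pos j
  simp only [adaptedMatrix, conv_fourierInv_structuredGenerator hg]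
  rw [mul_assoc]
  calc _ ≤ ENNReal.ofReal (max (w i / w j) (w j / w i)) *
      (ENNReal.ofReal (Real.sqrt |(structuredLattice Q δ j).det|) *
      (ENNReal.ofReal (2 ^ (d + 1) * (1 + 2 * d) ^ d) *
        (ENNReal.ofReal ((d * Q.dil j i * Q.dil i j / δ) ^ (d + 1)) *
        (ENNReal.ofReal (Q.absDet i * (Real.sqrt (Q.absDet j))⁻¹) *
          (ENNReal.ofReal (2 ^ (d + 1)) * atomBound Q φ g i j))))) := by
        gcongr
        exact amalgamNorm_fourier_localAtom_comp_le hd hφ hQo hgs hδ hδ1 i j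
    _ = ENNReal.ofReal (max (w i / w j) (w j / w i)) * (ENNReal.ofReal
        (Real.sqrt |(structuredLattice Q δ j).det| * (2 ^ (d + 1) * (1 + 2 * d) ^ d) *
        ((d * Q.dil j i * Q.dil i j / δ) ^ (d + 1)) * (Q.absDet i * (Real.sqrt (Q.absDet j))⁻¹) *
        2 ^ (d + 1)) * atomBound Q φ g i j) := by
        rw [ofReal_mul_mul_mul_mul (Real.sqrt_nonneg _) (by positivity) (by positivity)
          (by positivity)]
        ring
    _ ≤ ENNReal.ofReal (max (w i / w j) (w j / w i)) *
        (ENNReal.ofReal (c₁ * (Q.dil i j * Q.dil j i ^ 2) ^ (d + 1)) * atomBound Q φ g i j) := by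
        refine mul_le_mul_right (mul_le_mul_left (ENNReal.ofReal_le_ofReal ?_) _) _
        rw [abs_det_structuredLattice Q hδ, Real.sqrt_mul (by positivity), Real.sqrt_inv]
        -- The two half powers of `|det A_j|⁻¹` leave `|det A_i| / |det A_j|`, bounded by `dil j i ^
        -- d`. Rounding the exponent up to `d + 1` produces the square of `dil j i` that appears in
        -- `K_{i,j}`.
        calc _ = c₁ * ((Q.dil j i * Q.dil i j) ^ (d + 1) *
              (Q.absDet i * (Real.sqrt (Q.absDet j) * Real.sqrt (Q.absDet j))⁻¹)) := by
              rw [hc₁, mul_inv, div_pow, div_pow, mul_pow _ (Q.dil i j), mul_pow _ (Q.dil j i),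
                mul_pow (Q.dil j i)]
              ring
          _ ≤ c₁ * ((Q.dil j i * Q.dil i j) ^ (d + 1) * Q.dil j i ^ (d + 1)) := by
              rw [Real.mul_self_sqrt haj.le]
              gcongr
              exact (absDet_mul_inv_le i j).trans (pow_le_pow_right₀ hY (by omega))
          _ = _ := by rw [mul_pow (Q.dil j i), mul_pow (Q.dil i j), ← pow_mul]; ring
    _ = ENNReal.ofReal c₁ * (ENNReal.ofReal (max (w i / w j) (w j / w i) *
      (Q.dil i j * Q.dil j i ^ 2) ^ (d + 1)) * atomBound Q φ g i j) := by
        rw [ENNReal.ofReal_mul hc₁0,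
          ENNReal.ofReal_mul' (q := (Q.dil i j * Q.dil j i ^ 2) ^ (d + 1)) (by positivity)]
        ring
    _ ≤ ENNReal.ofReal c₁ * (ENNReal.ofReal ((2 * d) ^ (d + 1)) * derivConst Q φ *
        Ytilde Q w g i j) := mul_le_mul_right (atomBound_le i j) _
    _ = _ := by ring

lemma schurNorm_le_mul {I : Type*} {M N : I → J → ℝ≥0∞} {c : ℝ≥0∞} (h : ∀ i j, M i j ≤ c * N i j) :
    schurNorm M ≤ c * schurNorm N := by
  refine max_le (iSup_le fun i => ?_) (iSup_le fun j => ?_)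
  · refine (ENNReal.tsum_le_tsum fun j => h i j).trans ?_
    rw [ENNReal.tsum_mul_left]
    gcongr
    exact (le_iSup (fun i => ∑' j, N i j) i).trans (le_max_left _ _)
  · refine (ENNReal.tsum_le_tsum fun i => h i j).trans ?_
    rw [ENNReal.tsum_mul_left]
    gcongr
    exact (le_iSup (fun j => ∑' i, N i j) j).trans (le_max_right _ _)

theorem isAdapted_structured (hd : 1 ≤ d) (hφ : Q.IsRegularPartitionOfUnity φ)
    (hQo : ∀ i, IsOpen (Q.Q' i)) (hg : Integrable g) (hgs : ContDiff ℝ ∞ (𝓕 g)) {δ : ℝ}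
    (hδ : 0 < δ) (hδ1 : δ ≤ 1) (hY : schurNorm (Ytilde Q w g) < ⊤) :
    IsAdapted φ (structuredGenerator Q g) (structuredLattice Q δ) w w := by
  obtain ⟨c, hc, h⟩ := exists_adaptedMatrix_le (w := w) hd hφ hQo hg hgs hδ hδ1
  exact (schurNorm_le_mul h).trans_lt (ENNReal.mul_lt_top hc.lt_top hY)

end SystemBounds

/-! ### Counting overlaps of translated sets, and the factor `δ²` -/

section Overlaps

variable {d : ℕ} {J : Type*} {Q : AffineFamily d J} {O : Opens (Space d)} {φ : J → 𝓓(O, ℂ)}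
  {g : Space d → ℂ} {w : J → ℝ} {δ : ℝ}

/-- The dual lattice points `δ⁻¹ A_j n`. -/
def dualPoint (Q : AffineFamily d J) (δ : ℝ) (j : J) (n : Fin d → ℤ) : Space d :=
  δ⁻¹ • Q.A j (intVec n)

/-- The set of all `n ≠ 0` for which `Q_m` meets `Q_i + δ⁻¹ A_j n`. -/
def overlapSet (Q : AffineFamily d J) (δ : ℝ) (i j m : J) : Set (Fin d → ℤ) :=
  {n | n ≠ 0 ∧ ∃ ξ ∈ Q.set m, ξ - dualPoint Q δ j n ∈ Q.set i}

/-- `max{1, |A_i⁻¹ (b_i - b_j)|}`. -/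
def AffineFamily.shift (Q : AffineFamily d J) (i j : J) : ℝ :=
  max 1 ‖(Q.A i).symm (Q.b i - Q.b j)‖

/-- `max{1, R_Q}`. -/
def AffineFamily.radius (Q : AffineFamily d J) : ℝ := max 1 Q.R.toReal

/-- The infimum of `1 + |η|` over `η ∈ S_j⁻¹(Q_i)`. -/
def AffineFamily.gap (Q : AffineFamily d J) (i j : J) : ℝ :=
  1 + Metric.infDist 0 (Q.Sinv j '' Q.set i)

lemma AffineFamily.one_le_shift (i j : J) : 1 ≤ Q.shift i j := le_max_left _ _

lemma AffineFamily.one_le_radius : 1 ≤ Q.radius := le_max_left _ _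

lemma AffineFamily.one_le_gap (i j : J) : 1 ≤ Q.gap i j := by
  have := Metric.infDist_nonneg (x := (0 : Space d)) (s := Q.Sinv j '' Q.set i)
  unfold AffineFamily.gap
  linarith

lemma AffineFamily.norm_le_radius (hR : Q.R < ⊤) {i : J} {ξ : Space d} (hξ : ξ ∈ Q.Q' i) :
    ‖ξ‖ ≤ Q.radius := by
  have h1 : ‖ξ‖ₑ ≤ Q.R := (le_iSup₂ (f := fun ξ (_ : ξ ∈ Q.Q' i) => ‖ξ‖ₑ) ξ hξ).trans
    (le_iSup (fun i => ⨆ ξ ∈ Q.Q' i, ‖ξ‖ₑ) i)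
  have h2 := ENNReal.toReal_mono hR.ne h1
  rw [toReal_enorm] at h2
  exact h2.trans (le_max_right _ _)

lemma AffineFamily.ofReal_radius_pow_le (hR : Q.R < ⊤) (n : ℕ) :
    ENNReal.ofReal (Q.radius ^ n) ≤ max 1 (Q.R ^ n) := by
  rcases le_total 1 Q.R.toReal with h | h
  · rw [AffineFamily.radius, max_eq_right h, ENNReal.ofReal_pow (by positivity),
      ENNReal.ofReal_toReal hR.ne]
    exact le_max_right _ _
  · rw [AffineFamily.radius, max_eq_left h]
    simp

/-- The transition map equals `A_j⁻¹ A_i (η + A_i⁻¹ (b_i - b_j))`, so the displacement of the sets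
is measured by `shift`. -/
lemma norm_Sinv_le_shift (hR : Q.R < ⊤) (i j : J) {ξ : Space d} (hξ : ξ ∈ Q.set i) :
    ‖Q.Sinv j ξ‖ ≤ 2 * Q.radius * (Q.shift i j * Q.dil j i) := by
  obtain ⟨η, hη, rfl⟩ := hξ
  have h1 : Q.Sinv j (Q.S i η) = Q.AinvA j i (η + (Q.A i).symm (Q.b i - Q.b j)) := by
    simp [AffineFamily.Sinv, AffineFamily.S, AffineFamily.AinvA, map_add, map_sub, add_sub_assoc]
  rw [h1]
  have h2 : ‖(Q.A i).symm (Q.b i - Q.b j)‖ ≤ Q.shift i j := le_max_right _ _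
  have hr := Q.one_le_radius
  have hx := Q.one_le_shift i j
  have hy := Q.one_le_dil j i
  calc _ ≤ ‖Q.AinvA j i‖ * ‖η + (Q.A i).symm (Q.b i - Q.b j)‖ := ContinuousLinearMap.le_opNorm _ _
    _ ≤ Q.dil j i * (Q.radius + Q.shift i j) := by
        gcongr
        · exact Q.norm_AinvA_le_dil j i
        · exact (norm_add_le _ _).trans (add_le_add (Q.norm_le_radius hR hη) h2)
    _ ≤ Q.dil j i * (2 * Q.radius * Q.shift i j) := by
        gcongr
        nlinarith
    _ = _ := by ring

/-- The set `S_j⁻¹(Q_i)` has diameter at most `2 · radius · dil j i`, so its points are not much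
farther from the origin than its nearest ones. Unlike `shift`, the quantity `gap` can be absorbed by
the growth weight inside the integral of `Ỹ`. -/
lemma norm_Sinv_le_gap (hR : Q.R < ⊤) (i j : J) {ξ : Space d} (hξ : ξ ∈ Q.set i) :
    ‖Q.Sinv j ξ‖ ≤ 2 * Q.radius * (Q.dil j i * Q.gap i j) := by
  have hr := Q.one_le_radius
  have hy := Q.one_le_dil j i
  have hg := Q.one_le_gap i j
  have h1 : ‖Q.Sinv j ξ‖ - 2 * Q.radius * Q.dil j i ≤
      Metric.infDist 0 (Q.Sinv j '' Q.set i) := by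
    refine (Metric.le_infDist (Set.Nonempty.image _ ⟨ξ, hξ⟩)).2 ?_
    rintro _ ⟨ζ, hζ, rfl⟩
    obtain ⟨η, hη, rfl⟩ := hξ
    obtain ⟨θ, hθ, rfl⟩ := hζ
    rw [dist_zero_left, Q.Sinv_S, Q.Sinv_S]
    have h2 : ‖Q.AinvA j i (η - θ)‖ ≤ Q.dil j i * (2 * Q.radius) := by
      refine (ContinuousLinearMap.le_opNorm _ _).trans ?_
      gcongr
      · exact Q.norm_AinvA_le_dil j i
      · refine (norm_sub_le _ _).trans ?_
        linarith [Q.norm_le_radius hR hη, Q.norm_le_radius hR hθ]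
    have h3 : Q.AinvA j i η + Q.Sinv j (Q.b i) =
        Q.AinvA j i (η - θ) + (Q.AinvA j i θ + Q.Sinv j (Q.b i)) := by
      rw [map_sub]; abel
    have h4 := norm_add_le (Q.AinvA j i (η - θ)) (Q.AinvA j i θ + Q.Sinv j (Q.b i))
    rw [← h3] at h4
    linarith
  have h5 : Metric.infDist 0 (Q.Sinv j '' Q.set i) = Q.gap i j - 1 := by
    simp [AffineFamily.gap]
  rw [h5] at h1
  have h6 : 1 ≤ 2 * Q.radius * Q.dil j i := by nlinarith
  nlinarith

lemma gap_le (i j : J) {ξ : Space d} (hξ : ξ ∈ Q.Q' i) : Q.gap i j ≤ 1 + ‖Q.Sinv j (Q.S i ξ)‖ := by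
  have := Metric.infDist_le_dist_of_mem (x := (0 : Space d))
    (mem_image_of_mem (Q.Sinv j) (mem_image_of_mem (Q.S i) hξ))
  rw [dist_zero_left] at this
  unfold AffineFamily.gap
  exact add_le_add_right this 1

/-- In the coordinates of `S_j` the translation by `δ⁻¹ A_j n` is translation by `δ⁻¹ n`, so an
overlap of bounded sets forces `n` to be of size `δ`. -/
lemma norm_intVec_le (hδ : 0 < δ) {j : J} {n : Fin d → ℤ} {ξ : Space d} {B₁ B₂ : ℝ}
    (h1 : ‖Q.Sinv j ξ‖ ≤ B₁) (h2 : ‖Q.Sinv j (ξ - dualPoint Q δ j n)‖ ≤ B₂) :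
    ‖intVec n‖ ≤ δ * (B₂ + B₁) := by
  have h3 : intVec n = δ • (Q.Sinv j ξ - Q.Sinv j (ξ - dualPoint Q δ j n)) := by
    simp only [AffineFamily.Sinv, dualPoint, ← map_sub]
    rw [show ξ - Q.b j - (ξ - δ⁻¹ • Q.A j (intVec n) - Q.b j) = δ⁻¹ • Q.A j (intVec n) by abel,
      map_smul, ContinuousLinearEquiv.symm_apply_apply, smul_smul, mul_inv_cancel₀ hδ.ne', one_smul]
  rw [h3, norm_smul, Real.norm_of_nonneg hδ.le]
  gcongr
  refine (norm_sub_le _ _).trans ?_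
  linarith

lemma one_le_norm_intVec {n : Fin d → ℤ} (hn : n ≠ 0) : 1 ≤ ‖(intVec n : Space d)‖ := by
  obtain ⟨l, hl⟩ := Function.ne_iff.1 hn
  have h1 : |(intVec n : Space d) l| ≤ ‖(intVec n : Space d)‖ := PiLp.norm_apply_le (intVec n : Space d) l
  refine le_trans ?_ h1
  have h2 : (1 : ℤ) ≤ |n l| := Int.one_le_abs hl
  have h3 : ((1 : ℤ) : ℝ) ≤ |((n l : ℤ) : ℝ)| := by exact_mod_cast h2
  simpa [intVec] using h3

lemma finite_intVec_le (r : ℝ) (hr : 1 ≤ r) :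
    {n : Fin d → ℤ | ‖(intVec n : Space d)‖ ≤ r}.Finite ∧
      ({n : Fin d → ℤ | ‖(intVec n : Space d)‖ ≤ r}.ncard : ℝ) ≤ (3 * r) ^ d := by
  classical
  set F : Finset (Fin d → ℤ) := Fintype.piFinset fun _ => Finset.Icc (-⌊r⌋) ⌊r⌋ with hF
  have hsub : {n : Fin d → ℤ | ‖(intVec n : Space d)‖ ≤ r} ⊆ F := by
    intro n hn
    rw [hF, Finset.mem_coe, Fintype.mem_piFinset]
    intro l
    rw [Finset.mem_Icc, ← abs_le, Int.le_floor]
    have h1 : |(intVec n : Space d) l| ≤ ‖(intVec n : Space d)‖ := PiLp.norm_apply_le (intVec n : Space d) l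
    have h2 := h1.trans hn
    simpa [intVec] using h2
  refine ⟨F.finite_toSet.subset hsub, ?_⟩
  have h1 := Set.ncard_le_ncard hsub F.finite_toSet
  rw [Set.ncard_coe_finset, hF, Fintype.card_piFinset, Finset.prod_const, Finset.card_univ,
    Fintype.card_fin, Int.card_Icc] at h1
  -- An interval of half-width `r` contains `2⌊r⌋ + 1` integers, and `1 ≤ r`.
  have h2 : (((⌊r⌋ + 1 - -⌊r⌋).toNat : ℕ) : ℝ) ≤ 3 * r := by
    have h3 : 0 ≤ ⌊r⌋ := Int.floor_nonneg.2 (by linarith)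
    have h4 : (((⌊r⌋ + 1 - -⌊r⌋).toNat : ℤ) : ℝ) = 2 * (⌊r⌋ : ℝ) + 1 := by
      rw [Int.toNat_of_nonneg (by linarith)]; push_cast; ring
    have h5 := Int.floor_le r
    have h6 : (((⌊r⌋ + 1 - -⌊r⌋).toNat : ℕ) : ℝ) = (((⌊r⌋ + 1 - -⌊r⌋).toNat : ℤ) : ℝ) := by
      push_cast; rfl
    rw [h6, h4]
    linarith
  calc _ ≤ (((⌊r⌋ + 1 - -⌊r⌋).toNat ^ d : ℕ) : ℝ) := by exact_mod_cast h1
    _ ≤ _ := by push_cast; gcongr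

/-- For numbers at least one the sum is at most twice the product. Thus the radius factors into an
`(i, j)` part and an `(m, j)` part, as a Schur estimate for a product of two matrices demands. -/
lemma overlapSet_subset (hR : Q.R < ⊤) (hδ : 0 < δ) (i j m : J) : overlapSet Q δ i j m ⊆
    {n | ‖(intVec n : Space d)‖ ≤ δ * (4 * Q.radius *
      ((Q.shift i j * Q.dil j i) * (Q.shift m j * Q.dil j m)))} := by
  rintro n ⟨-, ξ, hξ, hξ'⟩
  refine (norm_intVec_le hδ (norm_Sinv_le_shift hR m j hξ)
    (norm_Sinv_le_shift hR i j hξ')).trans ?_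
  have hr := Q.one_le_radius
  have h1 : 1 ≤ Q.shift i j * Q.dil j i := one_le_mul_of_one_le_of_one_le
    (Q.one_le_shift _ _) (Q.one_le_dil _ _)
  have h2 : 1 ≤ Q.shift m j * Q.dil j m := one_le_mul_of_one_le_of_one_le
    (Q.one_le_shift _ _) (Q.one_le_dil _ _)
  gcongr
  generalize Q.shift i j * Q.dil j i = a at *
  generalize Q.shift m j * Q.dil j m = b at *
  have : a + b ≤ 2 * (a * b) := by nlinarith
  nlinarith

lemma overlapSet_subset' (hR : Q.R < ⊤) (hδ : 0 < δ) (i j m : J) : overlapSet Q δ i j m ⊆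
    {n | ‖(intVec n : Space d)‖ ≤ δ * (4 * Q.radius *
      ((Q.dil j i * Q.gap i j) * (Q.dil j m * Q.gap m j)))} := by
  rintro n ⟨-, ξ, hξ, hξ'⟩
  refine (norm_intVec_le hδ (norm_Sinv_le_gap hR m j hξ)
    (norm_Sinv_le_gap hR i j hξ')).trans ?_
  have hr := Q.one_le_radius
  have h1 : 1 ≤ Q.dil j i * Q.gap i j := one_le_mul_of_one_le_of_one_le
    (Q.one_le_dil _ _) (Q.one_le_gap _ _)
  have h2 : 1 ≤ Q.dil j m * Q.gap m j := one_le_mul_of_one_le_of_one_le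
    (Q.one_le_dil _ _) (Q.one_le_gap _ _)
  gcongr
  generalize Q.dil j i * Q.gap i j = a at *
  generalize Q.dil j m * Q.gap m j = b at *
  have : a + b ≤ 2 * (a * b) := by nlinarith
  nlinarith

lemma finite_overlapSet (hR : Q.R < ⊤) (hδ : 0 < δ) (i j m : J) : (overlapSet Q δ i j m).Finite :=
  ((finite_intVec_le _ (le_max_left 1 (δ * (4 * Q.radius *
    ((Q.shift i j * Q.dil j i) * (Q.shift m j * Q.dil j m)))))).1).subset
    ((overlapSet_subset hR hδ i j m).trans fun _ hn => le_trans (mem_ofPred_eq ▸ hn) (le_max_right _ _))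

/-- The number of overlaps. The factor `δ²` comes from the fact that there are no overlaps at all
if `δ` is small. -/
lemma ncard_overlapSet_le (hR : Q.R < ⊤) (hδ : 0 < δ) (i j m : J) :
    (δ ^ d)⁻¹ * (overlapSet Q δ i j m).ncard ≤ δ ^ 2 * (16 * 12 ^ d * Q.radius ^ (d + 2)) *
      (((Q.shift i j * Q.dil j i) ^ (d + 1) * (Q.dil j i * Q.gap i j)) *
      ((Q.shift m j * Q.dil j m) ^ (d + 1) * (Q.dil j m * Q.gap m j))) := by
  have hr := Q.one_le_radius
  have hr0 : 0 < Q.radius := by linarith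
  have h1 : 1 ≤ Q.shift i j * Q.dil j i := one_le_mul_of_one_le_of_one_le
    (Q.one_le_shift _ _) (Q.one_le_dil _ _)
  have h2 : 1 ≤ Q.shift m j * Q.dil j m := one_le_mul_of_one_le_of_one_le
    (Q.one_le_shift _ _) (Q.one_le_dil _ _)
  have h3 : 1 ≤ Q.dil j i * Q.gap i j := one_le_mul_of_one_le_of_one_le
    (Q.one_le_dil _ _) (Q.one_le_gap _ _)
  have h4 : 1 ≤ Q.dil j m * Q.gap m j := one_le_mul_of_one_le_of_one_le
    (Q.one_le_dil _ _) (Q.one_le_gap _ _)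
  have s1 := overlapSet_subset hR hδ i j m
  have s2 := overlapSet_subset' hR hδ i j m
  generalize Q.shift i j * Q.dil j i = a at *
  generalize Q.shift m j * Q.dil j m = b at *
  generalize Q.dil j i * Q.gap i j = a' at *
  generalize Q.dil j m * Q.gap m j = b' at *
  rcases (overlapSet Q δ i j m).eq_empty_or_nonempty with he | ⟨n, hn⟩
  · rw [he]
    simp only [Set.ncard_empty, Nat.cast_zero, mul_zero]
    positivity
  have hn1 := one_le_norm_intVec (d := d) hn.1
  -- A nonzero integer vector has norm at least one, so a single overlap already yields `1 ≤ δρ` and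
  -- `1 ≤ δρ'`.
  have t1 := hn1.trans (s1 hn)
  have t2 := hn1.trans (s2 hn)
  set ρ := 4 * Q.radius * (a * b)
  set ρ' := 4 * Q.radius * (a' * b')
  obtain ⟨hf, hc⟩ := finite_intVec_le (d := d) (δ * ρ) t1
  have h5 : ((overlapSet Q δ i j m).ncard : ℝ) ≤ (3 * (δ * ρ)) ^ d := by
    refine le_trans ?_ hc
    exact_mod_cast Set.ncard_le_ncard s1 hf
  have hρ : 0 < ρ := by positivity
  calc (δ ^ d)⁻¹ * (overlapSet Q δ i j m).ncard ≤ (δ ^ d)⁻¹ * (3 * (δ * ρ)) ^ d := by gcongr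
    _ = 3 ^ d * ρ ^ d * 1 * 1 := by rw [mul_pow, mul_pow]; field_simp
    -- Both factors `1` are replaced by quantities at least one, which brings in `δ²`. The second
    -- uses `ρ'`: using `ρ` twice would need the power `d + 2` of `shift`, whereas `K_{i,j}`
    -- provides only `d + 1`. The factor `gap` is available from the growth weight.
    _ ≤ 3 ^ d * ρ ^ d * (δ * ρ) * (δ * ρ') := by gcongr
    _ = _ := by
        simp only [ρ, ρ']
        rw [show (12 : ℝ) = 3 * 4 by norm_num]
        simp only [mul_pow]
        ring

/-- Here the full kernel constant is used, and the powers of `gap` enter the integral because `gap`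
is at most the growth weight at each point of `Q_i'`. -/
lemma ofReal_weight_mul_atomBound_le (hQo : ∀ i, IsOpen (Q.Q' i)) (i j : J) : ENNReal.ofReal (max (w i / w j) (w j / w i) *
      ((Q.shift i j * Q.dil i j * Q.dil j i ^ 2) ^ (d + 1) * Q.gap i j ^ (d + 1))) *
        atomBound Q φ g i j ≤
    ENNReal.ofReal ((2 * d) ^ (d + 1)) * derivConst Q φ * Ytilde Q w g i j := by
  have hg := Q.one_le_gap i j
  have h1 : kernelConst Q w i j = max (w i / w j) (w j / w i) *
      (Q.shift i j * Q.dil i j * Q.dil j i ^ 2) ^ (d + 1) := by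
    rw [kernelConst, Q.dil_eq_one_or]
    rfl
  have h2 : ENNReal.ofReal (Q.gap i j ^ (d + 1)) *
      ∫⁻ ξ in Q.Q' i, maxDeriv (d + 1) (𝓕 g) (Q.Sinv j (Q.S i ξ)) ≤
      ∫⁻ ξ in Q.Q' i, ENNReal.ofReal ((1 + ‖Q.Sinv j (Q.S i ξ)‖) ^ (d + 1)) *
      maxDeriv (d + 1) (𝓕 g) (Q.Sinv j (Q.S i ξ)) := by
    rw [← lintegral_const_mul' _ _ ENNReal.ofReal_ne_top]
    refine setLIntegral_mono' (hQo i).measurableSet fun ξ hξ => ?_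
    gcongr
    exact gap_le i j hξ
  rw [atomBound, Ytilde, ← mul_assoc (max (w i / w j) (w j / w i)), ← h1,
    ENNReal.ofReal_mul' (by positivity)]
  calc _ = ENNReal.ofReal (kernelConst Q w i j) * (ENNReal.ofReal ((2 * d) ^ (d + 1)) *
        derivConst Q φ * (ENNReal.ofReal (Q.gap i j ^ (d + 1)) *
          ∫⁻ ξ in Q.Q' i, maxDeriv (d + 1) (𝓕 g) (Q.Sinv j (Q.S i ξ)))) := by ring
    _ ≤ ENNReal.ofReal (kernelConst Q w i j) * (ENNReal.ofReal ((2 * d) ^ (d + 1)) *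
        derivConst Q φ * ∫⁻ ξ in Q.Q' i, ENNReal.ofReal ((1 + ‖Q.Sinv j (Q.S i ξ)‖) ^ (d + 1)) *
      maxDeriv (d + 1) (𝓕 g) (Q.Sinv j (Q.S i ξ))) := by gcongr
    _ = _ := by ring

lemma div_le_max_mul_max (hw : ∀ i, 0 < w i) (i j m : J) : w i / w m ≤
    max (w i / w j) (w j / w i) * max (w m / w j) (w j / w m) := by
  have hi := hw i
  have hj := hw j
  have hm := hw m
  calc w i / w m = (w i / w j) * (w j / w m) := by field_simp
    _ ≤ _ := mul_le_mul (le_max_left _ _) (le_max_right _ _) (by positivity)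
        (le_max_of_le_left (by positivity))

/-- Apart from `16 ≤ 24`, both sides share the factor `12^d (8d)^(2d+2)`. What remains is `((1 +
2d)π)^(2d) ≤ (d+1)^3 (12(d+1)²)^(4(d+1))`, so the fourth power of `C'` absorbs the loss generously.
-/
lemma numeric_const_le (d : ℕ) :
    16 * 12 ^ d * (4 ^ (d + 1) * (1 + 2 * (d : ℝ)) ^ d) ^ 2 * ((2 * (d : ℝ)) ^ (d + 1)) ^ 2 ≤
    24 * Real.pi ^ 2 * (8 * d / Real.pi) ^ (2 * d + 2) * 12 ^ d * (d + 1) ^ 3 *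
      ((12 * ((d : ℝ) + 1) ^ 2) ^ (d + 1)) ^ 4 := by
  have hpi := Real.pi_pos
  have hd : (0 : ℝ) ≤ d := Nat.cast_nonneg d
  have h1 : ((1 + 2 * (d : ℝ)) * Real.pi) ^ (2 * d) ≤ (12 * ((d : ℝ) + 1) ^ 2) ^ (4 * (d + 1)) := by
    have h2 : (1 + 2 * (d : ℝ)) * Real.pi ≤ 12 * ((d : ℝ) + 1) ^ 2 := by
      nlinarith [Real.pi_le_four]
    have h3 : (1 : ℝ) ≤ 12 * ((d : ℝ) + 1) ^ 2 := by nlinarith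
    exact (pow_le_pow_left₀ (by positivity) h2 _).trans (pow_le_pow_right₀ h3 (by omega))
  have h4 : (1 : ℝ) ≤ (d + 1) ^ 3 := one_le_pow₀ (by linarith)
  have e1 : 16 * 12 ^ d * (4 ^ (d + 1) * (1 + 2 * (d : ℝ)) ^ d) ^ 2 * ((2 * (d : ℝ)) ^ (d + 1)) ^ 2
      = 16 * 12 ^ d * (8 * (d : ℝ)) ^ (2 * d + 2) * (1 + 2 * (d : ℝ)) ^ (2 * d) := by
    rw [show (8 : ℝ) * d = 4 * (2 * d) by ring, mul_pow (4 : ℝ)]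
    generalize (2 * (d : ℝ)) = a
    ring
  have e2 : 24 * Real.pi ^ 2 * (8 * d / Real.pi) ^ (2 * d + 2) * 12 ^ d * (d + 1) ^ 3 *
      ((12 * ((d : ℝ) + 1) ^ 2) ^ (d + 1)) ^ 4 = 24 * 12 ^ d * (8 * (d : ℝ)) ^ (2 * d + 2) *
      ((Real.pi ^ (2 * d))⁻¹ * ((d + 1) ^ 3 * (12 * ((d : ℝ) + 1) ^ 2) ^ (4 * (d + 1)))) := by
    rw [div_pow, ← pow_mul, mul_comm (d + 1) 4, pow_add Real.pi (2 * d) 2]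
    field_simp
  rw [e1, e2]
  have h5 : (1 + 2 * (d : ℝ)) ^ (2 * d) ≤
      (Real.pi ^ (2 * d))⁻¹ * ((d + 1) ^ 3 * (12 * ((d : ℝ) + 1) ^ 2) ^ (4 * (d + 1))) := by
    rw [le_inv_mul_iff₀ (by positivity), ← mul_pow, mul_comm Real.pi]
    exact h1.trans (le_mul_of_one_le_left (by positivity) h4)
  gcongr
  norm_num

lemma const_le (hR : Q.R < ⊤) : ENNReal.ofReal (16 * 12 ^ d * Q.radius ^ (d + 2) *
      (4 ^ (d + 1) * (1 + 2 * (d : ℝ)) ^ d) ^ 2) *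
      (ENNReal.ofReal ((2 * d) ^ (d + 1)) * derivConst Q φ) ^ 2 ≤
    constC0 Q φ * constC' d ^ 4 := by
  have hr := Q.one_le_radius
  have h1 : constC' d ^ 4 = ENNReal.ofReal (((12 * ((d : ℝ) + 1) ^ 2) ^ (d + 1)) ^ 4) := by
    rw [constC', ENNReal.ofReal_pow (by positivity), ENNReal.ofReal_pow (by positivity),
      ENNReal.ofReal_mul (by positivity), ENNReal.ofReal_pow (by positivity),
      ENNReal.ofReal_add (by positivity) (by positivity)]
    simp
  calc _ = ENNReal.ofReal (16 * 12 ^ d * (4 ^ (d + 1) * (1 + 2 * (d : ℝ)) ^ d) ^ 2 *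
        ((2 * (d : ℝ)) ^ (d + 1)) ^ 2) * ENNReal.ofReal (Q.radius ^ (d + 2)) *
        derivConst Q φ ^ 2 := by
        rw [mul_pow (ENNReal.ofReal _), ← ENNReal.ofReal_pow (by positivity), ← mul_assoc,
          ← ENNReal.ofReal_mul (by positivity), ← ENNReal.ofReal_mul (by positivity)]
        congr 2
        ring
    _ ≤ ENNReal.ofReal (24 * Real.pi ^ 2 * (8 * d / Real.pi) ^ (2 * d + 2) * 12 ^ d * (d + 1) ^ 3 *
      ((12 * ((d : ℝ) + 1) ^ 2) ^ (d + 1)) ^ 4) * max 1 (Q.R ^ (d + 2)) *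
      ⨆ (α : Fin d → ℕ) (_ : ∑ i, α i ≤ d + 1), Q.partitionConst φ α ^ 2 := by
        exact mul_le_mul' (mul_le_mul' (ENNReal.ofReal_le_ofReal (numeric_const_le d))
          (Q.ofReal_radius_pow_le hR _)) (derivConst_sq_le Q φ)
    _ = _ := by
        rw [constC0, h1, ENNReal.ofReal_mul (by positivity)]
        ring

variable (Q φ g) in
/-- The norm `‖𝓕(φ_i ĝ_j)‖_{L^1}`. -/
def atomNorm (i j : J) : ℝ≥0∞ := ∫⁻ y, ‖𝓕 (localAtom Q φ g i j) y‖ₑ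

/-- The key estimate for the remainder term. -/
lemma weight_mul_overlap_le (hd : 1 ≤ d) (hR : Q.R < ⊤) (hφ : Q.IsRegularPartitionOfUnity φ)
    (hQo : ∀ i, IsOpen (Q.Q' i)) (hgs : ContDiff ℝ ∞ (𝓕 g)) (hw : ∀ i, 0 < w i) (hδ : 0 < δ)
    (i j m : J) :
    ENNReal.ofReal (w i / w m) * (ENNReal.ofReal |(structuredLattice Q δ j).det|⁻¹ *
      ((overlapSet Q δ i j m).ncard : ℝ≥0∞) * (atomNorm Q φ g m j * atomNorm Q φ g i j)) ≤
    constC0 Q φ * constC' d ^ 4 * ENNReal.ofReal δ ^ 2 * (Ytilde Q w g i j * Ytilde Q w g m j) := by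
  have hD := Q.absDet_pos j
  have hr := Q.one_le_radius
  have hwi := hw i
  have hwj := hw j
  have hwm := hw m
  have hWi : 0 < max (w i / w j) (w j / w i) := lt_max_of_lt_left (by positivity)
  have hWm : 0 < max (w m / w j) (w j / w m) := lt_max_of_lt_left (by positivity)
  have hai := Q.one_le_shift i j
  have ham := Q.one_le_shift m j
  have hyi := Q.one_le_dil j i
  have hym := Q.one_le_dil j m
  have hzi := Q.one_le_dil i j
  have hzm := Q.one_le_dil m j
  have hgi := Q.one_le_gap i j
  have hgm := Q.one_le_gap m j
  set c : ℝ := 4 ^ (d + 1) * (1 + 2 * (d : ℝ)) ^ d with hc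
  have hc0 : 0 < c := by positivity
  have L : ∀ i, atomNorm Q φ g i j ≤ ENNReal.ofReal ((Real.sqrt (Q.absDet j))⁻¹ * Q.dil j i ^ d * c)
      * atomBound Q φ g i j := fun i => lintegral_enorm_fourier_localAtom_le hd hφ hQo hgs i j
  have hnc : ((overlapSet Q δ i j m).ncard : ℝ≥0∞) =
      ENNReal.ofReal ((overlapSet Q δ i j m).ncard : ℝ) := by simp
  -- The bookkeeping of exponents: `y` occurs `d + 1` times from the count, once with the gap, and
  -- `d` times from the `L¹` norm of the atom, in all `2(d + 1)`. This is why `K_{i,j}` contains the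
  -- square of the norm of `A_j⁻¹ A_i`.
  have fac : ∀ a y z γ : ℝ, 1 ≤ a → 1 ≤ y → 1 ≤ z → 1 ≤ γ →
      (a * y) ^ (d + 1) * (y * γ) * y ^ d ≤ (a * z * y ^ 2) ^ (d + 1) * γ ^ (d + 1) := by
    intro a y z γ ha hy hz hγ
    have h1 : γ ≤ γ ^ (d + 1) := le_self_pow₀ hγ (by omega)
    have h2 : 1 ≤ z ^ (d + 1) := one_le_pow₀ hz
    calc (a * y) ^ (d + 1) * (y * γ) * y ^ d = a ^ (d + 1) * 1 * (y ^ 2) ^ (d + 1) * γ := by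
          rw [mul_pow, ← pow_mul]; ring
      _ ≤ a ^ (d + 1) * z ^ (d + 1) * (y ^ 2) ^ (d + 1) * γ ^ (d + 1) := by gcongr
      _ = _ := by rw [mul_pow, mul_pow]
  have hreal : w i / w m * (((δ ^ d * (Q.absDet j)⁻¹)⁻¹ * (overlapSet Q δ i j m).ncard) *
      (((Real.sqrt (Q.absDet j))⁻¹ * Q.dil j m ^ d * c) *
        ((Real.sqrt (Q.absDet j))⁻¹ * Q.dil j i ^ d * c))) ≤
      δ ^ 2 * (16 * 12 ^ d * Q.radius ^ (d + 2) * c ^ 2) *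
      ((max (w i / w j) (w j / w i) *
        ((Q.shift i j * Q.dil i j * Q.dil j i ^ 2) ^ (d + 1) * Q.gap i j ^ (d + 1))) *
      (max (w m / w j) (w j / w m) *
        ((Q.shift m j * Q.dil m j * Q.dil j m ^ 2) ^ (d + 1) * Q.gap m j ^ (d + 1)))) := by
    have hsq : (Real.sqrt (Q.absDet j))⁻¹ * (Real.sqrt (Q.absDet j))⁻¹ = (Q.absDet j)⁻¹ := by
      rw [← mul_inv, Real.mul_self_sqrt hD.le]
    calc _ = w i / w m * (((δ ^ d)⁻¹ * (overlapSet Q δ i j m).ncard) *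
          (Q.dil j m ^ d * Q.dil j i ^ d * c ^ 2)) *
          -- The factor `|det A_j|` from `|det C_j|⁻¹` cancels against the normalisations of the two
          -- atoms.
          (Q.absDet j * ((Real.sqrt (Q.absDet j))⁻¹ * (Real.sqrt (Q.absDet j))⁻¹)) := by
          rw [mul_inv, inv_inv]; ring
      _ = w i / w m * (((δ ^ d)⁻¹ * (overlapSet Q δ i j m).ncard) *
          (Q.dil j m ^ d * Q.dil j i ^ d * c ^ 2)) := by
          rw [hsq, mul_inv_cancel₀ hD.ne', mul_one]
      _ ≤ (max (w i / w j) (w j / w i) * max (w m / w j) (w j / w m)) *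
          ((δ ^ 2 * (16 * 12 ^ d * Q.radius ^ (d + 2)) *
            (((Q.shift i j * Q.dil j i) ^ (d + 1) * (Q.dil j i * Q.gap i j)) *
            ((Q.shift m j * Q.dil j m) ^ (d + 1) * (Q.dil j m * Q.gap m j)))) *
          (Q.dil j m ^ d * Q.dil j i ^ d * c ^ 2)) := by
          refine mul_le_mul (div_le_max_mul_max hw i j m) (mul_le_mul_of_nonneg_right
            (ncard_overlapSet_le hR hδ i j m) (by positivity)) (by positivity) (by positivity)
      _ = δ ^ 2 * (16 * 12 ^ d * Q.radius ^ (d + 2) * c ^ 2) *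
          ((max (w i / w j) (w j / w i) *
            ((Q.shift i j * Q.dil j i) ^ (d + 1) * (Q.dil j i * Q.gap i j) * Q.dil j i ^ d)) *
          (max (w m / w j) (w j / w m) *
            ((Q.shift m j * Q.dil j m) ^ (d + 1) * (Q.dil j m * Q.gap m j) * Q.dil j m ^ d))) := by
          ring
      _ ≤ _ := by
          refine mul_le_mul_of_nonneg_left (mul_le_mul
            (mul_le_mul_of_nonneg_left (fac _ _ _ _ hai hyi hzi hgi) hWi.le)
            (mul_le_mul_of_nonneg_left (fac _ _ _ _ ham hym hzm hgm) hWm.le)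
            (by positivity) (by positivity)) (by positivity)
  rw [abs_det_structuredLattice Q hδ, hnc]
  calc _ ≤ ENNReal.ofReal (w i / w m) * (ENNReal.ofReal (δ ^ d * (Q.absDet j)⁻¹)⁻¹ *
        ENNReal.ofReal ((overlapSet Q δ i j m).ncard : ℝ) *
        ((ENNReal.ofReal ((Real.sqrt (Q.absDet j))⁻¹ * Q.dil j m ^ d * c) * atomBound Q φ g m j) *
        (ENNReal.ofReal ((Real.sqrt (Q.absDet j))⁻¹ * Q.dil j i ^ d * c) *
          atomBound Q φ g i j))) := by
        gcongr
        · exact L m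
        · exact L i
    _ = ENNReal.ofReal (w i / w m * (((δ ^ d * (Q.absDet j)⁻¹)⁻¹ * (overlapSet Q δ i j m).ncard) *
      (((Real.sqrt (Q.absDet j))⁻¹ * Q.dil j m ^ d * c) *
        ((Real.sqrt (Q.absDet j))⁻¹ * Q.dil j i ^ d * c)))) *
        (atomBound Q φ g i j * atomBound Q φ g m j) := by
        rw [ENNReal.ofReal_mul (p := w i / w m) (by positivity),
          ENNReal.ofReal_mul (p := (δ ^ d * (Q.absDet j)⁻¹)⁻¹ * (overlapSet Q δ i j m).ncard)
            (by positivity), ENNReal.ofReal_mul (p := (δ ^ d * (Q.absDet j)⁻¹)⁻¹) (by positivity),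
          ENNReal.ofReal_mul (p := (Real.sqrt (Q.absDet j))⁻¹ * Q.dil j m ^ d * c) (by positivity)]
        ring
    _ ≤ ENNReal.ofReal (δ ^ 2 * (16 * 12 ^ d * Q.radius ^ (d + 2) * c ^ 2) *
      ((max (w i / w j) (w j / w i) *
        ((Q.shift i j * Q.dil i j * Q.dil j i ^ 2) ^ (d + 1) * Q.gap i j ^ (d + 1))) *
      (max (w m / w j) (w j / w m) *
        ((Q.shift m j * Q.dil m j * Q.dil j m ^ 2) ^ (d + 1) * Q.gap m j ^ (d + 1))))) *
        (atomBound Q φ g i j * atomBound Q φ g m j) := by gcongr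
    _ = ENNReal.ofReal (δ ^ 2) * ENNReal.ofReal (16 * 12 ^ d * Q.radius ^ (d + 2) * c ^ 2) *
      ((ENNReal.ofReal (max (w i / w j) (w j / w i) *
        ((Q.shift i j * Q.dil i j * Q.dil j i ^ 2) ^ (d + 1) * Q.gap i j ^ (d + 1))) *
        atomBound Q φ g i j) *
      (ENNReal.ofReal (max (w m / w j) (w j / w m) *
        ((Q.shift m j * Q.dil m j * Q.dil j m ^ 2) ^ (d + 1) * Q.gap m j ^ (d + 1))) *
        atomBound Q φ g m j)) := by
        rw [ENNReal.ofReal_mul (p := δ ^ 2 * _) (by positivity),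
          ENNReal.ofReal_mul (p := δ ^ 2) (by positivity),
          ENNReal.ofReal_mul (p := max (w i / w j) (w j / w i) * _) (by positivity)]
        ring
    _ ≤ ENNReal.ofReal (δ ^ 2) * ENNReal.ofReal (16 * 12 ^ d * Q.radius ^ (d + 2) * c ^ 2) *
      ((ENNReal.ofReal ((2 * d) ^ (d + 1)) * derivConst Q φ * Ytilde Q w g i j) *
        (ENNReal.ofReal ((2 * d) ^ (d + 1)) * derivConst Q φ * Ytilde Q w g m j)) :=
        mul_le_mul_right (mul_le_mul' (ofReal_weight_mul_atomBound_le hQo i j)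
          (ofReal_weight_mul_atomBound_le hQo m j)) _
    _ = (ENNReal.ofReal (16 * 12 ^ d * Q.radius ^ (d + 2) * c ^ 2) *
      (ENNReal.ofReal ((2 * d) ^ (d + 1)) * derivConst Q φ) ^ 2) * ENNReal.ofReal δ ^ 2 *
        (Ytilde Q w g i j * Ytilde Q w g m j) := by
        rw [ENNReal.ofReal_pow hδ.le]; ring
    _ ≤ _ := mul_le_mul_left (mul_le_mul_left (const_le hR) _) _

end Overlaps

/-! ### Sampling continuous functions on lattices -/

section LatticeSampling

variable {d : ℕ}

/-- For a continuous function the essential supremum over a closed cube is a pointwise bound: a null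
open set is empty, and the open cube is dense in the closed one. -/
lemma enorm_le_eLpNorm_unitCube {b : Space d → ℂ} (hb : Continuous b) (n : Fin d → ℤ) {x : Space d}
    (hx : x ∈ unitCube n) : ‖b x‖ₑ ≤ eLpNorm (indicator (unitCube n) b) ⊤ volume := by
  set E := eLpNorm (indicator (unitCube n) b) ⊤ volume with hE
  set U : Set (Space d) := (WithLp.ofLp : Space d → Fin d → ℝ) ⁻¹'
    (Set.pi univ fun i => Ioo (n i : ℝ) (n i + 1)) with hU
  have hUo : IsOpen U := (isOpen_set_pi finite_univ fun i _ => isOpen_Ioo).preimage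
    (PiLp.continuous_ofLp 2 _)
  have hUc : U ⊆ unitCube n := by
    rw [unitCube_eq]
    exact preimage_mono (pi_mono fun i _ => Ioo_subset_Icc_self)
  have hcl : x ∈ closure U := by
    have h1 : closure U = (PiLp.homeomorph 2 (fun _ : Fin d => ℝ)) ⁻¹'
        closure (Set.pi univ fun i => Ioo (n i : ℝ) (n i + 1)) :=
      ((PiLp.homeomorph 2 (fun _ : Fin d => ℝ)).preimage_closure _).symm
    rw [h1, closure_pi_set]
    intro i _
    change x i ∈ closure (Ioo (n i : ℝ) (n i + 1))
    rw [closure_Ioo (by simp)]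
    exact hx i
  have hbE : Continuous fun y => ‖b y‖ₑ := hb.enorm
  have hclosed : IsClosed {y | ‖b y‖ₑ ≤ E} := isClosed_le hbE continuous_const
  suffices h : U ⊆ {y | ‖b y‖ₑ ≤ E} from hclosed.closure_subset_iff.2 h hcl
  have h0 : volume (U ∩ {y | ‖b y‖ₑ ≤ E}ᶜ) = 0 := by
    have h2 : ∀ᵐ y, ‖indicator (unitCube n) b y‖ₑ ≤ E := by
      rw [hE, eLpNorm_exponent_top]
      exact enorm_ae_le_eLpNormEssSup _ _
    refine measure_mono_null ?_ h2
    rintro y ⟨hy, hy'⟩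
    simpa [hUc hy] using hy'
  have h3 := (hUo.inter hclosed.isOpen_compl).measure_eq_zero_iff volume |>.1 h0
  intro y hy
  by_contra hy'
  exact (h3 ▸ (⟨hy, hy'⟩ : y ∈ U ∩ {y | ‖b y‖ₑ ≤ E}ᶜ) : y ∈ (∅ : Set (Space d)))

/-- Sampling a continuous function on a translated lattice. -/
lemma tsum_enorm_le_amalgamNorm {b : Space d → ℂ} (hb : Continuous b) (z : Space d) :
    ∑' k : Fin d → ℤ, ‖b (intVec k - z)‖ₑ ≤ amalgamNorm b := by
  -- The point `k - z` lies in the cube of `k + ⌊-z⌋`, so different `k` are charged to different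
  -- cubes.
  rw [amalgamNorm_eq, ← (Equiv.addRight fun i => ⌊-z i⌋).tsum_eq
    fun n => eLpNorm (indicator (unitCube n) b) ⊤ volume]
  refine ENNReal.tsum_le_tsum fun k => enorm_le_eLpNorm_unitCube hb _ ?_
  have h := mem_unitCube_floor (intVec k - z)
  convert h using 1
  congr 1
  funext i
  simp [intVec, sub_eq_add_neg]

lemma amalgamNorm_fourier_lt_top (hd : 1 ≤ d) {h : Space d → ℂ} (hh : ContDiff ℝ ∞ h)
    (hc : HasCompactSupport h) : amalgamNorm (𝓕 h) < ⊤ := by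
  have hi : ∀ {f : Space d → ℂ}, ContDiff ℝ ∞ f → HasCompactSupport f → ∫⁻ ξ, ‖f ξ‖ₑ < ⊤ :=
    fun hf hc => (hf.continuous.integrable_of_hasCompactSupport hc).2
  -- The sum dominates every norm required by the decay lemma at scale one.
  set N : ℝ≥0∞ := (∫⁻ ξ, ‖h ξ‖ₑ) + ∑ l, ∫⁻ ξ, ‖(pderiv l)^[d + 1] h ξ‖ₑ with hN
  have hNt : N < ⊤ := ENNReal.add_lt_top.2 ⟨hi hh hc, ENNReal.sum_lt_top.2 fun l _ =>
    hi (contDiff_pderiv_iterate hh l _) (hasCompactSupport_pderiv_iterate hc l _)⟩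
  have h1 := amalgamNorm_le_of_decay hd (f := 𝓕 h) (B := ENNReal.ofReal (2 ^ (d + 1)) * N)
    fun x l => by
      have := enorm_fourier_decay hh hc le_rfl (N := N) le_self_add (fun l => by
        rw [one_pow, ENNReal.ofReal_one, one_mul]
        exact (Finset.single_le_sum (f := fun l => ∫⁻ ξ, ‖(pderiv l)^[d + 1] h ξ‖ₑ)
          (fun _ _ => zero_le) (Finset.mem_univ l)).trans le_add_self) x l
      simpa using this
  refine h1.trans_lt (ENNReal.mul_lt_top ENNReal.ofReal_lt_top
    (ENNReal.mul_lt_top ENNReal.ofReal_lt_top hNt))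

lemma summable_norm_of_tsum_enorm_lt_top {ι : Type*} {f : ι → ℂ} (h : ∑' i, ‖f i‖ₑ < ⊤) :
    Summable fun i => ‖f i‖ := by
  have := ENNReal.summable_toReal h.ne
  simpa using this

end LatticeSampling

/-! ### The Poisson summation formula -/

section Poisson

variable {d : ℕ}

lemma finite_translates_meet {K K' : Set (Space d)} (hK : Bornology.IsBounded K)
    (hK' : Bornology.IsBounded K') :
    {n : Fin d → ℤ | ∃ x ∈ K, x + intVec n ∈ K'}.Finite := by
  obtain ⟨r, hr⟩ := hK.exists_norm_le
  obtain ⟨r', hr'⟩ := hK'.exists_norm_le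
  refine (finite_intVec_le (max 1 (r + r')) (le_max_left 1 (r + r'))).1.subset ?_
  rintro n ⟨x, hx, hx'⟩
  rw [mem_ofPred_eq]
  refine le_trans ?_ (le_max_right 1 (r + r'))
  have h1 : (intVec n : Space d) = (x + intVec n) - x := by abel
  rw [h1]
  refine (norm_sub_le _ _).trans ?_
  linarith [hr x hx, hr' _ hx']

/-- The periodization of a function. -/
def periodize (h : Space d → ℂ) (x : Space d) : ℂ := ∑' n : Fin d → ℤ, h (x + intVec n)

/-- Over a bounded set the periodization is a finite sum with an index set independent of the point,
which settles both continuity and the interchange with integration. -/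
lemma exists_periodize_eq_sum {h : Space d → ℂ} (hc : HasCompactSupport h) {K : Set (Space d)}
    (hK : Bornology.IsBounded K) : ∃ s : Finset (Fin d → ℤ), ∀ x ∈ K, 
      (∀ n ∉ s, h (x + intVec n) = 0) ∧ periodize h x = ∑ n ∈ s, h (x + intVec n) := by
  have hf := finite_translates_meet hK hc.isCompact.isBounded
  have h1 : ∀ x ∈ K, ∀ n ∉ hf.toFinset, h (x + intVec n) = 0 := by
    intro x hx n hn
    by_contra h0
    exact hn (hf.mem_toFinset.2 ⟨x, hx, subset_tsupport _ h0⟩)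
  exact ⟨hf.toFinset, fun x hx => ⟨h1 x hx, tsum_eq_sum (h1 x hx)⟩⟩

lemma continuous_periodize {h : Space d → ℂ} (hh : Continuous h) (hc : HasCompactSupport h) :
    Continuous (periodize h) := by
  rw [continuous_iff_continuousAt]
  intro x
  obtain ⟨s, hs⟩ := exists_periodize_eq_sum hc (Metric.isBounded_ball (x := x) (r := 1))
  have h1 : periodize h =ᶠ[𝓝 x] fun y => ∑ n ∈ s, h (y + intVec n) := by
    filter_upwards [Metric.ball_mem_nhds x one_pos] with y hy using (hs y hy).2
  refine ContinuousAt.congr ?_ h1.symm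
  exact (continuous_finsetSum _ fun n _ => hh.comp (continuous_id.add continuous_const)).continuousAt

lemma intVec_add (m n : Fin d → ℤ) : (intVec (m + n) : Space d) = intVec m + intVec n := by
  ext i; simp [intVec]

lemma intVec_neg (n : Fin d → ℤ) : (intVec (-n) : Space d) = -intVec n := by
  ext i; simp [intVec]

lemma periodize_add_intVec (h : Space d → ℂ) (x : Space d) (m : Fin d → ℤ) :
    periodize h (x + intVec m) = periodize h x := by
  unfold periodize
  rw [← (Equiv.addLeft m).tsum_eq fun n => h (x + intVec n)]
  refine tsum_congr fun n => ?_
  simp only [Equiv.coe_addLeft, intVec_add]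
  rw [add_assoc]

/-- The projection of `ℝ^d` onto the torus. -/
def torusMk (x : Fin d → ℝ) : UnitAddTorus (Fin d) := fun i => (x i : UnitAddCircle)

lemma isOpenQuotientMap_torusMk : IsOpenQuotientMap (torusMk (d := d)) :=
  IsOpenQuotientMap.piMap fun _ : Fin d =>
    (QuotientAddGroup.isOpenQuotientMap_mk : IsOpenQuotientMap (QuotientAddGroup.mk (s := AddSubgroup.zmultiples (1 : ℝ))))

/-- The periodization as a continuous function on the torus. -/
lemma exists_torus_periodize {h : Space d → ℂ} (hh : Continuous h) (hc : HasCompactSupport h) :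
    ∃ F : C(UnitAddTorus (Fin d), ℂ), ∀ x : Fin d → ℝ,
      F (torusMk x) = periodize h (WithLp.toLp 2 x) := by
  have hq := (isOpenQuotientMap_torusMk (d := d)).isQuotientMap
  let P : C(Fin d → ℝ, ℂ) := ⟨fun x => periodize h (WithLp.toLp 2 x),
    (continuous_periodize hh hc).comp (PiLp.continuous_toLp 2 _)⟩
  have hP : Function.FactorsThrough P (torusMk (d := d)) := by
    intro x y hxy
    have h1 : ∀ i, ∃ n : ℤ, y i - x i = n := by
      intro i
      have h2 : ((x i : ℝ) : UnitAddCircle) = (y i : ℝ) := congrFun hxy i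
      rw [QuotientAddGroup.eq] at h2
      obtain ⟨n, hn⟩ := AddSubgroup.mem_zmultiples_iff.1 h2
      exact ⟨n, by simpa [sub_eq_neg_add] using hn.symm⟩
    choose n hn using h1
    have h3 : (WithLp.toLp 2 y : Space d) = WithLp.toLp 2 x + intVec n := by
      ext i
      simp [intVec, ← hn]
    change periodize h _ = periodize h _
    rw [h3, periodize_add_intVec]
  have hq' : Topology.IsQuotientMap (⟨torusMk, hq.continuous⟩ :
    C(Fin d → ℝ, UnitAddTorus (Fin d))) := hq
  exact ⟨hq'.lift P hP, fun x => congrArg (fun f : C(Fin d → ℝ, ℂ) => f x) (hq'.lift_comp P hP)⟩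

lemma mFourier_torusMk (k : Fin d → ℤ) (x : Fin d → ℝ) :
    UnitAddTorus.mFourier k (torusMk x) = character (intVec k) (WithLp.toLp 2 x) := by
  simp only [UnitAddTorus.mFourier, ContinuousMap.coe_mk, torusMk, fourier_coe_apply, character]
  rw [← Complex.exp_sum]
  congr 1
  rw [PiLp.inner_apply]
  push_cast
  rw [Finset.mul_sum]
  refine Finset.sum_congr rfl fun i _ => ?_
  simp [intVec]
  ring

/-- Unfolding: the integral of the periodization over one period is the integral of `h` over the
whole space. -/
lemma mFourierCoeff_torus_periodize {h : Space d → ℂ} (hh : Continuous h)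
    (hc : HasCompactSupport h) {F : C(UnitAddTorus (Fin d), ℂ)}
    (hF : ∀ x : Fin d → ℝ, F (torusMk x) = periodize h (WithLp.toLp 2 x)) (k : Fin d → ℤ) :
    UnitAddTorus.mFourierCoeff F k = 𝓕 h (intVec k) := by
  -- Half-open cubes tile the space exactly, and `T 0` is the fundamental domain in the integral
  -- formula for the coefficients.
  set T : (Fin d → ℤ) → Set (Fin d → ℝ) := fun n => {x | ∀ i, x i ∈ Ioc (n i : ℝ) (n i + 1)} with hT
  have hTm : ∀ n, MeasurableSet (T n) := fun n => MeasurableSet.univ_pi' fun i => measurableSet_Ioc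
  have hTu : ⋃ n, T n = univ := by
    refine eq_univ_of_forall fun x => mem_iUnion.2 ⟨fun i => ⌈x i⌉ - 1, fun i => ?_⟩
    have := Int.ceil_lt_add_one (x i)
    have := Int.le_ceil (x i)
    constructor <;> push_cast <;> linarith
  have hTd : Pairwise (Function.onFun Disjoint T) := by
    intro m n hmn
    refine Set.disjoint_left.2 fun x hx hx' => hmn (funext fun i => ?_)
    have h1 := hx i
    have h2 := hx' i
    have h3 : (m i : ℝ) < n i + 1 := h1.1.trans_le h2.2
    have h4 : (n i : ℝ) < m i + 1 := h2.1.trans_le h1.2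
    have h5 : m i < n i + 1 := by exact_mod_cast h3
    have h6 : n i < m i + 1 := by exact_mod_cast h4
    omega
  set G : (Fin d → ℝ) → ℂ := fun x => h (WithLp.toLp 2 x) * character (-intVec k) (WithLp.toLp 2 x)
    with hG
  have hGi : Integrable G := by
    have h1 : Integrable fun x : Space d => h x * character (-intVec k) x :=
      (hh.mul (continuous_character _)).integrable_of_hasCompactSupport hc.mul_right
    exact (PiLp.volume_preserving_toLp (Fin d)).integrable_comp_of_integrable h1
  have h𝓕 : 𝓕 h (intVec k) = ∫ x, G x := by
    rw [fourier_eq_integral_character, ← (PiLp.volume_preserving_toLp (Fin d)).integral_comp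
      (MeasurableEquiv.toLp 2 _).measurableEmbedding]
  have hsum := hasSum_integral_iUnion hTm hTd (f := G) (μ := volume) (by
    rw [hTu]; exact hGi.integrableOn)
  rw [hTu, setIntegral_univ, ← h𝓕] at hsum
  have htr : ∀ n, ∫ x in T n, G x = ∫ x in T 0, h (WithLp.toLp 2 x + intVec n) *
      character (-intVec k) (WithLp.toLp 2 x) := by
    intro n
    have h1 := (measurePreserving_add_right (volume : Measure (Fin d → ℝ))
      (fun i => (n i : ℝ))).setIntegral_preimage_emb
      (MeasurableEquiv.addRight (fun i => (n i : ℝ))).measurableEmbedding G (T n)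
    rw [← h1]
    have h2 : (fun x : Fin d → ℝ => x + fun i => (n i : ℝ)) ⁻¹' T n = T 0 := by
      ext x
      simp only [hT, mem_preimage, mem_ofPred_eq, Pi.add_apply, mem_Ioc, Pi.zero_apply]
      refine forall_congr' fun i => ?_
      constructor <;> rintro ⟨ha, hb⟩ <;> constructor <;> push_cast at * <;> linarith
    rw [h2]
    refine setIntegral_congr_fun (hTm 0) fun x _ => ?_
    have h3 : (WithLp.toLp 2 (x + fun i => (n i : ℝ)) : Space d) = WithLp.toLp 2 x + intVec n := by
      ext i; simp [intVec]
    -- Integer vectors pair to integers, so the character does not see the translation.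
    have h4 : character (-intVec k) (intVec n : Space d) = 1 := by
      rw [character, PiLp.inner_apply]
      have : (∑ i, inner ℝ ((-intVec k : Space d) i) ((intVec n : Space d) i)) =
          ((-∑ i, k i * n i : ℤ) : ℝ) := by
        push_cast
        rw [← Finset.sum_neg_distrib]
        refine Finset.sum_congr rfl fun i _ => ?_
        simp [intVec]; ring
      rw [this]
      have := Complex.exp_int_mul_two_pi_mul_I (-∑ i, k i * n i : ℤ)
      rw [← this]
      congr 1
      push_cast
      ring
    simp only [hG, h3, character_add_right, h4, mul_one]
  have hbd : Bornology.IsBounded ((WithLp.toLp 2 : (Fin d → ℝ) → Space d) '' T 0) := by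
    have h1 : IsCompact ((WithLp.toLp 2 : (Fin d → ℝ) → Space d) ''
        (Set.pi univ fun _ => Icc (0 : ℝ) 1)) :=
      (isCompact_univ_pi fun _ => isCompact_Icc).image (PiLp.continuous_toLp 2 _)
    refine h1.isBounded.subset (image_mono fun x hx i _ => ?_)
    have := hx i
    simp only [Pi.zero_apply, Int.cast_zero, zero_add] at this
    exact Ioc_subset_Icc_self this
  obtain ⟨s, hs⟩ := exists_periodize_eq_sum hc hbd
  have hL : UnitAddTorus.mFourierCoeff F k = ∑ n ∈ s, ∫ x in T n, G x := by
    rw [UnitAddTorus.mFourierCoeff_eq_integral _ _ 0]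
    simp_rw [htr]
    rw [← integral_finsetSum]
    · have h0 : {x : Fin d → ℝ | ∀ i, x i ∈ Ioc ((0 : Fin d → ℝ) i) ((0 : Fin d → ℝ) i + 1)} = T 0 := by
        simp [hT]
      rw [h0]
      refine setIntegral_congr_fun (hTm 0) fun x hx => ?_
      have h1 := hF x
      have h2 := mFourier_torusMk (-k) x
      unfold torusMk at h1 h2
      simp only [smul_eq_mul, h1, h2, (hs _ (mem_image_of_mem _ hx)).2, intVec_neg]
      rw [mul_comm, Finset.sum_mul]
    · intro n _
      have h1 : Integrable fun x : Space d => h (x + intVec n) * character (-intVec k) x := by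
        refine ((hh.comp (continuous_id.add continuous_const)).mul
          (continuous_character _)).integrable_of_hasCompactSupport ?_
        exact (hc.comp_homeomorph (Homeomorph.addRight (intVec n))).mul_right
      exact ((PiLp.volume_preserving_toLp (Fin d)).integrable_comp_of_integrable h1).integrableOn
  rw [hL]
  have h0 : ∀ n ∉ s, ∫ x in T n, G x = 0 := by
    intro n hn
    rw [htr]
    rw [setIntegral_congr_fun (g := fun _ => (0 : ℂ)) (hTm 0)]
    · simp
    · intro x hx
      simp [(hs _ (mem_image_of_mem _ hx)).1 n hn]
  exact (hasSum_sum_of_ne_finset_zero h0).unique hsum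

/-- The Poisson summation formula for the integer lattice. -/
lemma hasSum_fourier_intVec (hd : 1 ≤ d) {h : Space d → ℂ} (hh : ContDiff ℝ ∞ h)
    (hc : HasCompactSupport h) (ξ : Space d) :
    HasSum (fun k : Fin d → ℤ => 𝓕 h (intVec k) * character (intVec k) ξ) (periodize h ξ) := by
  obtain ⟨F, hF⟩ := exists_torus_periodize hh.continuous hc
  have hco := mFourierCoeff_torus_periodize hh.continuous hc hF
  -- The coefficients are samples of `𝓕 h` on the lattice, so the amalgam norm bounds their sum and
  -- the Fourier series converges pointwise.
  have hs : Summable (UnitAddTorus.mFourierCoeff F) := by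
    refine Summable.of_norm (summable_norm_of_tsum_enorm_lt_top ?_)
    simp_rw [hco]
    have := tsum_enorm_le_amalgamNorm (continuous_fourier
      (hh.continuous.integrable_of_hasCompactSupport hc)) (0 : Space d)
    simp only [sub_zero] at this
    exact this.trans_lt (amalgamNorm_fourier_lt_top hd hh hc)
  have h1 := UnitAddTorus.hasSum_mFourier_series_apply_of_summable hs (torusMk ξ.ofLp)
  simp only [hco, mFourier_torusMk, hF, smul_eq_mul] at h1
  exact h1

/-- The Poisson summation formula for a lattice `C ℤ^d`, with dual lattice `D ℤ^d`, `D = C^{-t}`. -/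
lemma hasSum_fourier_lattice (hd : 1 ≤ d) {κ : Space d → ℂ} (hκ : ContDiff ℝ ∞ κ)
    (hc : HasCompactSupport κ) {D D' : Space d →L[ℝ] Space d} (h : ∀ x, D' (D x) = x)
    (h' : ∀ x, D (D' x) = x) (ξ : Space d) :
    HasSum (fun k : Fin d → ℤ => 𝓕 κ (ContinuousLinearMap.adjoint D' (intVec k)) *
      character (ContinuousLinearMap.adjoint D' (intVec k)) ξ)
      ((|D.det| : ℝ) * ∑' n : Fin d → ℤ, κ (ξ - D (intVec n))) := by
  have hdet : (|D.det| : ℝ) ≠ 0 := abs_ne_zero.2 (det_ne_zero_of_leftInverse h)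
  let e : Space d ≃L[ℝ] Space d := ContinuousLinearEquiv.equivOfInverse D D' h h'
  have h1 := hasSum_fourier_intVec hd (h := fun x => κ (D x)) (hκ.comp D.contDiff)
    (hc.comp_homeomorph e.toHomeomorph) (D' ξ)
  have h2 : periodize (fun x => κ (D x)) (D' ξ) = ∑' n : Fin d → ℤ, κ (ξ - D (intVec n)) := by
    unfold periodize
    -- The reflection `n ↦ -n` puts the dual translates in the form `ξ - D n` in which the overlaps
    -- are counted.
    rw [← (Equiv.neg (Fin d → ℤ)).tsum_eq]
    refine tsum_congr fun n => ?_
    simp [intVec_neg, h', sub_eq_add_neg]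
  rw [h2] at h1
  refine (h1.mul_left ((|D.det| : ℝ) : ℂ)).congr_fun fun k => ?_
  rw [fourier_comp_linear h, ← mul_assoc, ← mul_assoc, ← Complex.ofReal_mul, mul_inv_cancel₀ hdet,
    Complex.ofReal_one, one_mul]
  congr 1
  rw [character, character, ContinuousLinearMap.adjoint_inner_left]

end Poisson

/-! ### Admissible covers, clusters and the clustering norm -/

section Covers

variable {d : ℕ} {J : Type*} {Q : AffineFamily d J} {O : Opens (Space d)} {φ : J → 𝓓(O, ℂ)}

namespace AffineFamily

lemma IsAdmissibleCover.finite_cluster (hQ : Q.IsAdmissibleCover O) (i : J) :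
    (Q.cluster i).Finite :=
  Set.encard_lt_top_iff.1 ((le_iSup (fun i => (Q.cluster i).encard) i).trans_lt hQ.finite_overlap)

/-- The cluster `i^*` as a finite set. -/
def IsAdmissibleCover.clusterFinset (hQ : Q.IsAdmissibleCover O) (i : J) : Finset J :=
  (hQ.finite_cluster i).toFinset

@[simp] lemma IsAdmissibleCover.mem_clusterFinset (hQ : Q.IsAdmissibleCover O) {i l : J} :
    l ∈ hQ.clusterFinset i ↔ l ∈ Q.cluster i := (hQ.finite_cluster i).mem_toFinset

lemma IsAdmissibleCover.exists_card_le (hQ : Q.IsAdmissibleCover O) :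
    ∃ N : ℕ, ∀ i, (hQ.clusterFinset i).card ≤ N := by
  obtain ⟨N, hN⟩ := ENat.ne_top_iff_exists.1 hQ.finite_overlap.ne
  refine ⟨N, fun i => ?_⟩
  have h1 : (Q.cluster i).encard ≤ N := by
    rw [hN]; exact le_iSup (fun i => (Q.cluster i).encard) i
  rw [(hQ.finite_cluster i).encard_eq_coe_toFinset_card] at h1
  exact_mod_cast h1

lemma mem_cluster_comm {i l : J} : l ∈ Q.cluster i ↔ i ∈ Q.cluster l := by
  simp only [cluster, mem_ofPred_eq, inter_comm]

lemma isOpen_set (hQo : ∀ i, IsOpen (Q.Q' i)) (i : J) : IsOpen (Q.set i) := by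
  have : Q.set i = Q.Sinv i ⁻¹' Q.Q' i := by
    ext ξ; rw [Q.mem_set_iff]; rfl
  rw [this]
  exact (hQo i).preimage (Q.contDiff_Sinv i).continuous

/-- Finitely many sets of the cover contain `K`; any other set meeting `K` belongs to the cluster of
one of them. -/
lemma IsAdmissibleCover.finite_meet (hQ : Q.IsAdmissibleCover O) (hQo : ∀ i, IsOpen (Q.Q' i))
    {K : Set (Space d)} (hK : IsCompact K) (hKO : K ⊆ O) :
    {i | (Q.set i ∩ K).Nonempty}.Finite := by
  obtain ⟨t, ht⟩ := hK.elim_finite_subcover Q.set (isOpen_set hQo) (hKO.trans hQ.cover.subset)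
  refine (t.finite_toSet.biUnion fun l _ => hQ.finite_cluster l).subset ?_
  rintro i ⟨ξ, hξi, hξK⟩
  obtain ⟨l, hl, hξl⟩ := mem_iUnion₂.1 (ht hξK)
  exact mem_iUnion₂.2 ⟨l, hl, ξ, hξi, hξl⟩

lemma IsAdmissibleCover.set_subset (hQ : Q.IsAdmissibleCover O) (i : J) : Q.set i ⊆ O := by
  rw [hQ.cover]; exact subset_iUnion _ i

lemma IsRegularPartitionOfUnity.sum_eq_one (hφ : Q.IsRegularPartitionOfUnity φ) {s : Finset J}
    {ξ : Space d} (hξ : ξ ∈ O) (hs : ∀ l, ξ ∈ Q.set l → l ∈ s) : ∑ l ∈ s, φ l ξ = 1 :=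
  (hasSum_sum_of_ne_finset_zero fun l hl =>
    hφ.eq_zero_of_notMem l fun h => hl (hs l h)).unique (hφ.hasSum_one ξ hξ)

lemma IsRegularPartitionOfUnity.sum_cluster_eq_one (hφ : Q.IsRegularPartitionOfUnity φ)
    (hQ : Q.IsAdmissibleCover O) (i : J) {ξ : Space d} (hξ : ξ ∈ Q.set i) :
    ∑ l ∈ hQ.clusterFinset i, φ l ξ = 1 :=
  hφ.sum_eq_one (hQ.set_subset i hξ) fun _ hl => hQ.mem_clusterFinset.2 ⟨ξ, hl, hξ⟩

lemma IsAdmissibleCover.clusterSum_eq (hQ : Q.IsAdmissibleCover O) (φ : J → 𝓓(O, ℂ)) (i : J)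
    (ξ : Space d) : Q.clusterSum φ i ξ = ∑ l ∈ hQ.clusterFinset i, φ l ξ :=
  finsum_mem_eq_finite_toFinset_sum _ _

lemma IsAdmissibleCover.clustering_eq (hQ : Q.IsAdmissibleCover O) (c : J → ℂ) (i : J) :
    Q.clustering c i = ∑ l ∈ hQ.clusterFinset i, c l :=
  finsum_mem_eq_finite_toFinset_sum _ _

end AffineFamily

/-- The functions `∑_{ℓ ∈ m^*} 𝓕⁻¹(φ_ℓ T)`. -/
def clusterPiece (hQ : Q.IsAdmissibleCover O) (φ : J → 𝓓(O, ℂ)) (T : 𝓓(O, ℂ) →L[ℂ] ℂ) (m : J)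
    (x : Space d) : ℂ := ∑ l ∈ hQ.clusterFinset m, localPiece (φ l) T x

lemma continuous_clusterPiece (hQ : Q.IsAdmissibleCover O) (T : 𝓓(O, ℂ) →L[ℂ] ℂ) (m : J) :
    Continuous (clusterPiece hQ φ T m) :=
  continuous_finsetSum _ fun l _ => continuous_localPiece (φ l) T

lemma eLpNorm_clusterPiece_le (hQ : Q.IsAdmissibleCover O) (T : 𝓓(O, ℂ) →L[ℂ] ℂ) {p : ℝ≥0∞}
    (hp : 1 ≤ p) (m : J) : eLpNorm (clusterPiece hQ φ T m) p volume ≤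
      ∑ l ∈ hQ.clusterFinset m, eLpNorm (localPiece (φ l) T) p volume := by
  have h : clusterPiece hQ φ T m = ∑ l ∈ hQ.clusterFinset m, localPiece (φ l) T := by
    funext x; simp [clusterPiece]
  rw [h]
  exact eLpNorm_sum_le (fun l _ => (continuous_localPiece (φ l) T).aestronglyMeasurable) hp

/-- The Fourier transform of a test function belongs to all `L^q`. -/
lemma eLpNorm_fourier_lt_top {h : Space d → ℂ} (hh : ContDiff ℝ ∞ h) (hc : HasCompactSupport h)
    {q : ℝ≥0∞} (hq : 1 ≤ q) : eLpNorm (𝓕 h) q volume < ⊤ := by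
  obtain ⟨B, hB0, hB⟩ := exists_norm_fourier_le (d := d) ⟨tsupport h, hc⟩ (d + 1)
  have h1 := hB (ContDiffMapSupportedIn.of_support_subset hh subset_closure)
  set P := ((Finset.range (d + 1 + 1)).sup fun i =>
    ContDiffMapSupportedIn.seminorm ℂ (Space d) ℂ ⊤ ⟨tsupport h, hc⟩ i)
    (ContDiffMapSupportedIn.of_support_subset hh subset_closure)
  have hP0 : 0 ≤ P := apply_nonneg _ _
  have h2 : eLpNorm (𝓕 h) q volume ≤
      eLpNorm ((B * P) • fun x : Space d => ((1 + ‖x‖) ^ (d + 1))⁻¹) q volume := by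
    refine eLpNorm_mono fun x => ?_
    rw [Pi.smul_apply, smul_eq_mul, Real.norm_of_nonneg (by positivity), ← div_eq_mul_inv,
      le_div_iff₀ (by positivity), mul_comm]
    exact h1 x
  refine h2.trans_lt ?_
  rw [eLpNorm_const_smul]
  exact ENNReal.mul_lt_top enorm_lt_top (eLpNorm_one_add_norm_lt_top hq)

lemma integrable_mul_fourier {u h : Space d → ℂ} (hu : Continuous u) {p : ℝ≥0∞} (hp : 1 ≤ p)
    (hup : eLpNorm u p volume < ⊤) (hh : ContDiff ℝ ∞ h) (hc : HasCompactSupport h) :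
    Integrable fun x => u x * 𝓕 h x := by
  have hc' := continuous_fourier (hh.continuous.integrable_of_hasCompactSupport (μ := volume) hc)
  refine ⟨(hu.mul hc').aestronglyMeasurable, ?_⟩
  have := ENNReal.HolderConjugate.conjExponent hp
  have h1 := lintegral_mul_le_eLpNorm volume hu.enorm.measurable.aemeasurable
    hc'.enorm.measurable.aemeasurable p (ENNReal.conjExponent p)
  rw [hasFiniteIntegral_iff_enorm]
  simp only [enorm_mul]
  refine h1.trans_lt ?_
  rw [eLpNorm_enorm, eLpNorm_enorm]
  exact ENNReal.mul_lt_top hup (eLpNorm_fourier_lt_top hh hc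
    (ENNReal.HolderConjugate.one_le _ p))

/-- A distribution is determined on `Q_m` by the local pieces which belong to the cluster of `m`. -/
lemma apply_eq_integral_clusterPiece (hQ : Q.IsAdmissibleCover O)
    (hφ : Q.IsRegularPartitionOfUnity φ) (T : 𝓓(O, ℂ) →L[ℂ] ℂ) {p : ℝ≥0∞} (hp : 1 ≤ p)
    (hT : ∀ l, eLpNorm (localPiece (φ l) T) p volume < ⊤) (m : J) (η : 𝓓(O, ℂ))
    (hη : ∀ ξ ∉ Q.set m, η ξ = 0) :
    T η = ∫ x, clusterPiece hQ φ T m x * 𝓕 (η : Space d → ℂ) x := by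
  -- The partition functions of the cluster of `m` sum to one on `Q_m`, where `η` lives.
  have h1 : η = ∑ l ∈ hQ.clusterFinset m, mulSmooth (φ l) η η.contDiff := by
    ext ξ
    have h2 : (∑ l ∈ hQ.clusterFinset m, mulSmooth (φ l) η η.contDiff) ξ =
        (∑ l ∈ hQ.clusterFinset m, φ l ξ) * η ξ := by
      rw [sum_apply, Finset.sum_mul]
      rfl
    rw [h2]
    by_cases hξ : ξ ∈ Q.set m
    · rw [hφ.sum_cluster_eq_one hQ m hξ, one_mul]
    · rw [hη ξ hξ, mul_zero]
  have h3 : T η = ∑ l ∈ hQ.clusterFinset m, T (mulSmooth (φ l) η η.contDiff) := by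
    conv_lhs => rw [h1]
    rw [map_sum]
  rw [h3]
  simp only [clusterPiece, Finset.sum_mul]
  rw [integral_finsetSum]
  · exact Finset.sum_congr rfl fun l _ => apply_mulSmooth_eq_integral (φ l) T η.contDiff
      η.hasCompactSupport
  · exact fun l _ => integrable_mul_fourier (continuous_localPiece _ _) hp (hT l) η.contDiff
      η.hasCompactSupport

variable {w : J → ℝ}

/-- The clustering map on families of extended nonnegative numbers. -/
lemma lqNorm_cluster_le (hQ : Q.IsAdmissibleCover O) (hw : ∀ i, 0 < w i) {q : ℝ≥0∞} (hq : 1 ≤ q)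
    {a : J → ℝ≥0∞} (ha : lqNorm w q a < ⊤) :
    lqNorm w q (fun i => ∑ l ∈ hQ.clusterFinset i, a l) ≤ Q.clusteringNorm w q * lqNorm w q a := by
  have hq0 : q ≠ 0 := (zero_lt_one.trans_le hq).ne'
  set N := lqNorm w q a with hN
  have hle : ∀ i, ENNReal.ofReal (w i) * a i ≤ N := le_lqNorm w hq0 a
  have hat : ∀ i, a i ≠ ⊤ := fun i h => by
    have := hle i
    rw [h, ENNReal.mul_top (ENNReal.ofReal_pos.2 (hw i)).ne'] at this
    exact ha.ne (top_le_iff.1 this)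
  rcases eq_or_ne N 0 with h0 | h0
  · have h1 : ∀ i, a i = 0 := fun i => by
      have := hle i
      rw [h0, nonpos_iff_eq_zero, mul_eq_zero] at this
      exact this.resolve_left (ENNReal.ofReal_pos.2 (hw i)).ne'
    have h2 : (fun i => ∑ l ∈ hQ.clusterFinset i, a l) = fun i => 0 * a i := by
      funext i; simp [h1]
    rw [h2, lqNorm_const_mul w hq0, zero_mul]
    exact zero_le
  -- The clustering norm is a supremum over complex sequences of norm at most one, so `a` is
  -- normalised; the matrix of `Γ_Q` is non-negative, hence nothing is lost.
  · set c : J → ℂ := fun i => ((N⁻¹ * a i).toReal : ℂ) with hc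
    have hct : ∀ i, N⁻¹ * a i ≠ ⊤ := fun i => ENNReal.mul_ne_top (ENNReal.inv_ne_top.2 h0) (hat i)
    have hce : ∀ i, ‖c i‖ₑ = N⁻¹ * a i := fun i => by
      rw [hc, ← ofReal_norm, Complex.norm_real, Real.norm_of_nonneg ENNReal.toReal_nonneg,
        ENNReal.ofReal_toReal (hct i)]
    have h1 : lqNorm w q (fun j => ‖c j‖ₑ) ≤ 1 := by
      simp_rw [hce]
      rw [lqNorm_const_mul w hq0, ← hN, ENNReal.inv_mul_cancel h0 ha.ne]
    have h2 : ∀ i, ‖Q.clustering c i‖ₑ = N⁻¹ * ∑ l ∈ hQ.clusterFinset i, a l := fun i => by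
      rw [hQ.clustering_eq, hc, ← Complex.ofReal_sum, ← ENNReal.toReal_sum fun l _ => hct l,
        ← ofReal_norm, Complex.norm_real, Real.norm_of_nonneg ENNReal.toReal_nonneg,
        ENNReal.ofReal_toReal (ENNReal.sum_ne_top.2 fun l _ => hct l), Finset.mul_sum]
    have h3 : lqNorm w q (fun j => ‖Q.clustering c j‖ₑ) ≤ Q.clusteringNorm w q :=
      le_iSup₂ (f := fun (c : J → ℂ) (_ : lqNorm w q (fun j => ‖c j‖ₑ) ≤ 1) =>
        lqNorm w q (fun j => ‖Q.clustering c j‖ₑ)) c h1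
    simp_rw [h2] at h3
    rw [lqNorm_const_mul w hq0] at h3
    calc _ = N * (N⁻¹ * lqNorm w q (fun i => ∑ l ∈ hQ.clusterFinset i, a l)) := by
          rw [← mul_assoc, ENNReal.mul_inv_cancel h0 ha.ne, one_mul]
      _ ≤ N * Q.clusteringNorm w q := by gcongr
      _ = _ := mul_comm _ _

/-- The zero-one matrix of `Γ_Q` is symmetric, with boundedly many ones in each row and weight
ratios bounded on clusters, so Schur's test applies. -/
lemma clusteringNorm_lt_top [Countable J] (hQ : Q.IsAdmissibleCover O) (hw : Q.IsModerate w) {q : ℝ≥0∞}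
    (hq : 1 ≤ q) : Q.clusteringNorm w q < ⊤ := by
  obtain ⟨hw0, C, hC⟩ := hw
  obtain ⟨N, hN⟩ := hQ.exists_card_le
  classical
  have h1 : ∀ i m, ENNReal.ofReal (w i / w m) * (if m ∈ hQ.clusterFinset i then 1 else 0) ≤
      if m ∈ hQ.clusterFinset i then ENNReal.ofReal C else 0 := fun i m => by
    split_ifs with h
    · rw [mul_one]
      exact ENNReal.ofReal_le_ofReal (hC i m (hQ.mem_clusterFinset.1 h))
    · simp
  have h2 : ∀ i, ∑' m, (if m ∈ hQ.clusterFinset i then ENNReal.ofReal C else 0) ≤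
      N * ENNReal.ofReal C := fun i => by
    rw [tsum_eq_sum (s := hQ.clusterFinset i) fun m hm => by simp [hm],
      Finset.sum_congr rfl fun m hm => if_pos hm, Finset.sum_const, nsmul_eq_mul]
    gcongr
    exact hN i
  have h3 := lqNorm_matrix_le w hw0 hq
    (H := fun i m => if m ∈ hQ.clusterFinset i then 1 else 0) (A := N * ENNReal.ofReal C)
    (fun i => (ENNReal.tsum_le_tsum fun m => h1 i m).trans (h2 i))
    fun m => by
      refine (ENNReal.tsum_le_tsum fun i => h1 i m).trans ((le_of_eq ?_).trans (h2 m))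
      refine tsum_congr fun i => ?_
      simp only [hQ.mem_clusterFinset, AffineFamily.mem_cluster_comm]
  refine (iSup₂_le fun c hc => ?_ : Q.clusteringNorm w q ≤ N * ENNReal.ofReal C).trans_lt
    (ENNReal.mul_lt_top (ENNReal.natCast_lt_top N) ENNReal.ofReal_lt_top)
  refine le_trans (lqNorm_mono w q fun i => ?_) ((h3 fun j => ‖c j‖ₑ).trans
    (mul_le_of_le_one_right' hc))
  rw [tsum_eq_sum (s := hQ.clusterFinset i) fun m hm => by simp [hm], hQ.clustering_eq]
  refine (enorm_sum_le _ _).trans (Finset.sum_le_sum fun m hm => ?_)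
  simp [hm]

lemma lqNorm_single [DecidableEq J] (hw : ∀ i, 0 < w i) {q : ℝ≥0∞} (hq : 1 ≤ q) (i : J) :
    lqNorm w q (fun j => if j = i then ENNReal.ofReal (w i)⁻¹ else 0) ≤ 1 := by
  have h1 : ∀ j, ENNReal.ofReal (w j) * (if j = i then ENNReal.ofReal (w i)⁻¹ else 0) =
      if j = i then 1 else 0 := fun j => by
    split_ifs with h
    · rw [h, ← ENNReal.ofReal_mul (hw i).le, mul_inv_cancel₀ (hw i).ne', ENNReal.ofReal_one]
    · simp
  unfold lqNorm
  simp_rw [h1]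
  split_ifs with hqt
  · exact iSup_le fun j => by split_ifs <;> simp
  · have hq0 : 0 < q.toReal := ENNReal.toReal_pos (zero_lt_one.trans_le hq).ne' hqt
    rw [tsum_eq_single i fun j hj => by simp [hj, hq0]]
    simp

/-- `‖Γ_Q‖² ≥ |i^*|`. -/
lemma card_cluster_le_clusteringNorm_sq (hQ : Q.IsAdmissibleCover O) (hw : ∀ i, 0 < w i)
    {q : ℝ≥0∞} (hq : 1 ≤ q) (i : J) :
    ((hQ.clusterFinset i).card : ℝ≥0∞) ≤ Q.clusteringNorm w q ^ 2 := by
  classical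
  have hq0 : q ≠ 0 := (zero_lt_one.trans_le hq).ne'
  set a : J → ℝ≥0∞ := fun j => if j = i then ENNReal.ofReal (w i)⁻¹ else 0 with ha
  have ha1 : lqNorm w q a ≤ 1 := lqNorm_single hw hq i
  by_cases hΓ : Q.clusteringNorm w q = ⊤
  · rw [hΓ]; simp
  have h1 := lqNorm_cluster_le hQ hw hq (ha1.trans_lt ENNReal.one_lt_top)
  have h1' : lqNorm w q (fun i => ∑ l ∈ hQ.clusterFinset i, a l) ≤ Q.clusteringNorm w q :=
    h1.trans (mul_le_of_le_one_right' ha1)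
  have h2 := (lqNorm_cluster_le hQ hw hq (h1'.trans_lt (lt_top_iff_ne_top.2 hΓ))).trans
    (mul_le_mul_right h1' _)
  have h3 := (le_lqNorm w hq0 (fun i => ∑ l ∈ hQ.clusterFinset i,
    ∑ l ∈ hQ.clusterFinset l, a l) i).trans h2
  -- Apply `Γ_Q` twice to a normalised unit mass at `i`: each member of `i^*` sees the mass once and
  -- returns it to `i`.
  have h4 : ∀ l ∈ hQ.clusterFinset i, ∑ m ∈ hQ.clusterFinset l, a m = ENNReal.ofReal (w i)⁻¹ := by
    intro l hl
    have : i ∈ hQ.clusterFinset l := by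
      rw [hQ.mem_clusterFinset] at hl ⊢
      exact AffineFamily.mem_cluster_comm.1 hl
    simp [ha, Finset.sum_ite_eq', this]
  rw [Finset.sum_congr rfl h4, Finset.sum_const, nsmul_eq_mul, mul_left_comm,
    ← ENNReal.ofReal_mul (hw i).le, mul_inv_cancel₀ (hw i).ne', ENNReal.ofReal_one, mul_one,
    ← pow_two] at h3
  exact h3

/-- `C_Φ |i^*| ≥ 1`. -/
lemma one_le_partitionL1Const_mul (hQ : Q.IsAdmissibleCover O)
    (hφ : Q.IsRegularPartitionOfUnity φ) (i : J) :
    1 ≤ partitionL1Const φ * (hQ.clusterFinset i).card := by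
  obtain ⟨ξ, hξ⟩ := hQ.set_nonempty i
  have h1 := hφ.sum_cluster_eq_one hQ i hξ
  -- A function is bounded pointwise by the `L¹` norm of its Fourier transform; at a point of `Q_i`
  -- the functions of the cluster sum to one.
  have h2 : ∀ l, ‖φ l ξ‖ₑ ≤ partitionL1Const φ := by
    intro l
    refine le_trans ?_ (le_iSup (fun i => eLpNorm (𝓕⁻ (φ i : Space d → ℂ)) 1 volume) l)
    rw [eLpNorm_one_eq_lintegral_enorm, lintegral_enorm_fourierInv,
      eq_integral_fourier_mul_character (φ l).contDiff (φ l).hasCompactSupport ξ]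
    refine (enorm_integral_le_lintegral_enorm _).trans (le_of_eq ?_)
    refine lintegral_congr fun x => ?_
    rw [enorm_mul, ← ofReal_norm (character x ξ), norm_character, ENNReal.ofReal_one, mul_one]
  calc (1 : ℝ≥0∞) = ‖∑ l ∈ hQ.clusterFinset i, φ l ξ‖ₑ := by rw [h1]; simp
    _ ≤ ∑ l ∈ hQ.clusterFinset i, ‖φ l ξ‖ₑ := enorm_sum_le _ _
    _ ≤ ∑ l ∈ hQ.clusterFinset i, partitionL1Const φ := Finset.sum_le_sum fun l _ => h2 l
    _ = _ := by rw [Finset.sum_const, nsmul_eq_mul, mul_comm]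

/-- The bounds `C_Φ |i^*| ≥ 1` and `|i^*| ≤ ‖Γ_Q‖²` combine, so an estimate with constant one
implies the stated one for every `p` and `q`. -/
lemma one_le_constCpq (hQ : Q.IsAdmissibleCover O) (hφ : Q.IsRegularPartitionOfUnity φ)
    (hw : ∀ i, 0 < w i) (p : ℝ≥0∞) {q : ℝ≥0∞} (hq : 1 ≤ q) [Nonempty J] :
    1 ≤ constCpq Q φ w p q := by
  unfold constCpq
  split_ifs
  · exact le_rfl
  · obtain ⟨i⟩ := ‹Nonempty J›
    refine (one_le_partitionL1Const_mul hQ hφ i).trans ?_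
    gcongr
    exact card_cluster_le_clusteringNorm_sq hQ hw hq i

end Covers

/-! ### Finiteness of the constants -/

section FiniteConstants

variable {d : ℕ} {J : Type*} {Q : AffineFamily d J} {O : Opens (Space d)} {φ : J → 𝓓(O, ℂ)}

/-- The functions `φ_i ∘ S_i` vanish off a common ball and have uniformly bounded derivatives, and
the `L¹` norm of the Fourier transform is invariant under affine changes of variable. -/
lemma partitionL1Const_lt_top (hd : 1 ≤ d) (hφ : Q.IsRegularPartitionOfUnity φ)
    (hQo : ∀ i, IsOpen (Q.Q' i)) (hR : Q.R < ⊤) : partitionL1Const φ < ⊤ := by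
  set V : ℝ≥0∞ := volume (Metric.closedBall (0 : Space d) Q.radius) with hV
  have hVt : V < ⊤ := measure_closedBall_lt_top
  have hsub : ∀ i, Q.Q' i ⊆ Metric.closedBall 0 Q.radius := fun i ξ hξ =>
    mem_closedBall_zero_iff.2 (Q.norm_le_radius hR hξ)
  have hD := derivConst_ne_top hφ
  have key : ∀ i l, ∀ n ≤ d + 1, ∫⁻ ξ, ‖(pderiv l)^[n] (pullback Q φ i) ξ‖ₑ ≤ derivConst Q φ * V := by
    intro i l n hn
    have h0 := ae_pderiv_iterate_eq_zero hd (contDiff_pullback (Q := Q) (φ := φ) i) l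
      (hQo i).measurableSet.compl (fun ξ hξ => pullback_eq_zero hφ i hξ) n
    have h1 : ∀ᵐ ξ, ‖(pderiv l)^[n] (pullback Q φ i) ξ‖ₑ ≤
        (Q.Q' i).indicator (fun _ => derivConst Q φ) ξ := by
      filter_upwards [h0] with ξ hξ
      by_cases h : ξ ∈ Q.Q' i
      · rw [indicator_of_mem h, ← mderiv_single (contDiff_pullback i)]
        exact enorm_mderiv_pullback_le i (by simpa using hn) ξ
      · simp [hξ h]
    refine (lintegral_mono_ae h1).trans ?_
    rw [lintegral_indicator (hQo i).measurableSet, setLIntegral_const]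
    exact mul_le_mul_right (measure_mono (hsub i)) _
  have hbound : ∀ i, eLpNorm (𝓕⁻ (φ i : Space d → ℂ)) 1 volume ≤
      ENNReal.ofReal (1 ^ d) * (ENNReal.ofReal (2 ^ (d + 1) * (1 + 2 * d) ^ d) *
        (ENNReal.ofReal (2 ^ (d + 1)) * (derivConst Q φ * V))) := by
    intro i
    rw [eLpNorm_one_eq_lintegral_enorm, lintegral_enorm_fourierInv]
    have h1 := lintegral_enorm_le_of_decay hd one_pos (f := 𝓕 (pullback Q φ i)) fun x l =>
      enorm_fourier_decay (contDiff_pullback i) (hasCompactSupport_pullback i) le_rfl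
        (N := derivConst Q φ * V) (key i ⟨0, hd⟩ 0 (by omega)) (fun l => by
          rw [one_pow, ENNReal.ofReal_one, one_mul]; exact key i l _ le_rfl) x l
    refine le_trans (le_of_eq ?_) h1
    have h2 : (φ i : Space d → ℂ) = fun ξ => (fun ξ => pullback Q φ i ((Q.A i).symm ξ)) (ξ - Q.b i) := by
      funext ξ
      have := Q.S_Sinv_self i ξ
      exact congrArg (φ i) this.symm
    have hdet : (ContinuousLinearMap.adjoint (Q.A i : Space d →L[ℝ] Space d)).det ≠ 0 := by
      rw [det_adjoint]; exact Q.det_A_ne_zero i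
    have h3 : ∀ y, ‖𝓕 (φ i : Space d → ℂ) y‖ₑ = ENNReal.ofReal (Q.absDet i) *
        ‖𝓕 (pullback Q φ i) (ContinuousLinearMap.adjoint (Q.A i : Space d →L[ℝ] Space d) y)‖ₑ := by
      intro y
      have h4 := fourier_comp_linear (B := ((Q.A i).symm : Space d →L[ℝ] Space d))
        (B' := (Q.A i : Space d →L[ℝ] Space d)) (by simp) (pullback Q φ i) y
      rw [Q.abs_det_symm, inv_inv] at h4
      rw [h2, fourier_comp_sub (fun ξ => pullback Q φ i ((Q.A i).symm ξ)), enorm_mul]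
      change _ * ‖𝓕 (fun x => pullback Q φ i (((Q.A i).symm : Space d →L[ℝ] Space d) x)) y‖ₑ = _
      rw [h4, enorm_mul, ← ofReal_norm (character _ _), norm_character, ENNReal.ofReal_one, one_mul,
        ← ofReal_norm ((Q.absDet i : ℝ) : ℂ), Complex.norm_real,
        Real.norm_of_nonneg (Q.absDet_pos i).le]
    simp_rw [h3]
    rw [lintegral_const_mul' _ _ ENNReal.ofReal_ne_top, lintegral_comp_linear hdet
      fun y => ‖𝓕 (pullback Q φ i) y‖ₑ, ← mul_assoc, det_adjoint,
      ← ENNReal.ofReal_mul (Q.absDet_pos i).le]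
    have h6 : |(Q.A i : Space d →L[ℝ] Space d).det| = Q.absDet i := rfl
    rw [h6, mul_inv_cancel₀ (Q.absDet_pos i).ne', ENNReal.ofReal_one, one_mul]
  refine (iSup_le hbound).trans_lt ?_
  exact ENNReal.mul_lt_top ENNReal.ofReal_lt_top (ENNReal.mul_lt_top ENNReal.ofReal_lt_top
    (ENNReal.mul_lt_top ENNReal.ofReal_lt_top (ENNReal.mul_lt_top hD.lt_top hVt)))

lemma constC0_lt_top (hφ : Q.IsRegularPartitionOfUnity φ) (hR : Q.R < ⊤) : constC0 Q φ < ⊤ := by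
  refine ENNReal.mul_lt_top (ENNReal.mul_lt_top ENNReal.ofReal_lt_top
    (max_lt ENNReal.one_lt_top (ENNReal.pow_lt_top hR))) ?_
  refine lt_of_le_of_lt (iSup₂_le fun α hα => ?_ : _ ≤ derivConst Q φ ^ 2)
    (ENNReal.pow_lt_top (derivConst_ne_top hφ).lt_top)
  gcongr
  exact le_iSup₂ (f := fun (α : Fin d → ℕ) (_ : ∑ i, α i ≤ d + 1) => Q.partitionConst φ α) α hα

lemma remainderBound_lt_top [Countable J] (hd : 1 ≤ d) (hφ : Q.IsRegularPartitionOfUnity φ)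
    (hQ : Q.IsAdmissibleCover O) (hQo : ∀ i, IsOpen (Q.Q' i)) (hR : Q.R < ⊤) {w : J → ℝ}
    (hw : Q.IsModerate w) {g : Space d → ℂ} (hY : schurNorm (Ytilde Q w g) < ⊤) (δ : ℝ)
    (p : ℝ≥0∞) {q : ℝ≥0∞} (hq : 1 ≤ q) : remainderBound Q φ w g δ p q < ⊤ := by
  have hΓ := clusteringNorm_lt_top hQ hw hq
  have h1 : constCpq Q φ w p q < ⊤ := by
    unfold constCpq
    split_ifs
    · exact ENNReal.one_lt_top
    · exact ENNReal.mul_lt_top (partitionL1Const_lt_top hd hφ hQo hR) (ENNReal.pow_lt_top hΓ)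
  have h2 : constC' d < ⊤ := by
    unfold constC'
    refine ENNReal.pow_lt_top (ENNReal.mul_lt_top (by simp) (ENNReal.pow_lt_top ?_))
    exact ENNReal.add_lt_top.2 ⟨ENNReal.natCast_lt_top d, ENNReal.one_lt_top⟩
  exact ENNReal.mul_lt_top (ENNReal.mul_lt_top (ENNReal.mul_lt_top (ENNReal.mul_lt_top
    (ENNReal.mul_lt_top (constC0_lt_top hφ hR) h1) (ENNReal.pow_lt_top h2)) hΓ)
    (ENNReal.pow_lt_top ENNReal.ofReal_lt_top)) (ENNReal.pow_lt_top hY)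

end FiniteConstants

/-! ### Kernel bounds for analysis followed by synthesis -/

section Synthesis

variable {d : ℕ} {J : Type*} {Q : AffineFamily d J} {O : Opens (Space d)} {φ : J → 𝓓(O, ℂ)}
  {g : Space d → ℂ} {w : J → ℝ} {δ : ℝ}

variable (Q φ g δ) in
/-- The numbers `|det C_j|^{1/2} ‖(𝓕⁻¹ φ_i ∗ g_j) ∘ C_j‖_{W(L^∞, ℓ^1)}`. -/
def sampleNorm (i j : J) : ℝ≥0∞ :=
  ENNReal.ofReal (Real.sqrt |(structuredLattice Q δ j).det|) *
    amalgamNorm fun x => 𝓕 (localAtom Q φ g i j) (-structuredLattice Q δ j x)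

lemma adaptedMatrix_eq (hg : Integrable g) (i j : J) :
    adaptedMatrix φ (structuredGenerator Q g) (structuredLattice Q δ) w w i j =
      ENNReal.ofReal (max (w i / w j) (w j / w i)) * sampleNorm Q φ g δ i j := by
  simp only [adaptedMatrix, sampleNorm, conv_fourierInv_structuredGenerator hg, mul_assoc]

lemma abs_det_structuredLattice_pos (Q : AffineFamily d J) (hδ : 0 < δ) (j : J) :
    0 < |(structuredLattice Q δ j).det| := by
  rw [abs_det_structuredLattice Q hδ]
  have := Q.absDet_pos j
  positivity

lemma continuous_fourier_localAtom (hgs : ContDiff ℝ ∞ (𝓕 g)) (i j : J) :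
    Continuous (𝓕 (localAtom Q φ g i j)) :=
  continuous_fourier ((contDiff_localAtom hgs i j).continuous.integrable_of_hasCompactSupport
    (hasCompactSupport_localAtom i j))

lemma exists_structuredLattice_eq (Q : AffineFamily d J) (hδ : 0 < δ) (j : J) (z : Space d) :
    ∃ z', structuredLattice Q δ j z' = z := by
  refine ⟨δ⁻¹ • ContinuousLinearMap.adjoint (Q.A j : Space d →L[ℝ] Space d) z, ?_⟩
  refine ext_inner_right ℝ fun y => ?_
  simp only [structuredLattice, _root_.smul_apply, map_smul, inner_smul_left,
    ContinuousLinearMap.adjoint_inner_left]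
  simp [hδ.ne']

/-- Summing over the lattice costs `|det C_j|^{-1/2}`, the inverse of what integrating costs in
`atomNorm_le_sampleNorm`. In the kernel of the frame operator one variable is summed and the other
integrated, so the determinants cancel. -/
lemma tsum_enorm_fourier_localAtom_le (hgs : ContDiff ℝ ∞ (𝓕 g)) (hδ : 0 < δ) (i j : J)
    (z : Space d) :
    ∑' k : Fin d → ℤ, ‖𝓕 (localAtom Q φ g i j) (structuredLattice Q δ j (intVec k) - z)‖ₑ ≤
      ENNReal.ofReal (Real.sqrt |(structuredLattice Q δ j).det|)⁻¹ * sampleNorm Q φ g δ i j := by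
  have h0 := abs_det_structuredLattice_pos Q hδ j
  have h1 : Continuous fun x => 𝓕 (localAtom Q φ g i j) (-structuredLattice Q δ j x) :=
    (continuous_fourier_localAtom hgs i j).comp (structuredLattice Q δ j).continuous.neg
  obtain ⟨z', hz'⟩ := exists_structuredLattice_eq Q hδ j z
  have h2 := tsum_enorm_le_amalgamNorm h1 (-z')
  rw [← (Equiv.neg (Fin d → ℤ)).tsum_eq] at h2
  have h3 : ENNReal.ofReal (Real.sqrt |(structuredLattice Q δ j).det|)⁻¹ * sampleNorm Q φ g δ i j =
      amalgamNorm fun x => 𝓕 (localAtom Q φ g i j) (-structuredLattice Q δ j x) := by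
    rw [sampleNorm, ← mul_assoc, ← ENNReal.ofReal_mul (by positivity),
      inv_mul_cancel₀ (Real.sqrt_pos.2 h0).ne', ENNReal.ofReal_one, one_mul]
  rw [h3]
  refine le_trans (le_of_eq (tsum_congr fun k => ?_)) h2
  have h4 : structuredLattice Q δ j (intVec k) - z =
      -structuredLattice Q δ j (intVec (Equiv.neg (Fin d → ℤ) k) - -z') := by
    rw [Equiv.neg_apply, intVec_neg, map_sub, map_neg, map_neg, hz']
    abel
  rw [h4]

lemma atomNorm_le_sampleNorm (hδ : 0 < δ) (i j : J) :
    atomNorm Q φ g i j ≤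
      ENNReal.ofReal (Real.sqrt |(structuredLattice Q δ j).det|) * sampleNorm Q φ g δ i j := by
  have h0 := abs_det_structuredLattice_pos Q hδ j
  have h1 := lintegral_enorm_le_amalgamNorm
    fun x => 𝓕 (localAtom Q φ g i j) (-structuredLattice Q δ j x)
  have h2 : |(-structuredLattice Q δ j).det| = |(structuredLattice Q δ j).det| := by
    rw [ContinuousLinearMap.det, ContinuousLinearMap.det, ContinuousLinearMap.toLinearMap_neg,
      ← neg_one_smul ℝ, LinearMap.det_smul, abs_mul]
    simp
  have h3 := lintegral_comp_linear (B := -structuredLattice Q δ j)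
    (by rw [← abs_ne_zero, h2]; exact h0.ne') fun y => ‖𝓕 (localAtom Q φ g i j) y‖ₑ
  rw [h2] at h3
  simp only [_root_.neg_apply] at h3
  rw [h3] at h1
  have h4 : Real.sqrt |(structuredLattice Q δ j).det| * Real.sqrt |(structuredLattice Q δ j).det| =
    |(structuredLattice Q δ j).det| := Real.mul_self_sqrt h0.le
  calc atomNorm Q φ g i j = ENNReal.ofReal |(structuredLattice Q δ j).det| *
        (ENNReal.ofReal |(structuredLattice Q δ j).det|⁻¹ * atomNorm Q φ g i j) := by
        rw [← mul_assoc, ← ENNReal.ofReal_mul h0.le, mul_inv_cancel₀ h0.ne', ENNReal.ofReal_one,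
          one_mul]
    _ ≤ ENNReal.ofReal |(structuredLattice Q δ j).det| *
        amalgamNorm fun x => 𝓕 (localAtom Q φ g i j) (-structuredLattice Q δ j x) := by
        gcongr
        exact h1
    _ = _ := by
        rw [sampleNorm, ← mul_assoc, ← ENNReal.ofReal_mul (by positivity), h4]

/-- The `L^p` bound for the sampling kernels. -/
lemma eLpNorm_lintegral_sample_le (hgs : ContDiff ℝ ∞ (𝓕 g)) (hδ : 0 < δ) (i j m : J)
    {u : Space d → ℝ≥0∞} (hu : Measurable u) {p : ℝ≥0∞} (hp : 1 ≤ p) :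
    eLpNorm (fun x => ∫⁻ y, (∑' k : Fin d → ℤ,
      ‖𝓕 (localAtom Q φ g i j) (structuredLattice Q δ j (intVec k) - x)‖ₑ *
      ‖𝓕 (localAtom Q φ g m j) (structuredLattice Q δ j (intVec k) - y)‖ₑ) * u y) p volume ≤
      sampleNorm Q φ g δ i j * sampleNorm Q φ g δ m j * eLpNorm u p volume := by
  have h0 := Real.sqrt_pos.2 (abs_det_structuredLattice_pos Q hδ j)
  have hc := fun i => continuous_fourier_localAtom (Q := Q) (φ := φ) hgs i j
  have hmeas : ∀ (i : J) (k : Fin d → ℤ), Measurable fun x =>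
      ‖𝓕 (localAtom Q φ g i j) (structuredLattice Q δ j (intVec k) - x)‖ₑ := fun i k =>
    ((hc i).comp (continuous_const.sub continuous_id)).enorm.measurable
  have hint : ∀ (i : J) (k : Fin d → ℤ), ∫⁻ x,
      ‖𝓕 (localAtom Q φ g i j) (structuredLattice Q δ j (intVec k) - x)‖ₑ = atomNorm Q φ g i j :=
    fun i k => lintegral_sub_left_eq_self (fun x => ‖𝓕 (localAtom Q φ g i j) x‖ₑ) _
  have hone : ENNReal.ofReal (Real.sqrt |(structuredLattice Q δ j).det|)⁻¹ *
      ENNReal.ofReal (Real.sqrt |(structuredLattice Q δ j).det|) = 1 := by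
    rw [← ENNReal.ofReal_mul (by positivity), inv_mul_cancel₀ h0.ne', ENNReal.ofReal_one]
  refine eLpNorm_lintegral_kernel_le volume volume ?_ (fun x => ?_) (fun y => ?_) hu hp
  · exact Measurable.tsum fun k => ((hmeas i k).comp measurable_fst).mul
      ((hmeas m k).comp measurable_snd)
  · rw [lintegral_tsum fun k => ((hmeas m k).const_mul _).aemeasurable]
    simp_rw [lintegral_const_mul _ (hmeas m _), hint]
    rw [ENNReal.tsum_mul_right]
    calc _ ≤ (ENNReal.ofReal (Real.sqrt |(structuredLattice Q δ j).det|)⁻¹ *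
          sampleNorm Q φ g δ i j) * (ENNReal.ofReal (Real.sqrt |(structuredLattice Q δ j).det|) *
          sampleNorm Q φ g δ m j) :=
          mul_le_mul' (tsum_enorm_fourier_localAtom_le hgs hδ i j x)
            (atomNorm_le_sampleNorm hδ m j)
      _ = (ENNReal.ofReal (Real.sqrt |(structuredLattice Q δ j).det|)⁻¹ *
          ENNReal.ofReal (Real.sqrt |(structuredLattice Q δ j).det|)) *
          (sampleNorm Q φ g δ i j * sampleNorm Q φ g δ m j) := by ring
      _ = _ := by rw [hone, one_mul]
  · rw [lintegral_tsum fun k => ((hmeas i k).mul_const _).aemeasurable]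
    simp_rw [lintegral_mul_const _ (hmeas i _), hint]
    rw [ENNReal.tsum_mul_left]
    calc _ ≤ (ENNReal.ofReal (Real.sqrt |(structuredLattice Q δ j).det|) *
          sampleNorm Q φ g δ i j) * (ENNReal.ofReal (Real.sqrt |(structuredLattice Q δ j).det|)⁻¹ *
          sampleNorm Q φ g δ m j) :=
          mul_le_mul' (atomNorm_le_sampleNorm hδ i j)
            (tsum_enorm_fourier_localAtom_le hgs hδ m j y)
      _ = (ENNReal.ofReal (Real.sqrt |(structuredLattice Q δ j).det|)⁻¹ *
          ENNReal.ofReal (Real.sqrt |(structuredLattice Q δ j).det|)) *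
          (sampleNorm Q φ g δ i j * sampleNorm Q φ g δ m j) := by ring
      _ = _ := by rw [hone, one_mul]

variable (Q φ g δ) in
/-- A bound for the frame coefficients with index `(j, k)`, in terms of functions `u_m`. -/
def coefBound (u : J → Space d → ℂ) (jk : J × (Fin d → ℤ)) : ℝ≥0∞ :=
  ∑' m, ∫⁻ y, ‖𝓕 (localAtom Q φ g m jk.1) (structuredLattice Q δ jk.1 (intVec jk.2) - y)‖ₑ *
    ‖u m y‖ₑ

variable (Q φ g δ) in
/-- A bound for the local pieces of a distribution with given frame coefficients. -/
def synthBound (u : J → Space d → ℂ) (i : J) (x : Space d) : ℝ≥0∞ :=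
  ∑' jk : J × (Fin d → ℤ), coefBound Q φ g δ u jk *
    ‖𝓕 (localAtom Q φ g i jk.1) (structuredLattice Q δ jk.1 (intVec jk.2) - x)‖ₑ

/-- Tonelli collects the samples into one integral kernel for each pair `(m, j)`, ready for Schur's
test. -/
lemma synthBound_eq (hgs : ContDiff ℝ ∞ (𝓕 g)) {u : J → Space d → ℂ} (hu : ∀ m, Continuous (u m))
    (i : J) (x : Space d) : synthBound Q φ g δ u i x = ∑' m, ∑' j, ∫⁻ y, (∑' k : Fin d → ℤ,
      ‖𝓕 (localAtom Q φ g i j) (structuredLattice Q δ j (intVec k) - x)‖ₑ *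
      ‖𝓕 (localAtom Q φ g m j) (structuredLattice Q δ j (intVec k) - y)‖ₑ) * ‖u m y‖ₑ := by
  have hm : ∀ (m j : J) (k : Fin d → ℤ), Measurable fun y =>
      ‖𝓕 (localAtom Q φ g m j) (structuredLattice Q δ j (intVec k) - y)‖ₑ * ‖u m y‖ₑ := fun m j k =>
    (((continuous_fourier_localAtom hgs m j).comp
      (continuous_const.sub continuous_id)).enorm.measurable).mul (hu m).enorm.measurable
  unfold synthBound coefBound
  rw [ENNReal.tsum_prod', ENNReal.tsum_comm (α := J) (β := J)]
  refine tsum_congr fun j => ?_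
  simp_rw [← ENNReal.tsum_mul_right]
  rw [ENNReal.tsum_comm]
  refine tsum_congr fun m => ?_
  rw [lintegral_tsum fun k => by
    simp_rw [mul_assoc]
    exact ((hm m j k).const_mul _).aemeasurable]
  refine tsum_congr fun k => ?_
  simp_rw [mul_assoc]
  rw [lintegral_const_mul _ (hm m j k), mul_comm]

lemma measurable_synthBound [Countable J] (hgs : ContDiff ℝ ∞ (𝓕 g)) (u : J → Space d → ℂ) (i : J) :
    Measurable (synthBound Q φ g δ u i) :=
  Measurable.tsum fun jk => (((continuous_fourier_localAtom hgs i jk.1).comp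
      (continuous_const.sub continuous_id)).enorm.measurable).const_mul _

lemma eLpNorm_synthBound_le [Countable J] (hgs : ContDiff ℝ ∞ (𝓕 g)) (hδ : 0 < δ)
    {u : J → Space d → ℂ} (hu : ∀ m, Continuous (u m)) (i : J) {p : ℝ≥0∞} (hp : 1 ≤ p) :
    eLpNorm (synthBound Q φ g δ u i) p volume ≤
      ∑' m, (∑' j, sampleNorm Q φ g δ i j * sampleNorm Q φ g δ m j) * eLpNorm (u m) p volume := by
  have hmeas : ∀ m j, Measurable fun x => ∫⁻ y, (∑' k : Fin d → ℤ,
      ‖𝓕 (localAtom Q φ g i j) (structuredLattice Q δ j (intVec k) - x)‖ₑ *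
      ‖𝓕 (localAtom Q φ g m j) (structuredLattice Q δ j (intVec k) - y)‖ₑ) * ‖u m y‖ₑ := by
    intro m j
    refine Measurable.lintegral_prod_right ?_
    refine Measurable.mul (Measurable.tsum fun k => ?_)
      ((hu m).enorm.measurable.comp measurable_snd)
    exact ((((continuous_fourier_localAtom hgs i j).comp
      (continuous_const.sub continuous_id)).enorm.measurable).comp measurable_fst).mul
      ((((continuous_fourier_localAtom hgs m j).comp
      (continuous_const.sub continuous_id)).enorm.measurable).comp measurable_snd)
  rw [funext (synthBound_eq hgs hu i)]
  refine (eLpNorm_tsum_le volume (fun m => Measurable.tsum fun j => hmeas m j) hp).trans ?_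
  refine ENNReal.tsum_le_tsum fun m => ?_
  refine (eLpNorm_tsum_le volume (hmeas m) hp).trans ?_
  rw [← ENNReal.tsum_mul_right]
  refine ENNReal.tsum_le_tsum fun j => ?_
  have := eLpNorm_lintegral_sample_le (Q := Q) (φ := φ) hgs hδ i j m (hu m).enorm.measurable hp
  rwa [eLpNorm_enorm] at this

/-- A Schur type estimate for products of matrices. -/
lemma lqNorm_tsum_tsum_le [Countable J] (hw : ∀ i, 0 < w i) {q : ℝ≥0∞} (hq : 1 ≤ q)
    {E : J → J → J → ℝ≥0∞} {N : J → J → ℝ≥0∞} {c : ℝ≥0∞}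
    (h : ∀ i j m, ENNReal.ofReal (w i / w m) * E i j m ≤ c * (N i j * N m j)) (a : J → ℝ≥0∞) :
    lqNorm w q (fun i => ∑' m, (∑' j, E i j m) * a m) ≤ c * schurNorm N ^ 2 * lqNorm w q a := by
  have hr : ∀ i, ∑' j, N i j ≤ schurNorm N := fun i =>
    (le_iSup (fun i => ∑' j, N i j) i).trans (le_max_left _ _)
  have hc : ∀ j, ∑' i, N i j ≤ schurNorm N := fun j =>
    (le_iSup (fun j => ∑' i, N i j) j).trans (le_max_right _ _)
  have key : ∀ i, ∑' m, ∑' j, N i j * N m j ≤ schurNorm N ^ 2 := fun i => by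
    rw [ENNReal.tsum_comm]
    simp_rw [ENNReal.tsum_mul_left]
    calc _ ≤ ∑' j, N i j * schurNorm N := ENNReal.tsum_le_tsum fun j => by gcongr; exact hc j
      _ ≤ _ := by rw [ENNReal.tsum_mul_right, pow_two]; gcongr; exact hr i
  refine lqNorm_matrix_le w hw hq (fun i => ?_) (fun m => ?_) a
  · calc _ ≤ ∑' m, c * ∑' j, N i j * N m j := ENNReal.tsum_le_tsum fun m => by
          rw [← ENNReal.tsum_mul_left, ← ENNReal.tsum_mul_left]
          exact ENNReal.tsum_le_tsum fun j => h i j m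
      _ ≤ _ := by rw [ENNReal.tsum_mul_left]; gcongr; exact key i
  · calc _ ≤ ∑' i, c * ∑' j, N m j * N i j := ENNReal.tsum_le_tsum fun i => by
          rw [← ENNReal.tsum_mul_left, ← ENNReal.tsum_mul_left]
          refine ENNReal.tsum_le_tsum fun j => (h i j m).trans (le_of_eq ?_)
          rw [mul_comm (N i j)]
      _ ≤ _ := by rw [ENNReal.tsum_mul_left]; gcongr; exact key m

lemma weight_mul_sampleNorm_le (hg : Integrable g) (hw : ∀ i, 0 < w i) (i j m : J) :
    ENNReal.ofReal (w i / w m) * (sampleNorm Q φ g δ i j * sampleNorm Q φ g δ m j) ≤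
      1 * (adaptedMatrix φ (structuredGenerator Q g) (structuredLattice Q δ) w w i j *
        adaptedMatrix φ (structuredGenerator Q g) (structuredLattice Q δ) w w m j) := by
  have hwi := hw i
  have hwj := hw j
  rw [one_mul, adaptedMatrix_eq hg, adaptedMatrix_eq hg]
  calc _ ≤ ENNReal.ofReal (max (w i / w j) (w j / w i) * max (w m / w j) (w j / w m)) *
        (sampleNorm Q φ g δ i j * sampleNorm Q φ g δ m j) := by
        gcongr
        exact div_le_max_mul_max hw i j m
    _ = _ := by
        rw [ENNReal.ofReal_mul (le_max_of_le_left (by positivity))]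
        ring

/-- The local pieces of synthesized distributions. -/
lemma lqNorm_synthBound_le [Countable J] (hg : Integrable g) (hgs : ContDiff ℝ ∞ (𝓕 g))
    (hδ : 0 < δ) (hw : ∀ i, 0 < w i) {u : J → Space d → ℂ} (hu : ∀ m, Continuous (u m))
    {p q : ℝ≥0∞} (hp : 1 ≤ p) (hq : 1 ≤ q) :
    lqNorm w q (fun i => eLpNorm (synthBound Q φ g δ u i) p volume) ≤
      schurNorm (adaptedMatrix φ (structuredGenerator Q g) (structuredLattice Q δ) w w) ^ 2 *
        lqNorm w q (fun m => eLpNorm (u m) p volume) := by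
  refine (lqNorm_mono w q fun i => eLpNorm_synthBound_le hgs hδ hu i hp).trans ?_
  have := lqNorm_tsum_tsum_le hw hq (weight_mul_sampleNorm_le (Q := Q) (φ := φ) (δ := δ) hg hw)
    fun m => eLpNorm (u m) p volume
  rwa [one_mul] at this

lemma lt_top_of_lqNorm_lt_top (hw : ∀ i, 0 < w i) {q : ℝ≥0∞} (hq : 1 ≤ q) {a : J → ℝ≥0∞}
    (ha : lqNorm w q a < ⊤) (i : J) : a i < ⊤ := by
  have h := (le_lqNorm w (zero_lt_one.trans_le hq).ne' a i).trans_lt ha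
  by_contra h0
  rw [not_lt_top_iff.1 h0, ENNReal.mul_top (ENNReal.ofReal_pos.2 (hw i)).ne'] at h
  exact lt_irrefl _ h

end Synthesis

/-! ### Distributions defined by series -/

section Functionals

variable {d : ℕ} {O : Opens (Space d)}

lemma fourier_finsetSum {ι : Type*} (s : Finset ι) {F : ι → Space d → ℂ}
    (hF : ∀ i ∈ s, Integrable (F i)) (z : Space d) :
    𝓕 (fun ξ => ∑ i ∈ s, F i ξ) z = ∑ i ∈ s, 𝓕 (F i) z := by
  simp_rw [fourier_eq_integral_character, Finset.sum_mul]
  refine integral_finsetSum s fun i hi => ?_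
  refine (hF i hi).mul_bdd (c := 1) (continuous_character _).aestronglyMeasurable ?_
  exact Filter.Eventually.of_forall fun ξ => (norm_character _ _).le

/-- Distributions which are defined by series of functionals. -/
lemma exists_distribution_hasSum {ι : Type*} (l : ι → 𝓓(O, ℂ) →ₗ[ℂ] ℂ) {q : ℝ≥0∞} (hq : 1 ≤ q)
    (hl : ∀ K : Compacts (Space d), (K : Set (Space d)) ⊆ O → ∃ C : ℝ≥0∞, C ≠ ⊤ ∧
      ∀ η : 𝓓(O, ℂ), tsupport η ⊆ K →
        ∑' i, ‖l i η‖ₑ ≤ C * eLpNorm (𝓕 (η : Space d → ℂ)) q volume) :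
    ∃ s : FourierDistribution O, ∀ η : 𝓓(O, ℂ),
      HasSum (fun i => l i η) (s (fourierToZ O η)) := by
  have hfin : ∀ η : 𝓓(O, ℂ), ∑' i, ‖l i η‖ₑ < ⊤ := fun η => by
    obtain ⟨C, hC, h⟩ := hl ⟨tsupport η, η.hasCompactSupport⟩ η.tsupport_subset
    exact (h η subset_rfl).trans_lt
      (ENNReal.mul_lt_top hC.lt_top (eLpNorm_fourier_lt_top η.contDiff η.hasCompactSupport hq))
  have hs : ∀ η : 𝓓(O, ℂ), Summable fun i => l i η := fun η =>
    (summable_norm_of_tsum_enorm_lt_top (hfin η)).of_norm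
  let L : 𝓓(O, ℂ) →ₗ[ℂ] ℂ :=
    { toFun := fun η => ∑' i, l i η
      map_add' := fun η θ => by simp_rw [map_add]; exact (hs η).tsum_add (hs θ)
      map_smul' := fun c η => by simp_rw [map_smul]; exact (hs η).tsum_const_smul c }
  have hL : Continuous L := by
    refine continuous_of_enorm_le_fourier L hq fun K hK => ?_
    obtain ⟨C, hC, h⟩ := hl K hK
    exact ⟨C, hC, fun η hη => (enorm_tsum_le_tsum_enorm).trans (h η hη)⟩
  refine ⟨FourierDistribution.ofFourier ⟨L, hL⟩, fun η => ?_⟩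
  rw [FourierDistribution.ofFourier_apply]
  exact (hs η).hasSum

/-- The pairing with an integrable function, as a functional on the test functions. -/
def pairingLM (O : Opens (Space d)) {u : Space d → ℂ} (hu : Integrable u) : 𝓓(O, ℂ) →ₗ[ℂ] ℂ where
  toFun η := functionPairing u (fourierToZ O η)
  map_add' η θ := by
    have h : ∀ η : 𝓓(O, ℂ), Integrable fun ξ => 𝓕 u ξ * η ξ := fun η =>
      ((continuous_fourier hu).mul η.continuous).integrable_of_hasCompactSupport
        η.hasCompactSupport.mul_left
    simp_rw [functionPairing_fourierToZ hu]
    rw [← integral_add (h η) (h θ)]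
    congr with ξ
    exact mul_add _ _ _
  map_smul' c η := by
    simp_rw [functionPairing_fourierToZ hu]
    rw [RingHom.id_apply, smul_eq_mul, ← integral_const_mul]
    congr with ξ
    exact mul_left_comm _ _ _

end Functionals

/-! ### Frame coefficients and their absolute convergence -/

section Coefficients

variable {d : ℕ} {J : Type*} {Q : AffineFamily d J} {O : Opens (Space d)} {φ : J → 𝓓(O, ℂ)}
  {g : Space d → ℂ} {w : J → ℝ} {δ : ℝ}

lemma contDiff_conj_localAtom (hgs : ContDiff ℝ ∞ (𝓕 g)) (i j : J) :
    ContDiff ℝ ∞ fun ξ => starRingEnd ℂ (localAtom Q φ g i j ξ) :=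
  Complex.conjCLE.contDiff.comp (contDiff_localAtom hgs i j)

lemma hasCompactSupport_conj_localAtom (i j : J) :
    HasCompactSupport fun ξ => starRingEnd ℂ (localAtom Q φ g i j ξ) :=
  (hasCompactSupport_localAtom i j).comp_left (map_zero (starRingEnd ℂ))

/-- The test function vanishes off `Q_m`, where `clusterPiece` represents the distribution; the
translation by `c` becomes a modulation and shifts the Fourier transform. -/
lemma extPairingTerm_eq (hQ : Q.IsAdmissibleCover O) (hφ : Q.IsRegularPartitionOfUnity φ)
    (hgs : ContDiff ℝ ∞ (𝓕 g)) (f : FourierDistribution O) {p : ℝ≥0∞} (hp : 1 ≤ p)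
    (hf : ∀ l, eLpNorm (localPiece (φ l) f.fourier) p volume < ⊤) (c : Space d) (m j : J) :
    extPairingTerm φ f (translate c (structuredGenerator Q g j)) m =
      ∫ y, clusterPiece hQ φ f.fourier m y *
        𝓕 (fun ξ => starRingEnd ℂ (localAtom Q φ g m j ξ)) (y - c) := by
  have h1 : ContDiff ℝ ∞ (𝓕 (translate c (structuredGenerator Q g j))) := by
    rw [funext (fourier_translate c (structuredGenerator Q g j))]
    exact (contDiff_character _).mul (contDiff_fourier_structuredGenerator Q hgs j)
  rw [extPairingTerm, dif_pos h1, apply_eq_integral_clusterPiece hQ hφ f.fourier hp hf m]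
  · congr with y
    rw [← fourier_mul_character]
    congr 1
    refine congrArg (fun h : Space d → ℂ => 𝓕 h y) (funext fun ξ => ?_)
    change starRingEnd ℂ (φ m ξ * 𝓕 (translate c (structuredGenerator Q g j)) ξ) = _
    rw [fourier_translate, localAtom, map_mul, map_mul, map_mul, conj_character, neg_neg]
    ring
  · intro ξ hξ
    change starRingEnd ℂ (φ m ξ * _) = 0
    rw [hφ.eq_zero_of_notMem m hξ, zero_mul, map_zero]

lemma enorm_extPairingTerm_le (hQ : Q.IsAdmissibleCover O) (hφ : Q.IsRegularPartitionOfUnity φ)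
    (hgs : ContDiff ℝ ∞ (𝓕 g)) (f : FourierDistribution O) {p : ℝ≥0∞} (hp : 1 ≤ p)
    (hf : ∀ l, eLpNorm (localPiece (φ l) f.fourier) p volume < ⊤) (c : Space d) (m j : J) :
    ‖extPairingTerm φ f (translate c (structuredGenerator Q g j)) m‖ₑ ≤
      ∫⁻ y, ‖𝓕 (localAtom Q φ g m j) (c - y)‖ₑ * ‖clusterPiece hQ φ f.fourier m y‖ₑ := by
  rw [extPairingTerm_eq hQ hφ hgs f hp hf]
  refine (enorm_integral_le_lintegral_enorm _).trans (le_of_eq (lintegral_congr fun y => ?_))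
  rw [enorm_mul, enorm_fourier_conj, neg_sub, mul_comm]

/-- Hölder's inequality for the terms of the frame coefficients. -/
lemma lintegral_fourier_localAtom_mul_le (hgs : ContDiff ℝ ∞ (𝓕 g)) (hδ : 0 < δ) (m j : J)
    (k : Fin d → ℤ) {u : Space d → ℝ≥0∞} (hu : Measurable u) {p : ℝ≥0∞} (hp : 1 ≤ p) :
    ∫⁻ y, ‖𝓕 (localAtom Q φ g m j) (structuredLattice Q δ j (intVec k) - y)‖ₑ * u y ≤
      (ENNReal.ofReal (Real.sqrt |(structuredLattice Q δ j).det|) +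
        ENNReal.ofReal (Real.sqrt |(structuredLattice Q δ j).det|)⁻¹) * sampleNorm Q φ g δ m j *
        eLpNorm u p volume := by
  have hm : Measurable fun y =>
      ‖𝓕 (localAtom Q φ g m j) (structuredLattice Q δ j (intVec k) - y)‖ₑ :=
    ((continuous_fourier_localAtom hgs m j).comp
      (continuous_const.sub continuous_id)).enorm.measurable
  -- With a one-point space as target, Schur's test bounds the pairing for every `p` by the larger
  -- of the `L¹` and supremum norms of the kernel. The constant adds both bounds.
  have h := eLpNorm_lintegral_kernel_le (Measure.dirac ()) (volume : Measure (Space d))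
    (K := fun _ y => ‖𝓕 (localAtom Q φ g m j) (structuredLattice Q δ j (intVec k) - y)‖ₑ)
    (hm.comp measurable_snd) (A := (ENNReal.ofReal (Real.sqrt |(structuredLattice Q δ j).det|) +
        ENNReal.ofReal (Real.sqrt |(structuredLattice Q δ j).det|)⁻¹) * sampleNorm Q φ g δ m j)
    (fun _ => by
      rw [lintegral_sub_left_eq_self fun y => ‖𝓕 (localAtom Q φ g m j) y‖ₑ]
      refine (atomNorm_le_sampleNorm hδ m j).trans ?_
      gcongr
      exact le_self_add)
    (fun y => by
      rw [lintegral_const, measure_univ, mul_one]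
      refine (ENNReal.le_tsum (f := fun k => ‖𝓕 (localAtom Q φ g m j)
        (structuredLattice Q δ j (intVec k) - y)‖ₑ) k).trans
        ((tsum_enorm_fourier_localAtom_le hgs hδ m j y).trans ?_)
      gcongr
      exact le_add_self) hu hp
  rw [eLpNorm_const _ (zero_lt_one.trans_le hp).ne' (NeZero.ne _)] at h
  simpa using h

/-- Each `‖u_m‖` is at most a constant over `w_m`, and the weight ratio `w_j / w_m` is contained in
the adapted matrix, whose column sums are finite. -/
lemma coefBound_lt_top (hg : Integrable g) (hgs : ContDiff ℝ ∞ (𝓕 g))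
    (hδ : 0 < δ) (hw : ∀ i, 0 < w i) {u : J → Space d → ℂ} (hu : ∀ m, Continuous (u m))
    {p q : ℝ≥0∞} (hp : 1 ≤ p) (hq : 1 ≤ q)
    (hM : IsAdapted φ (structuredGenerator Q g) (structuredLattice Q δ) w w)
    (hN : lqNorm w q (fun m => eLpNorm (u m) p volume) < ⊤) (jk : J × (Fin d → ℤ)) :
    coefBound Q φ g δ u jk < ⊤ := by
  obtain ⟨j, k⟩ := jk
  have hq0 : q ≠ 0 := (zero_lt_one.trans_le hq).ne'
  set M := adaptedMatrix φ (structuredGenerator Q g) (structuredLattice Q δ) w w with hMdef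
  set N := lqNorm w q (fun m => eLpNorm (u m) p volume)
  set D := ENNReal.ofReal (Real.sqrt |(structuredLattice Q δ j).det|) +
        ENNReal.ofReal (Real.sqrt |(structuredLattice Q δ j).det|)⁻¹
  have h1 : ∀ m, sampleNorm Q φ g δ m j * eLpNorm (u m) p volume ≤
      ENNReal.ofReal (w j)⁻¹ * N * M m j := by
    intro m
    have hwm := hw m
    have hwj := hw j
    have h2 := le_lqNorm w hq0 (fun m => eLpNorm (u m) p volume) m
    rw [hMdef, adaptedMatrix_eq hg]
    calc sampleNorm Q φ g δ m j * eLpNorm (u m) p volume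
        = ENNReal.ofReal (w j)⁻¹ * (ENNReal.ofReal (w m) * eLpNorm (u m) p volume) *
          (ENNReal.ofReal (w j / w m) * sampleNorm Q φ g δ m j) := by
          have : ENNReal.ofReal (w j)⁻¹ * ENNReal.ofReal (w m) * ENNReal.ofReal (w j / w m) = 1 := by
            rw [← ENNReal.ofReal_mul (by positivity), ← ENNReal.ofReal_mul (by positivity)]
            have : (w j)⁻¹ * w m * (w j / w m) = 1 := by field_simp
            rw [this, ENNReal.ofReal_one]
          calc _ = (ENNReal.ofReal (w j)⁻¹ * ENNReal.ofReal (w m) * ENNReal.ofReal (w j / w m)) *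
              (sampleNorm Q φ g δ m j * eLpNorm (u m) p volume) := by rw [this, one_mul]
            _ = _ := by ring
      _ ≤ _ := by
          gcongr
          exact le_max_right _ _
  calc coefBound Q φ g δ u (j, k) ≤ ∑' m, D * (ENNReal.ofReal (w j)⁻¹ * N * M m j) := by
        refine ENNReal.tsum_le_tsum fun m => ?_
        refine (lintegral_fourier_localAtom_mul_le hgs hδ m j k (hu m).enorm.measurable hp).trans ?_
        rw [eLpNorm_enorm, mul_assoc]
        exact mul_le_mul_right (h1 m) _
    _ = D * (ENNReal.ofReal (w j)⁻¹ * N * ∑' m, M m j) := by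
        rw [ENNReal.tsum_mul_left, ENNReal.tsum_mul_left]
    _ < ⊤ := by
        refine ENNReal.mul_lt_top (ENNReal.add_lt_top.2 ⟨ENNReal.ofReal_lt_top,
          ENNReal.ofReal_lt_top⟩) (ENNReal.mul_lt_top (ENNReal.mul_lt_top ENNReal.ofReal_lt_top hN)
          (lt_of_le_of_lt ?_ hM))
        exact (le_iSup (fun j => ∑' i, M i j) j).trans (le_max_right _ _)

/-- On the support of `η` finitely many `φ_i` sum to one. Inserting them replaces `ĝ_j`, which need
not have compact support, by atoms, and the product becomes a convolution. -/
lemma enorm_fourier_generator_mul_le (hφ : Q.IsRegularPartitionOfUnity φ)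
    (hgs : ContDiff ℝ ∞ (𝓕 g)) (η : 𝓓(O, ℂ)) {I : Finset J}
    (hI : ∀ ξ, η ξ ≠ 0 → ∀ i, ξ ∈ Q.set i → i ∈ I) (j : J) (z : Space d) :
    ‖𝓕 (fun ξ => 𝓕 (structuredGenerator Q g j) ξ * η ξ) z‖ₑ ≤
      ∑ i ∈ I, ∫⁻ y, ‖𝓕 (localAtom Q φ g i j) (z - y)‖ₑ * ‖𝓕 (η : Space d → ℂ) y‖ₑ := by
  have h1 : (fun ξ => 𝓕 (structuredGenerator Q g j) ξ * η ξ) =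
      fun ξ => ∑ i ∈ I, localAtom Q φ g i j ξ * η ξ := by
    funext ξ
    simp only [localAtom, mul_assoc]
    rw [← Finset.sum_mul]
    by_cases hη : η ξ = 0
    · simp [hη]
    · have hξO : ξ ∈ O := η.tsupport_subset (subset_tsupport _ hη)
      rw [hφ.sum_eq_one hξO (hI ξ hη), one_mul]
  have hint : ∀ i, Integrable (localAtom Q φ g i j) := fun i =>
    (contDiff_localAtom hgs i j).continuous.integrable_of_hasCompactSupport
      (hasCompactSupport_localAtom i j)
  rw [h1, fourier_finsetSum]
  · refine (enorm_sum_le _ _).trans (Finset.sum_le_sum fun i _ => ?_)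
    exact enorm_fourier_mul_le (hint i) η.contDiff η.hasCompactSupport z
  · exact fun i _ => (((contDiff_localAtom hgs i j).continuous).mul
      η.continuous).integrable_of_hasCompactSupport (hasCompactSupport_localAtom i j).mul_right

/-- By Tonelli the pairing of the frame series with a test function is dominated by finitely many
pairings with `synthBound`, to which Hölder applies. This gives both unconditional convergence and
continuity of the sum. -/
lemma tsum_coefBound_mul_le [Countable J] (hφ : Q.IsRegularPartitionOfUnity φ)
    (hgs : ContDiff ℝ ∞ (𝓕 g)) (u : J → Space d → ℂ) (p q : ℝ≥0∞) [p.HolderConjugate q]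
    (η : 𝓓(O, ℂ)) {I : Finset J} (hI : ∀ ξ, η ξ ≠ 0 → ∀ i, ξ ∈ Q.set i → i ∈ I) :
    ∑' jk : J × (Fin d → ℤ), coefBound Q φ g δ u jk *
      ‖𝓕 (fun ξ => 𝓕 (structuredGenerator Q g jk.1) ξ * η ξ)
        (structuredLattice Q δ jk.1 (intVec jk.2))‖ₑ ≤
      (∑ i ∈ I, eLpNorm (synthBound Q φ g δ u i) p volume) *
        eLpNorm (𝓕 (η : Space d → ℂ)) q volume := by
  have hη : Measurable fun y => ‖𝓕 (η : Space d → ℂ) y‖ₑ :=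
    (continuous_fourier (η.continuous.integrable_of_hasCompactSupport
      η.hasCompactSupport)).enorm.measurable
  have hm : ∀ (i : J) (jk : J × (Fin d → ℤ)), Measurable fun y =>
      ‖𝓕 (localAtom Q φ g i jk.1) (structuredLattice Q δ jk.1 (intVec jk.2) - y)‖ₑ := fun i jk =>
    ((continuous_fourier_localAtom hgs i jk.1).comp
      (continuous_const.sub continuous_id)).enorm.measurable
  calc _ ≤ ∑' jk : J × (Fin d → ℤ), ∑ i ∈ I, ∫⁻ y, coefBound Q φ g δ u jk *
        ‖𝓕 (localAtom Q φ g i jk.1) (structuredLattice Q δ jk.1 (intVec jk.2) - y)‖ₑ *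
          ‖𝓕 (η : Space d → ℂ) y‖ₑ := by
        refine ENNReal.tsum_le_tsum fun jk => ?_
        have h1 : ∀ i, ∫⁻ y, coefBound Q φ g δ u jk * ‖𝓕 (localAtom Q φ g i jk.1)
            (structuredLattice Q δ jk.1 (intVec jk.2) - y)‖ₑ * ‖𝓕 (η : Space d → ℂ) y‖ₑ =
            coefBound Q φ g δ u jk * ∫⁻ y, ‖𝓕 (localAtom Q φ g i jk.1)
            (structuredLattice Q δ jk.1 (intVec jk.2) - y)‖ₑ * ‖𝓕 (η : Space d → ℂ) y‖ₑ := fun i => by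
          simp only [mul_assoc]
          exact lintegral_const_mul _ ((hm i jk).mul hη)
        rw [Finset.sum_congr rfl fun i _ => h1 i, ← Finset.mul_sum]
        gcongr
        exact enorm_fourier_generator_mul_le hφ hgs η hI jk.1 _
    _ = ∑ i ∈ I, ∫⁻ y, synthBound Q φ g δ u i y * ‖𝓕 (η : Space d → ℂ) y‖ₑ := by
        rw [Summable.tsum_finsetSum fun _ _ => ENNReal.summable]
        refine Finset.sum_congr rfl fun i _ => ?_
        rw [← lintegral_tsum (f := fun (jk : J × (Fin d → ℤ)) y => coefBound Q φ g δ u jk *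
          ‖𝓕 (localAtom Q φ g i jk.1) (structuredLattice Q δ jk.1 (intVec jk.2) - y)‖ₑ *
          ‖𝓕 (η : Space d → ℂ) y‖ₑ) fun jk => (((hm i jk).const_mul _).mul hη).aemeasurable]
        refine lintegral_congr fun y => ?_
        rw [ENNReal.tsum_mul_right]
        rfl
    _ ≤ ∑ i ∈ I, eLpNorm (synthBound Q φ g δ u i) p volume *
          eLpNorm (𝓕 (η : Space d → ℂ)) q volume := by
        refine Finset.sum_le_sum fun i _ => ?_
        have := lintegral_mul_le_eLpNorm volume (measurable_synthBound (Q := Q) (φ := φ) (δ := δ)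
          hgs u i).aemeasurable hη.aemeasurable p q
        rwa [eLpNorm_enorm] at this
    _ = _ := by rw [Finset.sum_mul]

end Coefficients

/-! ### Existence and boundedness of the frame operator -/

section FrameOperator

variable {d : ℕ} {J : Type*} {Q : AffineFamily d J} {O : Opens (Space d)} {φ : J → 𝓓(O, ℂ)}
  {g : Space d → ℂ} {w : J → ℝ} {δ : ℝ} {p q : ℝ≥0∞}

lemma eLpNorm_localPiece_lt_top (hw : ∀ i, 0 < w i) (hq : 1 ≤ q) {f : FourierDistribution O}
    (hf : decompNorm φ w p q f < ⊤) (l : J) :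
    eLpNorm (localPiece (φ l) f.fourier) p volume < ⊤ := lt_top_of_lqNorm_lt_top hw hq hf l

lemma lqNorm_clusterPiece_le (hQ : Q.IsAdmissibleCover O) (hw : ∀ i, 0 < w i) (hp : 1 ≤ p)
    (hq : 1 ≤ q) {f : FourierDistribution O} (hf : decompNorm φ w p q f < ⊤) :
    lqNorm w q (fun m => eLpNorm (clusterPiece hQ φ f.fourier m) p volume) ≤
      Q.clusteringNorm w q * decompNorm φ w p q f :=
  (lqNorm_mono w q fun m => eLpNorm_clusterPiece_le hQ f.fourier hp m).trans
    (lqNorm_cluster_le hQ hw hq hf)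

lemma lqNorm_clusterPiece_lt_top [Countable J] (hQ : Q.IsAdmissibleCover O) (hw : Q.IsModerate w)
    (hp : 1 ≤ p) (hq : 1 ≤ q) {f : FourierDistribution O} (hf : decompNorm φ w p q f < ⊤) :
    lqNorm w q (fun m => eLpNorm (clusterPiece hQ φ f.fourier m) p volume) < ⊤ :=
  (lqNorm_clusterPiece_le hQ hw.1 hp hq hf).trans_lt
    (ENNReal.mul_lt_top (clusteringNorm_lt_top hQ hw hq) hf)

lemma tsum_enorm_extPairingTerm_le (hQ : Q.IsAdmissibleCover O)
    (hφ : Q.IsRegularPartitionOfUnity φ) (hgs : ContDiff ℝ ∞ (𝓕 g)) {f : FourierDistribution O}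
    (hp : 1 ≤ p) (hf : ∀ l, eLpNorm (localPiece (φ l) f.fourier) p volume < ⊤)
    (jk : J × (Fin d → ℤ)) :
    ∑' m, ‖extPairingTerm φ f (translate (structuredLattice Q δ jk.1 (intVec jk.2))
      (structuredGenerator Q g jk.1)) m‖ₑ ≤
      coefBound Q φ g δ (clusterPiece hQ φ f.fourier) jk :=
  ENNReal.tsum_le_tsum fun m => enorm_extPairingTerm_le hQ hφ hgs f hp hf _ m jk.1

/-- The frame operator is well defined. -/
theorem exists_isFrameSum [Countable J] (hQ : Q.IsAdmissibleCover O)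
    (hQo : ∀ i, IsOpen (Q.Q' i)) (hφ : Q.IsRegularPartitionOfUnity φ)
    (hw : Q.IsModerate w) (hg : Integrable g) (hgs : ContDiff ℝ ∞ (𝓕 g)) (hδ : 0 < δ)
    (hM : IsAdapted φ (structuredGenerator Q g) (structuredLattice Q δ) w w)
    (hp : 1 ≤ p) (hq : 1 ≤ q) {f : FourierDistribution O} (hf : decompNorm φ w p q f < ⊤) :
    ∃ s, IsFrameSum φ (structuredGenerator Q g) (structuredLattice Q δ) f s := by
  set u := clusterPiece hQ φ f.fourier with hu
  have huc : ∀ m, Continuous (u m) := continuous_clusterPiece hQ f.fourier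
  have hfl := eLpNorm_localPiece_lt_top hw.1 hq hf
  have hcb := fun jk => tsum_enorm_extPairingTerm_le (δ := δ) hQ hφ hgs hp hfl jk
  have hN := lqNorm_clusterPiece_lt_top hQ hw hp hq hf
  have hct := coefBound_lt_top hg hgs hδ hw.1 huc hp hq hM hN
  have hsyn : ∀ i, eLpNorm (synthBound Q φ g δ u i) p volume < ⊤ :=
    lt_top_of_lqNorm_lt_top hw.1 hq ((lqNorm_synthBound_le hg hgs hδ hw.1 huc hp hq).trans_lt
      (ENNReal.mul_lt_top (ENNReal.pow_lt_top hM) hN))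
  have := ENNReal.HolderConjugate.conjExponent hp
  obtain ⟨s, hs⟩ := exists_distribution_hasSum (O := O) (fun jk : J × (Fin d → ℤ) =>
    (extPairing φ f (translate (structuredLattice Q δ jk.1 (intVec jk.2))
      (structuredGenerator Q g jk.1))) • pairingLM O (integrable_translate
        (integrable_structuredGenerator Q hg jk.1) (structuredLattice Q δ jk.1 (intVec jk.2))))
    (q := ENNReal.conjExponent p) (ENNReal.HolderConjugate.one_le _ p) fun K hK => by
      refine ⟨∑ i ∈ (hQ.finite_meet hQo K.isCompact hK).toFinset,
        eLpNorm (synthBound Q φ g δ u i) p volume, ENNReal.sum_ne_top.2 fun i _ => (hsyn i).ne,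
        fun η hη => ?_⟩
      refine le_trans (ENNReal.tsum_le_tsum fun jk => ?_)
        (tsum_coefBound_mul_le (δ := δ) hφ hgs u p (ENNReal.conjExponent p) η fun ξ hξ i hi =>
          (hQ.finite_meet hQo K.isCompact hK).mem_toFinset.2
            ⟨ξ, hi, hη (subset_tsupport _ hξ)⟩)
      rw [LinearMap.smul_apply, smul_eq_mul, enorm_mul]
      refine mul_le_mul' (enorm_tsum_le_tsum_enorm.trans (hcb jk)) (le_of_eq ?_)
      rw [← functionPairing_translate (integrable_structuredGenerator Q hg jk.1)]
      rfl
  refine ⟨s, fun j k => summable_norm_of_tsum_enorm_lt_top ((hcb (j, k)).trans_lt (hct (j, k))),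
    fun ψ => ?_⟩
  obtain ⟨η, rfl⟩ := fourierToZ_surjective ψ
  exact hs η

lemma fourier_generator_mul_localTest (i j : J) (x z : Space d) :
    𝓕 (fun ξ => 𝓕 (structuredGenerator Q g j) ξ *
      mulSmooth (φ i) (character x) (contDiff_character x) ξ) z = 𝓕 (localAtom Q φ g i j) (z - x) := by
  rw [← fourier_mul_character]
  refine congrArg (fun h : Space d → ℂ => 𝓕 h z) (funext fun ξ => ?_)
  change _ * (φ i ξ * character x ξ) = _
  rw [localAtom]
  ring

/-- The frame operator is bounded. -/
theorem decompNorm_frameSum_le [Countable J] (hQ : Q.IsAdmissibleCover O)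
    (hφ : Q.IsRegularPartitionOfUnity φ)
    (hw : Q.IsModerate w) (hg : Integrable g) (hgs : ContDiff ℝ ∞ (𝓕 g)) (hδ : 0 < δ)
    (hp : 1 ≤ p) (hq : 1 ≤ q) {f s : FourierDistribution O} (hf : decompNorm φ w p q f < ⊤)
    (hs : IsFrameSum φ (structuredGenerator Q g) (structuredLattice Q δ) f s) :
    decompNorm φ w p q s ≤ schurNorm (adaptedMatrix φ (structuredGenerator Q g)
      (structuredLattice Q δ) w w) ^ 2 * Q.clusteringNorm w q * decompNorm φ w p q f := by
  set u := clusterPiece hQ φ f.fourier with hu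
  have huc : ∀ m, Continuous (u m) := continuous_clusterPiece hQ f.fourier
  have hfl := eLpNorm_localPiece_lt_top hw.1 hq hf
  have hcb := fun jk => tsum_enorm_extPairingTerm_le (δ := δ) hQ hφ hgs hp hfl jk
  -- A local piece is the value of the distribution at the test function `φ_i · character x`, whose
  -- pairing with a translate is a shifted sample of the transformed atom.
  have key : ∀ i x, ‖localPiece (φ i) s.fourier x‖ₑ ≤ synthBound Q φ g δ u i x := by
    intro i x
    rw [localPiece, FourierDistribution.fourier_apply, ← (hs.2 _).tsum_eq]
    refine enorm_tsum_le_tsum_enorm.trans (ENNReal.tsum_le_tsum fun jk => ?_)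
    rw [enorm_mul, functionPairing_translate (integrable_structuredGenerator Q hg jk.1),
      fourier_generator_mul_localTest]
    gcongr
    exact enorm_tsum_le_tsum_enorm.trans (hcb jk)
  calc decompNorm φ w p q s
      ≤ lqNorm w q fun i => eLpNorm (synthBound Q φ g δ u i) p volume := by
        refine lqNorm_mono w q fun i => eLpNorm_mono_enorm fun x => ?_
        rw [enorm_eq_self]
        exact key i x
    _ ≤ _ := lqNorm_synthBound_le hg hgs hδ hw.1 huc hp hq
    _ ≤ _ := by
        rw [mul_assoc]
        gcongr
        exact lqNorm_clusterPiece_le hQ hw.1 hp hq hf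

end FrameOperator

/-! ### Pairings with convolutions -/

section ConvolutionPairing

variable {d : ℕ} {O : Opens (Space d)} {χ u : Space d → ℂ} {p : ℝ≥0∞}

lemma lintegral_enorm_fourier_mul_le {v : Space d → ℂ} (hχ : Integrable χ) (hv : ContDiff ℝ ∞ v)
    (hc : HasCompactSupport v) :
    ∫⁻ z, ‖𝓕 (fun ξ => χ ξ * v ξ) z‖ₑ ≤ (∫⁻ z, ‖𝓕 χ z‖ₑ) * ∫⁻ z, ‖𝓕 v z‖ₑ := by
  have hm1 : Measurable fun z => ‖𝓕 χ z‖ₑ := (continuous_fourier hχ).enorm.measurable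
  have hm2 : Measurable fun z => ‖𝓕 v z‖ₑ :=
    (continuous_fourier (hv.continuous.integrable_of_hasCompactSupport hc)).enorm.measurable
  refine (lintegral_mono fun z => enorm_fourier_mul_le hχ hv hc z).trans (le_of_eq ?_)
  rw [lintegral_lintegral_swap (((hm1.comp (measurable_fst.sub measurable_snd)).mul
    (hm2.comp measurable_snd)).aemeasurable)]
  have h1 : ∀ y, ∫⁻ z, ‖𝓕 χ (z - y)‖ₑ * ‖𝓕 v y‖ₑ = (∫⁻ z, ‖𝓕 χ z‖ₑ) * ‖𝓕 v y‖ₑ := fun y => by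
    have h2 : Measurable fun z => ‖𝓕 χ (z - y)‖ₑ := hm1.comp (measurable_id.sub_const y)
    rw [lintegral_mul_const _ h2,
      lintegral_sub_right_eq_self fun z => ‖𝓕 χ z‖ₑ]
  simp_rw [h1]
  rw [lintegral_const_mul _ hm2]

lemma lintegral_lintegral_conv_le (hχ : Integrable χ) (hu : Continuous u) (hp : 1 ≤ p)
    {h : Space d → ℂ} (hh : Continuous h) :
    ∫⁻ x, ∫⁻ y, ‖𝓕⁻ χ (x - y) * u y * h x‖ₑ ≤
      (∫⁻ z, ‖𝓕 χ z‖ₑ) * (eLpNorm u p volume * eLpNorm h (ENNReal.conjExponent p) volume) := by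
  have := ENNReal.HolderConjugate.conjExponent hp
  have hm1 : Measurable fun z => ‖𝓕⁻ χ z‖ₑ := by
    simp_rw [fourierInv_eq_fourier_neg_apply]
    exact ((continuous_fourier hχ).comp continuous_neg).enorm.measurable
  have h1 := lintegral_lintegral_kernel_le (volume : Measure (Space d)) (volume : Measure (Space d))
    (K := fun x y => ‖𝓕⁻ χ (x - y)‖ₑ) (hm1.comp (measurable_fst.sub measurable_snd))
    (A := ∫⁻ z, ‖𝓕 χ z‖ₑ)
    (fun x => by
      rw [lintegral_sub_left_eq_self fun y => ‖𝓕⁻ χ y‖ₑ, lintegral_enorm_fourierInv])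
    (fun y => by
      rw [lintegral_sub_right_eq_self fun y => ‖𝓕⁻ χ y‖ₑ, lintegral_enorm_fourierInv])
    (f := fun x => ‖h x‖ₑ) hh.enorm.measurable (g := fun y => ‖u y‖ₑ) hu.enorm.measurable
    (ENNReal.conjExponent p) p
  rw [eLpNorm_enorm, eLpNorm_enorm, mul_comm (eLpNorm h _ _)] at h1
  refine le_trans (le_of_eq (lintegral_congr fun x => ?_)) h1
  have h2 : Measurable fun y => ‖𝓕⁻ χ (x - y)‖ₑ * ‖u y‖ₑ :=
    (hm1.comp (measurable_const.sub measurable_id)).mul hu.enorm.measurable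
  rw [← lintegral_const_mul _ h2]
  refine lintegral_congr fun y => ?_
  rw [enorm_mul, enorm_mul, mul_comm]

lemma functionPairing_conv_eq_integral_integral (η : 𝓓(O, ℂ)) :
    functionPairing (conv (𝓕⁻ χ) u) (fourierToZ O η) =
      ∫ x, ∫ y, 𝓕⁻ χ (x - y) * u y * 𝓕 (η : Space d → ℂ) x := by
  unfold functionPairing
  rw [fourierToZ_fn]
  congr with x
  rw [integral_mul_const, conv, convolution_def]
  congr 1
  rw [← integral_sub_left_eq_self _ volume x]
  congr with y
  simp

lemma integrable_conv_kernel (hχ : Integrable χ) (hχ1 : ∫⁻ z, ‖𝓕 χ z‖ₑ < ⊤) (hu : Continuous u)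
    (hp : 1 ≤ p) (hup : eLpNorm u p volume < ⊤) (η : 𝓓(O, ℂ)) :
    Integrable (fun z : Space d × Space d => 𝓕⁻ χ (z.1 - z.2) * u z.2 * 𝓕 (η : Space d → ℂ) z.1)
      (volume.prod volume) := by
  have := ENNReal.HolderConjugate.conjExponent hp
  have hη := continuous_fourier (η.continuous.integrable_of_hasCompactSupport (μ := volume)
    η.hasCompactSupport)
  have hc : Continuous (𝓕⁻ χ) := by
    rw [funext (fourierInv_eq_fourier_neg_apply χ)]
    exact (continuous_fourier hχ).comp continuous_neg
  have hm : Continuous fun z : Space d × Space d =>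
      𝓕⁻ χ (z.1 - z.2) * u z.2 * 𝓕 (η : Space d → ℂ) z.1 :=
    ((hc.comp (continuous_fst.sub continuous_snd)).mul (hu.comp continuous_snd)).mul
      (hη.comp continuous_fst)
  refine ⟨hm.aestronglyMeasurable, ?_⟩
  rw [hasFiniteIntegral_iff_enorm, lintegral_prod _ hm.enorm.measurable.aemeasurable]
  exact (lintegral_lintegral_conv_le hχ hu hp hη).trans_lt (ENNReal.mul_lt_top hχ1
    (ENNReal.mul_lt_top hup (eLpNorm_fourier_lt_top η.contDiff η.hasCompactSupport
      (ENNReal.HolderConjugate.one_le _ p))))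

/-- The pairing with a convolution, as a functional on the test functions. -/
def convPairingLM (O : Opens (Space d)) (hχ : Integrable χ) (hχ1 : ∫⁻ z, ‖𝓕 χ z‖ₑ < ⊤)
    (hu : Continuous u) (hp : 1 ≤ p) (hup : eLpNorm u p volume < ⊤) : 𝓓(O, ℂ) →ₗ[ℂ] ℂ where
  toFun η := functionPairing (conv (𝓕⁻ χ) u) (fourierToZ O η)
  map_add' η θ := by
    have h := fun η : 𝓓(O, ℂ) => (integrable_conv_kernel hχ hχ1 hu hp hup η).integral_prod_left
    have h' : ∀ η : 𝓓(O, ℂ), Integrable fun x =>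
        conv (𝓕⁻ χ) u x * (fourierToZ O η).fn x := fun η => by
      refine (h η).congr (Filter.Eventually.of_forall fun x => ?_)
      simp only [fourierToZ_fn]
      rw [integral_mul_const, conv, convolution_def, ← integral_sub_left_eq_self _ volume x]
      simp
    unfold functionPairing
    rw [← integral_add (h' η) (h' θ)]
    congr with x
    rw [map_add]
    exact mul_add _ _ _
  map_smul' c η := by
    unfold functionPairing
    rw [RingHom.id_apply, smul_eq_mul, ← integral_const_mul]
    congr with x
    rw [map_smul]
    exact mul_left_comm _ _ _

lemma enorm_functionPairing_conv_le (hχ : Integrable χ) (hu : Continuous u) (hp : 1 ≤ p)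
    (η : 𝓓(O, ℂ)) : ‖functionPairing (conv (𝓕⁻ χ) u) (fourierToZ O η)‖ₑ ≤
      (∫⁻ z, ‖𝓕 χ z‖ₑ) * (eLpNorm u p volume *
        eLpNorm (𝓕 (η : Space d → ℂ)) (ENNReal.conjExponent p) volume) := by
  rw [functionPairing_conv_eq_integral_integral]
  refine (enorm_integral_le_lintegral_enorm _).trans ((lintegral_mono fun x =>
    enorm_integral_le_lintegral_enorm _).trans ?_)
  exact lintegral_lintegral_conv_le hχ hu hp (continuous_fourier
    (η.continuous.integrable_of_hasCompactSupport η.hasCompactSupport))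

/-- Fubini moves the convolution to the other factor, where it becomes the Fourier transform of the
product `χ η`. -/
lemma functionPairing_conv (hχ : Integrable χ) (hχ1 : ∫⁻ z, ‖𝓕 χ z‖ₑ < ⊤) (hu : Continuous u)
    (hp : 1 ≤ p) (hup : eLpNorm u p volume < ⊤) (η : 𝓓(O, ℂ)) :
    functionPairing (conv (𝓕⁻ χ) u) (fourierToZ O η) =
      ∫ y, u y * 𝓕 (fun ξ => χ ξ * η ξ) y := by
  rw [functionPairing_conv_eq_integral_integral,
    integral_integral_swap (integrable_conv_kernel hχ hχ1 hu hp hup η)]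
  congr with y
  rw [fourier_mul_eq hχ η.contDiff η.hasCompactSupport, ← integral_const_mul]
  congr with x
  rw [fourierInv_eq_fourier_neg_apply, neg_sub]
  ring

end ConvolutionPairing

/-! ### Fourier multipliers with tame symbols -/

section Multipliers

variable {d : ℕ} {J : Type*} {Q : AffineFamily d J} {O : Opens (Space d)} {φ : J → 𝓓(O, ℂ)}
  {h : Space d → ℂ} {w : J → ℝ} {p q : ℝ≥0∞}

lemma continuous_mul_of_continuousOn (hh : ContinuousOn h O) (η : 𝓓(O, ℂ)) :
    Continuous fun ξ => η ξ * h ξ := by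
  rw [continuous_iff_continuousAt]
  intro ξ
  by_cases hξ : ξ ∈ O
  · exact η.continuous.continuousAt.mul (hh.continuousAt (O.isOpen.mem_nhds hξ))
  · have h1 : ξ ∉ tsupport η := fun h => hξ (η.tsupport_subset h)
    have h2 : (fun ξ => η ξ * h ξ) =ᶠ[𝓝 ξ] fun _ => 0 := by
      filter_upwards [notMem_tsupport_iff_eventuallyEq.1 h1] with ξ hξ
      rw [hξ, Pi.zero_apply, zero_mul]
    exact continuousAt_const.congr h2.symm

lemma integrable_mul_of_continuousOn (hh : ContinuousOn h O) (η : 𝓓(O, ℂ)) :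
    Integrable fun ξ => η ξ * h ξ :=
  (continuous_mul_of_continuousOn hh η).integrable_of_hasCompactSupport η.hasCompactSupport.mul_right

lemma clusterSum_mul_eq (hQ : Q.IsAdmissibleCover O) (φ : J → 𝓓(O, ℂ)) (h : Space d → ℂ) (l : J) :
    (fun ξ => Q.clusterSum φ l ξ * h ξ) = fun ξ => ∑ m ∈ hQ.clusterFinset l, φ m ξ * h ξ := by
  funext ξ
  rw [hQ.clusterSum_eq, Finset.sum_mul]

lemma integrable_clusterSum_mul (hQ : Q.IsAdmissibleCover O) (hh : ContinuousOn h O) (l : J) :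
    Integrable fun ξ => Q.clusterSum φ l ξ * h ξ := by
  rw [clusterSum_mul_eq hQ]
  exact integrable_finsetSum _ fun m _ => integrable_mul_of_continuousOn hh (φ m)

lemma lintegral_fourier_clusterSum_mul_le (hQ : Q.IsAdmissibleCover O) (hh : ContinuousOn h O)
    (l : J) : ∫⁻ z, ‖𝓕 (fun ξ => Q.clusterSum φ l ξ * h ξ) z‖ₑ ≤
      (hQ.clusterFinset l).card * ⨆ i, eLpNorm (𝓕⁻ (fun ξ => φ i ξ * h ξ)) 1 volume := by
  rw [clusterSum_mul_eq hQ]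
  have h1 : ∀ z, ‖𝓕 (fun ξ => ∑ m ∈ hQ.clusterFinset l, φ m ξ * h ξ) z‖ₑ ≤
      ∑ m ∈ hQ.clusterFinset l, ‖𝓕 (fun ξ => φ m ξ * h ξ) z‖ₑ := fun z => by
    rw [fourier_finsetSum _ fun m _ => integrable_mul_of_continuousOn hh (φ m)]
    exact enorm_sum_le _ _
  refine (lintegral_mono h1).trans ?_
  rw [lintegral_finsetSum _ fun m _ =>
    (continuous_fourier (integrable_mul_of_continuousOn hh (φ m))).enorm.measurable,
    ← nsmul_eq_mul, ← Finset.sum_const]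
  refine Finset.sum_le_sum fun m _ => ?_
  rw [← lintegral_enorm_fourierInv, ← eLpNorm_one_eq_lintegral_enorm]
  exact le_iSup (fun i => eLpNorm (𝓕⁻ (fun ξ => φ i ξ * h ξ)) 1 volume) m

lemma lintegral_fourier_clusterSum_mul_lt_top (hQ : Q.IsAdmissibleCover O) (hh : IsTame φ h)
    (l : J) : ∫⁻ z, ‖𝓕 (fun ξ => Q.clusterSum φ l ξ * h ξ) z‖ₑ < ⊤ :=
  (lintegral_fourier_clusterSum_mul_le hQ hh.1 l).trans_lt
    (ENNReal.mul_lt_top (ENNReal.natCast_lt_top _) hh.2)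

open Classical in
/-- The indices `ℓ ∈ ⋃_{m ∈ I} m^*`. -/
def AffineFamily.IsAdmissibleCover.clusterUnion (hQ : Q.IsAdmissibleCover O) (I : Finset J) :
    Finset J := I.biUnion hQ.clusterFinset

lemma AffineFamily.IsAdmissibleCover.mem_clusterUnion (hQ : Q.IsAdmissibleCover O) {I : Finset J}
    {l : J} : l ∈ hQ.clusterUnion I ↔ ∃ m ∈ I, l ∈ hQ.clusterFinset m := by
  classical
  exact Finset.mem_biUnion

lemma AffineFamily.IsAdmissibleCover.sum_clusterUnion_le (hQ : Q.IsAdmissibleCover O)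
    (I : Finset J) (a : J → ℝ≥0∞) :
    ∑ l ∈ hQ.clusterUnion I, a l ≤ ∑ m ∈ I, ∑ l ∈ hQ.clusterFinset m, a l := by
  classical
  induction I using Finset.induction_on with
  | empty => simp [clusterUnion]
  | insert m I hm ih =>
    rw [Finset.sum_insert hm]
    refine le_trans ?_ (add_le_add_right ih _)
    unfold clusterUnion
    rw [Finset.biUnion_insert, ← Finset.sum_union_inter]
    exact le_self_add

/-- If `φ_l^*` is nonzero at a point of the support of `η`, some `φ_m` with `m ∈ l^*` is nonzero
there; then `m ∈ I`, and by symmetry `l ∈ m^*`. So the multiplier series is finite on every test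
function. -/
lemma clusterSum_mul_eq_zero (hQ : Q.IsAdmissibleCover O) (hφ : Q.IsRegularPartitionOfUnity φ)
    (η : Space d → ℂ) {I : Finset J} (hI : ∀ ξ, η ξ ≠ 0 → ∀ i, ξ ∈ Q.set i → i ∈ I) {l : J}
    (hl : l ∉ hQ.clusterUnion I) (ξ : Space d) : Q.clusterSum φ l ξ * η ξ = 0 := by
  by_contra h0
  have h1 := left_ne_zero_of_mul h0
  rw [hQ.clusterSum_eq] at h1
  obtain ⟨m, hm, hmξ⟩ := Finset.exists_ne_zero_of_sum_ne_zero h1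
  have h2 : ξ ∈ Q.set m := by
    by_contra h
    exact hmξ (hφ.eq_zero_of_notMem m h)
  refine hl ?_
  refine hQ.mem_clusterUnion.2 ⟨m, hI ξ (right_ne_zero_of_mul h0) m h2, ?_⟩
  rw [hQ.mem_clusterFinset, AffineFamily.mem_cluster_comm, ← hQ.mem_clusterFinset]
  exact hm

lemma fourier_zero_fun (z : Space d) : 𝓕 (fun _ : Space d => (0 : ℂ)) z = 0 := by
  rw [fourier_eq_integral_character]
  simp

lemma multiplierTerm_eq (hQ : Q.IsAdmissibleCover O) (hh : IsTame φ h) {f : FourierDistribution O}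
    (hp : 1 ≤ p) (hf : ∀ l, eLpNorm (localPiece (φ l) f.fourier) p volume < ⊤) (η : 𝓓(O, ℂ))
    (l : J) : functionPairing (conv (𝓕⁻ (fun ξ => Q.clusterSum φ l ξ * h ξ))
      (localPiece (φ l) f.fourier)) (fourierToZ O η) =
      ∫ y, localPiece (φ l) f.fourier y * 𝓕 (fun ξ => Q.clusterSum φ l ξ * h ξ * η ξ) y :=
  functionPairing_conv (integrable_clusterSum_mul hQ hh.1 l)
    (lintegral_fourier_clusterSum_mul_lt_top hQ hh l) (continuous_localPiece _ _) hp (hf l) η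

lemma multiplierTerm_eq_zero (hQ : Q.IsAdmissibleCover O) (hφ : Q.IsRegularPartitionOfUnity φ)
    (hh : IsTame φ h) {f : FourierDistribution O}
    (hp : 1 ≤ p) (hf : ∀ l, eLpNorm (localPiece (φ l) f.fourier) p volume < ⊤) (η : 𝓓(O, ℂ))
    {I : Finset J} (hI : ∀ ξ, η ξ ≠ 0 → ∀ i, ξ ∈ Q.set i → i ∈ I) {l : J}
    (hl : l ∉ hQ.clusterUnion I) :
    functionPairing (conv (𝓕⁻ (fun ξ => Q.clusterSum φ l ξ * h ξ))
      (localPiece (φ l) f.fourier)) (fourierToZ O η) = 0 := by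
  have h1 : (fun ξ => Q.clusterSum φ l ξ * h ξ * η ξ) = fun _ => 0 := by
    funext ξ
    rw [mul_right_comm, clusterSum_mul_eq_zero hQ hφ η hI hl, zero_mul]
  rw [multiplierTerm_eq hQ hh hp hf, h1]
  simp [fourier_zero_fun]

/-- The Fourier multiplier is well defined. -/
theorem exists_isMultiplierSum (hQ : Q.IsAdmissibleCover O)
    (hQo : ∀ i, IsOpen (Q.Q' i)) (hφ : Q.IsRegularPartitionOfUnity φ) (hh : IsTame φ h)
    (hw : ∀ i, 0 < w i) (hp : 1 ≤ p) (hq : 1 ≤ q) {f : FourierDistribution O}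
    (hf : decompNorm φ w p q f < ⊤) : ∃ t, IsMultiplierSum Q φ h f t := by
  have hfl := eLpNorm_localPiece_lt_top hw hq hf
  have := ENNReal.HolderConjugate.conjExponent hp
  obtain ⟨t, ht⟩ := exists_distribution_hasSum (O := O) (fun l : J =>
    convPairingLM O (integrable_clusterSum_mul (φ := φ) hQ hh.1 l)
      (lintegral_fourier_clusterSum_mul_lt_top hQ hh l) (continuous_localPiece (φ l) f.fourier) hp
      (hfl l)) (q := ENNReal.conjExponent p) (ENNReal.HolderConjugate.one_le _ p) fun K hK => by
    refine ⟨∑ l ∈ hQ.clusterUnion (hQ.finite_meet hQo K.isCompact hK).toFinset,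
      (∫⁻ z, ‖𝓕 (fun ξ => Q.clusterSum φ l ξ * h ξ) z‖ₑ) *
        eLpNorm (localPiece (φ l) f.fourier) p volume,
      ENNReal.sum_ne_top.2 fun l _ => (ENNReal.mul_lt_top
        (lintegral_fourier_clusterSum_mul_lt_top hQ hh l) (hfl l)).ne, fun η hη => ?_⟩
    rw [tsum_eq_sum (s := hQ.clusterUnion (hQ.finite_meet hQo K.isCompact hK).toFinset)
      fun l hl => ?_, Finset.sum_mul]
    · refine Finset.sum_le_sum fun l _ => ?_
      rw [mul_assoc]
      exact enorm_functionPairing_conv_le (integrable_clusterSum_mul hQ hh.1 l)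
        (continuous_localPiece (φ l) f.fourier) hp η
    · rw [enorm_eq_zero]
      exact multiplierTerm_eq_zero hQ hφ hh hp hfl η (fun ξ hξ i hi =>
          (hQ.finite_meet hQo K.isCompact hK).mem_toFinset.2
            ⟨ξ, hi, hη (subset_tsupport _ hξ)⟩) hl
  refine ⟨t, fun ψ => ?_⟩
  obtain ⟨η, rfl⟩ := fourierToZ_surjective ψ
  exact ht η

lemma eq_sum_multiplierTerm (hQ : Q.IsAdmissibleCover O) (hφ : Q.IsRegularPartitionOfUnity φ)
    (hh : IsTame φ h) {f t : FourierDistribution O} (hp : 1 ≤ p)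
    (hf : ∀ l, eLpNorm (localPiece (φ l) f.fourier) p volume < ⊤)
    (ht : IsMultiplierSum Q φ h f t) (η : 𝓓(O, ℂ)) {I : Finset J}
    (hI : ∀ ξ, η ξ ≠ 0 → ∀ i, ξ ∈ Q.set i → i ∈ I) :
    t (fourierToZ O η) = ∑ l ∈ hQ.clusterUnion I,
      ∫ y, localPiece (φ l) f.fourier y * 𝓕 (fun ξ => Q.clusterSum φ l ξ * h ξ * η ξ) y := by
  refine (ht (fourierToZ O η)).unique ?_
  simp_rw [← multiplierTerm_eq hQ hh hp hf]
  exact hasSum_sum_of_ne_finset_zero fun l hl => multiplierTerm_eq_zero hQ hφ hh hp hf η hI hl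

/-- The test functions which define the local pieces vanish off the sets of the cover. -/
lemma mem_clusterFinset_of_localTest (hQ : Q.IsAdmissibleCover O)
    (hφ : Q.IsRegularPartitionOfUnity φ) (i : J) (x ξ : Space d)
    (hξ : mulSmooth (φ i) (character x) (contDiff_character x) ξ ≠ 0) (l : J) (hl : ξ ∈ Q.set l) :
    l ∈ hQ.clusterFinset i := by
  have h1 : ξ ∈ Q.set i := by
    by_contra h
    refine hξ ?_
    change φ i ξ * _ = 0
    rw [hφ.eq_zero_of_notMem i h, zero_mul]
  exact hQ.mem_clusterFinset.2 ⟨ξ, hl, h1⟩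

/-- The Fourier multiplier is bounded. -/
theorem exists_decompNorm_multiplier_le [Countable J] (hd : 1 ≤ d) (hQ : Q.IsAdmissibleCover O)
    (hQo : ∀ i, IsOpen (Q.Q' i)) (hR : Q.R < ⊤) (hφ : Q.IsRegularPartitionOfUnity φ)
    (hh : IsTame φ h) (hw : Q.IsModerate w) (hp : 1 ≤ p) (hq : 1 ≤ q) :
    ∃ c : ℝ≥0∞, c < ⊤ ∧ ∀ f t : FourierDistribution O, decompNorm φ w p q f < ⊤ →
      IsMultiplierSum Q φ h f t → decompNorm φ w p q t ≤ c * decompNorm φ w p q f := by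
  obtain ⟨N, hN⟩ := hQ.exists_card_le
  set τ := ⨆ i, eLpNorm (𝓕⁻ (fun ξ => φ i ξ * h ξ)) 1 volume
  -- At most `N` terms `φ_m h` make up `φ_l^* h`, each with Fourier transform of `L¹` norm at most
  -- `τ`; multiplication by `φ_i` convolves with a kernel of norm at most `C_Φ`.
  set B := N * τ * partitionL1Const φ with hB
  have hBt : B < ⊤ := ENNReal.mul_lt_top (ENNReal.mul_lt_top (ENNReal.natCast_lt_top _) hh.2)
    (partitionL1Const_lt_top hd hφ hQo hR)
  have hq0 : q ≠ 0 := (zero_lt_one.trans_le hq).ne'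
  have hΓ := clusteringNorm_lt_top hQ hw hq
  -- The piece with index `i` of the result involves the pieces of the clusters of all members of
  -- `i^*`, whence two applications of `Γ_Q`.
  refine ⟨B * (Q.clusteringNorm w q * Q.clusteringNorm w q),
    ENNReal.mul_lt_top hBt (ENNReal.mul_lt_top hΓ hΓ), fun f t hf ht => ?_⟩
  have hfl := eLpNorm_localPiece_lt_top hw.1 hq hf
  have hint : ∀ l i, Integrable fun ξ => Q.clusterSum φ l ξ * h ξ * φ i ξ := fun l i => by
    have hc : Continuous fun ξ => Q.clusterSum φ l ξ * h ξ * φ i ξ := by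
      have h1 : (fun ξ => Q.clusterSum φ l ξ * h ξ * φ i ξ) = fun ξ =>
          (∑ m ∈ hQ.clusterFinset l, φ m ξ) * (φ i ξ * h ξ) := by
        funext ξ
        rw [hQ.clusterSum_eq]
        ring
      rw [h1]
      exact (continuous_finsetSum _ fun m _ => (φ m).continuous).mul
        (continuous_mul_of_continuousOn hh.1 (φ i))
    exact hc.integrable_of_hasCompactSupport (φ i).hasCompactSupport.mul_left
  have hker : ∀ l i, ∫⁻ z, ‖𝓕 (fun ξ => Q.clusterSum φ l ξ * h ξ * φ i ξ) z‖ₑ ≤ B := fun l i => by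
    refine (lintegral_enorm_fourier_mul_le (integrable_clusterSum_mul hQ hh.1 l) (φ i).contDiff
      (φ i).hasCompactSupport).trans ?_
    refine mul_le_mul' ((lintegral_fourier_clusterSum_mul_le hQ hh.1 l).trans ?_) ?_
    · exact mul_le_mul_left (by exact_mod_cast hN l) _
    · rw [← lintegral_enorm_fourierInv, ← eLpNorm_one_eq_lintegral_enorm]
      exact le_iSup (fun i => eLpNorm (𝓕⁻ (φ i : Space d → ℂ)) 1 volume) i
  have hpt : ∀ i x, ‖localPiece (φ i) t.fourier x‖ₑ ≤
      ∑ l ∈ hQ.clusterUnion (hQ.clusterFinset i),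
        ∫⁻ y, ‖𝓕 (fun ξ => Q.clusterSum φ l ξ * h ξ * φ i ξ) (y - x)‖ₑ *
          ‖localPiece (φ l) f.fourier y‖ₑ := by
    intro i x
    rw [localPiece, FourierDistribution.fourier_apply, eq_sum_multiplierTerm hQ hφ hh hp hfl ht _
      (mem_clusterFinset_of_localTest hQ hφ i x)]
    refine (enorm_sum_le _ _).trans (Finset.sum_le_sum fun l _ => ?_)
    refine (enorm_integral_le_lintegral_enorm _).trans (le_of_eq (lintegral_congr fun y => ?_))
    rw [enorm_mul, mul_comm, ← fourier_mul_character]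
    congr 3
    refine congrArg (fun h : Space d → ℂ => 𝓕 h y) (funext fun ξ => ?_)
    exact (mul_assoc _ _ _).symm
  have hLp : ∀ i, eLpNorm (localPiece (φ i) t.fourier) p volume ≤
      B * ∑ m ∈ hQ.clusterFinset i, ∑ l ∈ hQ.clusterFinset m,
        eLpNorm (localPiece (φ l) f.fourier) p volume := by
    intro i
    have hm : ∀ l, Measurable fun x : Space d × Space d =>
        ‖𝓕 (fun ξ => Q.clusterSum φ l ξ * h ξ * φ i ξ) (x.2 - x.1)‖ₑ := fun l =>
      ((continuous_fourier (hint l i)).comp (continuous_snd.sub continuous_fst)).enorm.measurable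
    calc _ ≤ eLpNorm (∑ l ∈ hQ.clusterUnion (hQ.clusterFinset i), fun x =>
          ∫⁻ y, ‖𝓕 (fun ξ => Q.clusterSum φ l ξ * h ξ * φ i ξ) (y - x)‖ₑ *
            ‖localPiece (φ l) f.fourier y‖ₑ) p volume := by
          refine eLpNorm_mono_enorm fun x => ?_
          rw [enorm_eq_self, Finset.sum_apply]
          exact hpt i x
      _ ≤ ∑ l ∈ hQ.clusterUnion (hQ.clusterFinset i),
          B * eLpNorm (localPiece (φ l) f.fourier) p volume := by
          refine (eLpNorm_sum_le (fun l _ => ?_) hp).trans (Finset.sum_le_sum fun l _ => ?_)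
          · exact (Measurable.lintegral_prod_right ((hm l).mul
              ((continuous_localPiece (φ l) f.fourier).enorm.measurable.comp
                measurable_snd))).aestronglyMeasurable
          · have h1 := eLpNorm_lintegral_kernel_le (volume : Measure (Space d))
              (volume : Measure (Space d)) (K := fun x y =>
                ‖𝓕 (fun ξ => Q.clusterSum φ l ξ * h ξ * φ i ξ) (y - x)‖ₑ) (hm l) (A := B)
              (fun x => by
                rw [lintegral_sub_right_eq_self fun y =>
                  ‖𝓕 (fun ξ => Q.clusterSum φ l ξ * h ξ * φ i ξ) y‖ₑ]
                exact hker l i)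
              (fun y => by
                rw [lintegral_sub_left_eq_self fun y =>
                  ‖𝓕 (fun ξ => Q.clusterSum φ l ξ * h ξ * φ i ξ) y‖ₑ]
                exact hker l i)
              (continuous_localPiece (φ l) f.fourier).enorm.measurable hp
            rwa [eLpNorm_enorm] at h1
      _ ≤ _ := by
          rw [← Finset.mul_sum]
          gcongr
          exact hQ.sum_clusterUnion_le _ _
  calc decompNorm φ w p q t ≤ lqNorm w q (fun i => B * ∑ m ∈ hQ.clusterFinset i,
        ∑ l ∈ hQ.clusterFinset m, eLpNorm (localPiece (φ l) f.fourier) p volume) :=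
        lqNorm_mono w q hLp
    _ = B * lqNorm w q (fun i => ∑ m ∈ hQ.clusterFinset i,
        ∑ l ∈ hQ.clusterFinset m, eLpNorm (localPiece (φ l) f.fourier) p volume) :=
        lqNorm_const_mul w hq0 _ _
    _ ≤ B * (Q.clusteringNorm w q * (Q.clusteringNorm w q * decompNorm φ w p q f)) := by
        have h1 := lqNorm_cluster_le hQ hw.1 hq hf
        gcongr
        refine (lqNorm_cluster_le hQ hw.1 hq (h1.trans_lt (ENNReal.mul_lt_top hΓ hf))).trans ?_
        gcongr
        exact h1
    _ = _ := by ring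

end Multipliers

/-! ### The Walnut representation -/

section WalnutRepresentation

variable {d : ℕ} {θ κ u : Space d → ℂ} {D D' : Space d →L[ℝ] Space d} {p : ℝ≥0∞}

/-- Poisson summation for `κ` is applied at each `ξ` and integrated against `θ` times a character.
Summability of the samples of `𝓕 κ` justifies the interchange. -/
lemma tsum_fourier_mul_fourier_lattice (hd : 1 ≤ d) (hθ : Continuous θ) (hθc : HasCompactSupport θ)
    (hκ : ContDiff ℝ ∞ κ) (hκc : HasCompactSupport κ) (h : ∀ x, D' (D x) = x)
    (h' : ∀ x, D (D' x) = x)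
    (hsum : ∑' k : Fin d → ℤ, ‖𝓕 κ (ContinuousLinearMap.adjoint D' (intVec k))‖ₑ < ⊤)
    {F : Finset (Fin d → ℤ)} (hF : ∀ ξ, ∀ n ∉ F, θ ξ * κ (ξ - D (intVec n)) = 0) (y : Space d) :
    ∑' k : Fin d → ℤ, 𝓕 θ (y - ContinuousLinearMap.adjoint D' (intVec k)) *
      𝓕 κ (ContinuousLinearMap.adjoint D' (intVec k)) =
      (|D.det| : ℝ) * ∑ n ∈ F, 𝓕 (fun ξ => θ ξ * κ (ξ - D (intVec n))) y := by
  set C := ContinuousLinearMap.adjoint D' with hC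
  have hθi : Integrable θ := hθ.integrable_of_hasCompactSupport hθc
  have h1 : ∀ k : Fin d → ℤ, 𝓕 θ (y - C (intVec k)) * 𝓕 κ (C (intVec k)) =
      ∫ ξ, θ ξ * character (-y) ξ * (𝓕 κ (C (intVec k)) * character (C (intVec k)) ξ) := fun k => by
    rw [← fourier_mul_character, fourier_eq_integral_character, ← integral_mul_const]
    congr with ξ
    ring
  have hm : ∀ k : Fin d → ℤ, Continuous fun ξ =>
      θ ξ * character (-y) ξ * (𝓕 κ (C (intVec k)) * character (C (intVec k)) ξ) := fun k =>
    (hθ.mul (continuous_character _)).mul (continuous_const.mul (continuous_character _))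
  have he : ∀ x ξ : Space d, ‖character x ξ‖ₑ = 1 := fun x ξ => by
    rw [← ofReal_norm, norm_character, ENNReal.ofReal_one]
  simp_rw [h1]
  rw [← integral_tsum (fun k => (hm k).aestronglyMeasurable)]
  · have h2 : ∀ ξ, ∑' k : Fin d → ℤ,
        θ ξ * character (-y) ξ * (𝓕 κ (C (intVec k)) * character (C (intVec k)) ξ) =
        (|D.det| : ℝ) * (∑ n ∈ F, θ ξ * κ (ξ - D (intVec n))) * character (-y) ξ := fun ξ => by
      rw [((hasSum_fourier_lattice hd hκ hκc h h' ξ).mul_left _).tsum_eq]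
      have h3 : θ ξ * ∑' n : Fin d → ℤ, κ (ξ - D (intVec n)) =
          ∑ n ∈ F, θ ξ * κ (ξ - D (intVec n)) := by
        rw [← tsum_mul_left]
        exact tsum_eq_sum fun n hn => hF ξ n hn
      rw [← h3]
      ring
    have h4 : ∀ n : Fin d → ℤ, Integrable fun ξ => θ ξ * κ (ξ - D (intVec n)) := fun n =>
      (hθ.mul (hκ.continuous.comp (continuous_id.sub continuous_const))).integrable_of_hasCompactSupport
        hθc.mul_right
    simp_rw [h2, mul_assoc]
    rw [integral_const_mul, ← fourier_finsetSum F fun n _ => h4 n, fourier_eq_integral_character]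
  · have h5 : ∀ k : Fin d → ℤ, ∫⁻ ξ, ‖θ ξ * character (-y) ξ *
        (𝓕 κ (C (intVec k)) * character (C (intVec k)) ξ)‖ₑ =
        (∫⁻ ξ, ‖θ ξ‖ₑ) * ‖𝓕 κ (C (intVec k))‖ₑ := fun k => by
      simp_rw [enorm_mul, he, mul_one]
      rw [lintegral_mul_const _ hθ.enorm.measurable]
    simp_rw [h5]
    rw [ENNReal.tsum_mul_left]
    exact (ENNReal.mul_lt_top (hasFiniteIntegral_iff_enorm.1 hθi.2) hsum).ne

lemma eLpNorm_fourier_sub (hθ : Integrable θ) (q : ℝ≥0∞) (c : Space d) :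
    eLpNorm (fun y => 𝓕 θ (y - c)) q volume = eLpNorm (𝓕 θ) q volume :=
  eLpNorm_comp_measurePreserving (continuous_fourier hθ).aestronglyMeasurable
    (measurePreserving_sub_right volume c)

/-- The Walnut representation. -/
lemma tsum_integral_mul_fourier_lattice (hd : 1 ≤ d) (hθ : ContDiff ℝ ∞ θ)
    (hθc : HasCompactSupport θ) (hκ : ContDiff ℝ ∞ κ) (hκc : HasCompactSupport κ)
    (h : ∀ x, D' (D x) = x) (h' : ∀ x, D (D' x) = x)
    (hsum : ∑' k : Fin d → ℤ, ‖𝓕 κ (ContinuousLinearMap.adjoint D' (intVec k))‖ₑ < ⊤)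
    {F : Finset (Fin d → ℤ)} (hF : ∀ ξ, ∀ n ∉ F, θ ξ * κ (ξ - D (intVec n)) = 0)
    (hu : Continuous u) (hp : 1 ≤ p) (hup : eLpNorm u p volume < ⊤) :
    ∑' k : Fin d → ℤ, (∫ y, u y * 𝓕 θ (y - ContinuousLinearMap.adjoint D' (intVec k))) *
      𝓕 κ (ContinuousLinearMap.adjoint D' (intVec k)) =
      (|D.det| : ℝ) * ∑ n ∈ F, ∫ y, u y * 𝓕 (fun ξ => θ ξ * κ (ξ - D (intVec n))) y := by
  set C := ContinuousLinearMap.adjoint D' with hC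
  have := ENNReal.HolderConjugate.conjExponent hp
  have hθi : Integrable θ := hθ.continuous.integrable_of_hasCompactSupport hθc
  have hFθ := continuous_fourier hθi
  have hm : ∀ k : Fin d → ℤ, Continuous fun y => 𝓕 θ (y - C (intVec k)) := fun k =>
    hFθ.comp (continuous_id.sub continuous_const)
  have h1 : ∀ k : Fin d → ℤ, (∫ y, u y * 𝓕 θ (y - C (intVec k))) * 𝓕 κ (C (intVec k)) =
      ∫ y, u y * (𝓕 θ (y - C (intVec k)) * 𝓕 κ (C (intVec k))) := fun k => by
    rw [← integral_mul_const]
    simp_rw [mul_assoc]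
  simp_rw [h1]
  rw [← integral_tsum (f := fun (k : Fin d → ℤ) y => u y * (𝓕 θ (y - C (intVec k)) *
    𝓕 κ (C (intVec k)))) fun k => (hu.mul ((hm k).mul continuous_const)).aestronglyMeasurable]
  · have h2 : ∀ n : Fin d → ℤ, Integrable fun y => u y *
        𝓕 (fun ξ => θ ξ * κ (ξ - D (intVec n))) y := fun n =>
      integrable_mul_fourier hu hp hup (hθ.mul (hκ.comp (contDiff_id.sub contDiff_const)))
        hθc.mul_right
    have h5 : ∀ y, ∑' k : Fin d → ℤ, u y * (𝓕 θ (y - C (intVec k)) * 𝓕 κ (C (intVec k))) =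
        ∑ n ∈ F, (|D.det| : ℝ) * (u y * 𝓕 (fun ξ => θ ξ * κ (ξ - D (intVec n))) y) := fun y => by
      rw [tsum_mul_left, tsum_fourier_mul_fourier_lattice hd hθ.continuous hθc hκ hκc h h' hsum hF,
        mul_left_comm, Finset.mul_sum, Finset.mul_sum]
    rw [integral_congr_ae (Filter.Eventually.of_forall h5), Finset.mul_sum]
    rw [integral_finsetSum _ fun n _ => (h2 n).const_mul _]
    simp_rw [integral_const_mul]
  -- Hölder is uniform in `k`, because a translation does not change the norm of `𝓕 θ`; what remains
  -- is the summable family of samples of `𝓕 κ`.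
  · have h3 : ∀ k : Fin d → ℤ, ∫⁻ y, ‖u y * (𝓕 θ (y - C (intVec k)) * 𝓕 κ (C (intVec k)))‖ₑ ≤
        eLpNorm u p volume * eLpNorm (𝓕 θ) (ENNReal.conjExponent p) volume *
          ‖𝓕 κ (C (intVec k))‖ₑ := fun k => by
      simp_rw [enorm_mul, ← mul_assoc]
      have h6 : Measurable fun y => ‖u y‖ₑ * ‖𝓕 θ (y - C (intVec k))‖ₑ :=
        hu.enorm.measurable.mul (hm k).enorm.measurable
      rw [lintegral_mul_const _ h6]
      gcongr
      have h4 := lintegral_mul_le_eLpNorm volume hu.enorm.measurable.aemeasurable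
        (hm k).enorm.measurable.aemeasurable p (ENNReal.conjExponent p)
      rwa [eLpNorm_enorm, eLpNorm_enorm, eLpNorm_fourier_sub hθi] at h4
    refine ((ENNReal.tsum_le_tsum h3).trans_lt ?_).ne
    rw [ENNReal.tsum_mul_left]
    exact ENNReal.mul_lt_top (ENNReal.mul_lt_top hup (eLpNorm_fourier_lt_top hθ hθc
      (ENNReal.HolderConjugate.one_le _ p))) hsum

end WalnutRepresentation

/-! ### The nonzero dual lattice points -/

section Remainder

variable {d : ℕ} {J : Type*} {Q : AffineFamily d J} {O : Opens (Space d)} {φ : J → 𝓓(O, ℂ)}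
  {g : Space d → ℂ} {w : J → ℝ} {δ : ℝ} {p q : ℝ≥0∞}

variable (Q φ g δ) in
/-- The products `conj (φ_m ĝ_j) · (φ_i ĝ_j)(· - δ⁻¹ A_j n)`. -/
def overlapAtom (i j m : J) (n : Fin d → ℤ) (ξ : Space d) : ℂ :=
  starRingEnd ℂ (localAtom Q φ g m j ξ) * localAtom Q φ g i j (ξ - dualPoint Q δ j n)

lemma contDiff_overlapAtom (hgs : ContDiff ℝ ∞ (𝓕 g)) (i j m : J) (n : Fin d → ℤ) :
    ContDiff ℝ ∞ (overlapAtom Q φ g δ i j m n) :=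
  (contDiff_conj_localAtom hgs m j).mul
    ((contDiff_localAtom hgs i j).comp (contDiff_id.sub contDiff_const))

lemma hasCompactSupport_overlapAtom (i j m : J) (n : Fin d → ℤ) :
    HasCompactSupport (overlapAtom Q φ g δ i j m n) :=
  (hasCompactSupport_conj_localAtom m j).mul_right

lemma integrable_overlapAtom (hgs : ContDiff ℝ ∞ (𝓕 g)) (i j m : J) (n : Fin d → ℤ) :
    Integrable (overlapAtom Q φ g δ i j m n) :=
  (contDiff_overlapAtom hgs i j m n).continuous.integrable_of_hasCompactSupport
    (hasCompactSupport_overlapAtom i j m n)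

/-- A product becomes a convolution, and neither conjugation nor translation changes the `L¹` norm
of the transform. The bound does not depend on `n`, so only the number of overlaps matters. -/
lemma lintegral_fourier_overlapAtom_le (hgs : ContDiff ℝ ∞ (𝓕 g)) (i j m : J) (n : Fin d → ℤ) :
    ∫⁻ z, ‖𝓕 (overlapAtom Q φ g δ i j m n) z‖ₑ ≤ atomNorm Q φ g m j * atomNorm Q φ g i j := by
  have h1 : ContDiff ℝ ∞ fun ξ => localAtom Q φ g i j (ξ - dualPoint Q δ j n) :=
    (contDiff_localAtom hgs i j).comp (contDiff_id.sub contDiff_const)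
  have h2 : HasCompactSupport fun ξ => localAtom Q φ g i j (ξ - dualPoint Q δ j n) :=
    (hasCompactSupport_localAtom i j).comp_homeomorph (Homeomorph.subRight (dualPoint Q δ j n))
  refine (lintegral_enorm_fourier_mul_le ((contDiff_conj_localAtom hgs m
    j).continuous.integrable_of_hasCompactSupport (hasCompactSupport_conj_localAtom m j))
    h1 h2).trans (le_of_eq ?_)
  simp_rw [enorm_fourier_conj, enorm_fourier_comp_sub]
  rw [lintegral_neg_eq_self fun z => ‖𝓕 (localAtom Q φ g m j) z‖ₑ]
  rfl

variable (φ g δ) in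
/-- The contribution of the indices `j, m` to the local piece at `x` of the frame operator. -/
def framePart (hQ : Q.IsAdmissibleCover O) (T : 𝓓(O, ℂ) →L[ℂ] ℂ) (i : J) (x : Space d) (j m : J) :
    ℂ :=
  ∑' k : Fin d → ℤ, (∫ y, clusterPiece hQ φ T m y *
    𝓕 (fun ξ => starRingEnd ℂ (localAtom Q φ g m j ξ)) (y - structuredLattice Q δ j (intVec k))) *
    𝓕 (localAtom Q φ g i j) (structuredLattice Q δ j (intVec k) - x)

variable (φ g δ) in
/-- The part of `framePart` which belongs to the Fourier multiplier. -/
def multiplierPart (hQ : Q.IsAdmissibleCover O) (T : 𝓓(O, ℂ) →L[ℂ] ℂ) (i : J) (x : Space d)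
    (j m : J) : ℂ :=
  (|(structuredLattice Q δ j).det|⁻¹ : ℝ) * ∫ y, clusterPiece hQ φ T m y *
    𝓕 (overlapAtom Q φ g δ i j m 0) (y - x)

variable (φ g δ) in
/-- The bound for the difference of `framePart` and `multiplierPart`. -/
def overlapPart (hQ : Q.IsAdmissibleCover O) (hR : Q.R < ⊤) (hδ : 0 < δ) (T : 𝓓(O, ℂ) →L[ℂ] ℂ)
    (i : J) (x : Space d) (j m : J) : ℝ≥0∞ :=
  ENNReal.ofReal |(structuredLattice Q δ j).det|⁻¹ *
    ∑ n ∈ (finite_overlapSet hR hδ i j m).toFinset,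
      ∫⁻ y, ‖𝓕 (overlapAtom Q φ g δ i j m n) (y - x)‖ₑ * ‖clusterPiece hQ φ T m y‖ₑ

lemma dualPoint_zero (Q : AffineFamily d J) (δ : ℝ) (j : J) : dualPoint Q δ j 0 = 0 := by
  have : intVec (0 : Fin d → ℤ) = 0 := by
    ext l
    simp [intVec]
  rw [dualPoint, this, map_zero, smul_zero]

/-- The Walnut representation with `θ = conj(φ_m ĝ_j)` and `κ = φ_i ĝ_j · character x`. The term `n
= 0` is `multiplierPart`, and every other term with nonzero product has `n` in the overlap set. -/
lemma enorm_framePart_sub_le (hd : 1 ≤ d) (hQ : Q.IsAdmissibleCover O) (hR : Q.R < ⊤)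
    (hφ : Q.IsRegularPartitionOfUnity φ) (hgs : ContDiff ℝ ∞ (𝓕 g)) (hδ : 0 < δ)
    (T : 𝓓(O, ℂ) →L[ℂ] ℂ) (hp : 1 ≤ p) (i : J) (x : Space d) (j m : J)
    (hup : eLpNorm (clusterPiece hQ φ T m) p volume < ⊤) (hs : sampleNorm Q φ g δ i j < ⊤) :
    ‖framePart φ g δ hQ T i x j m - multiplierPart φ g δ hQ T i x j m‖ₑ ≤
      overlapPart φ g δ hQ hR hδ T i x j m := by
  set D : Space d →L[ℝ] Space d := δ⁻¹ • (Q.A j : Space d →L[ℝ] Space d) with hD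
  set D' : Space d →L[ℝ] Space d := δ • ((Q.A j).symm : Space d →L[ℝ] Space d) with hD'
  set κ : Space d → ℂ := fun ξ => localAtom Q φ g i j ξ * character x ξ with hκ
  set V := (finite_overlapSet hR hδ i j m).toFinset with hV
  have hC : structuredLattice Q δ j = ContinuousLinearMap.adjoint D' := by
    rw [structuredLattice, hD']
    simp
  have h : ∀ y, D' (D y) = y := fun y => by simp [hD, hD', smul_smul, hδ.ne']
  have h' : ∀ y, D (D' y) = y := fun y => by simp [hD, hD', smul_smul, hδ.ne']
  have hdet : |D.det| = |(structuredLattice Q δ j).det|⁻¹ := by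
    have h1 : |(structuredLattice Q δ j).det| = |D'.det| := by rw [hC, det_adjoint]
    have h2 : D.det * D'.det = 1 := by
      have h3 : D.toLinearMap * D'.toLinearMap = 1 := by
        ext1 y
        exact h' y
      have h4 := congrArg LinearMap.det h3
      rwa [map_mul, map_one] at h4
    rw [h1, eq_inv_of_mul_eq_one_left h2, abs_inv]
  have hDn : ∀ n : Fin d → ℤ, D (intVec n) = dualPoint Q δ j n := fun n => rfl
  have hκs : ContDiff ℝ ∞ κ := (contDiff_localAtom hgs i j).mul (contDiff_character x)
  have hκc : HasCompactSupport κ := (hasCompactSupport_localAtom i j).mul_right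
  have hsum : ∑' k : Fin d → ℤ, ‖𝓕 κ (ContinuousLinearMap.adjoint D' (intVec k))‖ₑ < ⊤ := by
    simp_rw [← hC, hκ, fourier_mul_character]
    exact (tsum_enorm_fourier_localAtom_le hgs hδ i j x).trans_lt
      (ENNReal.mul_lt_top ENNReal.ofReal_lt_top hs)
  have h0V : (0 : Fin d → ℤ) ∉ V := fun h => ((finite_overlapSet hR hδ i j m).mem_toFinset.1 h).1 rfl
  have hF : ∀ ξ, ∀ n ∉ V.cons 0 h0V, starRingEnd ℂ (localAtom Q φ g m j ξ) *
      κ (ξ - D (intVec n)) = 0 := by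
    intro ξ n hn
    by_contra h0
    refine hn (Finset.mem_cons.2 ?_)
    by_cases hn0 : n = 0
    · exact Or.inl hn0
    · refine Or.inr ((finite_overlapSet hR hδ i j m).mem_toFinset.2 ⟨hn0, ξ, ?_, ?_⟩)
      · by_contra hξ
        refine left_ne_zero_of_mul h0 ?_
        rw [localAtom, hφ.eq_zero_of_notMem m hξ, zero_mul, map_zero]
      · by_contra hξ
        refine right_ne_zero_of_mul h0 ?_
        simp only [hκ, hDn]
        rw [localAtom, hφ.eq_zero_of_notMem i hξ, zero_mul, zero_mul]
  -- Shifting the character produces a unimodular factor, trivial for `n = 0` and irrelevant in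
  -- absolute value otherwise.
  have hatom : ∀ (n : Fin d → ℤ) (y : Space d), 𝓕 (fun ξ => starRingEnd ℂ (localAtom Q φ g m j ξ) *
      κ (ξ - D (intVec n))) y =
      character x (-dualPoint Q δ j n) * 𝓕 (overlapAtom Q φ g δ i j m n) (y - x) := by
    intro n y
    rw [← fourier_mul_character, fourier_eq_integral_character, fourier_eq_integral_character,
      ← integral_const_mul]
    congr with ξ
    simp only [hκ, hDn]
    rw [sub_eq_add_neg ξ, character_add_right, overlapAtom, ← sub_eq_add_neg]
    ring
  have hmain := tsum_integral_mul_fourier_lattice hd (contDiff_conj_localAtom hgs m j)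
    (hasCompactSupport_conj_localAtom m j) hκs hκc h h' hsum hF
    (continuous_clusterPiece hQ T m) hp hup
  rw [← hC, hdet, Finset.sum_cons] at hmain
  simp_rw [hatom] at hmain
  have hframe : framePart φ g δ hQ T i x j m - multiplierPart φ g δ hQ T i x j m =
      (|(structuredLattice Q δ j).det|⁻¹ : ℝ) * ∑ n ∈ V, ∫ y, clusterPiece hQ φ T m y *
        (character x (-dualPoint Q δ j n) * 𝓕 (overlapAtom Q φ g δ i j m n) (y - x)) := by
    have h0 : character x (-dualPoint Q δ j 0) = 1 := by
      rw [dualPoint_zero]; simp [character]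
    unfold framePart multiplierPart
    simp_rw [hκ, fourier_mul_character] at hmain
    rw [hmain, h0]
    simp only [one_mul]
    ring
  rw [hframe, overlapPart, enorm_mul]
  refine mul_le_mul' (le_of_eq ?_) ((enorm_sum_le _ _).trans (Finset.sum_le_sum fun n _ => ?_))
  · rw [← ofReal_norm, Complex.norm_real, Real.norm_of_nonneg (by positivity)]
  · refine (enorm_integral_le_lintegral_enorm _).trans (le_of_eq (lintegral_congr fun y => ?_))
    rw [enorm_mul, enorm_mul, ← ofReal_norm (character _ _), norm_character, ENNReal.ofReal_one,
      one_mul, mul_comm]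

lemma measurable_lintegral_overlap (hQ : Q.IsAdmissibleCover O) (hgs : ContDiff ℝ ∞ (𝓕 g))
    (T : 𝓓(O, ℂ) →L[ℂ] ℂ) (i j m : J) (n : Fin d → ℤ) :
    Measurable fun x => ∫⁻ y, ‖𝓕 (overlapAtom Q φ g δ i j m n) (y - x)‖ₑ *
      ‖clusterPiece hQ φ T m y‖ₑ := by
  refine Measurable.lintegral_prod_right (Measurable.mul ?_
    ((continuous_clusterPiece hQ T m).enorm.measurable.comp measurable_snd))
  exact ((continuous_fourier (integrable_overlapAtom hgs i j m n)).comp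
    (continuous_snd.sub continuous_fst)).enorm.measurable

lemma eLpNorm_tsum_overlapPart_le [Countable J] (hQ : Q.IsAdmissibleCover O) (hR : Q.R < ⊤)
    (hgs : ContDiff ℝ ∞ (𝓕 g)) (hδ : 0 < δ) (T : 𝓓(O, ℂ) →L[ℂ] ℂ) (hp : 1 ≤ p) (i : J) :
    eLpNorm (fun x => ∑' j, ∑' m, overlapPart φ g δ hQ hR hδ T i x j m) p volume ≤
      ∑' m, (∑' j, ENNReal.ofReal |(structuredLattice Q δ j).det|⁻¹ *
        ((overlapSet Q δ i j m).ncard : ℝ≥0∞) * (atomNorm Q φ g m j * atomNorm Q φ g i j)) *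
        eLpNorm (clusterPiece hQ φ T m) p volume := by
  have hm : ∀ j m, Measurable fun x => overlapPart φ g δ hQ hR hδ T i x j m := fun j m =>
    (Finset.measurable_fun_sum _ fun n _ =>
      measurable_lintegral_overlap hQ hgs T i j m n).const_mul _
  have hjm : ∀ j m, eLpNorm (fun x => overlapPart φ g δ hQ hR hδ T i x j m) p volume ≤
      ENNReal.ofReal |(structuredLattice Q δ j).det|⁻¹ *
        ((overlapSet Q δ i j m).ncard : ℝ≥0∞) * (atomNorm Q φ g m j * atomNorm Q φ g i j) *
        eLpNorm (clusterPiece hQ φ T m) p volume := by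
    intro j m
    set c := ENNReal.ofReal |(structuredLattice Q δ j).det|⁻¹ with hc
    have h1 : ∀ n, eLpNorm (fun x => c * ∫⁻ y, ‖𝓕 (overlapAtom Q φ g δ i j m n) (y - x)‖ₑ *
        ‖clusterPiece hQ φ T m y‖ₑ) p volume ≤
        c * (atomNorm Q φ g m j * atomNorm Q φ g i j) *
          eLpNorm (clusterPiece hQ φ T m) p volume := by
      intro n
      have hF := continuous_fourier (integrable_overlapAtom (Q := Q) (φ := φ) (δ := δ) hgs i j m n)
      have h2 := eLpNorm_lintegral_kernel_le (volume : Measure (Space d))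
        (volume : Measure (Space d))
        (K := fun x y => c * ‖𝓕 (overlapAtom Q φ g δ i j m n) (y - x)‖ₑ)
        ((hF.comp (continuous_snd.sub continuous_fst)).enorm.measurable.const_mul c)
        (A := c * (atomNorm Q φ g m j * atomNorm Q φ g i j))
        (fun x => by
          rw [lintegral_const_mul' _ _ ENNReal.ofReal_ne_top,
            lintegral_sub_right_eq_self fun y => ‖𝓕 (overlapAtom Q φ g δ i j m n) y‖ₑ]
          exact mul_le_mul_right (lintegral_fourier_overlapAtom_le hgs i j m n) _)
        (fun y => by
          rw [lintegral_const_mul' _ _ ENNReal.ofReal_ne_top,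
            lintegral_sub_left_eq_self fun y => ‖𝓕 (overlapAtom Q φ g δ i j m n) y‖ₑ]
          exact mul_le_mul_right (lintegral_fourier_overlapAtom_le hgs i j m n) _)
        (continuous_clusterPiece (φ := φ) hQ T m).enorm.measurable hp
      rw [eLpNorm_enorm] at h2
      simp_rw [mul_assoc c, lintegral_const_mul' c _ ENNReal.ofReal_ne_top] at h2
      simpa only [mul_assoc] using h2
    have h3 : (fun x => overlapPart φ g δ hQ hR hδ T i x j m) =
        ∑ n ∈ (finite_overlapSet hR hδ i j m).toFinset, fun x => c * ∫⁻ y,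
            ‖𝓕 (overlapAtom Q φ g δ i j m n) (y - x)‖ₑ * ‖clusterPiece hQ φ T m y‖ₑ := by
      funext x
      rw [Finset.sum_apply, overlapPart, Finset.mul_sum]
    rw [h3]
    refine ((eLpNorm_sum_le (fun n _ => ((measurable_lintegral_overlap hQ hgs T i j m n).const_mul
      c).aestronglyMeasurable) hp).trans (Finset.sum_le_sum fun n _ => h1 n)).trans (le_of_eq ?_)
    rw [Finset.sum_const, nsmul_eq_mul,
      Set.ncard_eq_toFinset_card _ (finite_overlapSet hR hδ i j m)]
    ring
  refine (eLpNorm_tsum_le volume (fun j => Measurable.tsum fun m => hm j m) hp).trans ?_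
  refine (ENNReal.tsum_le_tsum fun j => (eLpNorm_tsum_le volume (hm j) hp).trans
    (ENNReal.tsum_le_tsum fun m => hjm j m)).trans (le_of_eq ?_)
  rw [ENNReal.tsum_comm]
  simp_rw [ENNReal.tsum_mul_right]

end Remainder

/-! ### Rearranging the frame series -/

section FrameParts

variable {d : ℕ} {J : Type*} {Q : AffineFamily d J} {O : Opens (Space d)} {φ : J → 𝓓(O, ℂ)}
  {g : Space d → ℂ} {w : J → ℝ} {δ : ℝ} {p q : ℝ≥0∞}

/-- The triple series over `j`, `k` and `m` converges absolutely by the synthesis bound, so the sum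
over `k` may be carried out first; this is the sum to which Poisson summation applies. -/
lemma hasSum_framePart [Countable J] (hQ : Q.IsAdmissibleCover O)
    (hφ : Q.IsRegularPartitionOfUnity φ) (hw : Q.IsModerate w) (hg : Integrable g)
    (hgs : ContDiff ℝ ∞ (𝓕 g)) (hδ : 0 < δ)
    (hM : IsAdapted φ (structuredGenerator Q g) (structuredLattice Q δ) w w)
    (hp : 1 ≤ p) (hq : 1 ≤ q) {f s : FourierDistribution O} (hf : decompNorm φ w p q f < ⊤)
    (hs : IsFrameSum φ (structuredGenerator Q g) (structuredLattice Q δ) f s) (i : J)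
    (x : Space d) :
    HasSum (fun j => ∑' m, framePart φ g δ hQ f.fourier i x j m) (localPiece (φ i) s.fourier x) ∧
      ∀ j, Summable fun m => framePart φ g δ hQ f.fourier i x j m := by
  have huc := continuous_clusterPiece (φ := φ) hQ f.fourier
  have hfl := eLpNorm_localPiece_lt_top hw.1 hq hf
  have hN := lqNorm_clusterPiece_lt_top hQ hw hp hq hf
  have hsyn : ∀ i, eLpNorm (synthBound Q φ g δ (clusterPiece hQ φ f.fourier) i) p volume < ⊤ :=
    lt_top_of_lqNorm_lt_top hw.1 hq ((lqNorm_synthBound_le hg hgs hδ hw.1 huc hp hq).trans_lt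
      (ENNReal.mul_lt_top (ENNReal.pow_lt_top hM) hN))
  have := ENNReal.HolderConjugate.conjExponent hp
  set η := mulSmooth (φ i) (character x) (contDiff_character x) with hη
  set E : J → (Fin d → ℤ) → J → ℂ := fun j k m => extPairingTerm φ f
    (translate (structuredLattice Q δ j (intVec k)) (structuredGenerator Q g j)) m with hE
  set G : J → (Fin d → ℤ) → ℂ := fun j k =>
    𝓕 (localAtom Q φ g i j) (structuredLattice Q δ j (intVec k) - x) with hG
  set F : J × (J × (Fin d → ℤ)) → ℂ := fun z => E z.1 z.2.2 z.2.1 * G z.1 z.2.2 with hF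
  -- The reordering `((j, k), m) ↦ (j, (m, k))`.
  let e : (J × (Fin d → ℤ)) × J ≃ J × (J × (Fin d → ℤ)) :=
    (Equiv.prodAssoc J (Fin d → ℤ) J).trans (Equiv.prodCongr (Equiv.refl J) (Equiv.prodComm _ _))
  have hsum' : Summable (F ∘ e) := by
    refine (summable_norm_of_tsum_enorm_lt_top ?_).of_norm
    rw [ENNReal.tsum_prod']
    have h1 := tsum_coefBound_mul_le (δ := δ) hφ hgs (clusterPiece hQ φ f.fourier) p
      (ENNReal.conjExponent p) η (mem_clusterFinset_of_localTest hQ hφ i x)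
    refine lt_of_le_of_lt ((ENNReal.tsum_le_tsum fun jk => ?_).trans h1) (ENNReal.mul_lt_top
      (ENNReal.sum_lt_top.2 fun i _ => hsyn i) (eLpNorm_fourier_lt_top η.contDiff
        η.hasCompactSupport (ENNReal.HolderConjugate.one_le _ p)))
    rw [hη, fourier_generator_mul_localTest]
    have h2 : ∀ m, ‖(F ∘ e) (jk, m)‖ₑ = ‖E jk.1 jk.2 m‖ₑ * ‖G jk.1 jk.2‖ₑ := fun m => enorm_mul _ _
    simp_rw [h2]
    rw [ENNReal.tsum_mul_right]
    exact mul_le_mul_left (tsum_enorm_extPairingTerm_le hQ hφ hgs hp hfl jk) _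
  have hsum : Summable F := e.summable_iff.1 hsum'
  have hFs : ∑' z, F z = localPiece (φ i) s.fourier x := by
    rw [← e.tsum_eq]
    refine (hsum'.hasSum.prod_fiberwise fun jk => (hsum'.prod_factor jk).hasSum).unique ?_
    refine (hs.2 (fourierToZ O η)).congr_fun ?_
    intro jk
    rw [functionPairing_translate (integrable_structuredGenerator Q hg jk.1), hη,
      fourier_generator_mul_localTest, extPairing, ← tsum_mul_right]
    rfl
  have hframe : ∀ j m, ∑' k, F (j, (m, k)) = framePart φ g δ hQ f.fourier i x j m := fun j m => by
    refine tsum_congr fun k => ?_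
    simp only [hF, hE, hG]
    rw [extPairingTerm_eq hQ hφ hgs f hp hfl]
  have hj : ∀ j, ∑' z, F (j, z) = ∑' m, framePart φ g δ hQ f.fourier i x j m := fun j => by
    rw [(hsum.prod_factor j).tsum_prod]
    exact tsum_congr fun m => hframe j m
  constructor
  · rw [← hFs]
    simp_rw [← hj]
    exact hsum.hasSum.prod_fiberwise fun j => (hsum.prod_factor j).hasSum
  · intro j
    simp_rw [← hframe]
    exact (hsum.prod_factor j).prod

end FrameParts

/-! ### The dual lattice point zero and the multiplier `T₀` -/

section MultiplierParts

variable {d : ℕ} {J : Type*} {Q : AffineFamily d J} {O : Opens (Space d)} {φ : J → 𝓓(O, ℂ)}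
  {g : Space d → ℂ} {w : J → ℝ} {δ : ℝ} {p q : ℝ≥0∞}

variable (Q g δ) in
/-- The functions `|det C_j|⁻¹ |ĝ_j|²`. -/
def energy (j : J) (ξ : Space d) : ℂ :=
  (tZeroTerm (structuredGenerator Q g) (structuredLattice Q δ) ξ j : ℝ)

lemma energy_eq (j : J) (ξ : Space d) : energy Q g δ j ξ =
    (|(structuredLattice Q δ j).det|⁻¹ : ℝ) * (starRingEnd ℂ (𝓕 (structuredGenerator Q g j) ξ) *
      𝓕 (structuredGenerator Q g j) ξ) := by
  rw [energy, tZeroTerm, mul_comm (starRingEnd ℂ _), Complex.mul_conj, Complex.normSq_eq_norm_sq]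
  push_cast
  rfl

lemma contDiff_energy (hgs : ContDiff ℝ ∞ (𝓕 g)) (j : J) : ContDiff ℝ ∞ (energy Q g δ j) := by
  rw [funext (energy_eq (Q := Q) (g := g) (δ := δ) j)]
  have h := contDiff_fourier_structuredGenerator Q hgs j
  exact contDiff_const.mul ((Complex.conjCLE.contDiff.comp h).mul h)

/-- The partition of unity and its conjugate are inserted, which expresses `|ĝ_j|²` on the support
of `ρ` through products of atoms, whose Fourier transforms are controlled. -/
lemma energy_mul_eq (hφ : Q.IsRegularPartitionOfUnity φ) (ρ : 𝓓(O, ℂ)) {I : Finset J}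
    (hI : ∀ ξ, ρ ξ ≠ 0 → ∀ i, ξ ∈ Q.set i → i ∈ I) (j : J) (ξ : Space d) :
    energy Q g δ j ξ * ρ ξ = ∑ z ∈ I ×ˢ I, (|(structuredLattice Q δ j).det|⁻¹ : ℝ) *
      (overlapAtom Q φ g δ z.2 j z.1 0 ξ * ρ ξ) := by
  by_cases hρ : ρ ξ = 0
  · simp [hρ]
  · have h1 := hφ.sum_eq_one (ρ.tsupport_subset (subset_tsupport _ hρ)) (hI ξ hρ)
    have h2 : ∑ m ∈ I, starRingEnd ℂ (φ m ξ) = 1 := by rw [← map_sum, h1, map_one]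
    rw [Finset.sum_product, energy_eq]
    simp only [overlapAtom, localAtom, dualPoint_zero, sub_zero, map_mul]
    calc _ = (∑ m ∈ I, starRingEnd ℂ (φ m ξ)) * ((∑ m ∈ I, φ m ξ) *
        ((|(structuredLattice Q δ j).det|⁻¹ : ℝ) * (starRingEnd ℂ (𝓕 (structuredGenerator Q g j) ξ) *
        𝓕 (structuredGenerator Q g j) ξ) * ρ ξ)) := by rw [h1, h2, one_mul, one_mul]
      _ = _ := by
        simp_rw [Finset.sum_mul, Finset.mul_sum]
        refine Finset.sum_congr rfl fun m _ => Finset.sum_congr rfl fun m' _ => ?_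
        ring

lemma inv_mul_atomNorm_le (hδ : 0 < δ) (i j m : J) :
    ENNReal.ofReal |(structuredLattice Q δ j).det|⁻¹ *
      (atomNorm Q φ g m j * atomNorm Q φ g i j) ≤ sampleNorm Q φ g δ m j * sampleNorm Q φ g δ i j := by
  have h0 := abs_det_structuredLattice_pos Q hδ j
  set D := |(structuredLattice Q δ j).det|
  have h1 : ENNReal.ofReal D⁻¹ * (ENNReal.ofReal (Real.sqrt D) * ENNReal.ofReal (Real.sqrt D)) = 1 := by
    rw [← ENNReal.ofReal_mul (by positivity), Real.mul_self_sqrt h0.le,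
      ← ENNReal.ofReal_mul (by positivity), inv_mul_cancel₀ h0.ne', ENNReal.ofReal_one]
  calc _ ≤ ENNReal.ofReal D⁻¹ * ((ENNReal.ofReal (Real.sqrt D) * sampleNorm Q φ g δ m j) *
        (ENNReal.ofReal (Real.sqrt D) * sampleNorm Q φ g δ i j)) := by
        gcongr
        · exact atomNorm_le_sampleNorm hδ m j
        · exact atomNorm_le_sampleNorm hδ i j
    _ = ENNReal.ofReal D⁻¹ * (ENNReal.ofReal (Real.sqrt D) * ENNReal.ofReal (Real.sqrt D)) *
        (sampleNorm Q φ g δ m j * sampleNorm Q φ g δ i j) := by ring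
    _ = _ := by rw [h1, one_mul]

lemma lintegral_mul_fourier_energy_le (hφ : Q.IsRegularPartitionOfUnity φ)
    (hgs : ContDiff ℝ ∞ (𝓕 g)) (hδ : 0 < δ) {u : Space d → ℂ} (hu : Continuous u) (p q : ℝ≥0∞)
    [p.HolderConjugate q] (ρ : 𝓓(O, ℂ)) {I : Finset J}
    (hI : ∀ ξ, ρ ξ ≠ 0 → ∀ i, ξ ∈ Q.set i → i ∈ I) (j : J) :
    ∫⁻ y, ‖u y * 𝓕 (fun ξ => energy Q g δ j ξ * ρ ξ) y‖ₑ ≤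
      (∑ z ∈ I ×ˢ I, sampleNorm Q φ g δ z.1 j * sampleNorm Q φ g δ z.2 j) *
        (eLpNorm u p volume * eLpNorm (𝓕 (ρ : Space d → ℂ)) q volume) := by
  set c := ENNReal.ofReal |(structuredLattice Q δ j).det|⁻¹ with hc
  have hρF := continuous_fourier (ρ.continuous.integrable_of_hasCompactSupport (μ := volume)
    ρ.hasCompactSupport)
  have hFm : ∀ z : J × J, Continuous (𝓕 (overlapAtom Q φ g δ z.2 j z.1 0)) := fun z =>
    continuous_fourier (integrable_overlapAtom hgs z.2 j z.1 0)
  have hpt : ∀ y, ‖u y * 𝓕 (fun ξ => energy Q g δ j ξ * ρ ξ) y‖ₑ ≤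
      ∑ z ∈ I ×ˢ I, ‖u y‖ₑ * ∫⁻ x, c * ‖𝓕 (overlapAtom Q φ g δ z.2 j z.1 0) (y - x)‖ₑ *
        ‖𝓕 (ρ : Space d → ℂ) x‖ₑ := by
    intro y
    have hint : ∀ z : J × J, Integrable fun ξ => (|(structuredLattice Q δ j).det|⁻¹ : ℝ) *
        (overlapAtom Q φ g δ z.2 j z.1 0 ξ * ρ ξ) := fun z =>
      (((contDiff_overlapAtom hgs z.2 j z.1 0).continuous.mul
        ρ.continuous).integrable_of_hasCompactSupport ρ.hasCompactSupport.mul_left).const_mul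
          ((|(structuredLattice Q δ j).det|⁻¹ : ℝ) : ℂ)
    rw [funext (energy_mul_eq hφ ρ hI j), fourier_finsetSum _ fun z _ => hint z, enorm_mul,
      ← Finset.mul_sum]
    gcongr
    refine (enorm_sum_le _ _).trans (Finset.sum_le_sum fun z _ => ?_)
    have h1 : 𝓕 (fun ξ => ((|(structuredLattice Q δ j).det|⁻¹ : ℝ) : ℂ) *
        (overlapAtom Q φ g δ z.2 j z.1 0 ξ * ρ ξ)) y = ((|(structuredLattice Q δ j).det|⁻¹ : ℝ) : ℂ) *
        𝓕 (fun ξ => overlapAtom Q φ g δ z.2 j z.1 0 ξ * ρ ξ) y := by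
      rw [fourier_eq_integral_character, fourier_eq_integral_character, ← integral_const_mul]
      congr with ξ
      ring
    rw [h1, enorm_mul, ← ofReal_norm ((|(structuredLattice Q δ j).det|⁻¹ : ℝ) : ℂ),
      Complex.norm_real, Real.norm_of_nonneg (by positivity)]
    simp_rw [mul_assoc c]
    rw [lintegral_const_mul' _ _ ENNReal.ofReal_ne_top]
    exact mul_le_mul_right (enorm_fourier_mul_le (integrable_overlapAtom hgs z.2 j z.1 0)
      ρ.contDiff ρ.hasCompactSupport y) _
  have hmK : ∀ z : J × J, Measurable (Function.uncurry fun y x : Space d =>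
      c * ‖𝓕 (overlapAtom Q φ g δ z.2 j z.1 0) (y - x)‖ₑ) := fun z =>
    (((hFm z).comp (continuous_fst.sub continuous_snd)).enorm.measurable).const_mul c
  have hA : ∀ z : J × J, c * ∫⁻ x, ‖𝓕 (overlapAtom Q φ g δ z.2 j z.1 0) x‖ₑ ≤
      sampleNorm Q φ g δ z.1 j * sampleNorm Q φ g δ z.2 j := fun z =>
    (mul_le_mul_right (lintegral_fourier_overlapAtom_le hgs z.2 j z.1 0) c).trans
      (inv_mul_atomNorm_le hδ z.2 j z.1)
  have hmz : ∀ z : J × J, Measurable fun y => ‖u y‖ₑ * ∫⁻ x, c *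
      ‖𝓕 (overlapAtom Q φ g δ z.2 j z.1 0) (y - x)‖ₑ * ‖𝓕 (ρ : Space d → ℂ) x‖ₑ := fun z =>
    hu.enorm.measurable.mul (Measurable.lintegral_prod_right ((hmK z).mul
      (hρF.enorm.measurable.comp measurable_snd)))
  refine (lintegral_mono hpt).trans ?_
  rw [lintegral_finsetSum _ fun z _ => hmz z, Finset.sum_mul]
  refine Finset.sum_le_sum fun z _ => ?_
  have h2 := lintegral_lintegral_kernel_le (volume : Measure (Space d)) (volume : Measure (Space d))
    (hmK z) (A := sampleNorm Q φ g δ z.1 j * sampleNorm Q φ g δ z.2 j)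
    (fun y => by
      rw [lintegral_const_mul' _ _ ENNReal.ofReal_ne_top,
        lintegral_sub_left_eq_self fun x => ‖𝓕 (overlapAtom Q φ g δ z.2 j z.1 0) x‖ₑ]
      exact hA z)
    (fun x => by
      rw [lintegral_const_mul' _ _ ENNReal.ofReal_ne_top,
        lintegral_sub_right_eq_self fun x => ‖𝓕 (overlapAtom Q φ g δ z.2 j z.1 0) x‖ₑ]
      exact hA z)
    hu.enorm.measurable hρF.enorm.measurable p q
  rwa [eLpNorm_enorm, eLpNorm_enorm] at h2

lemma tsum_sampleNorm_mul_lt_top (hg : Integrable g) (hw : ∀ i, 0 < w i)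
    (hM : IsAdapted φ (structuredGenerator Q g) (structuredLattice Q δ) w w) (i m : J) :
    ∑' j, sampleNorm Q φ g δ i j * sampleNorm Q φ g δ m j < ⊤ := by
  set M := adaptedMatrix φ (structuredGenerator Q g) (structuredLattice Q δ) w w with hMdef
  have hwi := hw i
  have hwm := hw m
  have h1 : ∀ j, sampleNorm Q φ g δ i j * sampleNorm Q φ g δ m j ≤
      ENNReal.ofReal (w m / w i) * (schurNorm M * M i j) := fun j => by
    have h2 := weight_mul_sampleNorm_le (Q := Q) (φ := φ) (δ := δ) hg hw i j m
    have h3 : M m j ≤ schurNorm M :=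
      (ENNReal.le_tsum j).trans ((le_iSup (fun i => ∑' j, M i j) m).trans (le_max_left _ _))
    calc _ = ENNReal.ofReal (w m / w i) * (ENNReal.ofReal (w i / w m) *
          (sampleNorm Q φ g δ i j * sampleNorm Q φ g δ m j)) := by
          rw [← mul_assoc, ← ENNReal.ofReal_mul (by positivity)]
          have : w m / w i * (w i / w m) = 1 := by field_simp
          rw [this, ENNReal.ofReal_one, one_mul]
      _ ≤ _ := by
          refine mul_le_mul_right (h2.trans ?_) _
          rw [one_mul, mul_comm]
          exact mul_le_mul_left h3 _
  refine (ENNReal.tsum_le_tsum h1).trans_lt ?_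
  rw [ENNReal.tsum_mul_left, ENNReal.tsum_mul_left]
  refine ENNReal.mul_lt_top ENNReal.ofReal_lt_top (ENNReal.mul_lt_top hM (lt_of_le_of_lt ?_ hM))
  exact (le_iSup (fun i => ∑' j, M i j) i).trans (le_max_left _ _)

/-- The terms of `t_0` are non-negative, so the absolute sum of the integrands is `|t_0 ρ|`, which
is integrable by continuity of `t_0` on the compact support of `ρ`. -/
lemma tsum_fourier_energy [Countable J] (hgs : ContDiff ℝ ∞ (𝓕 g)) (hsum : ∀ ξ ∈ O,
      Summable (tZeroTerm (structuredGenerator Q g) (structuredLattice Q δ) ξ))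
    (ht : ContinuousOn (tZero (structuredGenerator Q g) (structuredLattice Q δ)) O) (ρ : 𝓓(O, ℂ))
    (y : Space d) : ∑' j, 𝓕 (fun ξ => energy Q g δ j ξ * ρ ξ) y =
      𝓕 (fun ξ => tZero (structuredGenerator Q g) (structuredLattice Q δ) ξ * ρ ξ) y := by
  have hc : ∀ j, Continuous fun ξ => energy Q g δ j ξ * ρ ξ := fun j =>
    (contDiff_energy hgs j).continuous.mul ρ.continuous
  have h0 : ∀ ξ j, 0 ≤ tZeroTerm (structuredGenerator Q g) (structuredLattice Q δ) ξ j := fun ξ j => by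
    unfold tZeroTerm; positivity
  have he : ∀ x ξ : Space d, ‖character x ξ‖ₑ = 1 := fun x ξ => by
    rw [← ofReal_norm, norm_character, ENNReal.ofReal_one]
  have h1 : ∀ ξ, ∑' j, ‖energy Q g δ j ξ * ρ ξ‖ₑ =
      ‖ρ ξ * tZero (structuredGenerator Q g) (structuredLattice Q δ) ξ‖ₑ := fun ξ => by
    simp_rw [enorm_mul]
    rw [ENNReal.tsum_mul_right, mul_comm]
    by_cases hρ : ρ ξ = 0
    · simp [hρ]
    · have hξ := hsum ξ (ρ.tsupport_subset (subset_tsupport _ hρ))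
      congr 1
      rw [tZero, ← ofReal_norm, Complex.norm_real, Real.norm_of_nonneg (tsum_nonneg (h0 ξ)),
        ENNReal.ofReal_tsum_of_nonneg (h0 ξ) hξ]
      refine tsum_congr fun j => ?_
      rw [energy, ← ofReal_norm, Complex.norm_real, Real.norm_of_nonneg (h0 ξ j)]
  simp_rw [fourier_eq_integral_character]
  rw [← integral_tsum (f := fun j ξ => energy Q g δ j ξ * ρ ξ * character (-y) ξ) fun j =>
    ((hc j).mul (continuous_character _)).aestronglyMeasurable]
  · congr with ξ
    rw [tsum_mul_right, tsum_mul_right, tZero, Complex.ofReal_tsum]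
    rfl
  · simp_rw [enorm_mul _ (character _ _), he, mul_one]
    rw [← lintegral_tsum fun j => (hc j).enorm.measurable.aemeasurable]
    simp_rw [h1]
    exact (hasFiniteIntegral_iff_enorm.1 (integrable_mul_of_continuousOn ht ρ).2).ne

/-- The interchange in the variable `y` needs more than tameness of `t_0`: absolute summability over
`j` comes from adaptedness, through finitely many products of rows of sampling norms. -/
lemma hasSum_integral_mul_fourier_energy [Countable J] (hQ : Q.IsAdmissibleCover O)
    (hQo : ∀ i, IsOpen (Q.Q' i)) (hφ : Q.IsRegularPartitionOfUnity φ) (hw : ∀ i, 0 < w i)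
    (hg : Integrable g) (hgs : ContDiff ℝ ∞ (𝓕 g)) (hδ : 0 < δ)
    (hM : IsAdapted φ (structuredGenerator Q g) (structuredLattice Q δ) w w) (hsum : ∀ ξ ∈ O,
      Summable (tZeroTerm (structuredGenerator Q g) (structuredLattice Q δ) ξ))
    (ht : ContinuousOn (tZero (structuredGenerator Q g) (structuredLattice Q δ)) O)
    {u : Space d → ℂ} (hu : Continuous u) (hp : 1 ≤ p) (hup : eLpNorm u p volume < ⊤)
    (ρ : 𝓓(O, ℂ)) :
    HasSum (fun j => ∫ y, u y * 𝓕 (fun ξ => energy Q g δ j ξ * ρ ξ) y)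
      (∫ y, u y *
        𝓕 (fun ξ => tZero (structuredGenerator Q g) (structuredLattice Q δ) ξ * ρ ξ) y) := by
  have := ENNReal.HolderConjugate.conjExponent hp
  set I := (hQ.finite_meet hQo ρ.hasCompactSupport ρ.tsupport_subset).toFinset with hIdef
  have hI : ∀ ξ, ρ ξ ≠ 0 → ∀ i, ξ ∈ Q.set i → i ∈ I := fun ξ hξ i hi =>
    (hQ.finite_meet hQo ρ.hasCompactSupport ρ.tsupport_subset).mem_toFinset.2
      ⟨ξ, hi, subset_tsupport _ hξ⟩
  have hfin : ∑' j, ∫⁻ y, ‖u y * 𝓕 (fun ξ => energy Q g δ j ξ * ρ ξ) y‖ₑ < ⊤ := by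
    refine (ENNReal.tsum_le_tsum fun j => lintegral_mul_fourier_energy_le hφ hgs hδ hu p
      (ENNReal.conjExponent p) ρ hI j).trans_lt ?_
    rw [ENNReal.tsum_mul_right, Summable.tsum_finsetSum fun _ _ => ENNReal.summable]
    exact ENNReal.mul_lt_top (ENNReal.sum_lt_top.2 fun z _ =>
      tsum_sampleNorm_mul_lt_top hg hw hM z.1 z.2) (ENNReal.mul_lt_top hup
        (eLpNorm_fourier_lt_top ρ.contDiff ρ.hasCompactSupport
          (ENNReal.HolderConjugate.one_le _ p)))
  have hc : ∀ j, Continuous (𝓕 fun ξ => energy Q g δ j ξ * ρ ξ) := fun j =>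
    continuous_fourier (((contDiff_energy hgs j).continuous.mul
      ρ.continuous).integrable_of_hasCompactSupport ρ.hasCompactSupport.mul_left)
  have hs : Summable fun j => ∫ y, u y * 𝓕 (fun ξ => energy Q g δ j ξ * ρ ξ) y := by
    refine (summable_norm_of_tsum_enorm_lt_top (lt_of_le_of_lt ?_ hfin)).of_norm
    exact ENNReal.tsum_le_tsum fun j => enorm_integral_le_lintegral_enorm _
  have h1 := integral_tsum (μ := volume) (f := fun j y => u y *
    𝓕 (fun ξ => energy Q g δ j ξ * ρ ξ) y) (fun j => (hu.mul (hc j)).aestronglyMeasurable) hfin.ne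
  simp_rw [tsum_mul_left, tsum_fourier_energy hgs hsum ht ρ] at h1
  rw [h1]
  exact hs.hasSum

lemma contDiff_clusterSum (hQ : Q.IsAdmissibleCover O) (l : J) :
    ContDiff ℝ ∞ (Q.clusterSum φ l) := by
  rw [funext (hQ.clusterSum_eq φ l)]
  exact ContDiff.sum fun m _ => (φ m).contDiff

lemma multiplierPart_eq (hQ : Q.IsAdmissibleCover O) (hφ : Q.IsRegularPartitionOfUnity φ)
    (hgs : ContDiff ℝ ∞ (𝓕 g)) (T : 𝓓(O, ℂ) →L[ℂ] ℂ) (hp : 1 ≤ p)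
    (hT : ∀ l, eLpNorm (localPiece (φ l) T) p volume < ⊤) (i : J) (x : Space d) (j m : J) :
    multiplierPart φ g δ hQ T i x j m = T (mulSmooth (conjTest (φ m)) (fun ξ => energy Q g δ j ξ *
      mulSmooth (φ i) (character x) (contDiff_character x) ξ)
      ((contDiff_energy hgs j).mul (mulSmooth (φ i) (character x)
        (contDiff_character x)).contDiff)) := by
  rw [apply_eq_integral_clusterPiece hQ hφ T hp hT m]
  · rw [multiplierPart, ← integral_const_mul]
    congr with y
    rw [← fourier_mul_character, mul_left_comm]
    congr 1
    rw [fourier_eq_integral_character, fourier_eq_integral_character, ← integral_const_mul]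
    congr with ξ
    change _ = (starRingEnd ℂ (φ m ξ) * (energy Q g δ j ξ * (φ i ξ * character x ξ))) * _
    rw [energy_eq, overlapAtom, localAtom, localAtom, dualPoint_zero, sub_zero, map_mul]
    ring
  · intro ξ hξ
    change starRingEnd ℂ (φ m ξ) * _ = 0
    rw [hφ.eq_zero_of_notMem m hξ, map_zero, zero_mul]

lemma multiplierPart_eq_zero (hQ : Q.IsAdmissibleCover O) (hφ : Q.IsRegularPartitionOfUnity φ)
    (T : 𝓓(O, ℂ) →L[ℂ] ℂ) (i : J) (x : Space d) (j : J) {m : J} (hm : m ∉ hQ.clusterFinset i) :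
    multiplierPart φ g δ hQ T i x j m = 0 := by
  have h1 : overlapAtom Q φ g δ i j m 0 = fun _ => 0 := by
    funext ξ
    by_contra h0
    rw [overlapAtom, dualPoint_zero, sub_zero, localAtom, localAtom, map_mul] at h0
    refine hm (hQ.mem_clusterFinset.2 ⟨ξ, ?_, ?_⟩)
    · by_contra h
      exact h0 (by rw [hφ.eq_zero_of_notMem m h, map_zero, zero_mul, zero_mul])
    · by_contra h
      exact h0 (by rw [hφ.eq_zero_of_notMem i h, zero_mul, mul_zero])
  rw [multiplierPart, h1]
  simp [fourier_zero_fun]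

/-- Both sides evaluate `T` at the same test function. On the left the conjugated partition sums to
one; on the right `φ_l φ_l^* = φ_l`, and the sum over `l` is again one. This reconciles the
localisation used for the frame series with the one defining `T₀`. -/
lemma sum_multiplierPart (hQ : Q.IsAdmissibleCover O) (hφ : Q.IsRegularPartitionOfUnity φ)
    (hgs : ContDiff ℝ ∞ (𝓕 g)) (T : 𝓓(O, ℂ) →L[ℂ] ℂ) (hp : 1 ≤ p)
    (hT : ∀ l, eLpNorm (localPiece (φ l) T) p volume < ⊤) (i : J) (x : Space d) (j : J) :
    ∑ m ∈ hQ.clusterFinset i, multiplierPart φ g δ hQ T i x j m =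
      ∑ l ∈ hQ.clusterUnion (hQ.clusterFinset i), ∫ y, localPiece (φ l) T y *
        𝓕 (fun ξ => energy Q g δ j ξ * (mulSmooth (mulSmooth (φ i) (character x)
          (contDiff_character x)) (Q.clusterSum φ l) (contDiff_clusterSum hQ l)) ξ) y := by
  set η := mulSmooth (φ i) (character x) (contDiff_character x) with hη
  have h1 : ∀ l, ∫ y, localPiece (φ l) T y * 𝓕 (fun ξ => energy Q g δ j ξ *
      (mulSmooth η (Q.clusterSum φ l) (contDiff_clusterSum hQ l)) ξ) y =
      T (mulSmooth (φ l) _ ((contDiff_energy hgs j).mul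
        (mulSmooth η (Q.clusterSum φ l) (contDiff_clusterSum hQ l)).contDiff)) := fun l =>
    (apply_mulSmooth_eq_integral (φ l) T _ (mulSmooth η (Q.clusterSum φ l)
      (contDiff_clusterSum hQ l)).hasCompactSupport.mul_left).symm
  simp_rw [h1, multiplierPart_eq hQ hφ hgs T hp hT]
  rw [← map_sum, ← map_sum]
  congr 1
  ext ξ
  rw [sum_apply, sum_apply]
  change ∑ m ∈ hQ.clusterFinset i, starRingEnd ℂ (φ m ξ) * (energy Q g δ j ξ * η ξ) =
    ∑ l ∈ hQ.clusterUnion (hQ.clusterFinset i),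
      φ l ξ * (energy Q g δ j ξ * (η ξ * Q.clusterSum φ l ξ))
  by_cases hξ : η ξ = 0
  · simp [hξ]
  · have h2 := mem_clusterFinset_of_localTest hQ hφ i x ξ hξ
    have hO : ξ ∈ O := η.tsupport_subset (subset_tsupport _ hξ)
    have h3 : ∑ m ∈ hQ.clusterFinset i, starRingEnd ℂ (φ m ξ) = 1 := by
      rw [← map_sum, hφ.sum_eq_one hO h2, map_one]
    have h4 : ∑ l ∈ hQ.clusterUnion (hQ.clusterFinset i), φ l ξ = 1 :=
      hφ.sum_eq_one hO fun l hl => hQ.mem_clusterUnion.2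
        ⟨l, h2 l hl, hQ.mem_clusterFinset.2 ⟨ξ, hl, hl⟩⟩
    have h5 : ∀ l, φ l ξ * (energy Q g δ j ξ * (η ξ * Q.clusterSum φ l ξ)) =
        φ l ξ * (energy Q g δ j ξ * η ξ) := fun l => by
      by_cases hl : ξ ∈ Q.set l
      · rw [hQ.clusterSum_eq, hφ.sum_cluster_eq_one hQ l hl, mul_one]
      · rw [hφ.eq_zero_of_notMem l hl, zero_mul, zero_mul]
    rw [Finset.sum_congr rfl fun l _ => h5 l, ← Finset.sum_mul, ← Finset.sum_mul, h3, h4]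

/-- For fixed `i` only finitely many `m` and `l` matter, so the sum over `j` can be taken inside
each `l`, where the terms `|det C_j|⁻¹ |ĝ_j|²` add up to `t_0`. -/
lemma hasSum_multiplierPart [Countable J] (hQ : Q.IsAdmissibleCover O)
    (hQo : ∀ i, IsOpen (Q.Q' i)) (hφ : Q.IsRegularPartitionOfUnity φ) (hw : ∀ i, 0 < w i)
    (hg : Integrable g) (hgs : ContDiff ℝ ∞ (𝓕 g)) (hδ : 0 < δ)
    (hM : IsAdapted φ (structuredGenerator Q g) (structuredLattice Q δ) w w) (hsum : ∀ ξ ∈ O,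
      Summable (tZeroTerm (structuredGenerator Q g) (structuredLattice Q δ) ξ))
    (hh : IsTame φ (tZero (structuredGenerator Q g) (structuredLattice Q δ)))
    (hp : 1 ≤ p) (hq : 1 ≤ q) {f t : FourierDistribution O} (hf : decompNorm φ w p q f < ⊤)
    (ht : IsMultiplierSum Q φ (tZero (structuredGenerator Q g) (structuredLattice Q δ)) f t)
    (i : J) (x : Space d) :
    HasSum (fun j => ∑' m, multiplierPart φ g δ hQ f.fourier i x j m)
      (localPiece (φ i) t.fourier x) := by
  have hfl := eLpNorm_localPiece_lt_top hw hq hf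
  have h1 : ∀ j, ∑' m, multiplierPart φ g δ hQ f.fourier i x j m = _ := fun j =>
    (tsum_eq_sum fun m hm => multiplierPart_eq_zero hQ hφ f.fourier i x j hm).trans
      (sum_multiplierPart hQ hφ hgs f.fourier hp hfl i x j)
  simp_rw [h1]
  rw [localPiece, FourierDistribution.fourier_apply, eq_sum_multiplierTerm hQ hφ hh hp hfl ht _
      (mem_clusterFinset_of_localTest hQ hφ i x)]
  refine hasSum_sum fun l _ => ?_
  have h2 := hasSum_integral_mul_fourier_energy hQ hQo hφ hw hg hgs hδ hM hsum hh.1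
    (continuous_localPiece (φ l) f.fourier) hp (hfl l) (mulSmooth (mulSmooth (φ i) (character x)
      (contDiff_character x)) (Q.clusterSum φ l) (contDiff_clusterSum hQ l))
  have h3 : (fun ξ => Q.clusterSum φ l ξ * tZero (structuredGenerator Q g) (structuredLattice Q δ) ξ *
      mulSmooth (φ i) (character x) (contDiff_character x) ξ) = fun ξ =>
      tZero (structuredGenerator Q g) (structuredLattice Q δ) ξ * mulSmooth (mulSmooth (φ i)
        (character x) (contDiff_character x)) (Q.clusterSum φ l) (contDiff_clusterSum hQ l) ξ := by
    funext ξ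
    change _ * _ * (φ i ξ * character x ξ) = _ * (φ i ξ * character x ξ * _)
    ring
  rw [h3]
  exact h2

end MultiplierParts

/-- A relation that is additive, homogeneous and single valued has a linear graph. The operators are
specified by convergence of series, and this turns the specifications into linear maps on the
decomposition space. -/
lemma exists_linearMap_of_rel {V : Type*} [AddCommGroup V] [Module ℂ V] (D : Submodule ℂ V)
    (r : V → V → Prop) (hex : ∀ f ∈ D, ∃ s ∈ D, r f s)
    (hadd : ∀ f ∈ D, ∀ f' ∈ D, ∀ s s', r f s → r f' s' → r (f + f') (s + s'))
    (hsmul : ∀ (c : ℂ) f s, r f s → r (c • f) (c • s))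
    (huniq : ∀ f s s', r f s → r f s' → s = s') :
    ∃ S : D →ₗ[ℂ] D, ∀ f : D, r f (S f) := by
  choose! S hSD hS using hex
  refine ⟨{ toFun := fun f => ⟨S f, hSD f f.2⟩, map_add' := ?_, map_smul' := ?_ },
    fun f => hS f f.2⟩
  · intro f f'
    exact Subtype.ext (huniq _ _ _ (hS _ (f + f').2) (hadd _ f.2 _ f'.2 _ _ (hS f f.2) (hS f' f'.2)))
  · intro c f
    exact Subtype.ext (huniq _ _ _ (hS _ (c • f).2) (hsmul c _ _ (hS f f.2)))

/-! ### Linearity and uniqueness of frame sums -/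

section Linearity

variable {d : ℕ} {J : Type*} {O : Opens (Space d)} {φ : J → 𝓓(O, ℂ)}
  {g : J → Space d → ℂ} {C : J → (Space d →L[ℝ] Space d)}

lemma extPairingTerm_add (f f' : FourierDistribution O) (u : Space d → ℂ) (i : J) :
    extPairingTerm φ (f + f') u i = extPairingTerm φ f u i + extPairingTerm φ f' u i := by
  unfold extPairingTerm
  split_ifs
  · rfl
  · simp

lemma extPairingTerm_smul (c : ℂ) (f : FourierDistribution O) (u : Space d → ℂ) (i : J) :
    extPairingTerm φ (c • f) u i = c * extPairingTerm φ f u i := by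
  unfold extPairingTerm
  split_ifs
  · rfl
  · simp

lemma IsFrameSum.add {f f' s s' : FourierDistribution O} (h : IsFrameSum φ g C f s)
    (h' : IsFrameSum φ g C f' s') : IsFrameSum φ g C (f + f') (s + s') := by
  refine ⟨fun j k => ?_, fun ψ => ?_⟩
  · refine Summable.of_nonneg_of_le (fun _ => norm_nonneg _) (fun i => ?_) ((h.1 j k).add (h'.1 j k))
    rw [extPairingTerm_add]
    exact norm_add_le _ _
  · refine ((h.2 ψ).add (h'.2 ψ)).congr_fun fun jk => ?_
    simp only [extPairing, extPairingTerm_add]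
    rw [(h.1 jk.1 jk.2).of_norm.tsum_add (h'.1 jk.1 jk.2).of_norm, add_mul]

lemma IsFrameSum.smul (c : ℂ) {f s : FourierDistribution O} (h : IsFrameSum φ g C f s) :
    IsFrameSum φ g C (c • f) (c • s) := by
  refine ⟨fun j k => ?_, fun ψ => ?_⟩
  · simp_rw [extPairingTerm_smul, norm_mul]
    exact (h.1 j k).mul_left _
  · refine ((h.2 ψ).mul_left c).congr_fun fun jk => ?_
    simp only [extPairing, extPairingTerm_smul]
    rw [tsum_mul_left, mul_assoc]

lemma IsFrameSum.unique {f s s' : FourierDistribution O} (h : IsFrameSum φ g C f s)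
    (h' : IsFrameSum φ g C f s') : s = s' :=
  ContinuousLinearMap.ext fun ψ => (h.2 ψ).unique (h'.2 ψ)

end Linearity

/-! ### The estimate for the remainder, and linearity of the multiplier -/

section MainEstimates

variable {d : ℕ} {J : Type*} {Q : AffineFamily d J} {O : Opens (Space d)} {φ : J → 𝓓(O, ℂ)}
  {g h : Space d → ℂ} {w : J → ℝ} {δ : ℝ} {p q : ℝ≥0∞}

lemma localPiece_add (ψ : 𝓓(O, ℂ)) (f f' : FourierDistribution O) (x : Space d) :
    localPiece ψ (f + f').fourier x = localPiece ψ f.fourier x + localPiece ψ f'.fourier x := rfl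

lemma localPiece_smul (ψ : 𝓓(O, ℂ)) (c : ℂ) (f : FourierDistribution O) (x : Space d) :
    localPiece ψ (c • f).fourier x = c * localPiece ψ f.fourier x := rfl

lemma localPiece_sub (ψ : 𝓓(O, ℂ)) (f f' : FourierDistribution O) (x : Space d) :
    localPiece ψ (f - f').fourier x = localPiece ψ f.fourier x - localPiece ψ f'.fourier x := rfl

lemma sampleNorm_lt_top (hg : Integrable g) (hw : ∀ i, 0 < w i)
    (hM : IsAdapted φ (structuredGenerator Q g) (structuredLattice Q δ) w w) (i j : J) :
    sampleNorm Q φ g δ i j < ⊤ := by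
  set M := adaptedMatrix φ (structuredGenerator Q g) (structuredLattice Q δ) w w with hMdef
  have h1 : M i j < ⊤ := (ENNReal.le_tsum j).trans_lt
    (((le_iSup (fun i => ∑' j, M i j) i).trans (le_max_left _ _)).trans_lt hM)
  rw [hMdef, adaptedMatrix_eq hg] at h1
  have h2 : 0 < max (w i / w j) (w j / w i) := lt_max_of_lt_left (div_pos (hw i) (hw j))
  by_contra h3
  rw [not_lt_top_iff.1 h3, ENNReal.mul_top (ENNReal.ofReal_pos.2 h2).ne'] at h1
  exact lt_irrefl _ h1

/-- The estimate for the difference of the frame operator and the Fourier multiplier. -/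
theorem decompNorm_frameSum_sub_multiplierSum_le [Countable J] [Nonempty J] (hd : 1 ≤ d)
    (hQ : Q.IsAdmissibleCover O) (hQo : ∀ i, IsOpen (Q.Q' i)) (hR : Q.R < ⊤)
    (hφ : Q.IsRegularPartitionOfUnity φ) (hw : Q.IsModerate w) (hg : Integrable g)
    (hgs : ContDiff ℝ ∞ (𝓕 g)) (hδ : 0 < δ)
    (hM : IsAdapted φ (structuredGenerator Q g) (structuredLattice Q δ) w w) (hsum : ∀ ξ ∈ O,
      Summable (tZeroTerm (structuredGenerator Q g) (structuredLattice Q δ) ξ))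
    (hh : IsTame φ (tZero (structuredGenerator Q g) (structuredLattice Q δ)))
    (hp : 1 ≤ p) (hq : 1 ≤ q) {f s t : FourierDistribution O} (hf : decompNorm φ w p q f < ⊤)
    (hs : IsFrameSum φ (structuredGenerator Q g) (structuredLattice Q δ) f s)
    (ht : IsMultiplierSum Q φ (tZero (structuredGenerator Q g) (structuredLattice Q δ)) f t) :
    decompNorm φ w p q (s - t) ≤ remainderBound Q φ w g δ p q * decompNorm φ w p q f := by
  set u := clusterPiece hQ φ f.fourier with hu
  have hN := lqNorm_clusterPiece_lt_top hQ hw hp hq hf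
  have hup := lt_top_of_lqNorm_lt_top hw.1 hq hN
  -- Both local pieces are double sums over `j` and `m` in the same order, so the difference can be
  -- estimated term by term.
  have hpt : ∀ i x, ‖localPiece (φ i) (s - t).fourier x‖ₑ ≤
      ∑' j, ∑' m, overlapPart φ g δ hQ hR hδ f.fourier i x j m := by
    intro i x
    obtain ⟨h1, h2⟩ := hasSum_framePart hQ hφ hw hg hgs hδ hM hp hq hf hs i x
    have h3 := hasSum_multiplierPart hQ hQo hφ hw.1 hg hgs hδ hM hsum hh hp hq hf ht i x
    have h4 : ∀ j, Summable fun m => multiplierPart φ g δ hQ f.fourier i x j m := fun j =>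
      summable_of_ne_finset_zero (s := hQ.clusterFinset i) fun m hm =>
        multiplierPart_eq_zero hQ hφ f.fourier i x j hm
    rw [localPiece_sub, ← (h1.sub h3).tsum_eq]
    refine enorm_tsum_le_tsum_enorm.trans (ENNReal.tsum_le_tsum fun j => ?_)
    rw [← (h2 j).tsum_sub (h4 j)]
    refine enorm_tsum_le_tsum_enorm.trans (ENNReal.tsum_le_tsum fun m => ?_)
    exact enorm_framePart_sub_le hd hQ hR hφ hgs hδ f.fourier hp i x j m (hup m)
      (sampleNorm_lt_top hg hw.1 hM i j)
  have hY := lqNorm_tsum_tsum_le hw.1 hq (weight_mul_overlap_le hd hR hφ hQo hgs hw.1 hδ)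
    fun m => eLpNorm (u m) p volume
  calc decompNorm φ w p q (s - t)
      ≤ lqNorm w q fun i => eLpNorm (fun x =>
          ∑' j, ∑' m, overlapPart φ g δ hQ hR hδ f.fourier i x j m) p volume := by
        refine lqNorm_mono w q fun i => eLpNorm_mono_enorm fun x => ?_
        rw [enorm_eq_self]
        exact hpt i x
    _ ≤ _ := lqNorm_mono w q fun i => eLpNorm_tsum_overlapPart_le hQ hR hgs hδ f.fourier hp i
    _ ≤ _ := hY
    _ ≤ constC0 Q φ * constC' d ^ 4 * ENNReal.ofReal δ ^ 2 * schurNorm (Ytilde Q w g) ^ 2 *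
        (Q.clusteringNorm w q * decompNorm φ w p q f) :=
        mul_le_mul_right (lqNorm_clusterPiece_le hQ hw.1 hp hq hf) _
    _ = 1 * (constC0 Q φ * constC' d ^ 4 * ENNReal.ofReal δ ^ 2 * schurNorm (Ytilde Q w g) ^ 2 *
        (Q.clusteringNorm w q * decompNorm φ w p q f)) := (one_mul _).symm
    _ ≤ constCpq Q φ w p q * (constC0 Q φ * constC' d ^ 4 * ENNReal.ofReal δ ^ 2 *
        schurNorm (Ytilde Q w g) ^ 2 * (Q.clusteringNorm w q * decompNorm φ w p q f)) :=
        mul_le_mul_left (one_le_constCpq hQ hφ hw.1 p hq) _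
    _ = _ := by
        rw [remainderBound]
        ring

lemma functionPairing_conv_eq_integral_prod {χ u : Space d → ℂ} (hχ : Integrable χ)
    (hχ1 : ∫⁻ z, ‖𝓕 χ z‖ₑ < ⊤) (hu : Continuous u) (hp : 1 ≤ p) (hup : eLpNorm u p volume < ⊤)
    (η : 𝓓(O, ℂ)) : functionPairing (conv (𝓕⁻ χ) u) (fourierToZ O η) =
      ∫ z : Space d × Space d, 𝓕⁻ χ (z.1 - z.2) * u z.2 * 𝓕 (η : Space d → ℂ) z.1
        ∂(volume.prod volume) := by
  rw [functionPairing_conv_eq_integral_integral,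
    integral_prod _ (integrable_conv_kernel hχ hχ1 hu hp hup η)]

/-- Membership in the decomposition space is what makes the kernels integrable on the product space;
without it the integrals need not be additive. -/
lemma IsMultiplierSum.add (hQ : Q.IsAdmissibleCover O) (hh : IsTame φ h)
    (hw : ∀ i, 0 < w i) (hp : 1 ≤ p) (hq : 1 ≤ q) {f f' t t' : FourierDistribution O}
    (hf : decompNorm φ w p q f < ⊤) (hf' : decompNorm φ w p q f' < ⊤)
    (ht : IsMultiplierSum Q φ h f t) (ht' : IsMultiplierSum Q φ h f' t') :
    IsMultiplierSum Q φ h (f + f') (t + t') := by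
  intro ψ
  obtain ⟨η, rfl⟩ := fourierToZ_surjective ψ
  have hfl := eLpNorm_localPiece_lt_top hw hq hf
  have hfl' := eLpNorm_localPiece_lt_top hw hq hf'
  have hff := eLpNorm_localPiece_lt_top hw hq ((DecompSpace φ w p q).add_mem hf hf')
  refine ((ht _).add (ht' _)).congr_fun fun l => ?_
  have hχ := integrable_clusterSum_mul (φ := φ) hQ hh.1 l
  have hχ1 := lintegral_fourier_clusterSum_mul_lt_top hQ hh l
  have hc := fun f : FourierDistribution O => continuous_localPiece (φ l) f.fourier
  rw [functionPairing_conv_eq_integral_prod hχ hχ1 (hc _) hp (hfl l),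
    functionPairing_conv_eq_integral_prod hχ hχ1 (hc _) hp (hfl' l),
    functionPairing_conv_eq_integral_prod hχ hχ1 (hc _) hp (hff l),
    ← integral_add (integrable_conv_kernel hχ hχ1 (hc _) hp (hfl l) η)
      (integrable_conv_kernel hχ hχ1 (hc _) hp (hfl' l) η)]
  congr with z
  rw [localPiece_add]
  ring

lemma IsMultiplierSum.smul (c : ℂ) {f t : FourierDistribution O} (ht : IsMultiplierSum Q φ h f t) :
    IsMultiplierSum Q φ h (c • f) (c • t) := by
  intro ψ
  refine ((ht ψ).mul_left c).congr_fun fun l => ?_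
  unfold functionPairing
  rw [← integral_const_mul]
  congr with x
  rw [conv, conv, convolution_def, convolution_def, ← mul_assoc, ← integral_const_mul]
  congr with y
  simp only [ContinuousLinearMap.mul_apply']
  rw [localPiece_smul]
  ring

lemma IsMultiplierSum.unique {f t t' : FourierDistribution O} (ht : IsMultiplierSum Q φ h f t)
    (ht' : IsMultiplierSum Q φ h f t') : t = t' :=
  ContinuousLinearMap.ext fun ψ => (ht ψ).unique (ht' ψ)

end MainEstimates

end GSI

end

/-! ### Assembly of the main theorem -/

theorem mainTheorem5 {d : ℕ} (hd : 1 ≤ d) {J : Type*} [Countable J]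
    (O : Opens (Space d)) (hO : volume ((O : Set (Space d))ᶜ) = 0)
    (Q : AffineFamily d J) (hQ : Q.IsAffinelyGeneratedCover O)
    (φ : J → 𝓓(O, ℂ)) (hφ : Q.IsRegularPartitionOfUnity φ)
    (w : J → ℝ) (hw : Q.IsModerate w)
    (g : Space d → ℂ) (hg1 : Integrable g) (hg2 : MemLp g 2) (hgs : ContDiff ℝ ∞ (𝓕 g))
    (δ : ℝ) (hδ0 : 0 < δ) (hδ1 : δ ≤ 1)
    (hsum : ∀ ξ ∈ O,
      Summable (tZeroTerm (structuredGenerator Q g) (structuredLattice Q δ) ξ))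
    (ht : IsTame φ (tZero (structuredGenerator Q g) (structuredLattice Q δ)))
    (hY : schurNorm (Ytilde Q w g) < ⊤) :
    IsAdapted φ (structuredGenerator Q g) (structuredLattice Q δ) w w ∧
    ∀ p q : ℝ≥0∞, 1 ≤ p → 1 ≤ q →
      remainderBound Q φ w g δ p q < ⊤ ∧
      ∃ S T₀ R₀ : DecompSpace φ w p q →ₗ[ℂ] DecompSpace φ w p q,
        (∀ f : DecompSpace φ w p q,
          IsFrameSum φ (structuredGenerator Q g) (structuredLattice Q δ) f (S f)) ∧
        (∃ c : ℝ≥0∞, c < ⊤ ∧ ∀ f : DecompSpace φ w p q,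
          decompNorm φ w p q (S f) ≤ c * decompNorm φ w p q f) ∧
        (∀ f : DecompSpace φ w p q,
          IsMultiplierSum Q φ (tZero (structuredGenerator Q g) (structuredLattice Q δ)) f (T₀ f)) ∧
        (∃ c : ℝ≥0∞, c < ⊤ ∧ ∀ f : DecompSpace φ w p q,
          decompNorm φ w p q (T₀ f) ≤ c * decompNorm φ w p q f) ∧
        (∀ f : DecompSpace φ w p q, R₀ f = S f - T₀ f) ∧
        ∀ f : DecompSpace φ w p q,
          decompNorm φ w p q (R₀ f) ≤ remainderBound Q φ w g δ p q * decompNorm φ w p q f := by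
  have hQa := hQ.admissible
  have hQo := hQ.isOpen
  have hM := isAdapted_structured hd hφ hQo hg1 hgs hδ0 hδ1 hY
  -- Needed for `C_{p,q} ≥ 1`; the cover of a non-empty set has at least one member.
  have : Nonempty J := by
    obtain ⟨ξ, hξ⟩ := hQa.nonempty
    rw [hQa.cover] at hξ
    obtain ⟨i, -⟩ := mem_iUnion.1 hξ
    exact ⟨i⟩
  refine ⟨hM, fun p q hp hq => ⟨remainderBound_lt_top hd hφ hQa hQo hQ.bounded hw hY δ p hq, ?_⟩⟩
  obtain ⟨S, hS⟩ := exists_linearMap_of_rel (DecompSpace φ w p q)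
    (IsFrameSum φ (structuredGenerator Q g) (structuredLattice Q δ))
    (fun f hf => by
      obtain ⟨s, hs⟩ := exists_isFrameSum hQa hQo hφ hw hg1 hgs hδ0 hM hp hq hf
      have hb := decompNorm_frameSum_le hQa hφ hw hg1 hgs hδ0 hp hq hf hs
      refine ⟨s, hb.trans_lt (ENNReal.mul_lt_top (ENNReal.mul_lt_top (ENNReal.pow_lt_top hM)
        (clusteringNorm_lt_top hQa hw hq)) hf), hs⟩)
    (fun _ _ _ _ _ _ h h' => h.add h') (fun c _ _ h => h.smul c) (fun _ _ _ h h' => h.unique h')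
  obtain ⟨c, hc, hcT⟩ := exists_decompNorm_multiplier_le hd hQa hQo hQ.bounded hφ ht hw hp hq
  obtain ⟨T₀, hT₀⟩ := exists_linearMap_of_rel (DecompSpace φ w p q)
    (IsMultiplierSum Q φ (tZero (structuredGenerator Q g) (structuredLattice Q δ)))
    (fun f hf => by
      obtain ⟨t, htf⟩ := exists_isMultiplierSum hQa hQo hφ ht hw.1 hp hq hf
      exact ⟨t, (hcT f t hf htf).trans_lt (ENNReal.mul_lt_top hc hf), htf⟩)
    (fun _ hf _ hf' _ _ h h' => h.add hQa ht hw.1 hp hq hf hf' h') (fun c _ _ h => h.smul c)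
    (fun _ _ _ h h' => h.unique h')
  refine ⟨S, T₀, S - T₀, hS, ⟨_, ENNReal.mul_lt_top (ENNReal.pow_lt_top hM)
    (clusteringNorm_lt_top hQa hw hq), fun f => decompNorm_frameSum_le hQa hφ hw hg1 hgs hδ0 hp hq
      f.2 (hS f)⟩, hT₀, ⟨c, hc, fun f => hcT f _ f.2 (hT₀ f)⟩, fun f => rfl, fun f => ?_⟩
  exact decompNorm_frameSum_sub_multiplierSum_le hd hQa hQo hQ.bounded hφ hw hg1 hgs hδ0 hM hsum ht
    hp hq f.2 (hS f) (hT₀ f)
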